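/- For strings $X,Y$ and a real $t\ge 0$ let $\mathrm{LCS}_t(X,Y)$ be the maximal $m$ such that some length-$m$ substring of $X$ and some length-$m$ substring of $Y$ are at Hamming distance at most $t$. In the decision variant of \textsf{LCS with Approximately $k$ Mismatches}, for a constant $\varepsilon>0$, the input consists of two strings $X,Y$ of length at most $n$ and integers $k,\ell\ge 0$. The answer must be YES if $\ell\le \mathrm{LCS}_k(X,Y)$, must be NO if $\ell>\mathrm{LCS}_{(1+\varepsilon)k}(X,Y)$, and may be anything otherwise; an answer YES must come with a witness pair, that is, (the starting positions of) length-$\ell$ substrings $S_1$ of $X$ and $S_2$ of $Y$ with Hamming distance $d_H(S_1,S_2)\le(1+\varepsilon)k$. Theorem. Let $\varepsilon>0$ and $\delta>0$ be real constants and assume that the alphabet is $\{1,\dots,\sigma\}$ with $\sigma=n^{O(1)}$. There is a randomised word RAM program, with words of $w=\Omega(\log n)$ bits (the constant in $\Omega$ may depend on $\varepsilon$, $\delta$ and the $O(1)$), that solves every such instance with $n\ge 2$ and $k,\ell<2^w$ correctly, including the witness pair, with probability at least $1-\delta$, in $O(n^{1+1/(1+\varepsilon)}\log^2 n)$ time,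 whatever the random choices, and in $O(n)$ space (counted in words). The constants hidden in the $O(\cdot)$ bounds on time and space depend only on $\varepsilon$, $\delta$ and the alphabet exponent, and not on $w$. A program step is an arithmetic operation or a comparison of words, a memory access, or the choice of a uniformly random integer in $\{0,\dots,b-1\}$ for a word $b$; if $\varepsilon$ is irrational, a step may also test whether $x\le\varepsilon y$ for words $x,y$, and this is the only access of the program to the real number $\varepsilon$. For rational $\varepsilon$ no such test is used. -/

import Mathlib

namespace LCSApprox

/-! Strings are lists of natural numbers (letters). -/

/-- Hamming distance of two strings of the same length: the number of mismatching positions. -/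
def mismatches (S T : List ℕ) : ℕ :=
  (List.zip S T).countP (fun p => decide (p.1 ≠ p.2))

/-- `LCS_t(X, Y)`: the maximal `m` such that some length-`m` substrings of `X` and of `Y` are at
Hamming distance at most `t`. For `t ≥ 0` the set contains `0`, and it is bounded by `|X|`, so the
supremum is a maximum. The threshold is real, since `(1 + ε) k` need not be an integer. -/
noncomputable def lcs (t : ℝ) (X Y : List ℕ) : ℕ :=
  sSup {m : ℕ | ∃ S T : List ℕ, S <:+: X ∧ T <:+: Y ∧ S.length = m ∧ T.length = m ∧
    (mismatches S T : ℝ) ≤ t}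

/-- The substring of `X` of length `m` that starts at the (0-based) position `i`. -/
def substr (X : List ℕ) (i m : ℕ) : List ℕ := (X.drop i).take m

/-- The answer `ans` (`1` for YES, `0` for NO) with the start positions `i`, `j` is a correct
solution of the decision variant of LCS with Approximately `k` Mismatches. The positions matter
only for the answer YES; then they have to give a witness pair. -/
def Correct (ε : ℝ) (X Y : List ℕ) (k l ans i j : ℕ) : Prop :=
  (ans = 0 ∨ ans = 1) ∧
  (l ≤ lcs (k : ℝ) X Y → ans = 1) ∧
  (lcs ((1 + ε) * k) X Y < l → ans = 0) ∧
  (ans = 1 → i + l ≤ X.length ∧ j + l ≤ Y.length ∧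
    (mismatches (substr X i l) (substr Y j l) : ℝ) ≤ (1 + ε) * k)

/-! The randomised word RAM. Its programs are written with structured control flow. A machine has
registers (of which a program uses a constant number) and a memory of `S` cells; all of them hold
`w`-bit words, i.e. natural numbers below `2 ^ w`. -/

/-- Arithmetic operations on words. -/
inductive Op where
  | add | sub | mul | div | mod

/-- Results are reduced modulo `2 ^ w`; subtraction is truncated at `0`. -/
def Op.eval (w : ℕ) : Op → ℕ → ℕ → ℕ
  | .add, a, b => (a + b) % 2 ^ w
  | .sub, a, b => a - b
  | .mul, a, b => (a * b) % 2 ^ w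
  | .div, a, b => a / b
  | .mod, a, b => a % b

/-- Tests on the contents `a`, `b` of two registers: `a < b`, `a = b`, and, as the only access to a
real parameter `ε` of the problem, `a ≤ ε * b`. -/
inductive Test where
  | lt (r s : ℕ)
  | eq (r s : ℕ)
  | leEps (r s : ℕ)

/-- Programs. -/
inductive Prog where
  | skip
  /-- put the constant `v` into register `r` -/
  | const (r v : ℕ)
  /-- put the result of an operation on registers `a` and `b` into register `r` -/
  | op (o : Op) (r a b : ℕ)
  /-- copy the memory cell whose address is in register `a` to register `r` -/
  | load (r a : ℕ)
  /-- copy register `r` to the memory cell whose address is in register `a` -/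
  | store (a r : ℕ)
  /-- put a uniformly random element of `{0, …, b - 1}` into register `r`, where `b` is the content
  of register `a` -/
  | rand (r a : ℕ)
  | seq (p q : Prog)
  | ite (t : Test) (p q : Prog)
  | loop (t : Test) (p : Prog)

/-- The test does not refer to `ε`. -/
def Test.EpsFree : Test → Prop
  | .lt _ _ => True
  | .eq _ _ => True
  | .leEps _ _ => False

/-- The program never refers to `ε`: it is an ordinary word RAM program. -/
def Prog.EpsFree : Prog → Prop
  | .seq p q => p.EpsFree ∧ q.EpsFree
  | .ite t p q => t.EpsFree ∧ p.EpsFree ∧ q.EpsFree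
  | .loop t p => t.EpsFree ∧ p.EpsFree
  | _ => True

/-- A configuration: the programs that remain to be executed, in this order, the contents of the
registers and the contents of the memory. -/
structure Config where
  todo : List Prog
  reg : ℕ → ℕ
  mem : ℕ → ℕ

/-- Truth of a test in given registers. -/
def Test.Holds (ε : ℝ) (reg : ℕ → ℕ) : Test → Prop
  | .lt r s => reg r < reg s
  | .eq r s => reg r = reg s
  | .leEps r s => (reg r : ℝ) ≤ ε * (reg s : ℝ)

/-- One step of the machine with word size `w` and `S` memory cells. A machine with nothing left to
do has halted. An access to an address outside the memory and a random choice from the empty set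
block the machine: it stays in the same configuration and never halts. -/
noncomputable def step (ε : ℝ) (w S : ℕ) (c : Config) : PMF Config :=
  match c.todo with
  | [] => PMF.pure c
  | .skip :: rest => PMF.pure { c with todo := rest }
  | .const r v :: rest =>
      PMF.pure { c with todo := rest, reg := Function.update c.reg r (v % 2 ^ w) }
  | .op o r a b :: rest =>
      PMF.pure { c with
        todo := rest, reg := Function.update c.reg r (o.eval w (c.reg a) (c.reg b)) }
  | .load r a :: rest =>
      if c.reg a < S then
        PMF.pure { c with todo := rest, reg := Function.update c.reg r (c.mem (c.reg a)) }
      else PMF.pure c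
  | .store a r :: rest =>
      if c.reg a < S then
        PMF.pure { c with todo := rest, mem := Function.update c.mem (c.reg a) (c.reg r) }
      else PMF.pure c
  | .rand r a :: rest =>
      if h : 0 < c.reg a then
        (PMF.uniformOfFinset (Finset.range (c.reg a)) ⟨0, Finset.mem_range.2 h⟩).map
          (fun x => { c with todo := rest, reg := Function.update c.reg r x })
      else PMF.pure c
  | .seq p q :: rest => PMF.pure { c with todo := p :: q :: rest }
  | .ite t p q :: rest =>
      open Classical in
      PMF.pure { c with todo := (if t.Holds ε c.reg then p else q) :: rest }
  | .loop t p :: rest =>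
      open Classical in
      PMF.pure { c with
        todo := if t.Holds ε c.reg then p :: .loop t p :: rest else rest }

/-- The distribution of the configuration after `T` steps. -/
noncomputable def run (ε : ℝ) (w S : ℕ) : ℕ → Config → PMF Config
  | 0, c => PMF.pure c
  | T + 1, c => (step ε w S c).bind (run ε w S T)

/-- The initial configuration of a program `P` on an instance: the registers `0, …, 4` hold
`n, |X|, |Y|, k, l`, the memory starts with the letters of `X` followed by the letters of `Y`, and
everything else is `0`. -/
def init (P : Prog) (n : ℕ) (X Y : List ℕ) (k l : ℕ) : Config where
  todo := [P]
  reg := fun r => [n, X.length, Y.length, k, l].getD r 0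
  mem := fun a => (X ++ Y).getD a 0

/-- On the given instance, with `w`-bit words and `S` memory cells, the program halts after at most
`T` steps whatever the random choices are, and with probability at least `1 - δ` its output, in the
registers `0`, `1`, `2`, is correct. -/
def Solves (ε δ : ℝ) (w S T : ℕ) (P : Prog) (n : ℕ) (X Y : List ℕ) (k l : ℕ) : Prop :=
  (∀ c ∈ (run ε w S T (init P n X Y k l)).support, c.todo = []) ∧
  ENNReal.ofReal (1 - δ) ≤ (run ε w S T (init P n X Y k l)).toOuterMeasure
    {c | Correct ε X Y k l (c.reg 0) (c.reg 1) (c.reg 2)}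

end LCSApprox

/-! The program is a locality-sensitive hashing scheme for the windows of length `l`. A random class
consists of a modulus `P ≤ R`, a residue `c < R`, a base `z` and a factor `y`; the fingerprint of a
window is `y` times the polynomial at `z` whose coefficients are the letters at the positions `≡ c`
modulo `P` in the window. All windows are treated together in time `O(n)`, by a suffix recurrence
with step `P`. Two windows with `d` mismatches are told apart only by a class that contains a
mismatch. This has probability at most `d / R` (`E_hit_le`), and nearly `d / R` for `d` slightly
above `(1 + ε) k`, because few moduli of the table make two positions collide (`tabOk`, `le_E_hit`).
For `k ≥ 1` one has `R = k m`, so a block of `m` classes avoids all mismatches with probability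
about `exp (-1)` if `d ≤ k`, and at most about `exp (-(1 + ε))` if `d > (1 + ε) k`. If a mismatch is
hit, a root bound for polynomials and the random factor make equal fingerprints unlikely
(`E_match_le`). The choice of `m` of order `log² n` keeps the accumulated losses bounded.

Take `b` about `log n / (1 + ε)` consecutive blocks. A bad pair (more than `(1 + ε) k` mismatches)
then falls into the same of `n` buckets with probability `O(1/n)`. A good pair (at most `k`
mismatches) does so whenever all `b` blocks avoid its mismatches. The expected waiting time for such
a run in a sequence of independent blocks is a geometric sum of order `exp b = O(n ^ (1/(1+ε)))`, so
that many blocks suffice by Markov's inequality (`rep_E_noRun_le`). The windows of `b` blocks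
overlap: a new class replaces the oldest one in a ring buffer, at cost `O(n)`. Hence the hashing
costs `O(n log² n)` per block, and no further logarithm for `b`.

Pairs in a common bucket are candidates. A candidate is filtered in time `O(log n)` by independent
sketches: the fingerprints of `O(log n)` further blocks modulo a constant `g`. Bad candidates pass
with probability at most `1/n`, good ones nearly always; those that pass are verified letter by
letter. Witnesses with more than `k` mismatches may be numerous and fail the filter, so the number
of candidates is not under control. Therefore the candidate with a random number `r < lim` is
verified in any case. Either fewer candidates exist, and then all of them are examined, or this
candidate is a witness unless it is one of the bad ones, whose expected number is a small fraction
of `lim` (`foldl_proc_complete`). The answer YES is given only after an exact verification, so the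
error is one-sided (`outcome_sound`). `Probs.E_le` adds up the failure probabilities for a fixed
prime `p`; that the random `p` is large and keeps distinct letters distinct is `rep_E_firstGood_le`.

To speak about the machine, the program is written in a small structured language and compiled
(`Stmt.reach`). The ranges of its random choices form a list that is fixed in advance. Therefore the
law of the final configuration is the image of a product of uniform distributions
(`run_eq_map_draws`), and all probabilities become finite averages over such draws. Polynomial
bounds for all values show that words of `O(log n)` bits suffice. -/

namespace LCSApprox

/-! ### Traces of random choices and the law of the final configuration. -/

/-- `Reach ε w S c tr c' t`: the machine gets from `c` to `c'` in `t` steps if its random choices,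
with their ranges, are those listed in `tr`. -/
inductive Reach (ε : ℝ) (w S : ℕ) : Config → List (ℕ × ℕ) → Config → ℕ → Prop
  | refl (c : Config) : Reach ε w S c [] c 0
  | det {c c₁ c' : Config} {tr : List (ℕ × ℕ)} {t : ℕ} (hne : c.todo ≠ [])
      (hr : ∀ r a rest, c.todo ≠ .rand r a :: rest) (h : step ε w S c = PMF.pure c₁)
      (H : Reach ε w S c₁ tr c' t) : Reach ε w S c tr c' (t + 1)
  | rand {r a : ℕ} {rest : List Prog} {reg mem : ℕ → ℕ} {x : ℕ} {c' : Config}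
      {tr : List (ℕ × ℕ)} {t : ℕ} (hx : x < reg a)
      (H : Reach ε w S ⟨rest, Function.update reg r x, mem⟩ tr c' t) :
      Reach ε w S ⟨.rand r a :: rest, reg, mem⟩ ((reg a, x) :: tr) c' (t + 1)

theorem Reach.trans {ε : ℝ} {w S : ℕ} {c₁ c₂ c₃ : Config} {tr₁ tr₂ : List (ℕ × ℕ)} {t₁ t₂ : ℕ}
    (h₁ : Reach ε w S c₁ tr₁ c₂ t₁) (h₂ : Reach ε w S c₂ tr₂ c₃ t₂) :
    Reach ε w S c₁ (tr₁ ++ tr₂) c₃ (t₁ + t₂) := by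
  induction h₁ with
  | refl c => simpa using h₂
  | det hne hr h _ ih => rw [Nat.add_right_comm]; exact .det hne hr h (ih h₂)
  | rand hx _ ih => rw [Nat.add_right_comm]; exact .rand hx (ih h₂)

/-- The values `xs` lie in the ranges `bs`. -/
abbrev Valid (bs xs : List ℕ) : Prop := List.Forall₂ (fun b x => x < b) bs xs

/-- The uniform distribution on `{0, …, b - 1}`. -/
noncomputable def unifRange (b : ℕ) (h : 0 < b) : PMF ℕ :=
  PMF.uniformOfFinset (Finset.range b) (Finset.nonempty_range_iff.2 h.ne')

theorem mem_support_unifRange {b : ℕ} (h : 0 < b) {x : ℕ} : x ∈ (unifRange b h).support ↔ x < b := by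
  rw [unifRange, PMF.mem_support_uniformOfFinset_iff, Finset.mem_range]

theorem unifRange_apply {b : ℕ} (h : 0 < b) (x : ℕ) :
    unifRange b h x = if x < b then (b : ENNReal)⁻¹ else 0 := by
  rw [unifRange, PMF.uniformOfFinset_apply]
  simp

/-- Independent uniform choices from the ranges `bs`. -/
noncomputable def draws : List ℕ → PMF (List ℕ)
  | [] => PMF.pure []
  | b :: bs =>
      if h : 0 < b then
        (unifRange b h).bind
          (fun x => (draws bs).map (x :: ·))
      else PMF.pure []

theorem pmf_bind_congr {α β : Type*} {p : PMF α} {f g : α → PMF β} (h : ∀ a ∈ p.support, f a = g a) :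
    p.bind f = p.bind g := by
  ext b
  simp only [PMF.bind_apply]
  refine tsum_congr fun a => ?_
  by_cases ha : p a = 0
  · simp [ha]
  · rw [h a ((PMF.mem_support_iff _ _).2 ha)]

theorem mem_support_draws {bs xs : List ℕ} (hb : ∀ b ∈ bs, 0 < b) :
    xs ∈ (draws bs).support ↔ Valid bs xs := by
  induction bs generalizing xs with
  | nil => simp [draws, Valid]
  | cons b bs ih =>
    have h0 : 0 < b := hb b (by simp)
    have ih' : ∀ ys, ys ∈ (draws bs).support ↔ Valid bs ys :=
      fun ys => ih (fun x hx => hb x (by simp [hx]))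
    simp only [draws, h0, dif_pos]
    constructor
    · intro h
      rw [PMF.mem_support_bind_iff] at h
      obtain ⟨x, hx, h⟩ := h
      rw [PMF.mem_support_map_iff] at h
      obtain ⟨ys, hy, rfl⟩ := h
      exact .cons ((mem_support_unifRange h0).1 hx) ((ih' ys).1 hy)
    · intro h
      cases h with
      | cons hx hy =>
        rw [PMF.mem_support_bind_iff]
        exact ⟨_, (mem_support_unifRange h0).2 hx, (PMF.mem_support_map_iff _ _ _).2 ⟨_, (ih' _).2 hy, rfl⟩⟩

theorem exists_valid {bs : List ℕ} (hb : ∀ b ∈ bs, 0 < b) : ∃ xs, Valid bs xs := by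
  obtain ⟨xs, h⟩ := (draws bs).support_nonempty
  exact ⟨xs, (mem_support_draws hb).1 h⟩

theorem run_of_halted (ε : ℝ) (w S T : ℕ) {c : Config} (h : c.todo = []) : run ε w S T c = PMF.pure c := by
  induction T with
  | zero => rfl
  | succ T ih => simp [run, step, h, ih]

/-- If the machine halts for all random choices from the ranges `bs`, the distribution of its final
configuration is the image of the uniform distribution on those choices. -/
theorem run_eq_map_draws {ε : ℝ} {w S : ℕ} (T : ℕ) :
    ∀ (c : Config) (bs : List ℕ) (f : List ℕ → Config), (∀ b ∈ bs, 0 < b) →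
      (∀ xs, Valid bs xs → ∃ t ≤ T, Reach ε w S c (bs.zip xs) (f xs) t ∧ (f xs).todo = []) →
      run ε w S T c = (draws bs).map f := by
  induction T with
  | zero =>
    intro c bs f hb h
    obtain ⟨xs, hxs⟩ := exists_valid hb
    cases bs with
    | nil =>
      obtain ⟨t, ht, hR, -⟩ := h [] (by simp [Valid])
      obtain rfl : t = 0 := by omega
      generalize hc : f [] = c' at hR
      cases hR
      simp [run, draws, PMF.pure_map, hc]
    | cons b bs =>
      obtain ⟨t, ht, hR, -⟩ := h xs hxs
      obtain rfl : t = 0 := by omega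
      cases hxs
      cases hR
  | succ T ih =>
    intro c bs f hb h
    obtain ⟨todo, reg, mem⟩ := c
    by_cases hhalt : todo = []
    · rw [run_of_halted _ _ _ _ hhalt]
      subst hhalt
      cases bs with
      | nil =>
        obtain ⟨t, ht, hR, -⟩ := h [] (by simp [Valid])
        generalize hc : f [] = c' at hR
        cases hR with
        | refl => simp [draws, PMF.pure_map, hc]
        | det hne => exact absurd rfl hne
      | cons b bs =>
        obtain ⟨xs, hxs⟩ := exists_valid hb
        obtain ⟨t, ht, hR, -⟩ := h xs hxs
        cases hxs
        cases hR with
        | det hne => exact absurd rfl hne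
    · by_cases hrand : ∃ r a rest, todo = .rand r a :: rest
      · obtain ⟨r, a, rest, rfl⟩ := hrand
        cases bs with
        | nil =>
          obtain ⟨t, ht, hR, hd⟩ := h [] (by simp [Valid])
          generalize f [] = c' at hR hd
          cases hR with
          | refl => simp at hd
          | det hne hr => exact absurd rfl (hr _ _ _)
        | cons b bs =>
          have h0 : 0 < b := hb b (by simp)
          obtain ⟨ys, hys⟩ := exists_valid (bs := bs) (fun x hx => hb x (by simp [hx]))
          -- A random step consumes the head of the trace, which forces the range in the register to
          -- be `b`; the tails give the hypothesis for every successor configuration.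
          have key : ∀ x < b, ∀ ys, Valid bs ys → reg a = b ∧ ∃ t ≤ T,
              Reach ε w S ⟨rest, Function.update reg r x, mem⟩ (bs.zip ys) (f (x :: ys)) t ∧
              (f (x :: ys)).todo = [] := by
            intro x hx ys hys
            obtain ⟨t, ht, hR, hd⟩ := h (x :: ys) (.cons hx hys)
            rw [List.zip_cons_cons] at hR
            generalize hl : (b, x) :: bs.zip ys = l at hR
            generalize f (x :: ys) = c' at hR hd
            cases hR with
            | refl => simp at hl
            | det hne hr => exact absurd rfl (hr _ _ _)
            | rand hx H =>
              simp only [List.cons.injEq, Prod.mk.injEq] at hl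
              obtain ⟨⟨h1, h2⟩, h3⟩ := hl
              subst h3
              refine ⟨h1.symm, _, Nat.le_of_succ_le_succ ht, ?_, hd⟩
              rw [h2]; exact H
          have hreg : reg a = b := (key 0 h0 ys hys).1
          subst hreg
          have hs : step ε w S ⟨.rand r a :: rest, reg, mem⟩ = (unifRange (reg a) h0).map
              (fun x => ⟨rest, Function.update reg r x, mem⟩) := by
            simp only [step, h0, dif_pos]; rfl
          simp only [run, hs, h0, dif_pos, draws, PMF.bind_map, PMF.map_bind]
          refine pmf_bind_congr fun x hx => ?_
          have hx' : x < reg a := (mem_support_unifRange h0).1 hx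
          simp only [Function.comp, PMF.map_comp]
          exact ih _ bs (fun ys => f (x :: ys)) (fun x hx => hb x (by simp [hx]))
            (fun ys hys => (key x hx' ys hys).2)
      · obtain ⟨xs₀, hxs₀⟩ := exists_valid hb
        -- A deterministic step uses no draw, so the same ranges serve for its successor, which does
        -- not depend on the draws.
        have inv : ∀ xs, Valid bs xs → ∃ c₁, step ε w S ⟨todo, reg, mem⟩ = PMF.pure c₁ ∧
            ∃ t ≤ T, Reach ε w S c₁ (bs.zip xs) (f xs) t ∧ (f xs).todo = [] := by
          intro xs hxs
          obtain ⟨t, ht, hR, hd⟩ := h xs hxs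
          generalize bs.zip xs = l at hR
          generalize f xs = c' at hR hd
          cases hR with
          | refl => exact absurd hd hhalt
          | det hne hr h H => exact ⟨_, h, _, by omega, H, hd⟩
          | rand hx H => exact absurd ⟨_, _, _, rfl⟩ hrand
        obtain ⟨c₁, hs, -⟩ := inv xs₀ hxs₀
        rw [run, hs, PMF.pure_bind]
        refine ih c₁ bs f hb fun xs hxs => ?_
        obtain ⟨c₂, hs₂, h⟩ := inv xs hxs
        rw [hs] at hs₂
        have : c₁ = c₂ := by
          have h1 : c₁ ∈ (PMF.pure c₂ : PMF Config).support := by rw [← hs₂]; simp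
          simpa using h1
        rw [this]; exact h

/-! ### Finite averages over independent draws. -/

/-- Expectation over independent uniform choices from the ranges `bs`. -/
noncomputable def expect : List ℕ → (List ℕ → ℝ) → ℝ
  | [], f => f []
  | b :: bs, f => (∑ x ∈ Finset.range b, expect bs (fun xs => f (x :: xs))) / b

theorem expect_append (b₁ b₂ : List ℕ) (f : List ℕ → ℝ) :
    expect (b₁ ++ b₂) f = expect b₁ (fun xs => expect b₂ (fun ys => f (xs ++ ys))) := by
  induction b₁ generalizing f with
  | nil => simp [expect]
  | cons b bs ih => simp [expect, ih]

theorem expect_congr {bs : List ℕ} {f g : List ℕ → ℝ} (h : ∀ xs, Valid bs xs → f xs = g xs) :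
    expect bs f = expect bs g := by
  induction bs generalizing f g with
  | nil => simpa [expect, Valid] using h
  | cons b bs ih =>
    simp only [expect]
    congr 1
    refine Finset.sum_congr rfl fun x hx => ih fun xs hxs => h _ (.cons (by simpa using hx) hxs)

theorem expect_mono {bs : List ℕ} {f g : List ℕ → ℝ} (h : ∀ xs, Valid bs xs → f xs ≤ g xs) :
    expect bs f ≤ expect bs g := by
  induction bs generalizing f g with
  | nil => simpa [expect, Valid] using h
  | cons b bs ih =>
    simp only [expect]
    gcongr with x hx
    exact ih fun xs hxs => h _ (.cons (by simpa using hx) hxs)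

theorem expect_add (bs : List ℕ) (f g : List ℕ → ℝ) :
    expect bs (fun xs => f xs + g xs) = expect bs f + expect bs g := by
  induction bs generalizing f g with
  | nil => simp [expect]
  | cons b bs ih => simp [expect, ih, Finset.sum_add_distrib, add_div]

theorem expect_mul_left (bs : List ℕ) (r : ℝ) (f : List ℕ → ℝ) :
    expect bs (fun xs => r * f xs) = r * expect bs f := by
  induction bs generalizing f with
  | nil => simp [expect]
  | cons b bs ih => simp [expect, ih, ← Finset.mul_sum, mul_div_assoc]

theorem expect_const {bs : List ℕ} (hb : ∀ b ∈ bs, 0 < b) (r : ℝ) : expect bs (fun _ => r) = r := by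
  induction bs with
  | nil => simp [expect]
  | cons b bs ih =>
    have : (b : ℝ) ≠ 0 := by have := hb b (by simp); positivity
    simp [expect, ih (fun x hx => hb x (by simp [hx])), this]

open Classical in
theorem toOuterMeasure_draws {bs : List ℕ} (hb : ∀ b ∈ bs, 0 < b) (s : Set (List ℕ)) :
    (draws bs).toOuterMeasure s = ENNReal.ofReal (expect bs (fun xs => if xs ∈ s then 1 else 0)) := by
  induction bs generalizing s with
  | nil =>
    simp only [draws, expect, PMF.toOuterMeasure_pure_apply]
    split_ifs <;> simp
  | cons b bs ih =>
    have h0 : 0 < b := hb b (by simp)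
    have ih' := ih (fun x hx => hb x (by simp [hx]))
    simp only [draws, h0, dif_pos, expect, PMF.toOuterMeasure_bind_apply, PMF.toOuterMeasure_map_apply, ih']
    rw [tsum_eq_sum (s := Finset.range b)]
    · rw [ENNReal.ofReal_div_of_pos (by positivity), ENNReal.ofReal_sum_of_nonneg, div_eq_mul_inv,
        Finset.sum_mul]
      · refine Finset.sum_congr rfl fun x hx => ?_
        rw [unifRange_apply, if_pos (Finset.mem_range.1 hx), mul_comm, ENNReal.ofReal_natCast]
        rfl
      · intro x _
        conv_lhs => rw [← expect_const (bs := bs) (fun x hx => hb x (by simp [hx])) 0]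
        exact expect_mono fun xs _ => by split_ifs <;> simp
    · intro x hx
      rw [unifRange_apply, if_neg (fun h => hx (Finset.mem_range.2 h)), zero_mul]

/-! ### Random sources and their combinations. -/

/-- A source of random objects of type `α`, which are encoded in lists of uniform choices. -/
structure Gen (α : Type) where
  bs : List ℕ
  dec : List ℕ → α
  enc : α → List (ℕ × ℕ)
  zip_eq : ∀ xs, Valid bs xs → bs.zip xs = enc (dec xs)

namespace Gen
variable {α β : Type}

/-- Expectation. -/
noncomputable def E (G : Gen α) (f : α → ℝ) : ℝ := expect G.bs (fun xs => f (G.dec xs))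

/-- The objects that can be produced. -/
def Mem (G : Gen α) (a : α) : Prop := ∃ xs, Valid G.bs xs ∧ G.dec xs = a

def Pos (G : Gen α) : Prop := ∀ b ∈ G.bs, 0 < b

theorem E_congr (G : Gen α) {f g : α → ℝ} (h : ∀ a, G.Mem a → f a = g a) : G.E f = G.E g :=
  expect_congr fun xs hx => h _ ⟨xs, hx, rfl⟩

theorem E_mono (G : Gen α) {f g : α → ℝ} (h : ∀ a, G.Mem a → f a ≤ g a) : G.E f ≤ G.E g :=
  expect_mono fun xs hx => h _ ⟨xs, hx, rfl⟩

theorem E_add (G : Gen α) (f g : α → ℝ) : G.E (fun a => f a + g a) = G.E f + G.E g :=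
  expect_add _ _ _

theorem E_mul_left (G : Gen α) (r : ℝ) (f : α → ℝ) : G.E (fun a => r * f a) = r * G.E f :=
  expect_mul_left _ _ _

theorem E_mul_right (G : Gen α) (r : ℝ) (f : α → ℝ) : G.E (fun a => f a * r) = G.E f * r := by
  simp only [mul_comm _ r, E_mul_left]

theorem E_const (G : Gen α) (h : G.Pos) (r : ℝ) : G.E (fun _ => r) = r := expect_const h r

theorem E_zero (G : Gen α) : G.E (fun _ => 0) = 0 := by
  simpa using G.E_mul_left 0 (fun _ => 0)

theorem E_nonneg (G : Gen α) {f : α → ℝ} (h : ∀ a, G.Mem a → 0 ≤ f a) : 0 ≤ G.E f := by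
  rw [← G.E_zero]; exact G.E_mono h

theorem E_sum {ι : Type*} (G : Gen α) (s : Finset ι) (f : ι → α → ℝ) :
    G.E (fun a => ∑ i ∈ s, f i a) = ∑ i ∈ s, G.E (f i) := by
  classical
  induction s using Finset.induction_on with
  | empty => simp [E_zero]
  | insert i s hi ih => simp only [Finset.sum_insert hi, E_add, ih]

theorem E_swap (G : Gen α) (H : Gen β) (f : α → β → ℝ) :
    G.E (fun a => H.E (f a)) = H.E (fun b => G.E (fun a => f a b)) := by
  obtain ⟨bs, dec, enc, hz⟩ := G
  simp only [E]
  clear hz enc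
  generalize hg : (fun xs => f (dec xs)) = g
  have hg' : ∀ xs, f (dec xs) = g xs := fun xs => by rw [← hg]
  simp only [hg']
  clear hg hg' dec f
  induction bs generalizing g with
  | nil => simp [expect]
  | cons b bs ih =>
    simp only [expect]
    have := H.E_sum (Finset.range b) (fun x b => expect bs fun a => g (x :: a) (b))
    simp only [E] at this
    simp only [div_eq_mul_inv, mul_comm _ (b : ℝ)⁻¹, expect_mul_left, this]
    congr 1
    exact Finset.sum_congr rfl fun x _ => ih _

/-- A uniform choice from `{0, …, b - 1}`. -/
def unif (b : ℕ) : Gen ℕ where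
  bs := [b]
  dec xs := xs.headI
  enc x := [(b, x)]
  zip_eq xs h := by cases h with | cons _ h => cases h; rfl

theorem unif_E (b : ℕ) (f : ℕ → ℝ) : (unif b).E f = (∑ x ∈ Finset.range b, f x) / b := rfl

theorem unif_mem {b x : ℕ} : (unif b).Mem x ↔ x < b := by
  constructor
  · rintro ⟨xs, h, rfl⟩
    cases h with | cons h' h => cases h; exact h'
  · intro h; exact ⟨[x], .cons h .nil, rfl⟩

theorem valid_split {b₁ b₂ xs : List ℕ} (h : Valid (b₁ ++ b₂) xs) :
    Valid b₁ (xs.take b₁.length) ∧ Valid b₂ (xs.drop b₁.length) :=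
  ⟨List.forall₂_take_append xs b₁ b₂ h.flip |>.flip, List.forall₂_drop_append xs b₁ b₂ h.flip |>.flip⟩

/-- Independent pairs. -/
def prod (G : Gen α) (H : Gen β) : Gen (α × β) where
  bs := G.bs ++ H.bs
  dec xs := (G.dec (xs.take G.bs.length), H.dec (xs.drop G.bs.length))
  enc p := G.enc p.1 ++ H.enc p.2
  zip_eq xs h := by
    obtain ⟨h₁, h₂⟩ := valid_split h
    rw [← G.zip_eq _ h₁, ← H.zip_eq _ h₂, ← List.zip_append h₁.length_eq, List.take_append_drop]

theorem prod_E (G : Gen α) (H : Gen β) (f : α × β → ℝ) :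
    (G.prod H).E f = G.E (fun a => H.E (fun b => f (a, b))) := by
  simp only [E, prod, expect_append]
  refine expect_congr fun xs hx => expect_congr fun ys _ => ?_
  rw [hx.length_eq, List.take_left, List.drop_left]

theorem prod_mem {G : Gen α} {H : Gen β} {p : α × β} (h : (G.prod H).Mem p) : G.Mem p.1 ∧ H.Mem p.2 := by
  obtain ⟨xs, hx, rfl⟩ := h
  obtain ⟨h₁, h₂⟩ := valid_split hx
  exact ⟨⟨_, h₁, rfl⟩, ⟨_, h₂, rfl⟩⟩

theorem prod_pos {G : Gen α} {H : Gen β} (h₁ : G.Pos) (h₂ : H.Pos) : (G.prod H).Pos := by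
  intro b hb
  rcases List.mem_append.1 hb with h | h
  exacts [h₁ b h, h₂ b h]

theorem unif_pos {b : ℕ} (h : 0 < b) : (unif b).Pos := by
  intro x hx
  obtain rfl : x = b := by simpa [unif] using hx
  exact h

/-- `q` independent copies. -/
def rep (G : Gen α) : ℕ → Gen (List α)
  | 0 => ⟨[], fun _ => [], fun _ => [], fun xs h => by cases h; rfl⟩
  | q + 1 =>
    { bs := G.bs ++ (rep G q).bs
      dec := fun xs => G.dec (xs.take G.bs.length) :: (rep G q).dec (xs.drop G.bs.length)
      enc := fun l => match l with
        | [] => []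
        | a :: l => G.enc a ++ (rep G q).enc l
      zip_eq := fun xs h => by
        obtain ⟨h₁, h₂⟩ := valid_split h
        dsimp only
        rw [← G.zip_eq _ h₁, ← (rep G q).zip_eq _ h₂, ← List.zip_append h₁.length_eq, List.take_append_drop] }

theorem rep_zero_E (G : Gen α) (f : List α → ℝ) : (G.rep 0).E f = f [] := rfl

theorem rep_succ_E (G : Gen α) (q : ℕ) (f : List α → ℝ) :
    (G.rep (q + 1)).E f = G.E (fun a => (G.rep q).E (fun l => f (a :: l))) := by
  simp only [E, rep, expect_append]
  refine expect_congr fun xs hx => expect_congr fun ys _ => ?_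
  rw [hx.length_eq, List.take_left, List.drop_left]

theorem rep_mem {G : Gen α} {q : ℕ} {l : List α} (h : (G.rep q).Mem l) : l.length = q ∧ ∀ a ∈ l, G.Mem a := by
  induction q generalizing l with
  | zero => obtain ⟨xs, hx, rfl⟩ := h; simp [rep]
  | succ q ih =>
    obtain ⟨xs, hx, rfl⟩ := h
    obtain ⟨h₁, h₂⟩ := valid_split hx
    have := ih ⟨_, h₂, rfl⟩
    refine ⟨by simp [rep, this.1], ?_⟩
    intro a ha
    rcases List.mem_cons.1 ha with rfl | ha
    exacts [⟨_, h₁, rfl⟩, this.2 a ha]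

theorem rep_pos {G : Gen α} (h : G.Pos) (q : ℕ) : (G.rep q).Pos := by
  induction q with
  | zero => intro b hb; simp [rep] at hb
  | succ q ih =>
    intro b hb
    rcases List.mem_append.1 hb with h' | h'
    exacts [h b h', ih b h']

theorem rep_enc (G : Gen α) {q : ℕ} {l : List α} (h : l.length = q) : (G.rep q).enc l = l.flatMap G.enc := by
  induction q generalizing l with
  | zero => obtain rfl := List.length_eq_zero_iff.1 h; rfl
  | succ q ih =>
    obtain ⟨a, l, rfl⟩ := List.exists_cons_of_length_eq_add_one h
    simp only [rep, List.flatMap_cons, ih (by simpa using h)]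

theorem rep_add_E (G : Gen α) (q₁ q₂ : ℕ) (f : List α → ℝ) :
    (G.rep (q₁ + q₂)).E f = (G.rep q₁).E (fun l₁ => (G.rep q₂).E (fun l₂ => f (l₁ ++ l₂))) := by
  induction q₁ generalizing f with
  | zero => simp [rep_zero_E]
  | succ q ih => simp only [Nat.add_right_comm q 1, rep_succ_E, ih, List.cons_append]

end Gen

/-- To solve an instance it is enough to halt for all random choices and to be wrong for at most a
fraction `δ` of them. -/
theorem solves_of_gen {α : Type} {ε δ : ℝ} {w S T : ℕ} {P : Prog} {n : ℕ} {X Y : List ℕ} {k l : ℕ}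
    (G : Gen α) (hG : G.Pos) (f : α → Config)
    (h : ∀ a, G.Mem a → ∃ t ≤ T, Reach ε w S (init P n X Y k l) (G.enc a) (f a) t ∧ (f a).todo = [])
    (fail : α → ℝ) (h0 : ∀ a, G.Mem a → 0 ≤ fail a)
    (h1 : ∀ a, G.Mem a → ¬ Correct ε X Y k l ((f a).reg 0) ((f a).reg 1) ((f a).reg 2) → 1 ≤ fail a)
    (hE : G.E fail ≤ δ) : Solves ε δ w S T P n X Y k l := by
  classical
  have hrun : run ε w S T (init P n X Y k l) = (draws G.bs).map (fun xs => f (G.dec xs)) := by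
    refine run_eq_map_draws T _ _ _ hG fun xs hxs => ?_
    rw [G.zip_eq xs hxs]
    exact h _ ⟨xs, hxs, rfl⟩
  refine ⟨?_, ?_⟩
  · intro c hc
    rw [hrun, PMF.mem_support_map_iff] at hc
    obtain ⟨xs, hx, rfl⟩ := hc
    obtain ⟨t, -, -, h⟩ := h _ ⟨xs, (mem_support_draws hG).1 hx, rfl⟩
    exact h
  · rw [hrun, PMF.toOuterMeasure_map_apply, toOuterMeasure_draws hG]
    refine ENNReal.ofReal_le_ofReal ?_
    have h2 : (1 : ℝ) ≤ expect G.bs (fun xs => if xs ∈ (fun xs => f (G.dec xs)) ⁻¹'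
        {c | Correct ε X Y k l (c.reg 0) (c.reg 1) (c.reg 2)} then 1 else 0) + G.E fail := by
      rw [Gen.E, ← expect_add]
      conv_lhs => rw [← expect_const hG 1]
      refine expect_mono fun xs hxs => ?_
      have hM : G.Mem (G.dec xs) := ⟨xs, hxs, rfl⟩
      split_ifs with hc
      · linarith [h0 _ hM]
      · have := h1 _ hM hc
        linarith
    linarith

/-! A small language with variables, arrays and expressions, and its translation to machine
programs. -/

/-- Result of an operation without overflow. -/
def Op.val : Op → ℕ → ℕ → ℕ
  | .add, a, b => a + b
  | .sub, a, b => a - b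
  | .mul, a, b => a * b
  | .div, a, b => a / b
  | .mod, a, b => a % b

/-- Expressions; `get A e` is the entry of the array `A` at the index `e`. -/
inductive Ex where
  | var (x : ℕ)
  | const (c : ℕ)
  | op (o : Op) (a b : Ex)
  | get (A : ℕ) (e : Ex)

/-- Contents of variables and of arrays. -/
@[ext] structure State where
  v : ℕ → ℕ
  a : ℕ → ℕ → ℕ

def State.set (s : State) (x n : ℕ) : State := { s with v := Function.update s.v x n }

def State.put (s : State) (A i n : ℕ) : State :=
  { s with a := Function.update s.a A (Function.update (s.a A) i n) }

@[simp] theorem State.set_v (s : State) (x n y : ℕ) :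
    (s.set x n).v y = if y = x then n else s.v y := by
  simp [State.set, Function.update_apply]

@[simp] theorem State.set_a (s : State) (x n : ℕ) : (s.set x n).a = s.a := rfl

@[simp] theorem State.put_v (s : State) (A i n : ℕ) : (s.put A i n).v = s.v := rfl

@[simp] theorem State.put_a (s : State) (A i n B : ℕ) :
    (s.put A i n).a B = if B = A then Function.update (s.a A) i n else s.a B := by
  by_cases h : B = A
  · subst h; simp [State.put]
  · simp [State.put, h]

/-- Parameters of the semantics: the real number `ε`, a strict bound `U` for the contents of
variables and arrays, and the lengths of the arrays. -/
structure Ctx where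
  ε : ℝ
  U : ℕ
  cap : ℕ → ℕ

namespace Ex

def val (s : State) : Ex → ℕ
  | var x => s.v x
  | const c => c
  | op o a b => o.val (a.val s) (b.val s)
  | get A e => s.a A (e.val s)

/-- All array accesses are within bounds. -/
def Ok (K : Ctx) (s : State) : Ex → Prop
  | var _ => True
  | const _ => True
  | op _ a b => a.Ok K s ∧ b.Ok K s
  | get A e => e.Ok K s ∧ e.val s < K.cap A

/-- The value of an expression `e` is less than `U ^ e.deg`. -/
def deg : Ex → ℕ
  | var _ => 1
  | const _ => 1
  | op .add a b => max a.deg b.deg + 1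
  | op .mul a b => a.deg + b.deg
  | op _ a b => max a.deg b.deg
  | get _ e => max 1 e.deg

/-- `V` bounds the names of variables, `N` those of arrays and `U` the constants. -/
def Wf (V N U : ℕ) : Ex → Prop
  | var x => x < V
  | const c => c < U
  | op _ a b => a.Wf V N U ∧ b.Wf V N U
  | get A e => A ≤ N ∧ e.Wf V N U

end Ex

inductive Cond where
  | lt (a b : Ex)
  | eq (a b : Ex)
  | leEps (a b : Ex)

namespace Cond

def left : Cond → Ex
  | lt a _ => a
  | eq a _ => a
  | leEps a _ => a

def right : Cond → Ex
  | lt _ b => b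
  | eq _ b => b
  | leEps _ b => b

def Holds (K : Ctx) (s : State) : Cond → Prop
  | lt a b => a.val s < b.val s
  | eq a b => a.val s = b.val s
  | leEps a b => (a.val s : ℝ) ≤ K.ε * (b.val s : ℝ)

def Ok (K : Ctx) (s : State) (c : Cond) : Prop := c.left.Ok K s ∧ c.right.Ok K s

def test : Cond → ℕ → ℕ → Test
  | lt _ _, r, s => .lt r s
  | eq _ _, r, s => .eq r s
  | leEps _ _, r, s => .leEps r s

end Cond

inductive Stmt where
  | skip
  | assign (x : ℕ) (e : Ex)
  | put (A : ℕ) (i e : Ex)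
  | rand (x : ℕ) (e : Ex)
  | seq (p q : Stmt)
  | ite (c : Cond) (p q : Stmt)
  | loop (c : Cond) (p : Stmt)

/-- `HEval K P s tr s' t`: the program `P` leads from `s` to `s'` in time `t` with the random
choices `tr`. -/
inductive HEval (K : Ctx) : Stmt → State → List (ℕ × ℕ) → State → ℕ → Prop
  | skip (s) : HEval K .skip s [] s 1
  | assign {x e s} (h : e.Ok K s) (hU : e.val s < K.U) :
      HEval K (.assign x e) s [] (s.set x (e.val s)) 1
  | put {A i e s} (hi : i.Ok K s) (he : e.Ok K s) (hc : i.val s < K.cap A) (hU : e.val s < K.U) :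
      HEval K (.put A i e) s [] (s.put A (i.val s) (e.val s)) 1
  | rand {x e s n} (h : e.Ok K s) (hU : e.val s ≤ K.U) (hn : n < e.val s) :
      HEval K (.rand x e) s [(e.val s, n)] (s.set x n) 1
  | seq {p q s₁ s₂ s₃ tr₁ tr₂ t₁ t₂} (h₁ : HEval K p s₁ tr₁ s₂ t₁) (h₂ : HEval K q s₂ tr₂ s₃ t₂) :
      HEval K (.seq p q) s₁ (tr₁ ++ tr₂) s₃ (t₁ + t₂)
  | ite_true {c p q s tr s' t} (hok : c.Ok K s) (hc : c.Holds K s) (h : HEval K p s tr s' t) :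
      HEval K (.ite c p q) s tr s' (t + 1)
  | ite_false {c p q s tr s' t} (hok : c.Ok K s) (hc : ¬ c.Holds K s) (h : HEval K q s tr s' t) :
      HEval K (.ite c p q) s tr s' (t + 1)
  | loop_false {c p s} (hok : c.Ok K s) (hc : ¬ c.Holds K s) : HEval K (.loop c p) s [] s 1
  | loop_true {c p s₁ s₂ s₃ tr₁ tr₂ t₁ t₂} (hok : c.Ok K s₁) (hc : c.Holds K s₁)
      (h₁ : HEval K p s₁ tr₁ s₂ t₁) (h₂ : HEval K (.loop c p) s₂ tr₂ s₃ t₂) :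
      HEval K (.loop c p) s₁ (tr₁ ++ tr₂) s₃ (t₁ + t₂ + 1)

/-! Translation. -/

/-- Translates the index in register `t` to an address; the input is the array `0`. -/
def addrP (V N A t : ℕ) : Prog :=
  match A with
  | 0 => .skip
  | A + 1 =>
    .seq (.const (t + 1) N) (.seq (.op .mul t t (t + 1)) (.seq (.op .add t t V)
      (.seq (.const (t + 1) A) (.op .add t t (t + 1)))))

/-- The `N` work arrays are interleaved behind the input, with stride `N`. Thus addresses are
computed without knowing the lengths of the arrays when the program is compiled. -/
def addr (base N A i : ℕ) : ℕ :=
  match A with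
  | 0 => i
  | A + 1 => i * N + base + A

/-- The registers from `t` on serve as an evaluation stack, with the result in `t`. There is no move
instruction, so a variable is copied by subtracting `0`. -/
def Ex.comp (V N : ℕ) : Ex → ℕ → Prog
  | .var x, t => .seq (.const t 0) (.op .sub t x t)
  | .const c, t => .const t c
  | .op o a b, t => .seq (a.comp V N t) (.seq (b.comp V N (t + 1)) (.op o t t (t + 1)))
  | .get A e, t => .seq (e.comp V N t) (.seq (addrP V N A t) (.load t t))

def Cond.comp (V N : ℕ) (c : Cond) : Prog :=
  .seq (c.left.comp V N (V + 1)) (c.right.comp V N (V + 2))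

/-- Tests of the machine compare registers only, so a loop evaluates the two sides of its condition
once before it starts and again at the end of its body. -/
def Stmt.comp (V N : ℕ) : Stmt → Prog
  | .skip => .skip
  | .assign x e => .seq (e.comp V N (V + 1)) (.seq (.const (V + 2) 0) (.op .sub x (V + 1) (V + 2)))
  | .put A i e => .seq (i.comp V N (V + 1)) (.seq (addrP V N A (V + 1))
      (.seq (e.comp V N (V + 2)) (.store (V + 1) (V + 2))))
  | .rand x e => .seq (e.comp V N (V + 1)) (.rand x (V + 1))
  | .seq p q => .seq (p.comp V N) (q.comp V N)
  | .ite c p q => .seq (c.comp V N) (.ite (c.test (V + 1) (V + 2)) (p.comp V N) (q.comp V N))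
  | .loop c p => .seq (c.comp V N)
      (.loop (c.test (V + 1) (V + 2)) (.seq (p.comp V N) (c.comp V N)))

def Ex.cost : Ex → ℕ
  | .var _ => 3
  | .const _ => 1
  | .op _ a b => a.cost + b.cost + 3
  | .get _ e => e.cost + 12

def Cond.cost (c : Cond) : ℕ := c.left.cost + c.right.cost + 1

/-- Bound for the number of machine steps per unit of time. -/
def Stmt.cost : Stmt → ℕ
  | .skip => 2
  | .assign _ e => e.cost + 5
  | .put _ i e => i.cost + e.cost + 14
  | .rand _ e => e.cost + 3
  | .seq p q => max p.cost q.cost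
  | .ite c p q => max (c.cost + 3) (max p.cost q.cost)
  | .loop c p => max (c.cost + 4) p.cost

def Cond.Wf (V N U D : ℕ) (c : Cond) : Prop :=
  c.left.Wf V N U ∧ c.right.Wf V N U ∧ c.left.deg ≤ D ∧ c.right.deg ≤ D

def Stmt.Wf (V N U D : ℕ) : Stmt → Prop
  | .skip => True
  | .assign x e => x < V ∧ e.Wf V N U ∧ e.deg ≤ D
  | .put A i e => A ≤ N ∧ 0 < A ∧ i.Wf V N U ∧ e.Wf V N U ∧ i.deg ≤ D ∧ e.deg ≤ D
  | .rand x e => x < V ∧ e.Wf V N U ∧ e.deg ≤ D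
  | .seq p q => p.Wf V N U D ∧ q.Wf V N U D
  | .ite c p q => c.Wf V N U D ∧ p.Wf V N U D ∧ q.Wf V N U D
  | .loop c p => c.Wf V N U D ∧ p.Wf V N U D

/-- All contents are less than `U`. -/
structure State.Lt (U : ℕ) (s : State) : Prop where
  v : ∀ x, s.v x < U
  a : ∀ A i, s.a A i < U

theorem State.Lt.set {U : ℕ} {s : State} (h : s.Lt U) {x n : ℕ} (hn : n < U) : (s.set x n).Lt U :=
  ⟨fun y => by rw [State.set_v]; split_ifs; exacts [hn, h.v y], h.a⟩

theorem State.Lt.put {U : ℕ} {s : State} (h : s.Lt U) {A i n : ℕ} (hn : n < U) : (s.put A i n).Lt U := by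
  refine ⟨h.v, fun B j => ?_⟩
  rw [State.put_a]
  split_ifs
  · rw [Function.update_apply]; split_ifs; exacts [hn, h.a A j]
  · exact h.a B j

theorem HEval.lt {K : Ctx} {P : Stmt} {s s' : State} {tr : List (ℕ × ℕ)} {t : ℕ} (h : HEval K P s tr s' t)
    (hs : s.Lt K.U) : s'.Lt K.U := by
  induction h with
  | skip => exact hs
  | assign _ hU => exact hs.set hU
  | put _ _ _ hU => exact hs.put hU
  | rand _ hU hn => exact hs.set (by omega)
  | seq _ _ ih₁ ih₂ => exact ih₂ (ih₁ hs)
  | ite_true _ _ _ ih => exact ih hs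
  | ite_false _ _ _ ih => exact ih hs
  | loop_false => exact hs
  | loop_true _ _ _ _ ih₁ ih₂ => exact ih₂ (ih₁ hs)

theorem Ex.deg_pos (e : Ex) : 1 ≤ e.deg := by
  induction e with
  | var | const => simp [deg]
  | op o a b iha ihb => cases o <;> simp [deg] <;> omega
  | get A e ih => simp [deg]

/-- This rules out overflow in intermediate results. A sum at most doubles the bound, which one more
factor `U ≥ 2` absorbs; in a product the degrees add. -/
theorem Ex.val_lt {V N U : ℕ} {s : State} (hU : 2 ≤ U) (hs : s.Lt U) (e : Ex) (h : e.Wf V N U) :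
    e.val s < U ^ e.deg := by
  induction e with
  | var x => simpa [val, deg] using hs.v x
  | const c => simpa [val, deg, Wf] using h
  | get A e ih =>
    refine lt_of_lt_of_le (hs.a A _) ?_
    calc U = U ^ 1 := (pow_one U).symm
      _ ≤ _ := Nat.pow_le_pow_right (by omega) (by simp [deg])
  | op o a b iha ihb =>
    have h1 := iha h.1
    have h2 := ihb h.2
    have m1 : U ^ a.deg ≤ U ^ max a.deg b.deg := Nat.pow_le_pow_right (by omega) (le_max_left _ _)
    have m2 : U ^ b.deg ≤ U ^ max a.deg b.deg := Nat.pow_le_pow_right (by omega) (le_max_right _ _)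
    cases o with
    | add =>
      simp only [val, Op.val, deg, pow_succ]
      nlinarith
    | sub => simp only [val, Op.val, deg]; omega
    | mul =>
      simp only [val, Op.val, deg, pow_add]
      exact Nat.mul_lt_mul'' h1 h2
    | div =>
      simp only [val, Op.val, deg]
      exact lt_of_le_of_lt (Nat.div_le_self _ _) (h1.trans_le m1)
    | mod =>
      simp only [val, Op.val, deg]
      exact lt_of_le_of_lt (Nat.mod_le _ _) (h1.trans_le m1)

/-! ### Single steps of the machine. -/

section Machine
variable {ε : ℝ} {w S : ℕ} {rest : List Prog} {reg mem : ℕ → ℕ}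

theorem reach_skip : Reach ε w S ⟨.skip :: rest, reg, mem⟩ [] ⟨rest, reg, mem⟩ 1 :=
  .det (by simp) (by simp) rfl (.refl _)

theorem reach_const {r v : ℕ} (h : v < 2 ^ w) :
    Reach ε w S ⟨.const r v :: rest, reg, mem⟩ [] ⟨rest, Function.update reg r v, mem⟩ 1 :=
  .det (by simp) (by simp) (by simp only [step, Nat.mod_eq_of_lt h]) (.refl _)

theorem reach_op {o : Op} {r a b : ℕ} (h : o.val (reg a) (reg b) < 2 ^ w) :
    Reach ε w S ⟨.op o r a b :: rest, reg, mem⟩ []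
      ⟨rest, Function.update reg r (o.val (reg a) (reg b)), mem⟩ 1 := by
  refine .det (by simp) (by simp) ?_ (.refl _)
  cases o <;> simp only [step, Op.eval, Op.val] at h ⊢ <;> rw [Nat.mod_eq_of_lt h]

theorem reach_load {r a : ℕ} (h : reg a < S) :
    Reach ε w S ⟨.load r a :: rest, reg, mem⟩ [] ⟨rest, Function.update reg r (mem (reg a)), mem⟩ 1 :=
  .det (by simp) (by simp) (by simp only [step, h, if_pos]) (.refl _)

theorem reach_store {r a : ℕ} (h : reg a < S) :
    Reach ε w S ⟨.store a r :: rest, reg, mem⟩ [] ⟨rest, reg, Function.update mem (reg a) (reg r)⟩ 1 :=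
  .det (by simp) (by simp) (by simp only [step, h, if_pos]) (.refl _)

theorem Reach.seq {p q : Prog} {tr : List (ℕ × ℕ)} {c' : Config} {t : ℕ}
    (h : Reach ε w S ⟨p :: q :: rest, reg, mem⟩ tr c' t) :
    Reach ε w S ⟨.seq p q :: rest, reg, mem⟩ tr c' (t + 1) :=
  .det (by simp) (by simp) rfl h

/-- The induction hypothesis for a loop speaks about its compiled form, a sequence that starts with
the condition. After the body the machine is already inside this sequence, hence one step has to be
taken off. -/
theorem Reach.seq_inv {p q : Prog} {tr : List (ℕ × ℕ)} {reg' mem' : ℕ → ℕ} {t : ℕ}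
    (h : Reach ε w S ⟨.seq p q :: rest, reg, mem⟩ tr ⟨rest, reg', mem'⟩ t) :
    ∃ t', t = t' + 1 ∧ Reach ε w S ⟨p :: q :: rest, reg, mem⟩ tr ⟨rest, reg', mem'⟩ t' := by
  generalize hc : (⟨rest, reg', mem'⟩ : Config) = c' at h
  cases h with
  | refl =>
    simp only [Config.mk.injEq] at hc
    exact absurd (congrArg List.length hc.1) (by simp)
  | det hne hr h H =>
    refine ⟨_, rfl, ?_⟩
    have h1 : (⟨p :: q :: rest, reg, mem⟩ : Config) ∈ (step ε w S ⟨.seq p q :: rest, reg, mem⟩).support := by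
      simp [step]
    rw [h] at h1
    simp only [PMF.support_pure, Set.mem_singleton_iff] at h1
    rw [h1]; exact H

theorem Reach.ite_true {u : Test} {p q : Prog} {tr : List (ℕ × ℕ)} {c' : Config} {t : ℕ}
    (hu : u.Holds ε reg) (h : Reach ε w S ⟨p :: rest, reg, mem⟩ tr c' t) :
    Reach ε w S ⟨.ite u p q :: rest, reg, mem⟩ tr c' (t + 1) :=
  .det (by simp) (by simp) (by simp only [step, hu, if_pos]) h

theorem Reach.ite_false {u : Test} {p q : Prog} {tr : List (ℕ × ℕ)} {c' : Config} {t : ℕ}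
    (hu : ¬ u.Holds ε reg) (h : Reach ε w S ⟨q :: rest, reg, mem⟩ tr c' t) :
    Reach ε w S ⟨.ite u p q :: rest, reg, mem⟩ tr c' (t + 1) :=
  .det (by simp) (by simp) (by simp only [step, hu, if_neg, not_false_eq_true]) h

theorem Reach.loop_true {u : Test} {p : Prog} {tr : List (ℕ × ℕ)} {c' : Config} {t : ℕ} (hu : u.Holds ε reg)
    (h : Reach ε w S ⟨p :: .loop u p :: rest, reg, mem⟩ tr c' t) :
    Reach ε w S ⟨.loop u p :: rest, reg, mem⟩ tr c' (t + 1) :=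
  .det (by simp) (by simp) (by simp only [step, hu, if_pos]) h

theorem Reach.loop_false {u : Test} {p : Prog} {tr : List (ℕ × ℕ)} {c' : Config} {t : ℕ}
    (hu : ¬ u.Holds ε reg) (h : Reach ε w S ⟨rest, reg, mem⟩ tr c' t) :
    Reach ε w S ⟨.loop u p :: rest, reg, mem⟩ tr c' (t + 1) :=
  .det (by simp) (by simp) (by simp only [step, hu, if_neg, not_false_eq_true]) h

end Machine

/-! ### Correctness of the translation. -/

/-- The machine with registers `reg` and memory `mem` represents the state `s`. -/
structure Rep (K : Ctx) (V N base : ℕ) (s : State) (reg mem : ℕ → ℕ) : Prop where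
  v : ∀ x < V, reg x = s.v x
  reg_base : reg V = base
  a : ∀ A ≤ N, ∀ i < K.cap A, mem (addr base N A i) = s.a A i

/-- The machine is large enough for the translated program. -/
structure Fits (K : Ctx) (V N D base w S : ℕ) : Prop where
  two_le : 2 ≤ K.U
  one_le : 1 ≤ D
  word : K.U ^ D ≤ 2 ^ w
  N_lt : N < 2 ^ w
  N_pos : 0 < N
  cap0 : K.cap 0 ≤ base
  base_le : base ≤ S
  cap : ∀ A, 0 < A → A ≤ N → K.cap A * N + base + N ≤ S
  S_le : S ≤ 2 ^ w

section Translation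
variable {K : Ctx} {V N D base w S : ℕ}

theorem addr_lt (hF : Fits K V N D base w S) {A i : ℕ} (hA : A ≤ N) (hi : i < K.cap A) :
    addr base N A i < S := by
  cases A with
  | zero => exact lt_of_lt_of_le (lt_of_lt_of_le hi hF.cap0) hF.base_le
  | succ A =>
    have := hF.cap (A + 1) (by omega) hA
    have h2 : i * N ≤ K.cap (A + 1) * N := Nat.mul_le_mul_right _ hi.le
    simp only [addr]; omega

/-- The input lies below `base`; behind it, index and array are quotient and remainder modulo `N`.
-/
theorem addr_inj (hF : Fits K V N D base w S) {A i B j : ℕ} (hA : A ≤ N) (hB : B ≤ N) (hi : i < K.cap A)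
    (hj : j < K.cap B) (h : addr base N A i = addr base N B j) : A = B ∧ i = j := by
  have h0 := hF.cap0
  rcases A with - | A <;> rcases B with - | B <;> simp only [addr] at h
  · exact ⟨rfl, h⟩
  · omega
  · omega
  · have h1 : i * N + A = j * N + B := by omega
    have h2 : (i * N + A) / N = (j * N + B) / N := by rw [h1]
    have hN := hF.N_pos
    rw [Nat.add_comm, Nat.add_mul_div_right _ _ hN, Nat.add_comm, Nat.add_comm (j * N),
      Nat.add_mul_div_right _ _ hN, Nat.div_eq_of_lt (by omega), Nat.div_eq_of_lt (by omega)] at h2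
    have h3 : i = j := by omega
    subst h3
    exact ⟨by omega, rfl⟩

theorem reach_addr (hF : Fits K V N D base w S) {ε : ℝ} {A i t : ℕ} (hA : A ≤ N) (hi : i < K.cap A)
    {reg mem : ℕ → ℕ} (hV : reg V = base) (ht : V < t) (hr : reg t = i) (rest : List Prog) :
    ∃ reg' n, Reach ε w S ⟨addrP V N A t :: rest, reg, mem⟩ [] ⟨rest, reg', mem⟩ n ∧ n ≤ 9 ∧
      (∀ x < t, reg' x = reg x) ∧ reg' t = addr base N A i := by
  cases A with
  | zero => exact ⟨reg, 1, reach_skip, by omega, fun _ _ => rfl, hr⟩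
  | succ A =>
    have h1 := addr_lt hF hA hi
    have h2 := hF.S_le
    have h3 := hF.N_lt
    simp only [addr] at h1
    have e1 : t ≠ t + 1 := by omega
    have e2 : V ≠ t + 1 := by omega
    have e3 : V ≠ t := by omega
    refine ⟨_, _, .seq (.trans (reach_const h3) (.seq (.trans (reach_op ?_)
      (.seq (.trans (reach_op ?_) (.seq (.trans (reach_const ?_) (reach_op ?_)))))))), ?_, ?_, ?_⟩
    all_goals try simp [Op.val, Function.update_apply, e2, e3, hr, hV, addr]
    all_goals try omega
    intro x hx
    have f1 : x ≠ t := by omega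
    have f2 : x ≠ t + 1 := by omega
    simp [f1, f2]

/-- The induction rests on the stack discipline: registers below `t` keep their contents, so
variables, the base address and operands computed earlier survive the evaluation. -/
theorem Ex.reach (hF : Fits K V N D base w S) {s : State} (hs : s.Lt K.U) {ε : ℝ} {mem : ℕ → ℕ} (e : Ex) :
    ∀ {t : ℕ} {reg : ℕ → ℕ}, e.Wf V N K.U → e.deg ≤ D → e.Ok K s → V < t → Rep K V N base s reg mem →
      ∀ rest : List Prog, ∃ reg' n, Reach ε w S ⟨e.comp V N t :: rest, reg, mem⟩ [] ⟨rest, reg', mem⟩ n ∧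
      n ≤ e.cost ∧ (∀ x < t, reg' x = reg x) ∧ reg' t = e.val s := by
  have hlt : ∀ e : Ex, e.Wf V N K.U → e.deg ≤ D → e.val s < 2 ^ w := fun e h hd =>
    lt_of_lt_of_le (Ex.val_lt hF.two_le hs e h)
      ((Nat.pow_le_pow_right (by have := hF.two_le; omega) hd).trans hF.word)
  induction e with
  | var x =>
    intro t reg hwf hd hok ht hR rest
    have hx : x < V := hwf
    have e1 : x ≠ t := by omega
    have h1 := hlt (.var x) hwf hd
    refine ⟨_, _, .seq (.trans (reach_const (by positivity)) (reach_op ?_)), ?_, ?_, ?_⟩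
    all_goals simp [Op.val, Function.update_apply, e1, hR.v x hx, val, cost]
    · exact h1
    · intro y hy
      rw [if_neg (by omega), if_neg (by omega)]
  | const c =>
    intro t reg hwf hd hok ht hR rest
    refine ⟨_, _, reach_const (hlt (.const c) hwf hd), le_rfl, ?_, by simp [val]⟩
    intro y hy
    rw [Function.update_of_ne (by omega)]
  | op o a b iha ihb =>
    intro t reg hwf hd hok ht hR rest
    have h1 := hlt (.op o a b) hwf hd
    have hda : a.deg ≤ D := by
      have := b.deg_pos
      cases o <;> simp only [deg] at hd <;> omega
    have hdb : b.deg ≤ D := by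
      have := a.deg_pos
      cases o <;> simp only [deg] at hd <;> omega
    obtain ⟨r1, n1, H1, c1, f1, v1⟩ := iha hwf.1 hda hok.1 ht hR
      (.seq (b.comp V N (t + 1)) (.op o t t (t + 1)) :: rest)
    have hR1 : Rep K V N base s r1 mem :=
      ⟨fun x hx => by rw [f1 x (by omega), hR.v x hx], by rw [f1 V ht, hR.reg_base], hR.a⟩
    obtain ⟨r2, n2, H2, c2, f2, v2⟩ := ihb (t := t + 1) hwf.2 hdb hok.2 (by omega) hR1
      (.op o t t (t + 1) :: rest)
    have h3 : r2 t = a.val s := by rw [f2 t (by omega), v1]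
    refine ⟨_, _, .seq (H1.trans (.seq (H2.trans (reach_op ?_)))), ?_, ?_, ?_⟩
    · rw [h3, v2]; exact h1
    · simp only [cost]; omega
    · intro y hy
      rw [Function.update_of_ne (by omega), f2 y (by omega), f1 y hy]
    · rw [Function.update_self, h3, v2]; rfl
  | get A e ih =>
    intro t reg hwf hd hok ht hR rest
    obtain ⟨r1, n1, H1, c1, f1, v1⟩ := ih hwf.2 (by simp [deg] at hd; omega) hok.1 ht hR
      (.seq (addrP V N A t) (.load t t) :: rest)
    obtain ⟨r2, n2, H2, c2, f2, v2⟩ := reach_addr hF (ε := ε) (mem := mem) hwf.1 hok.2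
      (by rw [f1 V ht, hR.reg_base]) ht v1 (.load t t :: rest)
    refine ⟨_, _, .seq (H1.trans (.seq (H2.trans (reach_load ?_)))), ?_, ?_, ?_⟩
    · rw [v2]; exact addr_lt hF hwf.1 hok.2
    · simp only [cost]; omega
    · intro y hy
      rw [Function.update_of_ne (by omega), f2 y hy, f1 y hy]
    · rw [Function.update_self, v2, hR.a A hwf.1 _ hok.2, val]

theorem Rep.congr {s : State} {reg reg' mem : ℕ → ℕ} (hR : Rep K V N base s reg mem)
    (h : ∀ x ≤ V, reg' x = reg x) : Rep K V N base s reg' mem :=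
  ⟨fun x hx => by rw [h x hx.le, hR.v x hx], by rw [h V le_rfl, hR.reg_base], hR.a⟩

theorem Rep.set {s : State} {reg reg' mem : ℕ → ℕ} {y m : ℕ} (hR : Rep K V N base s reg mem) (hy : y < V)
    (h : ∀ x ≤ V, x ≠ y → reg' x = reg x) (hm : reg' y = m) : Rep K V N base (s.set y m) reg' mem := by
  refine ⟨fun x hx => ?_, by rw [h V le_rfl (by omega), hR.reg_base], hR.a⟩
  rw [State.set_v]
  split_ifs with e
  · rw [e, hm]
  · rw [h x hx.le e, hR.v x hx]

theorem Cond.reach (hF : Fits K V N D base w S) {s : State} (hs : s.Lt K.U) {mem : ℕ → ℕ} (c : Cond)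
    {reg : ℕ → ℕ} (hwf : c.Wf V N K.U D) (hok : c.Ok K s) (hR : Rep K V N base s reg mem) (rest : List Prog) :
    ∃ reg' n, Reach K.ε w S ⟨c.comp V N :: rest, reg, mem⟩ [] ⟨rest, reg', mem⟩ n ∧ n ≤ c.cost ∧
      Rep K V N base s reg' mem ∧ ((c.test (V + 1) (V + 2)).Holds K.ε reg' ↔ c.Holds K s) := by
  obtain ⟨r1, n1, H1, c1, f1, v1⟩ := c.left.reach hF hs (ε := K.ε) hwf.1 hwf.2.2.1 hok.1
    (Nat.lt_succ_self V) hR (c.right.comp V N (V + 2) :: rest)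
  have hR1 := hR.congr (fun x hx => f1 x (Nat.lt_succ_of_le hx))
  obtain ⟨r2, n2, H2, c2, f2, v2⟩ := c.right.reach hF hs (ε := K.ε) (t := V + 2) hwf.2.1 hwf.2.2.2
    hok.2 (by omega) hR1 rest
  have hR2 := hR1.congr (fun x hx => f2 x (by omega))
  have h3 : r2 (V + 1) = c.left.val s := by rw [f2 _ (by omega), v1]
  refine ⟨r2, _, .seq (H1.trans H2), by simp only [Cond.cost]; omega, hR2, ?_⟩
  cases c <;> simp [Cond.test, Test.Holds, Cond.Holds, h3, v2, Cond.left, Cond.right]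

/-- Simulation with a constant factor. The spare step in `n + 1 ≤ C * t` pays for unfolding a
sequence, so that the bound adds up under composition. -/
theorem Stmt.reach (hF : Fits K V N D base w S) {P : Stmt} {s s' : State} {tr : List (ℕ × ℕ)} {t : ℕ}
    (h : HEval K P s tr s' t) :
    s.Lt K.U → P.Wf V N K.U D → ∀ C, P.cost ≤ C → ∀ reg mem, Rep K V N base s reg mem →
      ∀ rest : List Prog, ∃ reg' mem' n, Reach K.ε w S ⟨P.comp V N :: rest, reg, mem⟩ tr ⟨rest, reg', mem'⟩
      n ∧ n + 1 ≤ C * t ∧ Rep K V N base s' reg' mem' := by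
  induction h with
  | skip s =>
    intro hs hwf C hC reg mem hR rest
    exact ⟨reg, mem, _, reach_skip, by simpa [cost] using hC, hR⟩
  | @assign x e s hok hU =>
    intro hs hwf C hC reg mem hR rest
    obtain ⟨hx, hwf, hd⟩ := hwf
    obtain ⟨r1, n1, H1, c1, f1, v1⟩ := e.reach hF hs (ε := K.ε) hwf hd hok (Nat.lt_succ_self V) hR
      (.seq (.const (V + 2) 0) (.op .sub x (V + 1) (V + 2)) :: rest)
    have hR1 := hR.congr (fun x hx => f1 x (Nat.lt_succ_of_le hx))
    have hw : e.val s < 2 ^ w := lt_of_lt_of_le hU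
      ((Nat.le_self_pow (by have := hF.one_le; omega) _).trans hF.word)
    refine ⟨_, mem, _, .seq (H1.trans (.seq (.trans (reach_const (by positivity)) (reach_op ?_)))), ?_, ?_⟩
    · simpa [Op.val, v1] using hw
    · simp only [cost] at hC; omega
    · refine hR1.set hx ?_ ?_
      · intro y hy hyx
        rw [Function.update_of_ne hyx, Function.update_of_ne (by omega)]
      · simp [Op.val, v1]
  | @put A i e s hi he hc hU =>
    intro hs hwf C hC reg mem hR rest
    obtain ⟨hA, hA0, hwi, hwe, hdi, hde⟩ := hwf
    obtain ⟨r1, n1, H1, c1, f1, v1⟩ := i.reach hF hs (ε := K.ε) hwi hdi hi (Nat.lt_succ_self V) hR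
      (.seq (addrP V N A (V + 1)) (.seq (e.comp V N (V + 2)) (.store (V + 1) (V + 2))) :: rest)
    have hR1 := hR.congr (fun x hx => f1 x (Nat.lt_succ_of_le hx))
    obtain ⟨r2, n2, H2, c2, f2, v2⟩ := reach_addr hF (ε := K.ε) (mem := mem) hA hc
      hR1.reg_base (Nat.lt_succ_self V) v1 (.seq (e.comp V N (V + 2)) (.store (V + 1) (V + 2)) :: rest)
    have hR2 := hR1.congr (fun x hx => f2 x (Nat.lt_succ_of_le hx))
    obtain ⟨r3, n3, H3, c3, f3, v3⟩ := e.reach hF hs (ε := K.ε) (t := V + 2) hwe hde he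
      (by omega) hR2 (.store (V + 1) (V + 2) :: rest)
    have hR3 := hR2.congr (fun x hx => f3 x (by omega))
    have h3 : r3 (V + 1) = addr base N A (i.val s) := by rw [f3 _ (by omega), v2]
    refine ⟨_, _, _, .seq (H1.trans (.seq (H2.trans (.seq (H3.trans (reach_store ?_)))))), ?_, ?_⟩
    · rw [h3]; exact addr_lt hF hA hc
    · simp only [cost] at hC; omega
    · refine ⟨hR3.v, hR3.reg_base, fun B hB j hj => ?_⟩
      rw [h3, v3, State.put_a, Function.update_apply]
      split_ifs with e1 e2 e2
      · subst e2
        obtain ⟨-, rfl⟩ := addr_inj hF hB hA hj hc e1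
        simp
      · exact absurd (addr_inj hF hB hA hj hc e1).1 e2
      · subst e2
        rw [Function.update_of_ne (by rintro rfl; contradiction), hR3.a _ hB _ hj]
      · exact hR3.a B hB j hj
  | @rand x e s m hok hU hm =>
    intro hs hwf C hC reg mem hR rest
    obtain ⟨hx, hwf, hd⟩ := hwf
    obtain ⟨r1, n1, H1, c1, f1, v1⟩ := e.reach hF hs (ε := K.ε) hwf hd hok (Nat.lt_succ_self V) hR
      (.rand x (V + 1) :: rest)
    have hR1 := hR.congr (fun x hx => f1 x (Nat.lt_succ_of_le hx))
    have H2 : Reach K.ε w S ⟨.rand x (V + 1) :: rest, r1, mem⟩ [(r1 (V + 1), m)] _ 1 :=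
      .rand (by rw [v1]; exact hm) (.refl _)
    rw [v1] at H2
    refine ⟨_, mem, _, .seq (H1.trans H2), ?_, hR1.set hx ?_ ?_⟩
    · simp only [cost] at hC; omega
    · intro y hy hyx
      rw [Function.update_of_ne hyx]
    · simp
  | @seq p q s₁ s₂ s₃ tr₁ tr₂ t₁ t₂ h₁ h₂ ih₁ ih₂ =>
    intro hs hwf C hC reg mem hR rest
    simp only [cost, max_le_iff] at hC
    obtain ⟨r1, m1, n1, H1, c1, hR1⟩ := ih₁ hs hwf.1 C hC.1 reg mem hR (q.comp V N :: rest)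
    obtain ⟨r2, m2, n2, H2, c2, hR2⟩ := ih₂ (h₁.lt hs) hwf.2 C hC.2 r1 m1 hR1 rest
    exact ⟨r2, m2, _, .seq (H1.trans H2), by rw [Nat.mul_add]; omega, hR2⟩
  | @ite_true c p q s tr s' t hok hc h ih =>
    intro hs hwf C hC reg mem hR rest
    simp only [cost, max_le_iff] at hC
    obtain ⟨r1, n1, H1, c1, hR1, hT⟩ := c.reach hF hs hwf.1 hok hR
      (.ite (c.test (V + 1) (V + 2)) (p.comp V N) (q.comp V N) :: rest)
    obtain ⟨r2, m2, n2, H2, c2, hR2⟩ := ih hs hwf.2.1 C hC.2.1 r1 mem hR1 rest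
    exact ⟨r2, m2, _, .seq (H1.trans (.ite_true (hT.2 hc) H2)), by rw [Nat.mul_add]; omega, hR2⟩
  | @ite_false c p q s tr s' t hok hc h ih =>
    intro hs hwf C hC reg mem hR rest
    simp only [cost, max_le_iff] at hC
    obtain ⟨r1, n1, H1, c1, hR1, hT⟩ := c.reach hF hs hwf.1 hok hR
      (.ite (c.test (V + 1) (V + 2)) (p.comp V N) (q.comp V N) :: rest)
    obtain ⟨r2, m2, n2, H2, c2, hR2⟩ := ih hs hwf.2.2 C hC.2.2 r1 mem hR1 rest
    exact ⟨r2, m2, _, .seq (H1.trans (.ite_false (mt hT.1 hc) H2)), by rw [Nat.mul_add]; omega, hR2⟩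
  | @loop_false c p s hok hc =>
    intro hs hwf C hC reg mem hR rest
    simp only [cost, max_le_iff] at hC
    obtain ⟨r1, n1, H1, c1, hR1, hT⟩ := c.reach hF hs hwf.1 hok hR
      (.loop (c.test (V + 1) (V + 2)) (.seq (p.comp V N) (c.comp V N)) :: rest)
    exact ⟨r1, mem, _, .seq (H1.trans (.loop_false (mt hT.1 hc) (.refl _))), by omega, hR1⟩
  | @loop_true c p s₁ s₂ s₃ tr₁ tr₂ t₁ t₂ hok hc h₁ h₂ ih₁ ih₂ =>
    intro hs hwf C hC reg mem hR rest
    have hC' := hC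
    simp only [cost, max_le_iff] at hC
    obtain ⟨r1, n1, H1, c1, hR1, hT⟩ := c.reach hF hs hwf.1 hok hR
      (.loop (c.test (V + 1) (V + 2)) (.seq (p.comp V N) (c.comp V N)) :: rest)
    obtain ⟨r2, m2, n2, H2, c2, hR2⟩ := ih₁ hs hwf.2 C hC.2 r1 mem hR1
      (c.comp V N :: .loop (c.test (V + 1) (V + 2)) (.seq (p.comp V N) (c.comp V N)) :: rest)
    obtain ⟨r3, m3, n3, H3, c3, hR3⟩ := ih₂ (h₁.lt hs) hwf C hC' r2 m2 hR2 rest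
    obtain ⟨n3', rfl, H3'⟩ := Reach.seq_inv H3
    refine ⟨r3, m3, _, .seq (H1.trans (.loop_true (hT.2 hc) (.seq (H2.trans H3')))), ?_, hR3⟩
    simp only [Nat.mul_add]; omega

end Translation

/-! The translated program is free of tests against `ε` if the source is. -/

def Cond.EpsFree : Cond → Prop
  | .leEps _ _ => False
  | _ => True

def Stmt.EpsFree : Stmt → Prop
  | .seq p q => p.EpsFree ∧ q.EpsFree
  | .ite c p q => c.EpsFree ∧ p.EpsFree ∧ q.EpsFree
  | .loop c p => c.EpsFree ∧ p.EpsFree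
  | _ => True

theorem addrP_epsFree (V N A t : ℕ) : (addrP V N A t).EpsFree := by
  cases A <;> simp [addrP, Prog.EpsFree]

theorem Ex.comp_epsFree (V N : ℕ) (e : Ex) (t : ℕ) : (e.comp V N t).EpsFree := by
  induction e generalizing t with
  | var | const => simp [Ex.comp, Prog.EpsFree]
  | op o a b iha ihb => simp [Ex.comp, Prog.EpsFree, iha, ihb]
  | get A e ih => simp [Ex.comp, Prog.EpsFree, ih, addrP_epsFree]

theorem Cond.comp_epsFree (V N : ℕ) (c : Cond) : (c.comp V N).EpsFree :=
  ⟨Ex.comp_epsFree _ _ _ _, Ex.comp_epsFree _ _ _ _⟩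

theorem Cond.test_epsFree {c : Cond} (h : c.EpsFree) (r s : ℕ) : (c.test r s).EpsFree := by
  cases c <;> trivial

theorem Stmt.comp_epsFree (V N : ℕ) {P : Stmt} (h : P.EpsFree) : (P.comp V N).EpsFree := by
  induction P with
  | skip => trivial
  | assign x e => simp [Stmt.comp, Prog.EpsFree, Ex.comp_epsFree]
  | put A i e => simp [Stmt.comp, Prog.EpsFree, Ex.comp_epsFree, addrP_epsFree]
  | rand x e => simp [Stmt.comp, Prog.EpsFree, Ex.comp_epsFree]
  | seq p q ihp ihq => exact ⟨ihp h.1, ihq h.2⟩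
  | ite c p q ihp ihq =>
    exact ⟨c.comp_epsFree V N, Cond.test_epsFree h.1 _ _, ihp h.2.1, ihq h.2.2⟩
  | loop c p ih =>
    exact ⟨c.comp_epsFree V N, Cond.test_epsFree h.1 _ _, ih h.2, c.comp_epsFree V N⟩

/-! Reasoning about programs. -/

/-- The program `P` makes the choices `tr` when started in `s`, and it ends in a state `s'` at a
time `τ'` with `Q s' τ'` if it is started at time `τ`. -/
def wp (K : Ctx) (P : Stmt) (tr : List (ℕ × ℕ)) (Q : State → ℕ → Prop) (s : State) (τ : ℕ) : Prop :=
  ∃ s' t, HEval K P s tr s' t ∧ Q s' (τ + t)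

section Rules
variable {K : Ctx} {Q Q' : State → ℕ → Prop} {s : State} {τ : ℕ}

theorem wp.conseq {P : Stmt} {tr : List (ℕ × ℕ)} (h : wp K P tr Q s τ) (hQ : ∀ s' τ', Q s' τ' → Q' s' τ') :
    wp K P tr Q' s τ := by
  obtain ⟨s', t, h, hq⟩ := h
  exact ⟨s', t, h, hQ _ _ hq⟩

theorem wp_skip : wp K .skip [] Q s τ ↔ Q s (τ + 1) := by
  constructor
  · rintro ⟨s', t, h, hq⟩
    cases h; exact hq
  · exact fun h => ⟨s, 1, .skip s, h⟩

theorem wp_assign {x : ℕ} {e : Ex} :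
    wp K (.assign x e) [] Q s τ ↔ e.Ok K s ∧ e.val s < K.U ∧ Q (s.set x (e.val s)) (τ + 1) := by
  constructor
  · rintro ⟨s', t, h, hq⟩
    cases h with | assign h hU => exact ⟨h, hU, hq⟩
  · exact fun h => ⟨_, 1, .assign h.1 h.2.1, h.2.2⟩

theorem wp_put {A : ℕ} {i e : Ex} :
    wp K (.put A i e) [] Q s τ ↔ i.Ok K s ∧ e.Ok K s ∧ i.val s < K.cap A ∧ e.val s < K.U ∧
      Q (s.put A (i.val s) (e.val s)) (τ + 1) := by
  constructor
  · rintro ⟨s', t, h, hq⟩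
    cases h with | put h1 h2 h3 h4 => exact ⟨h1, h2, h3, h4, hq⟩
  · exact fun h => ⟨_, 1, .put h.1 h.2.1 h.2.2.1 h.2.2.2.1, h.2.2.2.2⟩

theorem wp_rand {x b m : ℕ} {e : Ex} (h : e.Ok K s) (hb : e.val s = b) (hU : b ≤ K.U) (hm : m < b)
    (hq : Q (s.set x m) (τ + 1)) : wp K (.rand x e) [(b, m)] Q s τ := by
  subst hb
  exact ⟨_, 1, .rand h hU hm, hq⟩

theorem wp_seq_tr {p q : Stmt} {tr₁ tr₂ : List (ℕ × ℕ)} (h : wp K p tr₁ (wp K q tr₂ Q) s τ) :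
    wp K (.seq p q) (tr₁ ++ tr₂) Q s τ := by
  obtain ⟨s', t, h, s'', t', h', hq⟩ := h
  exact ⟨s'', _, .seq h h', by rwa [← Nat.add_assoc]⟩

theorem wp_seq {p q : Stmt} : wp K (.seq p q) [] Q s τ ↔ wp K p [] (wp K q [] Q) s τ := by
  constructor
  · rintro ⟨s', t, h, hq⟩
    generalize htr : ([] : List (ℕ × ℕ)) = tr at h
    cases h with
    | seq h₁ h₂ =>
      obtain ⟨rfl, rfl⟩ := List.append_eq_nil_iff.1 htr.symm
      exact ⟨_, _, h₁, _, _, h₂, by rwa [Nat.add_assoc]⟩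
  · exact wp_seq_tr (tr₁ := []) (tr₂ := [])

theorem wp_seq_right {p q : Stmt} {tr : List (ℕ × ℕ)} (h : wp K p [] (wp K q tr Q) s τ) :
    wp K (.seq p q) tr Q s τ := wp_seq_tr (tr₁ := []) h

theorem wp_seq_left {p q : Stmt} {tr : List (ℕ × ℕ)} (h : wp K p tr (wp K q [] Q) s τ) :
    wp K (.seq p q) tr Q s τ := by
  simpa using wp_seq_tr h

theorem wp_ite {c : Cond} {p q : Stmt} {tr : List (ℕ × ℕ)} :
    wp K (.ite c p q) tr Q s τ ↔ c.Ok K s ∧ (c.Holds K s → wp K p tr Q s (τ + 1)) ∧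
      (¬ c.Holds K s → wp K q tr Q s (τ + 1)) := by
  constructor
  · rintro ⟨s', t, h, hq⟩
    cases h with
    | ite_true hok hc h =>
      exact ⟨hok, fun _ => ⟨_, _, h, by rwa [Nat.add_assoc, Nat.add_comm 1]⟩, fun h' => absurd hc h'⟩
    | ite_false hok hc h =>
      exact ⟨hok, fun h' => absurd h' hc, fun _ => ⟨_, _, h, by rwa [Nat.add_assoc, Nat.add_comm 1]⟩⟩
  · rintro ⟨hok, h1, h2⟩
    by_cases hc : c.Holds K s
    · obtain ⟨s', t, h, hq⟩ := h1 hc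
      exact ⟨s', _, .ite_true hok hc h, by rwa [Nat.add_comm t, ← Nat.add_assoc]⟩
    · obtain ⟨s', t, h, hq⟩ := h2 hc
      exact ⟨s', _, .ite_false hok hc h, by rwa [Nat.add_comm t, ← Nat.add_assoc]⟩

/-- A loop with `L.length` iterations that makes the choices `L[i]` in iteration `i`. -/
theorem wp_loop_tr {c : Cond} {p : Stmt} (L : List (List (ℕ × ℕ))) (I : ℕ → State → ℕ → Prop) (h0 : I 0 s τ)
    (hok : ∀ i ≤ L.length, ∀ s τ, I i s τ → c.Ok K s)
    (hstep : ∀ i (h : i < L.length), ∀ s τ, I i s τ → c.Holds K s ∧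
      wp K p L[i] (fun s' τ' => I (i + 1) s' (τ' + 1)) s τ)
    (hfin : ∀ s τ, I L.length s τ → ¬ c.Holds K s ∧ Q s (τ + 1)) : wp K (.loop c p) L.flatten Q s τ := by
  induction L generalizing s τ I with
  | nil => exact ⟨s, 1, .loop_false (hok 0 le_rfl s τ h0) (hfin s τ h0).1, (hfin s τ h0).2⟩
  | cons tr L ih =>
    obtain ⟨hc, s', t, hev, hI⟩ := hstep 0 (by simp) s τ h0
    obtain ⟨s'', t', hev', hq⟩ := ih (s := s') (τ := τ + t + 1) (fun i => I (i + 1)) hI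
      (fun i hi => hok (i + 1) (by simpa using hi))
      (fun i hi => hstep (i + 1) (by simpa using hi))
      (fun s τ h => hfin s τ (by simpa using h))
    refine ⟨s'', _, .loop_true (hok 0 (by simp) s τ h0) hc hev hev', ?_⟩
    have : τ + (t + t' + 1) = τ + t + 1 + t' := by omega
    rwa [this]

theorem wp_loop {c : Cond} {p : Stmt} (N : ℕ) (I : ℕ → State → ℕ → Prop) (h0 : I 0 s τ)
    (hok : ∀ i ≤ N, ∀ s τ, I i s τ → c.Ok K s)
    (hstep : ∀ i < N, ∀ s τ, I i s τ → c.Holds K s ∧ wp K p [] (fun s' τ' => I (i + 1) s' (τ' + 1)) s τ)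
    (hfin : ∀ s τ, I N s τ → ¬ c.Holds K s ∧ Q s (τ + 1)) : wp K (.loop c p) [] Q s τ := by
  have := wp_loop_tr (K := K) (c := c) (p := p) (Q := Q) (s := s) (τ := τ) (List.replicate N []) I h0
    (by simpa using hok) (fun i hi => by simpa using hstep i (by simpa using hi)) (by simpa using hfin)
  simpa using this

end Rules

/-! Variables and arrays that are not modified. -/

def Stmt.mods : Stmt → List ℕ
  | .assign x _ => [x]
  | .rand x _ => [x]
  | .seq p q => p.mods ++ q.mods
  | .ite _ p q => p.mods ++ q.mods
  | .loop _ p => p.mods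
  | _ => []

def Stmt.amods : Stmt → List ℕ
  | .put A _ _ => [A]
  | .seq p q => p.amods ++ q.amods
  | .ite _ p q => p.amods ++ q.amods
  | .loop _ p => p.amods
  | _ => []

/-- The states agree except for the variables in `l` and the arrays in `la`. -/
structure Fr (l la : List ℕ) (s s' : State) : Prop where
  v : ∀ x, x ∉ l → s'.v x = s.v x
  a : ∀ A, A ∉ la → s'.a A = s.a A

theorem Fr.rfl' {l la : List ℕ} {s : State} : Fr l la s s := ⟨fun _ _ => rfl, fun _ _ => rfl⟩

theorem Fr.trans {l la : List ℕ} {s₁ s₂ s₃ : State} (h₁ : Fr l la s₁ s₂) (h₂ : Fr l la s₂ s₃) :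
    Fr l la s₁ s₃ :=
  ⟨fun x hx => (h₂.v x hx).trans (h₁.v x hx), fun A hA => (h₂.a A hA).trans (h₁.a A hA)⟩

theorem Fr.mono {l la l' la' : List ℕ} {s s' : State} (h : Fr l la s s') (h1 : l ⊆ l') (h2 : la ⊆ la') :
    Fr l' la' s s' :=
  ⟨fun x hx => h.v x (fun h => hx (h1 h)), fun A hA => h.a A (fun h => hA (h2 h))⟩

theorem Fr.set {l la : List ℕ} {s s' : State} {x m : ℕ} (h : Fr l la s s') (hx : x ∈ l) :
    Fr l la s (s'.set x m) :=
  ⟨fun y hy => by rw [State.set_v, if_neg (by rintro rfl; exact hy hx), h.v y hy], h.a⟩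

theorem HEval.frame {K : Ctx} {P : Stmt} {s s' : State} {tr : List (ℕ × ℕ)} {t : ℕ}
    (h : HEval K P s tr s' t) : Fr P.mods P.amods s s' := by
  induction h with
  | skip => exact .rfl'
  | assign => exact Fr.rfl'.set (by simp [Stmt.mods])
  | rand => exact Fr.rfl'.set (by simp [Stmt.mods])
  | put =>
    refine ⟨fun _ _ => rfl, fun B hB => ?_⟩
    rw [State.put_a, if_neg (by simpa [Stmt.amods] using hB)]
  | seq _ _ ih₁ ih₂ =>
    exact (ih₁.mono (by simp [Stmt.mods]) (by simp [Stmt.amods])).trans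
      (ih₂.mono (by simp [Stmt.mods]) (by simp [Stmt.amods]))
  | ite_true _ _ _ ih => exact ih.mono (by simp [Stmt.mods]) (by simp [Stmt.amods])
  | ite_false _ _ _ ih => exact ih.mono (by simp [Stmt.mods]) (by simp [Stmt.amods])
  | loop_false => exact .rfl'
  | loop_true _ _ _ _ ih₁ ih₂ => exact Fr.trans ih₁ ih₂

theorem wp.frame {K : Ctx} {P : Stmt} {tr : List (ℕ × ℕ)} {Q : State → ℕ → Prop} {s : State} {τ : ℕ}
    (h : wp K P tr Q s τ) : wp K P tr (fun s' τ' => Q s' τ' ∧ Fr P.mods P.amods s s') s τ := by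
  obtain ⟨s', t, h, hq⟩ := h
  exact ⟨s', t, h, hq, h.frame⟩

/-- Uses a specification, the frame and a bound for the contents. -/
theorem wp.use {K : Ctx} {P : Stmt} {tr : List (ℕ × ℕ)} {Q Q' : State → ℕ → Prop} {s : State} {τ : ℕ}
    (h : wp K P tr Q s τ) (hQ : ∀ s' τ', Q s' τ' → Fr P.mods P.amods s s' → Q' s' τ') : wp K P tr Q' s τ :=
  h.frame.conseq fun s' τ' h => hQ s' τ' h.1 h.2

theorem wp.spec {K : Ctx} {P : Stmt} {tr : List (ℕ × ℕ)} {Q : State → ℕ → Prop} {s : State} {τ T : ℕ}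
    {R : State → Prop} (h : wp K P tr (fun s' τ' => τ' ≤ T ∧ R s') s τ)
    (hQ : ∀ s' τ', Fr P.mods P.amods s s' → τ' ≤ T → R s' → Q s' τ') : wp K P tr Q s τ :=
  h.use fun s' τ' h hf => hQ s' τ' hf h.1 h.2

/-! Notation for programs. -/

instance : Add Ex := ⟨.op .add⟩
instance : Sub Ex := ⟨.op .sub⟩
instance : Mul Ex := ⟨.op .mul⟩
instance : Div Ex := ⟨.op .div⟩
instance : Mod Ex := ⟨.op .mod⟩

prefix:max "𝗏" => Ex.var
prefix:max "𝖼" => Ex.const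
infix:60 " ≔ " => Stmt.assign
infixr:55 " ;; " => Stmt.seq

section Simp
variable (K : Ctx) (s : State) (a b : Ex)
theorem Ex.val_add : (a + b).val s = a.val s + b.val s := rfl
theorem Ex.val_sub : (a - b).val s = a.val s - b.val s := rfl
theorem Ex.val_mul : (a * b).val s = a.val s * b.val s := rfl
theorem Ex.val_div : (a / b).val s = a.val s / b.val s := rfl
theorem Ex.val_mod : (a % b).val s = a.val s % b.val s := rfl
theorem Ex.ok_add : (a + b).Ok K s ↔ a.Ok K s ∧ b.Ok K s := .rfl
theorem Ex.ok_sub : (a - b).Ok K s ↔ a.Ok K s ∧ b.Ok K s := .rfl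
theorem Ex.ok_mul : (a * b).Ok K s ↔ a.Ok K s ∧ b.Ok K s := .rfl
theorem Ex.ok_div : (a / b).Ok K s ↔ a.Ok K s ∧ b.Ok K s := .rfl
theorem Ex.ok_mod : (a % b).Ok K s ↔ a.Ok K s ∧ b.Ok K s := .rfl
variable (V N U : ℕ)
theorem Ex.wf_add : (a + b).Wf V N U ↔ a.Wf V N U ∧ b.Wf V N U := .rfl
theorem Ex.wf_sub : (a - b).Wf V N U ↔ a.Wf V N U ∧ b.Wf V N U := .rfl
theorem Ex.wf_mul : (a * b).Wf V N U ↔ a.Wf V N U ∧ b.Wf V N U := .rfl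
theorem Ex.wf_div : (a / b).Wf V N U ↔ a.Wf V N U ∧ b.Wf V N U := .rfl
theorem Ex.wf_mod : (a % b).Wf V N U ↔ a.Wf V N U ∧ b.Wf V N U := .rfl
theorem Ex.deg_add : (a + b).deg = max a.deg b.deg + 1 := rfl
theorem Ex.deg_sub : (a - b).deg = max a.deg b.deg := rfl
theorem Ex.deg_mul : (a * b).deg = a.deg + b.deg := rfl
theorem Ex.deg_div : (a / b).deg = max a.deg b.deg := rfl
theorem Ex.deg_mod : (a % b).deg = max a.deg b.deg := rfl
end Simp

/-- Values of expressions and conditions. -/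
theorem Cond.holds_lt (K : Ctx) (s : State) (a b : Ex) : (Cond.lt a b).Holds K s ↔ a.val s < b.val s := .rfl
theorem Cond.holds_eq (K : Ctx) (s : State) (a b : Ex) : (Cond.eq a b).Holds K s ↔ a.val s = b.val s := .rfl
theorem Cond.ok_lt (K : Ctx) (s : State) (a b : Ex) : (Cond.lt a b).Ok K s ↔ a.Ok K s ∧ b.Ok K s := .rfl
theorem Cond.ok_eq (K : Ctx) (s : State) (a b : Ex) : (Cond.eq a b).Ok K s ↔ a.Ok K s ∧ b.Ok K s := .rfl
theorem Ex.val_var (s : State) (x : ℕ) : (𝗏 x).val s = s.v x := rfl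
theorem Ex.val_const (s : State) (c : ℕ) : (𝖼 c).val s = c := rfl
theorem Ex.val_get (s : State) (A : ℕ) (e : Ex) : (Ex.get A e).val s = s.a A (e.val s) := rfl
theorem Ex.ok_var (K : Ctx) (s : State) (x : ℕ) : (𝗏 x).Ok K s ↔ True := .rfl
theorem Ex.ok_const (K : Ctx) (s : State) (c : ℕ) : (𝖼 c).Ok K s ↔ True := .rfl
theorem Ex.ok_get (K : Ctx) (s : State) (A : ℕ) (e : Ex) :
    (Ex.get A e).Ok K s ↔ e.Ok K s ∧ e.val s < K.cap A := .rfl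

/-- `for x = 0, …, e - 1 do p`. -/
def forS (x : ℕ) (e : Ex) (p : Stmt) : Stmt :=
  x ≔ 𝖼 0 ;; .loop (.lt (𝗏 x) e) (p ;; x ≔ 𝗏 x + 𝖼 1)

/-- The frame condition and the value of the counter are handed to every obligation, so invariants
need to mention only what the body changes. The two units of time per round are the increment and
the test. -/
theorem wp_for_tr {K : Ctx} {Q : State → ℕ → Prop} {s₀ : State} {τ₀ : ℕ} {x : ℕ} {e : Ex} {p : Stmt}
    (L : List (List (ℕ × ℕ))) (I : ℕ → State → ℕ → Prop) (hx : x ∉ p.mods) (hN : L.length < K.U)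
    (he : ∀ s, Fr (x :: p.mods) p.amods s₀ s → e.Ok K s ∧ e.val s = L.length)
    (h0 : I 0 (s₀.set x 0) (τ₀ + 1))
    (hstep : ∀ i (h : i < L.length), ∀ s τ, Fr (x :: p.mods) p.amods s₀ s → s.v x = i → I i s τ →
      wp K p L[i] (fun s' τ' => I (i + 1) (s'.set x (i + 1)) (τ' + 2)) s τ)
    (hfin : ∀ s τ, Fr (x :: p.mods) p.amods s₀ s → s.v x = L.length → I L.length s τ → Q s (τ + 1)) :
    wp K (forS x e p) L.flatten Q s₀ τ₀ := by
  refine wp_seq_right (wp_assign.2 ⟨trivial, by simp only [Ex.val_const]; omega, ?_⟩)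
  refine wp_loop_tr L (fun i s τ => I i s τ ∧ s.v x = i ∧ Fr (x :: p.mods) p.amods s₀ s) ?_ ?_ ?_ ?_
  · exact ⟨h0, by simp [Ex.val_const], Fr.rfl'.set (by simp)⟩
  · rintro i - s τ ⟨-, -, hf⟩
    exact ⟨trivial, (he s hf).1⟩
  · rintro i hi s τ ⟨hI, hxi, hf⟩
    refine ⟨?_, wp_seq_left ?_⟩
    · rw [Cond.holds_lt, (he s hf).2]
      simpa [Ex.val_var, hxi] using hi
    · refine (hstep i hi s τ hf hxi hI).use fun s' τ' h hf' => wp_assign.2 ?_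
      have hv : s'.v x = i := by rw [hf'.v x hx, hxi]
      have hval : (𝗏 x + 𝖼 1).val s' = i + 1 := by rw [Ex.val_add, Ex.val_var, hv]; rfl
      rw [hval]
      refine ⟨⟨trivial, trivial⟩, by omega, h, by simp, ?_⟩
      exact (hf.trans (hf'.mono (by simp) (by simp))).set (by simp)
  · rintro s τ ⟨hI, hxi, hf⟩
    refine ⟨?_, hfin s τ hf hxi hI⟩
    rw [Cond.holds_lt, (he s hf).2, Ex.val_var, hxi]
    omega

theorem wp_for {K : Ctx} {Q : State → ℕ → Prop} {s₀ : State} {τ₀ : ℕ} {x : ℕ} {e : Ex} {p : Stmt} (N : ℕ)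
    (I : ℕ → State → ℕ → Prop) (hx : x ∉ p.mods) (hN : N < K.U)
    (he : ∀ s, Fr (x :: p.mods) p.amods s₀ s → e.Ok K s ∧ e.val s = N) (h0 : I 0 (s₀.set x 0) (τ₀ + 1))
    (hstep : ∀ i < N, ∀ s τ, Fr (x :: p.mods) p.amods s₀ s → s.v x = i → I i s τ →
      wp K p [] (fun s' τ' => I (i + 1) (s'.set x (i + 1)) (τ' + 2)) s τ)
    (hfin : ∀ s τ, Fr (x :: p.mods) p.amods s₀ s → s.v x = N → I N s τ → Q s (τ + 1)) :
    wp K (forS x e p) [] Q s₀ τ₀ := by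
  have := wp_for_tr (K := K) (Q := Q) (s₀ := s₀) (τ₀ := τ₀) (x := x) (e := e) (p := p)
    (List.replicate N []) I hx (by simpa using hN) (by simpa using he) h0
    (fun i hi => by simpa using hstep i (by simpa using hi)) (by simpa using hfin)
  simpa using this

theorem wp_for_list {α : Type} {K : Ctx} {Q : State → ℕ → Prop} {s₀ : State} {τ₀ : ℕ} {x : ℕ} {e : Ex}
    {p : Stmt} (l : List α) (enc : α → List (ℕ × ℕ)) (I : ℕ → State → ℕ → Prop) (hx : x ∉ p.mods)
    (hN : l.length < K.U) (he : ∀ s, Fr (x :: p.mods) p.amods s₀ s → e.Ok K s ∧ e.val s = l.length)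
    (h0 : I 0 (s₀.set x 0) (τ₀ + 1))
    (hstep : ∀ i (h : i < l.length), ∀ s τ, Fr (x :: p.mods) p.amods s₀ s → s.v x = i → I i s τ →
      wp K p (enc l[i]) (fun s' τ' => I (i + 1) (s'.set x (i + 1)) (τ' + 2)) s τ)
    (hfin : ∀ s τ, Fr (x :: p.mods) p.amods s₀ s → s.v x = l.length → I l.length s τ → Q s (τ + 1)) :
    wp K (forS x e p) (l.flatMap enc) Q s₀ τ₀ := by
  have := wp_for_tr (K := K) (Q := Q) (s₀ := s₀) (τ₀ := τ₀) (x := x) (e := e) (p := p)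
    (l.map enc) I hx (by simpa using hN) (by simpa using he) h0
    (fun i hi => by simpa using hstep i (by simpa using hi)) (by simpa using hfin)
  rwa [← List.flatMap_def] at this

attribute [simp] wp_skip wp_assign wp_put wp_seq wp_ite Ex.val_add Ex.val_sub Ex.val_mul Ex.val_div
  Ex.val_mod Ex.ok_add Ex.ok_sub Ex.ok_mul Ex.ok_div Ex.ok_mod Cond.holds_lt Cond.holds_eq
  Cond.ok_lt Cond.ok_eq Ex.val_var Ex.val_const Ex.val_get Ex.ok_var Ex.ok_const Ex.ok_get

/-! Names of variables. -/
notation "r_n" => (0 : ℕ)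
notation "r_lx" => (1 : ℕ)
notation "r_ly" => (2 : ℕ)
notation "r_k" => (3 : ℕ)
notation "r_l" => (4 : ℕ)
notation "r_lw" => (5 : ℕ)
notation "r_lam" => (6 : ℕ)
notation "r_h" => (7 : ℕ)
notation "r_b" => (8 : ℕ)
notation "r_b2" => (9 : ℕ)
notation "r_nt" => (10 : ℕ)
notation "r_m" => (11 : ℕ)
notation "r_R" => (12 : ℕ)
notation "r_np" => (13 : ℕ)
notation "r_B" => (14 : ℕ)
notation "r_p" => (15 : ℕ)
notation "r_lim" => (16 : ℕ)
notation "r_lim2" => (17 : ℕ)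
notation "r_r" => (18 : ℕ)
notation "r_ls" => (19 : ℕ)
notation "r_cnt" => (20 : ℕ)
notation "r_vcnt" => (21 : ℕ)
notation "r_ans" => (22 : ℕ)
notation "r_ai" => (23 : ℕ)
notation "r_aj" => (24 : ℕ)
notation "r_P" => (25 : ℕ)
notation "r_c" => (26 : ℕ)
notation "r_z" => (27 : ℕ)
notation "r_y" => (28 : ℕ)
notation "r_lr" => (29 : ℕ)
notation "r_q" => (30 : ℕ)
notation "r_i" => (31 : ℕ)
notation "r_j" => (32 : ℕ)
notation "r_u" => (33 : ℕ)
notation "r_t" => (34 : ℕ)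
notation "r_e1" => (35 : ℕ)
notation "r_e2" => (36 : ℕ)
notation "r_pw" => (37 : ℕ)
notation "r_f" => (38 : ℕ)
notation "r_d" => (39 : ℕ)
notation "r_x" => (40 : ℕ)
notation "r_cur" => (41 : ℕ)
notation "r_do" => (42 : ℕ)
notation "r_tr" => (43 : ℕ)
notation "r_mm" => (44 : ℕ)
notation "r_un" => (45 : ℕ)

/-! Names of arrays: the input, the letters modulo `p`, suffix fingerprints, window fingerprints,
sketches, links and heads of the buckets, marks of the sieve, moduli, and the classes in use. -/
notation "a_in" => (0 : ℕ)
notation "a_w" => (1 : ℕ)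
notation "a_g" => (2 : ℕ)
notation "a_f" => (3 : ℕ)
notation "a_sk" => (4 : ℕ)
notation "a_next" => (5 : ℕ)
notation "a_head" => (6 : ℕ)
notation "a_mark" => (7 : ℕ)
notation "a_pr" => (8 : ℕ)
notation "a_rP" => (9 : ℕ)
notation "a_rc" => (10 : ℕ)
notation "a_rz" => (11 : ℕ)
notation "a_ry" => (12 : ℕ)

/-! ### Fingerprints of all windows for one residue class. -/

/-- Suffix fingerprints along residue classes modulo `P`. -/
def gLoop : Stmt := forS r_i (𝗏 r_lw) (
  r_x ≔ 𝗏 r_lw - 𝖼 1 - 𝗏 r_i ;;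
  r_e1 ≔ .get a_w (𝗏 r_x) ;;
  .ite (.lt (𝗏 r_x + 𝗏 r_P) (𝗏 r_lw))
    (r_e1 ≔ (𝗏 r_e1 + 𝗏 r_z * .get a_g (𝗏 r_x + 𝗏 r_P)) % 𝗏 r_p) .skip ;;
  .put a_g (𝗏 r_x) (𝗏 r_e1))

/-- `f`, extended by zero beyond `N`. -/
def trunc (N : ℕ) (f : ℕ → ℕ) (x : ℕ) : ℕ := if x < N then f x else 0

/-- The array is filled from right to left by Horner's rule with stride `P`. As `P > 0`, the entry
that is read at `x + P` is already final and is not overwritten. -/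
theorem gLoop_spec {K : Ctx} {s : State} {τ lw p P z : ℕ} {Q : State → ℕ → Prop} (hlw : s.v r_lw = lw)
    (hp : s.v r_p = p) (hP : s.v r_P = P) (hz : s.v r_z = z) (hp0 : 0 < p) (hpU : p ≤ K.U) (hlU : lw < K.U)
    (hP0 : 0 < P) (hw : ∀ x < lw, s.a a_w x < p) (hc1 : lw ≤ K.cap a_w) (hc2 : lw ≤ K.cap a_g)
    (hQ : ∀ s' τ', Fr gLoop.mods gLoop.amods s s' → τ' ≤ τ + 7 * lw + 2 →
      (∀ x < lw, s'.a a_g x = (s.a a_w x + z * trunc lw (s'.a a_g) (x + P)) % p) → Q s' τ') :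
    wp K gLoop [] Q s τ := by
  refine (wp_for (Q := fun s' τ' => τ' ≤ τ + 7 * lw + 2 ∧
      (∀ x < lw, s'.a a_g x = (s.a a_w x + z * trunc lw (s'.a a_g) (x + P)) % p)) lw
    (fun m s' τ' => τ' ≤ τ + 7 * m + 1 ∧ ∀ x < lw, lw ≤ x + m →
      s'.a a_g x = (s.a a_w x + z * trunc lw (s'.a a_g) (x + P)) % p)
    (by decide) hlU ?_ ?_ ?_ ?_).use fun s' τ' h hf => hQ s' τ' hf h.1 h.2
  · intro s' hf
    simp [hf.v r_lw (by decide), hlw]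
  · refine ⟨by omega, fun x h1 h2 => absurd h1 (by omega)⟩
  · rintro m hm s' τ' hf hi ⟨hτ, hI⟩
    have v1 := hf.v r_lw (by decide)
    have v2 := hf.v r_p (by decide)
    have v3 := hf.v r_P (by decide)
    have v4 := hf.v r_z (by decide)
    have v5 := hf.a a_w (by decide)
    have hx : lw - 1 - m < lw := by omega
    have hwx := hw _ hx
    have key : ∀ e, e < p → e = (s.a a_w (lw - 1 - m) + z * trunc lw (s'.a a_g) (lw - 1 - m + P)) % p →
        ∀ x < lw, lw ≤ x + (m + 1) → Function.update (s'.a a_g) (lw - 1 - m) e x =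
          (s.a a_w x + z * trunc lw (Function.update (s'.a a_g) (lw - 1 - m) e) (x + P)) % p := by
      intro e _ he x hxl hxm
      have h2 : trunc lw (Function.update (s'.a a_g) (lw - 1 - m) e) (x + P) =
          trunc lw (s'.a a_g) (x + P) := by
        simp only [trunc]
        rw [Function.update_of_ne (by omega)]
      rw [h2]
      by_cases hxe : x = lw - 1 - m
      · subst hxe; rw [Function.update_self]; exact he
      · rw [Function.update_of_ne hxe]; exact hI x hxl (by omega)
    simp only [wp_seq, wp_assign, wp_ite, wp_put, wp_skip]
    simp [v1, v2, v3, v4, v5, hi, hlw, hp, hP, hz]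
    have hm1 : ∀ e, e % p < p := fun e => Nat.mod_lt _ hp0
    have hm2 : ∀ e, e % p < K.U := fun e => (hm1 e).trans_le hpU
    and_intros
    · omega
    · omega
    · omega
    · intro h
      and_intros
      all_goals first | omega | exact hm2 _ | skip
      exact key _ (hm1 _) (by rw [trunc, if_pos h])
    · intro h
      and_intros
      all_goals first | omega | skip
      exact key _ hwx (by rw [trunc, if_neg (by omega), Nat.mul_zero, Nat.add_zero, Nat.mod_eq_of_lt hwx])
  · rintro s' τ' hf hi ⟨hτ, hI⟩
    exact ⟨by omega, fun x hx => hI x hx (by omega)⟩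

/-- The power `z ^ un` modulo `p`. -/
def powLoop : Stmt := r_pw ≔ 𝖼 1 % 𝗏 r_p ;; forS r_u (𝗏 r_un) (r_pw ≔ 𝗏 r_pw * 𝗏 r_z % 𝗏 r_p)

theorem powLoop_spec {K : Ctx} {s : State} {τ p z N : ℕ} {Q : State → ℕ → Prop} (hp : s.v r_p = p)
    (hz : s.v r_z = z) (hN : s.v r_un = N) (hp0 : 0 < p) (hpU : p ≤ K.U) (hNU : N < K.U)
    (hQ : ∀ s' τ', Fr powLoop.mods powLoop.amods s s' → τ' ≤ τ + 3 * N + 3 → s'.v r_pw < p →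
      (s'.v r_pw : ZMod p) = (z : ZMod p) ^ N → Q s' τ') : wp K powLoop [] Q s τ := by
  refine wp.use (Q := fun s' τ' => τ' ≤ τ + 3 * N + 3 ∧ s'.v r_pw < p ∧
    (s'.v r_pw : ZMod p) = (z : ZMod p) ^ N) ?_ fun s' τ' h hf => hQ s' τ' hf h.1 h.2.1 h.2.2
  have hm1 : ∀ e, e % p < p := fun e => Nat.mod_lt _ hp0
  have hm2 : ∀ e, e % p < K.U := fun e => (hm1 e).trans_le hpU
  simp only [powLoop, wp_seq, wp_assign]
  refine ⟨⟨trivial, trivial⟩, by simpa [hp] using hm2 1, ?_⟩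
  refine wp_for N (fun m s' τ' => τ' ≤ τ + 3 * m + 2 ∧ s'.v r_pw < p ∧
    (s'.v r_pw : ZMod p) = (z : ZMod p) ^ m) (by decide) hNU ?_ ?_ ?_ ?_
  · intro s' hf
    simp [hf.v r_un (by decide), hN]
  · simp [hp]
    exact hm1 1
  · rintro m hm s' τ' hf hi ⟨hτ, hI, hI'⟩
    have v2 := hf.v r_p (by decide)
    have v4 := hf.v r_z (by decide)
    simp at v2 v4
    simp [v2, v4, hp, hz]
    refine ⟨hm2 _, by omega, hm1 _, ?_⟩
    rw [hI', pow_succ]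
  · rintro s' τ' hf hi ⟨hτ, hI⟩
    exact ⟨by omega, hI⟩

/-- Adds the class fingerprints, with the factor `y`, to the window fingerprints. -/
def fLoop : Stmt := forS r_i (𝗏 r_lw + 𝖼 1 - 𝗏 r_l) (
  r_e1 ≔ 𝖼 0 ;;
  .ite (.lt (𝗏 r_i + 𝗏 r_c) (𝗏 r_lw)) (r_e1 ≔ .get a_g (𝗏 r_i + 𝗏 r_c)) .skip ;;
  r_e2 ≔ 𝖼 0 ;;
  .ite (.lt (𝗏 r_i + 𝗏 r_c + 𝗏 r_un * 𝗏 r_P) (𝗏 r_lw))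
    (r_e2 ≔ 𝗏 r_pw * .get a_g (𝗏 r_i + 𝗏 r_c + 𝗏 r_un * 𝗏 r_P) % 𝗏 r_p) .skip ;;
  .put a_f (𝗏 r_i) ((.get a_f (𝗏 r_i) + 𝗏 r_y * (𝗏 r_e1 + (𝗏 r_p - 𝗏 r_e2))) % 𝗏 r_p))

/-- A window sum is a difference of two suffix sums, the second one scaled by a power of `z`.
Subtraction modulo `p` is done by adding `p - e2`, since subtraction of words is truncated. -/
theorem fLoop_spec {K : Ctx} {s : State} {τ lw l p P c y N pw : ℕ} {Q : State → ℕ → Prop}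
    (hlw : s.v r_lw = lw) (hl : s.v r_l = l) (hp : s.v r_p = p) (hP : s.v r_P = P) (hc : s.v r_c = c)
    (hy : s.v r_y = y) (hN : s.v r_un = N) (hpw : s.v r_pw = pw) (hp0 : 0 < p) (hpU : p ≤ K.U)
    (hlU : lw + 1 < K.U) (hg : ∀ x < lw, s.a a_g x < p) (hc1 : lw + 1 ≤ K.cap a_f + l)
    (hc2 : lw ≤ K.cap a_g)
    (hQ : ∀ s' τ', Fr fLoop.mods fLoop.amods s s' → τ' ≤ τ + 9 * (lw + 1) + 2 →
      (∀ i < lw + 1 - l, s'.a a_f i < p ∧ (s'.a a_f i : ZMod p) = s.a a_f i +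
      y * (trunc lw (s.a a_g) (i + c) - pw * trunc lw (s.a a_g) (i + c + N * P))) →
      (∀ i, lw + 1 - l ≤ i → s'.a a_f i = s.a a_f i) → Q s' τ') : wp K fLoop [] Q s τ := by
  refine (wp_for (Q := fun s' τ' => τ' ≤ τ + 9 * (lw + 1) + 2 ∧
      (∀ i < lw + 1 - l, s'.a a_f i < p ∧ (s'.a a_f i : ZMod p) = s.a a_f i + y *
        (trunc lw (s.a a_g) (i + c) - pw * trunc lw (s.a a_g) (i + c + N * P))) ∧
      (∀ i, lw + 1 - l ≤ i → s'.a a_f i = s.a a_f i)) (lw + 1 - l)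
    (fun m s' τ' => τ' ≤ τ + 9 * m + 1 ∧ (∀ i < m, s'.a a_f i < p ∧ (s'.a a_f i : ZMod p) = s.a a_f i + y *
        (trunc lw (s.a a_g) (i + c) - pw * trunc lw (s.a a_g) (i + c + N * P))) ∧
      (∀ i, m ≤ i → s'.a a_f i = s.a a_f i))
    (by decide) (by omega) ?_ ?_ ?_ ?_).use fun s' τ' h hf => hQ s' τ' hf h.1 h.2.1 h.2.2
  · intro s' hf
    simp [hf.v r_lw (by decide), hf.v r_l (by decide), hlw, hl]
  · refine ⟨by omega, fun x h1 => absurd h1 (by omega), fun _ _ => rfl⟩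
  · rintro m hm s' τ' hf hi ⟨hτ, hI1, hI2⟩
    have v1 := hf.v r_lw (by decide)
    have v2 := hf.v r_p (by decide)
    have v3 := hf.v r_P (by decide)
    have v4 := hf.v r_c (by decide)
    have v5 := hf.v r_y (by decide)
    have v6 := hf.v r_un (by decide)
    have v7 := hf.v r_pw (by decide)
    have v8 := hf.a a_g (by decide)
    have hm1 : ∀ e, e % p < p := fun e => Nat.mod_lt _ hp0
    have hm2 : ∀ e, e % p < K.U := fun e => (hm1 e).trans_le hpU
    have key : ∀ e1 e2, e1 = trunc lw (s.a a_g) (m + c) → e2 = (pw * trunc lw (s.a a_g) (m + c + N * P)) % p →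
        (∀ i < m + 1, Function.update (s'.a a_f) m ((s'.a a_f m + y * (e1 + (p - e2))) % p) i < p ∧
          (Function.update (s'.a a_f) m ((s'.a a_f m + y * (e1 + (p - e2))) % p) i : ZMod p) = s.a a_f i + y *
        (trunc lw (s.a a_g) (i + c) - pw * trunc lw (s.a a_g) (i + c + N * P))) ∧ (∀ i, m + 1 ≤ i →
          Function.update (s'.a a_f) m ((s'.a a_f m + y * (e1 + (p - e2))) % p) i = s.a a_f i) := by
      intro e1 e2 h1 h2
      constructor
      · intro i hi
        by_cases him : i = m
        · subst him
          rw [Function.update_self]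
          refine ⟨hm1 _, ?_⟩
          have he2 : e2 ≤ p := by rw [h2]; exact (hm1 _).le
          rw [ZMod.natCast_mod]
          push_cast [Nat.cast_sub he2]
          rw [h1, h2, ZMod.natCast_mod, hI2 i le_rfl]
          push_cast
          simp only [CharP.cast_eq_zero]
          ring
        · rw [Function.update_of_ne him]
          exact hI1 i (by omega)
      · intro i hi
        rw [Function.update_of_ne (by omega)]
        exact hI2 i (by omega)
    have hgU : ∀ x < lw, s.a a_g x < K.U := fun x hx => (hg x hx).trans_le hpU
    simp only [wp_seq, wp_assign, wp_ite, wp_put, wp_skip]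
    simp [v1, v2, v3, v4, v5, v6, v7, v8, hi, hlw, hp, hP, hc, hy, hN, hpw]
    have h0U : 0 < K.U := by omega
    refine ⟨h0U, fun h1 => ⟨by omega, hgU _ h1, h0U, fun h2 => ⟨by omega, hm2 _, ?_⟩,
      fun h2 => ?_⟩, fun h1 => ⟨h0U, fun h2 => ⟨by omega, hm2 _, ?_⟩, fun h2 => ?_⟩⟩
    · obtain ⟨k1, k2⟩ := key _ _ (by rw [trunc, if_pos h1]) (by rw [trunc, if_pos h2])
      and_intros
      all_goals first | exact hm2 _ | omega | exact fun i hi => k2 i hi |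
          exact fun i hi => k1 i (by omega)
    · obtain ⟨k1, k2⟩ := key _ 0 (by rw [trunc, if_pos h1]) (by rw [trunc, if_neg (by omega)]; simp)
      and_intros
      all_goals first | exact hm2 _ | omega | exact fun i hi => k2 i hi |
          exact fun i hi => k1 i (by omega)
    · obtain ⟨k1, k2⟩ := key 0 _ (by rw [trunc, if_neg (by omega)]) (by rw [trunc, if_pos h2])
      and_intros
      all_goals first | exact hm2 _ | omega | exact fun i hi => k2 i hi |
          exact fun i hi => k1 i (by omega)
    · obtain ⟨k1, k2⟩ := key 0 0 (by rw [trunc, if_neg (by omega)])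
        (by rw [trunc, if_neg (by omega)]; simp)
      simp at k1 k2
      and_intros
      all_goals first | exact hm2 _ | omega | exact fun i hi => k2 i hi |
          exact fun i hi => k1 i (by omega)
  · rintro s' τ' hf hi ⟨hτ, hI⟩
    exact ⟨by omega, hI⟩

/-- The fingerprint of the letters at the positions `a ≡ c` modulo `P` of the window of length `l`
that starts at `i`; it is empty if `P ≤ c`. -/
def clsSum (p l P c z : ℕ) (w : ℕ → ℕ) (i : ℕ) : ZMod p :=
  if c < P then ∑ u ∈ Finset.range ((l + P - 1 - c) / P), (z : ZMod p) ^ u * w (i + c + u * P)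
  else 0

/-- Unrolling the recurrence `N` times. Truncation by zero makes the recurrence hold for all `x`,
also behind the end of the text. -/
theorem trunc_telescope {p lw P z : ℕ} {w G : ℕ → ℕ}
    (hG : ∀ x < lw, G x = (w x + z * trunc lw G (x + P)) % p) (N x : ℕ) :
    (trunc lw G x : ZMod p) = ∑ u ∈ Finset.range N,
      (z : ZMod p) ^ u * trunc lw w (x + u * P) + (z : ZMod p) ^ N * trunc lw G (x + N * P) := by
  have h1 : ∀ x, (trunc lw G x : ZMod p) = trunc lw w x + z * trunc lw G (x + P) := by
    intro x
    by_cases hx : x < lw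
    · have : trunc lw G x = (w x + z * trunc lw G (x + P)) % p := by
        rw [trunc, if_pos hx]; exact hG x hx
      rw [this, ZMod.natCast_mod]
      push_cast
      rw [show trunc lw w x = w x by rw [trunc, if_pos hx]]
    · rw [show trunc lw G x = 0 by rw [trunc, if_neg hx], show trunc lw w x = 0 by
        rw [trunc, if_neg hx], show trunc lw G (x + P) = 0 by rw [trunc, if_neg (by omega)]]
      simp
  induction N with
  | zero => simp
  | succ N ih =>
    rw [ih, Finset.sum_range_succ, h1 (x + N * P)]
    have : x + N * P + P = x + (N + 1) * P := by ring
    rw [this]; ring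

/-- Adds a class, given by `P`, `c`, `z` and the factor `y`, to the window fingerprints. -/
def addClass : Stmt := .ite (.lt (𝗏 r_c) (𝗏 r_P))
  (r_un ≔ (𝗏 r_l + 𝗏 r_P - 𝖼 1 - 𝗏 r_c) / 𝗏 r_P ;; powLoop ;; gLoop ;; fLoop) .skip

theorem addClass_spec {K : Ctx} {s : State} {τ lw l p P c z y : ℕ} {Q : State → ℕ → Prop}
    (hlw : s.v r_lw = lw) (hl : s.v r_l = l) (hp : s.v r_p = p) (hP : s.v r_P = P) (hc : s.v r_c = c)
    (hz : s.v r_z = z) (hy : s.v r_y = y) (hp0 : 0 < p) (hpU : p ≤ K.U) (hlU : lw + 1 < K.U) (hl' : l ≤ lw)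
    (hw : ∀ x < lw, s.a a_w x < p) (hf : ∀ i < lw, s.a a_f i < p) (hc1 : lw ≤ K.cap a_w)
    (hc2 : lw ≤ K.cap a_g) (hc3 : lw + 1 ≤ K.cap a_f + l)
    (hQ : ∀ s' τ', Fr addClass.mods addClass.amods s s' → τ' ≤ τ + 30 * (lw + 1) →
      (∀ i < lw, s'.a a_f i < p) → (∀ i < lw + 1 - l,
      (s'.a a_f i : ZMod p) = s.a a_f i + y * clsSum p l P c z (trunc lw (s.a a_w)) i) → Q s' τ') :
    wp K addClass [] Q s τ := by
  refine wp.use (Q := fun s' τ' => τ' ≤ τ + 30 * (lw + 1) ∧ (∀ i < lw, s'.a a_f i < p) ∧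
    ∀ i < lw + 1 - l, (s'.a a_f i : ZMod p) = s.a a_f i + y *
        clsSum p l P c z (trunc lw (s.a a_w)) i) ?_
    fun s' τ' h hf => hQ s' τ' hf h.1 h.2.1 h.2.2
  rw [addClass, wp_ite]
  refine ⟨⟨trivial, trivial⟩, fun h => ?_, fun h => ?_⟩
  · simp [hc, hP] at h
    -- The quotient is the number of `u` with `c + u P < l`; its bound keeps the computation of the
    -- power linear.
    have hN : (l + P - 1 - c) / P ≤ l := by
      rw [← Nat.lt_succ_iff, Nat.div_lt_iff_lt_mul (by omega)]
      have : l ≤ l * P := Nat.le_mul_of_pos_right _ (by omega)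
      rw [Nat.succ_mul]; omega
    set N := (l + P - 1 - c) / P with hNdef
    simp only [wp_seq, wp_assign]
    simp only [Ex.val_div, Ex.val_sub, Ex.val_add, Ex.val_var, Ex.val_const, hl, hP, hc]
    rw [← hNdef]
    refine ⟨by simp, by omega, ?_⟩
    refine powLoop_spec (p := p) (z := z) (N := N) (by simpa) (by simpa) (by simp) hp0 hpU
      (by omega) ?_
    intro s1 τ1 f1 t1 hpw1 hpw2
    rw [wp_seq]
    refine gLoop_spec (lw := lw) (p := p) (P := P) (z := z) ?_ ?_ ?_ ?_ hp0 hpU (by omega) (by omega)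
      ?_ hc1 hc2 ?_
    · rw [f1.v _ (by decide)]; simpa
    · rw [f1.v _ (by decide)]; simpa
    · rw [f1.v _ (by decide)]; simpa
    · rw [f1.v _ (by decide)]; simpa
    · rw [f1.a _ (by decide)]; simpa
    intro s2 τ2 f2 t2 hG
    rw [f1.a a_w (by decide)] at hG
    simp only [State.set_a] at hG
    have hGp : ∀ x < lw, s2.a a_g x < p := fun x hx => by rw [hG x hx]; exact Nat.mod_lt _ hp0
    refine fLoop_spec (lw := lw) (l := l) (p := p) (P := P) (c := c) (y := y) (N := N)
      (pw := s1.v r_pw) ?_ ?_ ?_ ?_ ?_ ?_ ?_ ?_ hp0 hpU hlU hGp hc3 hc2 ?_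
    · rw [f2.v _ (by decide), f1.v _ (by decide)]; simpa
    · rw [f2.v _ (by decide), f1.v _ (by decide)]; simpa
    · rw [f2.v _ (by decide), f1.v _ (by decide)]; simpa
    · rw [f2.v _ (by decide), f1.v _ (by decide)]; simpa
    · rw [f2.v _ (by decide), f1.v _ (by decide)]; simpa
    · rw [f2.v _ (by decide), f1.v _ (by decide)]; simpa
    · rw [f2.v _ (by decide), f1.v _ (by decide)]; simp
    · rw [f2.v _ (by decide)]
    intro s3 τ3 f3 t3 hF hF'
    have hfe : s2.a a_f = s.a a_f := by
      rw [f2.a _ (by decide), f1.a _ (by decide)]; simp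
    rw [hfe] at hF hF'
    refine ⟨by omega, fun i hi => ?_, fun i hi => ?_⟩
    · by_cases hi2 : i < lw + 1 - l
      · exact (hF i hi2).1
      · rw [hF' i (by omega)]; exact hf i hi
    · rw [(hF i hi).2, clsSum, if_pos h, trunc_telescope hG N (i + c), hpw2]
      ring
  · simp [hc, hP] at h
    rw [wp_skip]
    refine ⟨by omega, hf, fun i hi => ?_⟩
    rw [clsSum, if_neg (by omega)]
    simp

/-! ### Parameters of a run and their computation. -/

section
variable {K : Ctx} {s : State} {τ : ℕ} {Q : State → ℕ → Prop} {D : Par}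

/-- Constants of the program. If `eps = some (p, q)`, then `ε = p / q`. -/
structure Cst where
  eps : Option (ℕ × ℕ)
  C0 : ℕ
  g0 : ℕ
  KN : ℕ
  C1 : ℕ
  K1 : ℕ
  KL : ℕ
  K2 : ℕ
  KS : ℕ
  KT : ℕ
  th : ℕ
  g : ℕ

/-- The test `a ≤ ε * b`. -/
def Cond.leE (o : Option (ℕ × ℕ)) (a b : Ex) : Cond :=
  match o with
  | none => .leEps a b
  | some (p, q) => .lt (𝖼 q * a) (𝖼 p * b + 𝖼 1)

/-- `o` describes the real number `ε`. -/
def EpsOk (o : Option (ℕ × ℕ)) (ε : ℝ) : Prop := ∀ p q, o = some (p, q) → 0 < q ∧ ε = p / q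

theorem Cond.leE_holds {o : Option (ℕ × ℕ)} (ho : EpsOk o K.ε) (s : State) (a b : Ex) :
    (Cond.leE o a b).Holds K s ↔ (a.val s : ℝ) ≤ K.ε * (b.val s : ℝ) := by
  rcases o with - | ⟨p, q⟩
  · rfl
  · obtain ⟨hq, he⟩ := ho p q rfl
    have hq' : (0 : ℝ) < q := by exact_mod_cast hq
    simp only [leE, Cond.holds_lt, Ex.val_mul, Ex.val_add, Ex.val_const, Nat.lt_succ_iff]
    rw [he, div_mul_eq_mul_div, le_div_iff₀ hq', mul_comm _ (q : ℝ)]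
    exact_mod_cast Iff.rfl

theorem Cond.leE_ok {o : Option (ℕ × ℕ)} {a b : Ex} : (Cond.leE o a b).Ok K s ↔ a.Ok K s ∧ b.Ok K s := by
  rcases o with - | ⟨p, q⟩
  · rfl
  · simp [leE, Cond.ok_lt]

/-- The binary length of `n`. -/
def lenLoop : Stmt := r_lam ≔ 𝖼 0 ;; r_x ≔ 𝖼 1 ;;
  .loop (.lt (𝗏 r_x) (𝗏 r_n + 𝖼 1)) (r_x ≔ 𝗏 r_x + 𝗏 r_x ;; r_lam ≔ 𝗏 r_lam + 𝖼 1)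

theorem lenLoop_spec {n : ℕ} (hn : s.v r_n = n) (hU : 2 * n + 2 < K.U)
    (hQ : ∀ s' τ', Fr lenLoop.mods lenLoop.amods s s' → τ' ≤ τ + 3 * n.size + 3 → s'.v r_lam = n.size →
      Q s' τ') : wp K lenLoop [] Q s τ := by
  refine wp.spec ?_ hQ
  simp only [lenLoop, wp_seq, wp_assign]
  refine ⟨trivial, by simp; omega, trivial, by simp; omega, ?_⟩
  refine wp_loop n.size (fun i s' τ' => τ' ≤ τ + 3 * i + 2 ∧ s'.v r_n = n ∧ s'.v r_lam = i ∧
    s'.v r_x = 2 ^ i) ?_ ?_ ?_ ?_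
  · simp [hn]
  · rintro i - s' τ' -
    simp
  · rintro i hi s' τ' ⟨h1, h2, h3, h4⟩
    have h5 : 2 ^ i ≤ n := Nat.lt_size.1 hi
    have h6 : i < n := lt_of_lt_of_le Nat.lt_two_pow_self h5
    refine ⟨by simp [h2, h4]; omega, ?_⟩
    simp [h2, h3, h4]
    refine ⟨by omega, by omega, by omega, by rw [pow_succ]; omega⟩
  · rintro s' τ' ⟨h1, h2, h3, h4⟩
    have h5 : n < 2 ^ n.size := Nat.lt_size_self n
    refine ⟨by simp [h2, h4]; omega, by omega, h3⟩

/-- The sum of `⌊n / i⌋`, `1 ≤ i ≤ n`. -/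
def divSum (n : ℕ) : ℕ := ∑ i ∈ Finset.range n, n / (i + 1)

theorem divSum_le_sq (n : ℕ) : divSum n ≤ n * n := by
  calc divSum n ≤ ∑ i ∈ Finset.range n, n := Finset.sum_le_sum fun i _ => Nat.div_le_self _ _
    _ = n * n := by simp

/-- An approximation of `log n`. -/
def logLoop : Stmt := r_e1 ≔ 𝖼 0 ;;
  forS r_i (𝗏 r_n) (r_e1 ≔ 𝗏 r_e1 + 𝗏 r_n / (𝗏 r_i + 𝖼 1)) ;; r_h ≔ 𝗏 r_e1 / 𝗏 r_n

theorem logLoop_spec {n : ℕ} (hn : s.v r_n = n) (hU : n * n + 2 < K.U)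
    (hQ : ∀ s' τ', Fr logLoop.mods logLoop.amods s s' → τ' ≤ τ + 3 * n + 4 → s'.v r_h = divSum n / n →
      Q s' τ') : wp K logLoop [] Q s τ := by
  refine wp.spec ?_ hQ
  have hnn : n ≤ n * n := Nat.le_mul_self n
  rw [logLoop, wp_seq, wp_assign]
  refine ⟨trivial, by simp; omega, ?_⟩
  rw [wp_seq]
  refine wp_for n (fun m s' τ' => τ' ≤ τ + 3 * m + 2 ∧
    s'.v r_e1 = ∑ i ∈ Finset.range m, n / (i + 1)) (by decide) (by omega) ?_ ?_ ?_ ?_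
  · intro s' hf
    have := hf.v r_n (by decide)
    simp at this
    simp [this, hn]
  · simp
  · rintro m hm s' τ' hf hi ⟨h1, h2⟩
    have v1 := hf.v r_n (by decide)
    simp at v1
    have h3 : (∑ i ∈ Finset.range m, n / (i + 1)) + n / (m + 1) ≤ n * n := by
      rw [← Finset.sum_range_succ]
      refine (Finset.sum_le_sum_of_subset (Finset.range_mono hm)).trans (divSum_le_sq n)
    simp [v1, hn, hi, h2, Finset.sum_range_succ]
    omega
  · rintro s' τ' hf hi ⟨h1, h2⟩
    have v1 := hf.v r_n (by decide)
    simp at v1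
    have h3 := divSum_le_sq n
    have h4 : divSum n / n ≤ divSum n := Nat.div_le_self _ _
    simp [v1, hn, h2]
    rw [divSum] at h3 h4
    refine ⟨by omega, by omega, rfl⟩

/-- The least `b ≥ 1` with `x ≤ (1 + ε) b`. -/
noncomputable def ceilDiv (ε : ℝ) (x : ℕ) : ℕ := sInf {b : ℕ | 1 ≤ b ∧ ((x - b : ℕ) : ℝ) ≤ ε * b}

theorem ceilDiv_mem {ε : ℝ} (hε : 0 < ε) (x : ℕ) :
    1 ≤ ceilDiv ε x ∧ ((x - ceilDiv ε x : ℕ) : ℝ) ≤ ε * ceilDiv ε x := by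
  have : (x + 1) ∈ {b : ℕ | 1 ≤ b ∧ ((x - b : ℕ) : ℝ) ≤ ε * b} := by
    refine ⟨by omega, ?_⟩
    rw [Nat.sub_eq_zero_of_le (by omega)]
    push_cast; positivity
  exact Nat.sInf_mem ⟨_, this⟩

theorem ceilDiv_le {ε : ℝ} (hε : 0 < ε) (x : ℕ) : ceilDiv ε x ≤ x + 1 := by
  refine Nat.sInf_le ⟨by omega, ?_⟩
  rw [Nat.sub_eq_zero_of_le (by omega)]
  push_cast; positivity

theorem not_of_lt_ceilDiv {ε : ℝ} {x b : ℕ} (h1 : 1 ≤ b) (h : b < ceilDiv ε x) :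
    ¬ ((x - b : ℕ) : ℝ) ≤ ε * b := fun h' => Nat.notMem_of_lt_sInf h ⟨h1, h'⟩

/-- Puts `ceilDiv ε x` into the variable `y`. -/
def ceilLoop (o : Option (ℕ × ℕ)) (x y : ℕ) : Stmt := y ≔ 𝖼 1 ;; r_f ≔ 𝖼 0 ;;
  .loop (.eq (𝗏 r_f) (𝖼 0)) (.ite (.leE o (𝗏 x - 𝗏 y) (𝗏 y)) (r_f ≔ 𝖼 1) (y ≔ 𝗏 y + 𝖼 1))

theorem ceilLoop_spec {o : Option (ℕ × ℕ)} {x y a : ℕ} (ho : EpsOk o K.ε) (hε : 0 < K.ε) (hxy : x ≠ y)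
    (hxf : x ≠ r_f) (hyf : y ≠ r_f) (ha : s.v x = a) (hU : a + 3 < K.U)
    (hQ : ∀ s' τ', Fr (ceilLoop o x y).mods (ceilLoop o x y).amods s s' → τ' ≤ τ + 3 * a + 20 →
      s'.v y = ceilDiv K.ε a → Q s' τ') : wp K (ceilLoop o x y) [] Q s τ := by
  refine wp.spec ?_ hQ
  have hb := ceilDiv_le hε a
  obtain ⟨hb1, hb2⟩ := ceilDiv_mem hε a
  simp only [ceilLoop, wp_seq, wp_assign]
  refine ⟨trivial, by simp; omega, trivial, by simp; omega, ?_⟩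
  -- Round `i` tests the value `i + 1`; the last round sets the flag and leaves the value as it is.
  refine wp_loop (ceilDiv K.ε a) (fun i s' τ' => τ' ≤ τ + 3 * i + 2 ∧ s'.v x = a ∧
    (i < ceilDiv K.ε a → s'.v r_f = 0 ∧ s'.v y = i + 1) ∧
    (i = ceilDiv K.ε a → s'.v r_f = 1 ∧ s'.v y = i)) ?_ ?_ ?_ ?_
  · simp [hxy, hxf, ha, hyf]; omega
  · rintro i - s' τ' -
    simp
  · rintro i hi s' τ' ⟨h1, h2, h3, -⟩
    obtain ⟨h3, h4⟩ := h3 hi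
    refine ⟨by simp [h3], ?_⟩
    rw [wp_ite, Cond.leE_ok, Cond.leE_holds ho]
    simp only [Ex.val_sub, Ex.val_var, h2, h4]
    refine ⟨by simp, fun hc => ?_, fun hc => ?_⟩
    · have hle : ceilDiv K.ε a ≤ i + 1 := Nat.sInf_le ⟨by omega, hc⟩
      simp [hxf, hyf, h2, h4]
      omega
    · have hne : i + 1 ≠ ceilDiv K.ε a := by
        intro h; rw [h] at hc; exact hc hb2
      simp [hxy, hxf, hyf, hyf.symm, h2, h3, h4]
      omega
  · rintro s' τ' ⟨h1, h2, -, h4⟩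
    obtain ⟨h4, h5⟩ := h4 rfl
    exact ⟨by simp [h4], by omega, h5⟩

/-- Puts `2 ^ b2` into a variable. -/
def powTwoLoop : Stmt := r_pw ≔ 𝖼 1 ;; forS r_i (𝗏 r_b2) (r_pw ≔ 𝗏 r_pw + 𝗏 r_pw)

theorem powTwoLoop_spec {b : ℕ} (hb : s.v r_b2 = b) (hU : 2 ^ b < K.U)
    (hQ : ∀ s' τ', Fr powTwoLoop.mods powTwoLoop.amods s s' → τ' ≤ τ + 3 * b + 3 → s'.v r_pw = 2 ^ b →
      Q s' τ') : wp K powTwoLoop [] Q s τ := by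
  refine wp.spec ?_ hQ
  have hb' : b < 2 ^ b := Nat.lt_two_pow_self
  simp only [powTwoLoop, wp_seq]
  refine wp_assign.2 ⟨trivial, by simp; omega, ?_⟩
  refine wp_for b (fun m s' τ' => τ' ≤ τ + 3 * m + 2 ∧ s'.v r_pw = 2 ^ m) (by decide) (by omega)
    ?_ ?_ ?_ ?_
  · intro s' hf
    have := hf.v r_b2 (by decide)
    simp at this
    simp [this, hb]
  · simp
  · rintro m hm s' τ' hf hi ⟨h1, h2⟩
    have h3 : 2 ^ (m + 1) ≤ 2 ^ b := Nat.pow_le_pow_right (by omega) hm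
    simp [h2]
    rw [pow_succ] at h3 ⊢
    omega
  · rintro s' τ' hf hi ⟨h1, h2⟩
    exact ⟨by omega, h2⟩

/-- The parameters of a run. -/
structure Par where
  n : ℕ
  lx : ℕ
  ly : ℕ
  k : ℕ
  l : ℕ
  lw : ℕ
  lam : ℕ
  b : ℕ
  nt : ℕ
  m : ℕ
  R : ℕ
  B : ℕ
  lim : ℕ
  lim2 : ℕ
  ls : ℕ
  lr : ℕ
  tr : ℕ

/-- The parameters are in their variables. -/
structure Par.In (D : Par) (s : State) : Prop where
  n : s.v r_n = D.n
  lx : s.v r_lx = D.lx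
  ly : s.v r_ly = D.ly
  k : s.v r_k = D.k
  l : s.v r_l = D.l
  lw : s.v r_lw = D.lw
  lam : s.v r_lam = D.lam
  b : s.v r_b = D.b
  nt : s.v r_nt = D.nt
  m : s.v r_m = D.m
  R : s.v r_R = D.R
  B : s.v r_B = D.B
  lim : s.v r_lim = D.lim
  lim2 : s.v r_lim2 = D.lim2
  ls : s.v r_ls = D.ls
  lr : s.v r_lr = D.lr
  tr : s.v r_tr = D.tr

/-- The variables for the parameters. -/
def parVars : List ℕ := [r_n, r_lx, r_ly, r_k, r_l, r_lw, r_lam, r_b, r_nt, r_m, r_R, r_B, r_lim,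
  r_lim2, r_ls, r_lr, r_tr]

theorem Par.In.fr {s s' : State} {l la : List ℕ} (h : D.In s) (hf : Fr l la s s')
    (hl : ∀ x ∈ parVars, x ∉ l) : D.In s' := by
  have key : ∀ x ∈ parVars, s'.v x = s.v x := fun x hx => hf.v x (hl x hx)
  constructor
  all_goals rw [key _ (by decide)]
  exacts [h.n, h.lx, h.ly, h.k, h.l, h.lw, h.lam, h.b, h.nt, h.m, h.R, h.B, h.lim, h.lim2, h.ls, h.lr, h.tr]

/-- The parameters for an instance. -/
noncomputable def par (c : Cst) (ε : ℝ) (n lx ly k l : ℕ) : Par where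
  n := n
  lx := lx
  ly := ly
  k := k
  l := l
  lw := lx + ly
  lam := n.size
  -- About `log n / (1 + ε)`, up to a bounded error. The natural logarithm is needed with bounded
  -- additive error, as it enters the collision probability through an exponential; the harmonic sum
  -- provides it with integer operations.
  b := ceilDiv ε (divSum n / n)
  -- Of order `n ^ (1 / (1 + ε))`. Here a bounded additive error in the exponent is harmless as
  -- well.
  nt := c.KN * 2 ^ ceilDiv ε n.size
  -- Colliding positions reduce the hit rate by a relative amount `O(1 / (C0 log n))` for this `m`.
  -- Summed over `b` blocks this costs only a constant factor in the collision probability.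
  m := c.C0 * c.g0 * (n.size * n.size)
  -- For `k = 0` good pairs are never hit, and leaving out the factor `g0 ≥ 1 + ε` gives a single
  -- mismatch the hit probability `g0 / m`.
  R := if k < 1 then c.C0 * (n.size * n.size) else k * (c.C0 * c.g0 * (n.size * n.size))
  -- Large enough that few primes below `B` identify two letters; its root is `O(n log n)`, which is
  -- the cost of a trial division.
  B := c.C1 * (n * n) * (n.size * n.size)
  lim := c.KL * (n * (c.KN * 2 ^ ceilDiv ε n.size))
  lim2 := c.K2 * (c.KN * 2 ^ ceilDiv ε n.size)
  ls := c.KS * n.size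
  lr := c.C0 * c.g0 * (n.size * n.size) * ceilDiv ε (divSum n / n)
  tr := c.KT * n.size

/-- Computes the parameters. -/
def paramsP (c : Cst) : Stmt :=
  r_lw ≔ 𝗏 r_lx + 𝗏 r_ly ;; lenLoop ;; logLoop ;; ceilLoop c.eps r_h r_b ;;
  ceilLoop c.eps r_lam r_b2 ;; powTwoLoop ;;
  r_nt ≔ 𝖼 c.KN * 𝗏 r_pw ;;
  r_e1 ≔ 𝗏 r_lam * 𝗏 r_lam ;;
  r_m ≔ 𝖼 c.C0 * 𝖼 c.g0 * 𝗏 r_e1 ;;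
  .ite (.lt (𝗏 r_k) (𝖼 1)) (r_R ≔ 𝖼 c.C0 * 𝗏 r_e1) (r_R ≔ 𝗏 r_k * 𝗏 r_m) ;;
  r_B ≔ 𝖼 c.C1 * (𝗏 r_n * 𝗏 r_n) * 𝗏 r_e1 ;;
  r_lim ≔ 𝖼 c.KL * (𝗏 r_n * 𝗏 r_nt) ;;
  r_lim2 ≔ 𝖼 c.K2 * 𝗏 r_nt ;;
  r_ls ≔ 𝖼 c.KS * 𝗏 r_lam ;;
  r_lr ≔ 𝗏 r_m * 𝗏 r_b ;;
  r_tr ≔ 𝖼 c.KT * 𝗏 r_lam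

/-- All parameters are small. -/
structure Par.Small (D : Par) (U : ℕ) : Prop where
  n : D.n * D.n + 2 * D.n + 3 < U
  lw : D.lw + 1 < U
  nt : D.nt < U
  m : D.m < U
  R : D.R < U
  B : D.B < U
  lim : D.lim < U
  lim2 : D.lim2 < U
  ls : D.ls < U
  lr : D.lr < U
  tr : D.tr < U
  q : D.m * D.nt < U

theorem paramsP_spec {c : Cst} {n lx ly k l : ℕ} (ho : EpsOk c.eps K.ε) (hε : 0 < K.ε) (hn : s.v r_n = n)
    (hlx : s.v r_lx = lx) (hly : s.v r_ly = ly) (hk : s.v r_k = k) (hl : s.v r_l = l) (hn1 : 1 ≤ n)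
    (hKN : 1 ≤ c.KN) (hU : (par c K.ε n lx ly k l).Small K.U)
    (hQ : ∀ s' τ', Fr (paramsP c).mods (paramsP c).amods s s' → τ' ≤ τ + 15 * n + 100 →
      (par c K.ε n lx ly k l).In s' → Q s' τ') : wp K (paramsP c) [] Q s τ := by
  refine wp.spec ?_ hQ
  have u0 := hU.n
  have u1 := hU.lw
  have u2 := hU.nt
  have u3 := hU.m
  have u4 := hU.R
  have u5 := hU.B
  have u6 := hU.lim
  have u7 := hU.lim2
  have u8 := hU.ls
  have u9 := hU.lr
  have u10 := hU.tr
  simp only [par] at u0 u1 u2 u3 u4 u5 u6 u7 u8 u9 u10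
  have hsz : n.size ≤ n := by
    rw [Nat.size_le]; exact Nat.lt_two_pow_self
  have hh : divSum n / n ≤ n := by
    calc divSum n / n ≤ n * n / n := Nat.div_le_div_right (divSum_le_sq n)
      _ = n := Nat.mul_div_cancel _ hn1
  have hsz2 : n.size * n.size ≤ n * n := Nat.mul_le_mul hsz hsz
  have hb1 : ceilDiv K.ε n.size ≤ n.size + 1 := ceilDiv_le hε _
  simp only [paramsP]
  rw [wp_seq, wp_assign]
  refine ⟨by simp, by simp [hlx, hly]; omega, ?_⟩
  rw [wp_seq]
  refine lenLoop_spec (n := n) (by simpa) (by omega) ?_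
  intro s1 τ1 f1 t1 h1
  rw [wp_seq]
  refine logLoop_spec (n := n) (by rw [f1.v _ (by decide)]; simpa) (by omega) ?_
  intro s2 τ2 f2 t2 h2
  rw [wp_seq]
  refine ceilLoop_spec ho hε (by decide) (by decide) (by decide) h2 (by omega) ?_
  intro s3 τ3 f3 t3 h3
  rw [wp_seq]
  have g3 : s3.v r_lam = n.size := by
    rw [f3.v _ (by simp [ceilLoop, Stmt.mods]), f2.v _ (by decide), h1]
  refine ceilLoop_spec ho hε (by decide) (by decide) (by decide) g3 (by omega) ?_
  intro s4 τ4 f4 t4 h4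
  rw [wp_seq]
  have hpw : 2 ^ ceilDiv K.ε n.size ≤ c.KN * 2 ^ ceilDiv K.ε n.size :=
    Nat.le_mul_of_pos_left _ hKN
  refine powTwoLoop_spec h4 (by omega) ?_
  intro s5 τ5 f5 t5 h5
  have hmem3 : ∀ x, x ≠ r_b → x ≠ r_f → s3.v x = s2.v x := fun x a1 a2 =>
    f3.v _ (by simp [ceilLoop, Stmt.mods, a1, a2])
  have hmem4 : ∀ x, x ≠ r_b2 → x ≠ r_f → s4.v x = s3.v x := fun x a1 a2 =>
    f4.v _ (by simp [ceilLoop, Stmt.mods, a1, a2])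
  have e : ∀ x, x ∉ [r_lam, r_x, r_h, r_e1, r_i, r_b, r_b2, r_f, r_pw, r_lw] → s5.v x = s.v x := by
    intro x hx
    simp only [List.mem_cons, List.not_mem_nil, or_false, not_or] at hx
    rw [f5.v x (by simp [powTwoLoop, forS, Stmt.mods]; tauto), hmem4 x (by tauto) (by tauto),
      hmem3 x (by tauto) (by tauto), f2.v x (by simp [logLoop, forS, Stmt.mods]; tauto),
      f1.v x (by simp [lenLoop, forS, Stmt.mods]; tauto), State.set_v, if_neg (by tauto)]
  have e1 := e r_n (by decide)
  have e2 := e r_lx (by decide)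
  have e3 := e r_ly (by decide)
  have e4 := e r_k (by decide)
  have e5 := e r_l (by decide)
  have e6 : s5.v r_lw = lx + ly := by
    rw [f5.v _ (by decide), hmem4 _ (by decide) (by decide), hmem3 _ (by decide) (by decide),
      f2.v _ (by decide), f1.v _ (by decide)]
    simp [hlx, hly]
  have e7 : s5.v r_lam = n.size := by
    rw [f5.v _ (by decide), hmem4 _ (by decide) (by decide), g3]
  have e8 : s5.v r_b = ceilDiv K.ε (divSum n / n) := by
    rw [f5.v _ (by decide), hmem4 _ (by decide) (by decide), h3]
  simp [e1, e2, e3, e4, e5, e6, e7, e8, hn, hlx, hly, hk, hl, h5]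
  refine ⟨u2, by omega, u3, fun hk0 => ?_, fun hk0 => ?_⟩
  · rw [if_pos (by omega)] at u4
    refine ⟨u4, u5, u6, u7, u8, u9, u10, by omega, ?_⟩
    constructor <;> simp [par, hk0, *]
  · rw [if_neg (by omega)] at u4
    refine ⟨u4, u5, u6, u7, u8, u9, u10, by omega, ?_⟩
    constructor <;> simp [par, hk0, *]

end

/-! ### Moduli: the sieve and the random prime. -/

section
variable {K : Ctx} {s : State} {τ : ℕ} {Q : State → ℕ → Prop} {tab : List ℕ}

/-- The table of moduli: the primes in `[√R, R]` or, if `R` is large, `R` itself. -/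
def tabList (n R : ℕ) : List ℕ :=
  if R < n then (List.range (R + 1)).filter (fun x => decide (x.Prime ∧ R ≤ x * x)) else [R]

/-- The table of moduli is in its place. -/
structure TabIn (tab : List ℕ) (s : State) : Prop where
  np : s.v r_np = tab.length
  pr : ∀ e < tab.length, s.a a_pr e = tab.getD e 0

theorem TabIn.fr {s s' : State} {l la : List ℕ} (h : TabIn tab s) (hf : Fr l la s s') (h1 : r_np ∉ l)
    (h2 : a_pr ∉ la) : TabIn tab s' :=
  ⟨by rw [hf.v _ h1, h.np], by rw [hf.a _ h2]; exact h.pr⟩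

/-- Marks the proper multiples of `i`. -/
def markLoop : Stmt := r_j ≔ 𝗏 r_i + 𝗏 r_i ;;
  .loop (.lt (𝗏 r_j) (𝗏 r_R + 𝖼 1)) (.put a_mark (𝗏 r_j) (𝖼 1) ;; r_j ≔ 𝗏 r_j + 𝗏 r_i)

theorem markLoop_spec {R i : ℕ} (hR : s.v r_R = R) (hi : s.v r_i = i) (hi1 : 1 ≤ i) (hiR : i ≤ R)
    (hU : 2 * R + 2 < K.U) (hc : R < K.cap a_mark)
    (hQ : ∀ s' τ', Fr markLoop.mods markLoop.amods s s' → τ' ≤ τ + 3 * (R / i) + 2 →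
      (∀ x ≤ R, s'.a a_mark x = if i ∣ x ∧ i < x then 1 else s.a a_mark x) → Q s' τ') :
    wp K markLoop [] Q s τ := by
  refine wp.spec ?_ hQ
  rw [markLoop, wp_seq, wp_assign]
  refine ⟨by simp, by simp [hi]; omega, ?_⟩
  have hdiv : 1 ≤ R / i := (Nat.one_le_div_iff hi1).2 hiR
  have hmul := Nat.div_mul_le_self R i
  have hlt : R < (R / i + 1) * i := by
    have := Nat.lt_div_mul_add (a := R) hi1
    rw [Nat.succ_mul]; exact this
  -- Marking starts at `2 i`, so `R / i - 1` multiples are visited.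
  refine wp_loop (R / i - 1) (fun u s' τ' => τ' ≤ τ + 3 * u + 1 ∧ s'.v r_R = R ∧ s'.v r_i = i ∧
    s'.v r_j = (u + 2) * i ∧ (∀ x, s'.a a_mark x =
      if i ∣ x ∧ i < x ∧ x < (u + 2) * i then 1 else s.a a_mark x)) ?_ ?_ ?_ ?_
  · simp [hi, hR]
    refine ⟨by omega, fun x h1 h2 h3 => ?_⟩
    obtain ⟨y, rfl⟩ := h1
    rw [mul_comm i y] at h2 h3
    have h4 := Nat.lt_of_mul_lt_mul_right h3
    have : 1 < y := by
      by_contra h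
      have : y * i ≤ 1 * i := Nat.mul_le_mul_right _ (by omega)
      omega
    omega
  · rintro u - s' τ' -
    simp
  · rintro u hu s' τ' ⟨h1, h2, h3, h4, h5⟩
    have h6 : (u + 2) * i ≤ R := le_trans (Nat.mul_le_mul_right _ (by omega)) hmul
    refine ⟨by simp [h2, h4]; omega, ?_⟩
    simp [h2, h3, h4]
    have h7 : (u + 1 + 2) * i = (u + 2) * i + i := by ring
    refine ⟨by omega, by omega, by omega, by omega, h7.symm, fun x => ?_⟩
    rw [h7]
    by_cases hx : x = (u + 2) * i
    · subst hx
      rw [Function.update_self, if_pos]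
      refine ⟨Dvd.intro_left _ rfl, ?_, by omega⟩
      have : 1 * i < (u + 2) * i := Nat.mul_lt_mul_of_pos_right (by omega) hi1
      omega
    · rw [Function.update_of_ne hx, h5]
      refine if_congr (and_congr_right fun hd => and_congr_right fun hlt => ?_) rfl rfl
      obtain ⟨y, rfl⟩ := hd
      constructor
      · omega
      · intro h
        rw [← h7, mul_comm i y] at h
        have h8 := Nat.lt_of_mul_lt_mul_right h
        rw [mul_comm i y] at hx ⊢
        refine Nat.mul_lt_mul_of_pos_right ?_ hi1
        have : y ≠ u + 2 := by rintro rfl; exact hx rfl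
        omega
  · rintro s' τ' ⟨h1, h2, h3, h4, h5⟩
    have h6 : R / i - 1 + 2 = R / i + 1 := by omega
    rw [h6] at h4 h5
    refine ⟨by simp [h2, h4]; omega, by omega, fun x hx => ?_⟩
    rw [h5]
    refine if_congr (and_congr_right fun hd => ?_) rfl rfl
    omega

/-- Computes the primes in `[√R, R]`. -/
def sieve : Stmt := r_np ≔ 𝖼 0 ;; forS r_i (𝗏 r_R + 𝖼 1) (
  .ite (.lt (𝗏 r_i) (𝖼 2)) .skip (
  .ite (.eq (.get a_mark (𝗏 r_i)) (𝖼 0)) (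
    .ite (.lt (𝗏 r_i * 𝗏 r_i) (𝗏 r_R)) .skip
      (.put a_pr (𝗏 r_np) (𝗏 r_i) ;; r_np ≔ 𝗏 r_np + 𝖼 1) ;; markLoop) .skip))

/-- The repeated inequality makes the right-hand side an instance, at `x = i`, of the condition for
marks in the invariant of the sieve. The witness for a composite number is its least prime factor.
-/
theorem prime_iff_no_prime_dvd {i : ℕ} (h2 : 2 ≤ i) : i.Prime ↔ ¬ ∃ q, q.Prime ∧ q < i ∧ q ∣ i ∧ q < i := by
  constructor
  · rintro hp ⟨q, hq, -, hd, hlt⟩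
    rcases (Nat.dvd_prime hp).1 hd with h | h
    · exact hq.one_lt.ne' h
    · omega
  · intro h
    by_contra hp
    have hne : i ≠ 1 := by omega
    have h1 := (Nat.minFac_le (by omega : 0 < i)).lt_of_ne
      (fun h => hp (h ▸ Nat.minFac_prime hne))
    exact h ⟨i.minFac, Nat.minFac_prime hne, h1, i.minFac_dvd, h1⟩

/-- Before round `i` exactly the proper multiples of the primes below `i` are marked, so an unmarked
`i ≥ 2` is prime. The harmonic sum bounds the number of marks set. -/
theorem sieve_spec {R : ℕ} (hR : s.v r_R = R) (hU : 2 * R + 2 < K.U) (hU2 : R + 1 < K.U)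
    (hc : R < K.cap a_mark) (hc2 : R < K.cap a_pr) (h0 : ∀ x ≤ R, s.a a_mark x = 0)
    (hQ : ∀ s' τ', Fr sieve.mods sieve.amods s s' → τ' ≤ τ + 3 * divSum R + 10 * R + 20 →
      TabIn ((List.range (R + 1)).filter (fun x => decide (x.Prime ∧ R ≤ x * x))) s' → Q s' τ') :
    wp K sieve [] Q s τ := by
  refine wp.spec ?_ hQ
  classical
  rw [sieve, wp_seq, wp_assign]
  refine ⟨by simp, by simp; omega, ?_⟩
  set L : ℕ → List ℕ := fun i => (List.range i).filter (fun x => decide (x.Prime ∧ R ≤ x * x))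
  have hLlen : ∀ i, (L i).length ≤ i := fun i =>
    (List.length_filter_le _ _).trans (List.length_range (n := i)).le
  have hLsucc : ∀ i, L (i + 1) = L i ++ if i.Prime ∧ R ≤ i * i then [i] else [] := by
    intro i
    simp only [L, List.range_succ, List.filter_append]
    congr 1
    by_cases h : i.Prime ∧ R ≤ i * i
    · rw [if_pos h, List.filter_singleton, decide_eq_true h]; rfl
    · rw [if_neg h, List.filter_singleton, decide_eq_false h]; rfl
  refine wp_for (R + 1) (fun i s' τ' => τ' ≤ τ + 10 * i + 3 * (∑ x ∈ Finset.range i, R / x) + 2 ∧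
    (∀ x ≤ R, s'.a a_mark x = if ∃ q, q.Prime ∧ q < i ∧ q ∣ x ∧ q < x then 1 else 0) ∧
    TabIn (L i) s') (by decide) (by omega) ?_ ?_ ?_ ?_
  · intro s' hf
    have v1 := hf.v r_R (by decide)
    simp at v1
    simp [v1, hR]
  · refine ⟨by omega, fun x hx => ?_, ⟨by simp [L], by simp [L]⟩⟩
    rw [if_neg (by rintro ⟨q, -, h, -⟩; omega)]
    exact h0 x hx
  · rintro i hi s' τ' hf hiv ⟨hτ, hm, hT⟩
    have v1 := hf.v r_R (by decide)
    simp [hR] at v1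
    have hnp : (L i).length ≤ i := hLlen i
    have hsum : ∑ x ∈ Finset.range (i + 1), R / x = ∑ x ∈ Finset.range i, R / x + R / i :=
      Finset.sum_range_succ (fun x => R / x) i
    obtain ⟨ri, hri⟩ : ∃ ri, R / i = ri := ⟨_, rfl⟩
    rw [hri] at hsum
    have hnp' := hT.np
    rw [wp_ite]
    refine ⟨by simp, fun hc2' => ?_, fun hc2' => ?_⟩
    · simp [hiv] at hc2'
      have hnp : ¬ i.Prime := by interval_cases i <;> decide
      rw [wp_skip]
      refine ⟨by omega, ?_, ?_⟩
      · intro x hx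
        simp only [State.set_a, hm x hx]
        refine if_congr (exists_congr fun q => and_congr_right fun hq => ?_) rfl rfl
        have : q ≠ i := by rintro rfl; exact hnp hq
        have : q < i ↔ q < i + 1 := by omega
        rw [this]
      · rw [hLsucc, if_neg (by tauto), List.append_nil]
        exact ⟨by simpa using hT.np, by simpa using hT.pr⟩
    · simp [hiv] at hc2'
      have hmark := hm i (by omega)
      have hmark' : s'.a a_mark i = 0 ↔ i.Prime := by
        rw [prime_iff_no_prime_dvd hc2', hmark]
        split_ifs with h <;> simp [h]
      rw [wp_ite]
      refine ⟨by simp [hiv]; omega, fun hp => ?_, fun hp => ?_⟩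
      · simp [hiv, hmark'] at hp
        have fin : ∀ s1 τ1, τ1 ≤ τ' + 5 → s1.v r_R = R → s1.v r_i = i →
            s1.a a_mark = s'.a a_mark → TabIn (L (i + 1)) s1 →
            wp K markLoop [] (fun s' τ' => (τ' + 2 ≤ τ + 10 * (i + 1) +
              3 * (∑ x ∈ Finset.range (i + 1), R / x) + 2) ∧ (∀ x ≤ R, (s'.set r_i (i + 1)).a a_mark x =
                if ∃ q, q.Prime ∧ q < i + 1 ∧ q ∣ x ∧ q < x then 1 else 0) ∧
              TabIn (L (i + 1)) (s'.set r_i (i + 1))) s1 τ1 := by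
          intro s1 τ1 t1 w1 w2 w3 w4
          refine markLoop_spec w1 w2 (by omega) (by omega) hU hc ?_
          intro s2 τ2 f2 t2 h2
          refine ⟨by omega, fun x hx => ?_, ?_⟩
          · rw [State.set_a, h2 x hx, w3, hm x hx]
            by_cases hd : i ∣ x ∧ i < x
            · rw [if_pos hd, if_pos ⟨i, hp, by omega, hd.1, hd.2⟩]
            · rw [if_neg hd]
              refine if_congr (exists_congr fun q => and_congr_right fun hq => ?_) rfl rfl
              constructor
              · rintro ⟨a1, a2⟩; exact ⟨by omega, a2⟩
              · rintro ⟨a1, a2⟩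
                refine ⟨?_, a2⟩
                have : q ≠ i := by rintro rfl; exact hd a2
                omega
          · have := w4.fr f2 (by decide) (by decide)
            exact ⟨by simpa using this.np, by simpa using this.pr⟩
        rw [wp_seq, wp_ite]
        refine ⟨by simp, fun hq => ?_, fun hq => ?_⟩
        · simp [hiv, v1] at hq
          rw [wp_skip]
          refine fin _ _ (by omega) v1 hiv rfl ?_
          rw [hLsucc, if_neg (by omega), List.append_nil]; exact hT
        · simp [hiv, v1] at hq
          rw [wp_seq, wp_put]
          refine ⟨by simp, by simp, by simp [hnp']; omega, by simp [hiv]; omega, ?_⟩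
          rw [wp_assign]
          refine ⟨by simp, by simp [hnp']; omega, fin _ _ (by omega) (by simpa) (by simpa) ?_ ?_⟩
          · simp
          · rw [hLsucc, if_pos ⟨hp, hq⟩]
            refine ⟨by simp [hnp'], fun e he => ?_⟩
            simp [hnp', hiv] at he ⊢
            rcases Nat.lt_or_ge e (L i).length with h | h
            · rw [Function.update_of_ne (by omega), hT.pr e h, List.getElem?_append_left h,
                List.getD_eq_getElem?_getD]
            · obtain rfl : e = (L i).length := by omega
              simp
      · simp [hiv, hmark'] at hp
        rw [wp_skip]
        refine ⟨by omega, ?_, ?_⟩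
        · intro x hx
          simp only [State.set_a, hm x hx]
          refine if_congr (exists_congr fun q => and_congr_right fun hq => ?_) rfl rfl
          have : q ≠ i := by rintro rfl; exact hp hq
          have : q < i ↔ q < i + 1 := by omega
          rw [this]
        · rw [hLsucc, if_neg (by tauto), List.append_nil]
          exact ⟨by simpa using hT.np, by simpa using hT.pr⟩
  · rintro s' τ' hf hiv ⟨hτ, hm, hT⟩
    refine ⟨?_, hT⟩
    -- The index `0` contributes `R / 0 = 0`; the others give `divSum R`.
    rw [Finset.sum_range_succ', Nat.div_zero] at hτ
    rw [divSum]
    omega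

/-- Computes the table of moduli. -/
def tables : Stmt := .ite (.lt (𝗏 r_R) (𝗏 r_n)) sieve (.put a_pr (𝖼 0) (𝗏 r_R) ;; r_np ≔ 𝖼 1)

theorem divSum_mono {a b : ℕ} (h : a ≤ b) : divSum a ≤ divSum b :=
  (Finset.sum_le_sum fun _ _ => Nat.div_le_div_right h).trans
    (Finset.sum_le_sum_of_subset (Finset.range_mono h))

theorem tables_spec {n R : ℕ} (hn : s.v r_n = n) (hR : s.v r_R = R) (hU : 2 * n + 2 < K.U) (hRU : R < K.U)
    (hc : n ≤ K.cap a_mark) (hc2 : n ≤ K.cap a_pr) (hn1 : 1 ≤ n) (h0 : ∀ x, s.a a_mark x = 0)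
    (hQ : ∀ s' τ', Fr tables.mods tables.amods s s' → τ' ≤ τ + 3 * divSum n + 10 * n + 30 →
      TabIn (tabList n R) s' → Q s' τ') : wp K tables [] Q s τ := by
  refine wp.spec ?_ hQ
  rw [tables, wp_ite]
  refine ⟨by simp, fun h => ?_, fun h => ?_⟩
  · simp [hR, hn] at h
    refine sieve_spec hR (by omega) (by omega) (by omega) (by omega) (fun x _ => h0 x) ?_
    intro s' τ' f t hT
    have := divSum_mono h.le
    refine ⟨by omega, ?_⟩
    rw [tabList, if_pos h]; exact hT
  · simp [hR, hn] at h
    simp [hR]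
    refine ⟨by omega, by omega, by omega, by omega, ?_⟩
    rw [tabList, if_neg (by omega)]
    exact ⟨by simp, by simp⟩

/-- Tests by trial division whether `x` is a prime number. -/
def trialDiv : Stmt := r_f ≔ 𝖼 1 ;; r_d ≔ 𝖼 2 ;;
  .loop (.lt (𝗏 r_d * 𝗏 r_d) (𝗏 r_x + 𝖼 1))
    (.ite (.eq (𝗏 r_x % 𝗏 r_d) (𝖼 0)) (r_f ≔ 𝖼 0) .skip ;; r_d ≔ 𝗏 r_d + 𝖼 1)

theorem trialDiv_spec {x : ℕ} (hx : s.v r_x = x) (hx2 : 2 ≤ x) (hU : x + 1 < K.U)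
    (hQ : ∀ s' τ', Fr trialDiv.mods trialDiv.amods s s' → τ' ≤ τ + 5 * x.sqrt + 10 →
      s'.v r_f = (if x.Prime then 1 else 0) → Q s' τ') : wp K trialDiv [] Q s τ := by
  refine wp.spec ?_ hQ
  classical
  simp only [trialDiv]
  rw [wp_seq, wp_assign]
  refine ⟨by simp, by simp; omega, ?_⟩
  rw [wp_seq, wp_assign]
  refine ⟨by simp, by simp; omega, ?_⟩
  have hsq := Nat.sqrt_le x
  have hsq' := Nat.sqrt_lt_self (n := x) (by omega)
  have hs1 : 1 ≤ x.sqrt := Nat.le_sqrt.2 (by omega)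
  refine wp_loop (x.sqrt - 1) (fun u s' τ' => τ' ≤ τ + 5 * u + 2 ∧ s'.v r_x = x ∧
    s'.v r_d = u + 2 ∧ s'.v r_f = (if ∃ d, 2 ≤ d ∧ d < u + 2 ∧ d ∣ x then 0 else 1)) ?_ ?_ ?_ ?_
  · simp [hx]
    intro d h1 h2; omega
  · rintro u - s' τ' -
    simp
  · rintro u hu s' τ' ⟨h1, h2, h3, h4⟩
    have h5 : (u + 2) * (u + 2) ≤ x := Nat.le_sqrt.1 (by omega)
    refine ⟨by simp [h2, h3]; omega, ?_⟩
    have h6 : u + 2 + 1 < K.U := by omega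
    have h7 : (∃ d, 2 ≤ d ∧ d < u + 1 + 2 ∧ d ∣ x) ↔ (∃ d, 2 ≤ d ∧ d < u + 2 ∧ d ∣ x) ∨ u + 2 ∣ x := by
      constructor
      · rintro ⟨d, a1, a2, a3⟩
        by_cases hd : d = u + 2
        · subst hd; exact .inr a3
        · exact .inl ⟨d, a1, by omega, a3⟩
      · rintro (⟨d, a1, a2, a3⟩ | h)
        · exact ⟨d, a1, by omega, a3⟩
        · exact ⟨u + 2, by omega, by omega, h⟩
    rw [wp_seq, wp_ite]
    refine ⟨by simp, fun h => ?_, fun h => ?_⟩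
    · simp [h2, h3] at h
      rw [wp_assign]
      refine ⟨by simp, by simp; omega, ?_⟩
      rw [wp_assign]
      refine ⟨by simp, by simp [h3]; omega, by omega, by simpa, by simp [h3], ?_⟩
      rw [if_pos (h7.2 (.inr (Nat.dvd_of_mod_eq_zero h)))]
      simp
    · simp [h2, h3] at h
      rw [wp_skip, wp_assign]
      refine ⟨by simp, by simp [h3]; omega, by omega, by simpa, by simp [h3], ?_⟩
      have : ¬ u + 2 ∣ x := fun hd => h (Nat.mod_eq_zero_of_dvd hd)
      simp only [h7, this, or_false]
      simpa using h4
  · rintro s' τ' ⟨h1, h2, h3, h4⟩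
    have h5 : x < (x.sqrt + 1) * (x.sqrt + 1) := Nat.lt_succ_sqrt x
    have h6 : x.sqrt - 1 + 2 = x.sqrt + 1 := by omega
    rw [h6] at h3 h4
    refine ⟨by simp [h2, h3]; omega, by omega, ?_⟩
    rw [h4]
    have : x.Prime ↔ ¬ ∃ d, 2 ≤ d ∧ d < x.sqrt + 1 ∧ d ∣ x := by
      rw [Nat.prime_def_le_sqrt]
      constructor
      · rintro ⟨-, h⟩ ⟨d, a1, a2, a3⟩
        exact h d a1 (by omega) a3
      · intro h
        exact ⟨hx2, fun d a1 a2 a3 => h ⟨d, a1, by omega, a3⟩⟩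
    simp only [this]
    split_ifs <;> simp_all

/-- The number `x` is a prime number above `a`. -/
def goodTry (a x : ℕ) : Prop := x.Prime ∧ a < x

open Classical in
/-- The first prime number above `a` in a list, or `1`. -/
noncomputable def firstGood (a : ℕ) : List ℕ → ℕ
  | [] => 1
  | x :: l => if goodTry a x then x else firstGood a l

theorem firstGood_pos (a : ℕ) (l : List ℕ) : 1 ≤ firstGood a l := by
  induction l with
  | nil => exact le_rfl
  | cons x l ih =>
    rw [firstGood]
    split_ifs with h
    · exact h.1.one_le
    · exact ih

theorem firstGood_append (a : ℕ) (l l' : List ℕ) :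
    firstGood a (l ++ l') = if firstGood a l = 1 then firstGood a l' else firstGood a l := by
  induction l with
  | nil => simp [firstGood]
  | cons x l ih =>
    simp only [List.cons_append, firstGood]
    split_ifs with h1 h2 h2 <;> simp_all
    have := h1.1.one_lt
    omega

theorem firstGood_mem {a : ℕ} {l : List ℕ} (h : firstGood a l ≠ 1) :
    firstGood a l ∈ l ∧ goodTry a (firstGood a l) := by
  induction l with
  | nil => simp [firstGood] at h
  | cons x l ih =>
    rw [firstGood] at h ⊢
    split_ifs at h ⊢ with h1
    · exact ⟨by simp, h1⟩
    · exact ⟨List.mem_cons_of_mem _ (ih h).1, (ih h).2⟩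

/-- Looks for a prime number above `K1 n²` among random numbers. -/
def primeSearch (K1 : ℕ) : Stmt := r_p ≔ 𝖼 1 ;; forS r_t (𝗏 r_tr) (
  .rand r_x (𝗏 r_B) ;;
  .ite (.eq (𝗏 r_p) (𝖼 1)) (
    .ite (.lt (𝖼 K1 * (𝗏 r_n * 𝗏 r_n)) (𝗏 r_x)) (trialDiv ;;
      .ite (.eq (𝗏 r_f) (𝖼 1)) (r_p ≔ 𝗏 r_x) .skip) .skip) .skip)

/-- All numbers are drawn, even after a prime is found, so that the ranges of the choices do not
depend on their outcomes. The value `1` stands for no success. -/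
theorem primeSearch_spec {n B K1 : ℕ} (l : List ℕ) (hl : ∀ x ∈ l, x < B) (hn : s.v r_n = n)
    (hB : s.v r_B = B) (htr : s.v r_tr = l.length) (hU : B + 1 < K.U) (hU2 : l.length < K.U) (hK1 : 1 ≤ K1)
    (hn1 : 1 ≤ n)
    (hQ : ∀ s' τ', Fr (primeSearch K1).mods (primeSearch K1).amods s s' →
      τ' ≤ τ + l.length * (5 * B.sqrt + 20) + 5 → s'.v r_p = firstGood (K1 * (n * n)) l → Q s' τ') :
    wp K (primeSearch K1) (l.flatMap (Gen.unif B).enc) Q s τ := by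
  refine wp.spec ?_ hQ
  refine wp_seq_right (wp_assign.2 ⟨by simp, by simp; omega, ?_⟩)
  have hne : 1 ≤ K1 * (n * n) := Nat.mul_pos hK1 (Nat.mul_pos hn1 hn1)
  refine wp_for_list l _ (fun i s' τ' => τ' ≤ τ + i * (5 * B.sqrt + 20) + 2 ∧
    s'.v r_p = firstGood (K1 * (n * n)) (l.take i)) (by simp [trialDiv, Stmt.mods]) hU2 ?_ ?_ ?_ ?_
  · intro s' hf
    have v1 := hf.v r_tr (by simp [trialDiv, Stmt.mods])
    simp at v1
    simp [v1, htr]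
  · simp [firstGood]
  · rintro i hi s' τ' hf hiv ⟨hτ, hp⟩
    have v1 := hf.v r_n (by simp [trialDiv, Stmt.mods])
    have v2 := hf.v r_B (by simp [trialDiv, Stmt.mods])
    simp [hn, hB] at v1 v2
    have hx := hl _ (List.getElem_mem hi)
    have hsq : l[i].sqrt ≤ B.sqrt := Nat.sqrt_le_sqrt hx.le
    have htake : l.take (i + 1) = l.take i ++ [l[i]] := by simp
    have hmul : (i + 1) * (5 * B.sqrt + 20) = i * (5 * B.sqrt + 20) + (5 * B.sqrt + 20) := by ring
    refine wp_seq_left (wp_rand (b := B) (by simp) (by simpa) (by omega) hx ?_)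
    rw [htake, firstGood_append]
    set p := firstGood (K1 * (n * n)) (l.take i)
    rw [wp_ite]
    refine ⟨by simp, fun h1 => ?_, fun h1 => ?_⟩
    · simp [hp] at h1
      rw [if_pos h1]
      simp only [firstGood]
      rw [wp_ite]
      refine ⟨by simp, fun h2 => ?_, fun h2 => ?_⟩
      · simp [v1] at h2
        rw [wp_seq]
        refine trialDiv_spec (x := l[i]) (by simp) (by omega) (by omega) ?_
        intro s2 τ2 f2 t2 h3
        have v3 := f2.v r_p (by decide)
        have v4 := f2.v r_x (by decide)
        simp [hp, h1] at v3 v4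
        rw [wp_ite]
        refine ⟨by simp, fun h4 => ?_, fun h4 => ?_⟩
        · simp [h3] at h4
          rw [wp_assign, if_pos ⟨h4, h2⟩]
          refine ⟨by simp, by simp [v4]; omega, by omega, by simp [v4]⟩
        · simp [h3] at h4
          rw [wp_skip, if_neg (fun h => h4 h.1)]
          refine ⟨by omega, by simpa using v3⟩
      · simp [v1] at h2
        rw [wp_skip, if_neg (fun h => absurd h.2 (by omega))]
        refine ⟨by omega, by simpa [hp] using h1⟩
    · simp [hp] at h1
      rw [if_neg h1, wp_skip]
      exact ⟨by omega, by simpa using hp⟩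
  · rintro s' τ' hf hiv ⟨hτ, hp⟩
    exact ⟨by omega, by simpa using hp⟩

end

/-! ### Random classes, fingerprints of blocks, and sketches. -/

section
variable {K : Ctx} {s : State} {τ : ℕ} {Q : State → ℕ → Prop} {D : Par} {tab : List ℕ}

/-- One unfolding of a loop. -/
theorem wp_loop_unfold {c : Cond} {p : Stmt} (hok : c.Ok K s)
    (h1 : c.Holds K s → wp K p [] (fun s' τ' => wp K (.loop c p) [] Q s' (τ' + 1)) s τ)
    (h2 : ¬ c.Holds K s → Q s (τ + 1)) : wp K (.loop c p) [] Q s τ := by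
  by_cases hc : c.Holds K s
  · obtain ⟨s', t, h, s'', t', h', hq⟩ := h1 hc
    have := HEval.loop_true hok hc h h'
    refine ⟨s'', _, this, ?_⟩
    have e : τ + (t + t' + 1) = τ + t + 1 + t' := by omega
    rwa [e]
  · exact ⟨s, 1, .loop_false hok hc, h2 hc⟩

/-- Conditions on the parameters that do not depend on the state. -/
structure Sta (K : Ctx) (D : Par) (tab : List ℕ) (p : ℕ) : Prop where
  small : D.Small K.U
  lim2 : D.lim2 + 2 < K.U
  ls : D.ls + 1 < K.U
  p_pos : 0 < p
  p_lt : p < K.U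
  lw : D.lw = D.lx + D.ly
  lx_le : D.lx ≤ D.n
  ly_le : D.ly ≤ D.n
  l_pos : 1 ≤ D.l
  l_lx : D.l ≤ D.lx
  l_ly : D.l ≤ D.ly
  cap0 : D.lw ≤ K.cap 0
  cap : ∀ A, 1 ≤ A → A ≤ 12 → 2 * D.n + 2 ≤ K.cap A ∧ D.lr ≤ K.cap A
  tab_len : tab.length < K.U
  tab_cap : tab.length ≤ K.cap a_pr
  tab_lt : ∀ P ∈ tab, P < K.U

theorem Sta.p_le {p : ℕ} (h : Sta K D tab p) : p ≤ K.U :=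
  h.p_lt.le

/-- The part of the state that is fixed after the preparations. -/
structure Env (D : Par) (tab : List ℕ) (p : ℕ) (w inp : ℕ → ℕ) (s : State) : Prop where
  par : D.In s
  tab : TabIn tab s
  p : s.v r_p = p
  w : s.a a_w = w
  inp : s.a a_in = inp

theorem Env.fr {p : ℕ} {w inp : ℕ → ℕ} {s s' : State} {l la : List ℕ} (h : Env D tab p w inp s)
    (hf : Fr l la s s') (h1 : ∀ x ∈ r_p :: r_np :: parVars, x ∉ l) (h2 : ∀ A ∈ [a_w, a_in, a_pr], A ∉ la) :
    Env D tab p w inp s' :=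
  ⟨h.par.fr hf fun x hx => h1 x (by simp [hx]), h.tab.fr hf (h1 _ (by simp)) (h2 _ (by simp)),
    by rw [hf.v _ (h1 _ (by simp)), h.p], by rw [hf.a _ (h2 _ (by simp)), h.w],
    by rw [hf.a _ (h2 _ (by simp)), h.inp]⟩

/-- Reduces the letters modulo `p`. -/
def lettersP : Stmt := forS r_i (𝗏 r_lw) (.put a_w (𝗏 r_i) (.get a_in (𝗏 r_i) % 𝗏 r_p))

theorem lettersP_spec {lw p : ℕ} (hlw : s.v r_lw = lw) (hp : s.v r_p = p) (hp0 : 0 < p) (hpU : p ≤ K.U)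
    (hU : lw < K.U) (hc0 : lw ≤ K.cap a_in) (hc : lw ≤ K.cap a_w)
    (hQ : ∀ s' τ', Fr lettersP.mods lettersP.amods s s' → τ' ≤ τ + 3 * lw + 2 →
      (∀ x < lw, s'.a a_w x = s.a a_in x % p) → Q s' τ') : wp K lettersP [] Q s τ := by
  refine wp.spec ?_ hQ
  refine wp_for lw (fun i s' τ' => τ' ≤ τ + 3 * i + 1 ∧ ∀ x < i, s'.a a_w x = s.a a_in x % p)
    (by decide) hU ?_ ?_ ?_ ?_
  · intro s' hf
    simp [hf.v r_lw (by decide), hlw]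
  · simp
  · rintro i hi s' τ' hf hiv ⟨h1, h2⟩
    have v1 := hf.v r_p (by decide)
    have v2 := hf.a a_in (by decide)
    simp only [wp_put]
    simp [hiv, v1, v2, hp]
    refine ⟨by omega, by omega, (Nat.mod_lt _ hp0).trans_le hpU, by omega, fun x hx => ?_⟩
    by_cases hxi : x = i
    · subst hxi; simp
    · rw [Function.update_of_ne hxi, h2 x (by omega)]
  · rintro s' τ' hf hiv ⟨h1, h2⟩
    exact ⟨by omega, h2⟩

/-- The choices for a class: the index of the modulus, the residue, the base of the polynomial, and
the factor. -/
abbrev Cls := ℕ × ℕ × ℕ × ℕ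

/-- Random classes. -/
def clsGen (np R B : ℕ) : Gen Cls :=
  (Gen.unif np).prod ((Gen.unif R).prod ((Gen.unif B).prod (Gen.unif B)))

/-- The contribution of a class to the fingerprint of the window at `i`. -/
def clsVal (p l : ℕ) (tab : List ℕ) (w : ℕ → ℕ) (i : ℕ) (a : Cls) : ZMod p :=
  a.2.2.2 * clsSum p l (tab.getD a.1 0) a.2.1 a.2.2.1 w i

/-- The fingerprint of the window at `i`. -/
def fp (p l : ℕ) (tab : List ℕ) (w : ℕ → ℕ) (i : ℕ) (cs : List Cls) : ZMod p :=
  (cs.map (clsVal p l tab w i)).sum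

theorem fp_append (p l : ℕ) (tab : List ℕ) (w : ℕ → ℕ) (i : ℕ) (cs cs' : List Cls) :
    fp p l tab w i (cs ++ cs') = fp p l tab w i cs + fp p l tab w i cs' := by
  simp [fp]

theorem clsSum_mod (p l P c z : ℕ) (w : ℕ → ℕ) (i : ℕ) :
    clsSum p l P c (z % p) w i = clsSum p l P c z w i := by
  simp [clsSum]

/-- Chooses a class. -/
def drawCls : Stmt := .rand r_e1 (𝗏 r_np) ;; r_P ≔ .get a_pr (𝗏 r_e1) ;; .rand r_c (𝗏 r_R) ;;
  .rand r_z (𝗏 r_B) ;; r_z ≔ 𝗏 r_z % 𝗏 r_p ;; .rand r_y (𝗏 r_B) ;; r_y ≔ 𝗏 r_y % 𝗏 r_p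

/-- The values `z` and `y` are drawn below `B` and then reduced: the modulus `p` is itself random
and may not be the range of a choice. Likewise the residue is drawn below `R` for every modulus, and
the class is empty if it is too large. -/
theorem drawCls_spec {p : ℕ} {w inp : ℕ → ℕ} (hS : Sta K D tab p) (hE : Env D tab p w inp s) {a : Cls}
    (ha : (clsGen tab.length D.R D.B).Mem a)
    (hQ : ∀ s' τ', Fr drawCls.mods drawCls.amods s s' → τ' ≤ τ + 8 → s'.v r_P = tab.getD a.1 0 →
      s'.v r_c = a.2.1 → s'.v r_z = a.2.2.1 % p → s'.v r_y = a.2.2.2 % p → Q s' τ') :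
    wp K drawCls ((clsGen tab.length D.R D.B).enc a) Q s τ := by
  refine wp.use (Q := fun s' τ' => τ' ≤ τ + 8 ∧ s'.v r_P = tab.getD a.1 0 ∧ s'.v r_c = a.2.1 ∧
    s'.v r_z = a.2.2.1 % p ∧ s'.v r_y = a.2.2.2 % p) ?_
    fun s' τ' h hf => hQ s' τ' hf h.1 h.2.1 h.2.2.1 h.2.2.2.1 h.2.2.2.2
  obtain ⟨e, c, z, y⟩ := a
  obtain ⟨h1, h2⟩ := Gen.prod_mem ha
  obtain ⟨h2, h3⟩ := Gen.prod_mem h2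
  obtain ⟨h3, h4⟩ := Gen.prod_mem h3
  rw [Gen.unif_mem] at h1 h2 h3 h4
  dsimp only at h1 h2 h3 h4
  have e1 := hE.tab.np
  have e2 := hE.tab.pr e h1
  have e3 := hE.par.R
  have e4 := hE.par.B
  have e5 := hE.p
  have u1 := hS.tab_len
  have u2 := hS.tab_cap
  have u3 := hS.small.R
  have u4 := hS.small.B
  have hm : ∀ x, x % p < K.U := fun x => (Nat.mod_lt _ hS.p_pos).trans_le hS.p_le
  have u5 : tab.getD e 0 < K.U := by
    rw [List.getD_eq_getElem _ _ h1]; exact hS.tab_lt _ (List.getElem_mem h1)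
  refine wp_seq_tr (tr₁ := [(tab.length, e)]) (tr₂ := [(D.R, c)] ++ ([(D.B, z)] ++ [(D.B, y)])) ?_
  refine wp_rand (by simp) (by simpa) (by omega) h1 ?_
  refine wp_seq_right (wp_assign.2 ⟨by simp; omega, by simp only [Ex.val_get, Ex.val_var]; simpa [e2] using u5, ?_⟩)
  refine wp_seq_tr (wp_rand (by simp) (by simpa) (by omega) h2 ?_)
  refine wp_seq_tr (wp_rand (by simp) (by simpa) (by omega) h3 ?_)
  refine wp_seq_right (wp_assign.2 ⟨by simp, by simp [e5, hm], ?_⟩)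
  refine wp_seq_left (wp_rand (by simp) (by simpa) (by omega) h4 ?_)
  rw [wp_assign]
  refine ⟨by simp, by simp [e5, hm], by omega, ?_⟩
  simp [e2, e5]

/-- The hypotheses of `addClass_spec` from the environment. -/
theorem addClass_env {p : ℕ} {w inp : ℕ → ℕ} {P c z y : ℕ} (hS : Sta K D tab p) (hE : Env D tab p w inp s)
    (hw : ∀ x < D.lw, w x < p) (hP : s.v r_P = P) (hc : s.v r_c = c) (hz : s.v r_z = z) (hy : s.v r_y = y)
    (hf : ∀ i < D.lw, s.a a_f i < p)
    (hQ : ∀ s' τ', Fr addClass.mods addClass.amods s s' → τ' ≤ τ + 30 * (D.lw + 1) →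
      (∀ i < D.lw, s'.a a_f i < p) → (∀ i < D.lw + 1 - D.l,
      (s'.a a_f i : ZMod p) = s.a a_f i + y * clsSum p D.l P c z (trunc D.lw w) i) → Q s' τ') :
    wp K addClass [] Q s τ := by
  have h1 := hS.lw
  have h2 := hS.lx_le
  have h3 := hS.ly_le
  have h4 := hS.l_lx
  have h5 := hS.l_pos
  have c1 := (hS.cap a_w (by omega) (by omega)).1
  have c2 := (hS.cap a_g (by omega) (by omega)).1
  have c3 := (hS.cap a_f (by omega) (by omega)).1
  refine addClass_spec hE.par.lw hE.par.l hE.p hP hc hz hy hS.p_pos hS.p_le hS.small.lw (by omega)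
    (by rw [hE.w]; exact hw) hf (by omega) (by omega) (by omega) ?_
  rw [hE.w]
  exact hQ

/-- Chooses a class and adds it. -/
def stepCls : Stmt := drawCls ;; addClass

theorem stepCls_spec {p : ℕ} {w inp : ℕ → ℕ} (hS : Sta K D tab p) (hE : Env D tab p w inp s)
    (hw : ∀ x < D.lw, w x < p) (hf : ∀ i < D.lw, s.a a_f i < p) {a : Cls}
    (ha : (clsGen tab.length D.R D.B).Mem a)
    (hQ : ∀ s' τ', Fr stepCls.mods stepCls.amods s s' → τ' ≤ τ + 30 * (D.lw + 1) + 8 →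
      (∀ i < D.lw, s'.a a_f i < p) → (∀ i < D.lw + 1 - D.l,
      (s'.a a_f i : ZMod p) = s.a a_f i + clsVal p D.l tab (trunc D.lw w) i a) → Q s' τ') :
    wp K stepCls ((clsGen tab.length D.R D.B).enc a) Q s τ := by
  refine wp.use (Q := fun s' τ' => τ' ≤ τ + 30 * (D.lw + 1) + 8 ∧ (∀ i < D.lw, s'.a a_f i < p) ∧
    (∀ i < D.lw + 1 - D.l, (s'.a a_f i : ZMod p) = s.a a_f i + clsVal p D.l tab (trunc D.lw w) i a)) ?_
    fun s' τ' h hf => hQ s' τ' hf h.1 h.2.1 h.2.2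
  refine wp_seq_left ?_
  refine drawCls_spec hS hE ha ?_
  intro s1 τ1 f1 t1 h1 h2 h3 h4
  have e := f1.a a_f (by decide)
  refine addClass_env hS (hE.fr f1 (by decide) (by decide)) hw h1 h2 h3 h4 (by rwa [e]) ?_
  intro s2 τ2 f2 t2 h5 h6
  refine ⟨by omega, h5, fun i hi => ?_⟩
  rw [h6 i hi, e, clsVal, clsSum_mod, ZMod.natCast_mod]

/-- Resets the fingerprints. -/
def resetF : Stmt := forS r_i (𝗏 r_lw) (.put a_f (𝗏 r_i) (𝖼 0))

theorem resetF_spec {lw : ℕ} (hlw : s.v r_lw = lw) (hU : lw < K.U) (hc : lw ≤ K.cap a_f)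
    (hQ : ∀ s' τ', Fr resetF.mods resetF.amods s s' → τ' ≤ τ + 3 * lw + 2 → (∀ x < lw, s'.a a_f x = 0) →
      Q s' τ') : wp K resetF [] Q s τ := by
  refine wp.spec ?_ hQ
  refine wp_for lw (fun i s' τ' => τ' ≤ τ + 3 * i + 1 ∧ ∀ x < i, s'.a a_f x = 0)
    (by decide) hU ?_ ?_ ?_ ?_
  · intro s' hf
    simp [hf.v r_lw (by decide), hlw]
  · simp
  · rintro i hi s' τ' hf hiv ⟨h1, h2⟩
    simp only [wp_put]
    simp [hiv]
    refine ⟨by omega, by omega, by omega, fun x hx => ?_⟩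
    by_cases hxi : x = i
    · subst hxi; simp
    · rw [Function.update_of_ne hxi, h2 x (by omega)]
  · rintro s' τ' hf hiv ⟨h1, h2⟩
    exact ⟨by omega, h2⟩

/-- The sketch of the window at `i`, for a list of blocks of classes. -/
def skVal (p l g : ℕ) (tab : List ℕ) (w : ℕ → ℕ) (i : ℕ) (bl : List (List Cls)) : ℕ :=
  bl.foldl (fun acc cs => acc * g + (fp p l tab w i cs).val % g) 0

theorem skVal_concat (p l g : ℕ) (tab : List ℕ) (w : ℕ → ℕ) (i : ℕ) (bl : List (List Cls)) (cs : List Cls) :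
    skVal p l g tab w i (bl ++ [cs]) = skVal p l g tab w i bl * g + (fp p l tab w i cs).val % g := by
  simp [skVal]

theorem skVal_lt {p l g : ℕ} (hg : 0 < g) (tab : List ℕ) (w : ℕ → ℕ) (i : ℕ) (bl : List (List Cls)) :
    skVal p l g tab w i bl < g ^ bl.length := by
  induction bl using List.reverseRecOn with
  | nil => simp [skVal]
  | append_singleton bl cs ih =>
    rw [skVal_concat, List.length_append, List.length_singleton, pow_succ]
    have h1 : (fp p l tab w i cs).val % g < g := Nat.mod_lt _ hg
    calc _ < skVal p l g tab w i bl * g + g := by omega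
      _ = (skVal p l g tab w i bl + 1) * g := by ring
      _ ≤ _ := Nat.mul_le_mul_right _ ih

/-- Computes the sketches. -/
def sketchP (g : ℕ) : Stmt := forS r_t (𝗏 r_ls) (resetF ;; forS r_mm (𝗏 r_m) stepCls ;;
  forS r_i (𝗏 r_lw + 𝖼 1 - 𝗏 r_l)
    (.put a_sk (𝗏 r_i) (.get a_sk (𝗏 r_i) * 𝖼 g + .get a_f (𝗏 r_i) % 𝖼 g)))

theorem natCast_eq_val {p a : ℕ} (ha : a < p) {x : ZMod p} (h : (a : ZMod p) = x) : a = x.val := by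
  rw [← h, ZMod.val_natCast, Nat.mod_eq_of_lt ha]

/-- Random blocks of classes. -/
def blockGen (D : Par) (np q : ℕ) : Gen (List (List Cls)) := ((clsGen np D.R D.B).rep D.m).rep q

theorem blockStep_spec {p : ℕ} {w inp : ℕ → ℕ} (hS : Sta K D tab p) (hE : Env D tab p w inp s)
    (hw : ∀ x < D.lw, w x < p) (hf : ∀ i < D.lw, s.a a_f i < p) {cs : List Cls}
    (ha : ((clsGen tab.length D.R D.B).rep D.m).Mem cs)
    (hQ : ∀ s' τ', Fr (forS r_mm (𝗏 r_m) stepCls).mods (forS r_mm (𝗏 r_m) stepCls).amods s s' →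
      τ' ≤ τ + D.m * (30 * (D.lw + 1) + 10) + 2 → (∀ i < D.lw, s'.a a_f i < p) →
      (∀ i < D.lw + 1 - D.l, (s'.a a_f i : ZMod p) = s.a a_f i + fp p D.l tab (trunc D.lw w) i cs) →
      Q s' τ') : wp K (forS r_mm (𝗏 r_m) stepCls) (((clsGen tab.length D.R D.B).rep D.m).enc cs) Q s τ := by
  refine wp.use (Q := fun s' τ' => τ' ≤ τ + D.m * (30 * (D.lw + 1) + 10) + 2 ∧
    (∀ i < D.lw, s'.a a_f i < p) ∧ (∀ i < D.lw + 1 - D.l, (s'.a a_f i : ZMod p) = s.a a_f i +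
        fp p D.l tab (trunc D.lw w) i cs)) ?_
    fun s' τ' h hf => hQ s' τ' hf h.1 h.2.1 h.2.2
  obtain ⟨hlen, hmem⟩ := Gen.rep_mem ha
  rw [Gen.rep_enc _ hlen]
  have um := hS.small.m
  refine wp_for_list cs _ (fun m s' τ' => τ' ≤ τ + m * (30 * (D.lw + 1) + 10) + 1 ∧
    (∀ i < D.lw, s'.a a_f i < p) ∧ (∀ i < D.lw + 1 - D.l, (s'.a a_f i : ZMod p) = s.a a_f i +
        fp p D.l tab (trunc D.lw w) i (cs.take m))) (by decide) (by omega) ?_ ?_ ?_ ?_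
  · intro s' hf'
    simp [hf'.v r_m (by decide), hE.par.m, hlen]
  · refine ⟨by omega, by simpa using hf, by simp [fp]⟩
  · rintro m hm s' τ' hf' hiv ⟨h1, h2, h3⟩
    refine stepCls_spec hS (hE.fr hf' (by decide) (by decide)) hw h2
      (hmem _ (List.getElem_mem hm)) ?_
    intro s2 τ2 f2 t2 h4 h5
    refine ⟨by rw [Nat.succ_mul]; omega, by simpa using h4, fun i hi => ?_⟩
    have : cs.take (m + 1) = cs.take m ++ [cs[m]] := by simp
    rw [State.set_a, h5 i hi, h3 i hi, this, fp_append]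
    simp [fp, add_assoc]
  · rintro s' τ' hf' hiv ⟨h1, h2, h3⟩
    rw [hlen] at h1
    refine ⟨by omega, h2, fun i hi => ?_⟩
    rw [h3 i hi, List.take_length]

theorem sketchP_spec {p g : ℕ} {w inp : ℕ → ℕ} (hS : Sta K D tab p) (hE : Env D tab p w inp s)
    (hw : ∀ x < D.lw, w x < p) (h0 : ∀ i, s.a a_sk i = 0) (hg : 0 < g) (hgU : g ^ D.ls ≤ K.U)
    {bl : List (List Cls)} (ha : (blockGen D tab.length D.ls).Mem bl)
    (hQ : ∀ s' τ', Fr (sketchP g).mods (sketchP g).amods s s' →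
      τ' ≤ τ + D.ls * (D.m * (30 * (D.lw + 1) + 10) + 10 * D.lw + 20) + 2 →
      (∀ i < D.lw + 1 - D.l, s'.a a_sk i = skVal p D.l g tab (trunc D.lw w) i bl) → Q s' τ') :
    wp K (sketchP g) ((blockGen D tab.length D.ls).enc bl) Q s τ := by
  refine wp.spec ?_ hQ
  obtain ⟨hlen, hmem⟩ := Gen.rep_mem ha
  rw [blockGen, Gen.rep_enc _ hlen]
  have ul := hS.small.ls
  have ulw := hS.small.lw
  have e1 := hS.lw
  have e2 := hS.lx_le
  have e3 := hS.ly_le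
  have e4 := hS.l_lx
  have e5 := hS.l_pos
  have c1 := (hS.cap a_sk (by omega) (by omega)).1
  have c3 := (hS.cap a_f (by omega) (by omega)).1
  refine wp_for_list bl _ (fun m s' τ' =>
    τ' ≤ τ + m * (D.m * (30 * (D.lw + 1) + 10) + 10 * D.lw + 20) + 1 ∧
    (∀ i < D.lw + 1 - D.l, s'.a a_sk i = skVal p D.l g tab (trunc D.lw w) i (bl.take m)))
    (by simp [forS, Stmt.mods, resetF, stepCls, drawCls, addClass, powLoop, gLoop, fLoop])
    (by omega) ?_ ?_ ?_ ?_
  · intro s' hf'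
    have := hf'.v r_ls (by simp [forS, Stmt.mods, resetF, stepCls, drawCls, addClass, powLoop, gLoop, fLoop])
    simp [this, hE.par.ls, hlen]
  · refine ⟨by omega, by simp [skVal, h0]⟩
  · rintro m hm s' τ' hf' hiv ⟨h1, h2⟩
    have hE' : Env D tab p w inp s' := hE.fr hf'
      (by simp [forS, Stmt.mods, resetF, stepCls, drawCls, addClass, powLoop, gLoop, fLoop, parVars])
      (by simp [forS, Stmt.amods, resetF, stepCls, drawCls, addClass, powLoop, gLoop, fLoop])
    refine wp_seq_right ?_
    refine resetF_spec hE'.par.lw (by omega) (by omega) ?_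
    intro s2 τ2 f2 t2 h3
    have hE2 := hE'.fr f2 (by decide) (by decide)
    refine wp_seq_left ?_
    refine blockStep_spec hS hE2 hw (fun i hi => by rw [h3 i hi]; exact hS.p_pos)
      (hmem _ (List.getElem_mem hm)) ?_
    intro s4 τ4 f4 t4 h4 h5
    have hE4 := hE2.fr f4 (by decide) (by decide)
    have hsk4 : s4.a a_sk = s'.a a_sk := by rw [f4.a _ (by decide), f2.a _ (by decide)]
    have htake : bl.take (m + 1) = bl.take m ++ [bl[m]] := by simp
    refine wp_for (D.lw + 1 - D.l) (fun i s6 τ6 => τ6 ≤ τ4 + 3 * i + 1 ∧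
      (∀ x < D.lw + 1 - D.l, s6.a a_sk x = if x < i then
        skVal p D.l g tab (trunc D.lw w) x (bl.take (m + 1)) else s'.a a_sk x))
      (by simp [Stmt.mods]) (by omega) ?_ ?_ ?_ ?_
    · intro s6 hf6
      have v1 := hf6.v r_lw (by simp [Stmt.mods])
      have v2 := hf6.v r_l (by simp [Stmt.mods])
      simp [v1, v2, hE4.par.lw, hE4.par.l]
    · refine ⟨by omega, by simp [hsk4]⟩
    · rintro i hi s6 τ6 hf6 hiv6 ⟨h6, h7⟩
      have v1 := hf6.a a_f (by simp [Stmt.amods])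
      have hval : s4.a a_f i = (fp p D.l tab (trunc D.lw w) i bl[m]).val := by
        refine natCast_eq_val (h4 i (by omega)) ?_
        rw [h5 i hi, h3 i (by omega)]; simp
      -- A sketch is a number in base `g`; each block appends one digit.
      have hnew : s'.a a_sk i * g + s4.a a_f i % g =
          skVal p D.l g tab (trunc D.lw w) i (bl.take (m + 1)) := by
        rw [htake, skVal_concat, h2 i hi, hval]
      have hlt := skVal_lt (p := p) (l := D.l) hg tab (trunc D.lw w) i (bl.take (m + 1))
      have hlt2 : g ^ (bl.take (m + 1)).length ≤ g ^ D.ls :=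
        Nat.pow_le_pow_right hg (by rw [List.length_take]; omega)
      have h7i := h7 i hi
      rw [if_neg (by omega)] at h7i
      rw [wp_put]
      simp only [Ex.val_add, Ex.val_mul, Ex.val_mod, Ex.val_get, Ex.val_var, Ex.val_const, hiv6,
        h7i, v1, hnew]
      refine ⟨by simp, by simp [hiv6]; omega, by omega, by omega, by omega, fun x hx => ?_⟩
      by_cases hxi : x = i
      · subst hxi; simp
      · have : x < i + 1 ↔ x < i := by omega
        simp [this]
        rw [Function.update_of_ne hxi, h7 x hx]
    · rintro s6 τ6 hf6 hiv6 ⟨h6, h7⟩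
      have hmul : (m + 1) * (D.m * (30 * (D.lw + 1) + 10) + 10 * D.lw + 20) =
        m * (D.m * (30 * (D.lw + 1) + 10) + 10 * D.lw + 20) +
          (D.m * (30 * (D.lw + 1) + 10) + 10 * D.lw + 20) := by ring
      refine ⟨by omega, fun i hi => ?_⟩
      rw [State.set_a, h7 i hi, if_pos hi]
  · rintro s' τ' hf' hiv ⟨h1, h2⟩
    rw [hlen] at h1
    refine ⟨by omega, fun i hi => ?_⟩
    rw [h2 i hi, List.take_length]

end

/-! ### Search: candidates, filter and verification. -/

section
variable {K : Ctx} {s : State} {τ : ℕ} {Q : State → ℕ → Prop} {D : Par} {tab : List ℕ}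

/-- The number of equal digits of two numbers in base `g`, among the last `n` ones. -/
def eqDigits (g n a b : ℕ) : ℕ := ((List.range n).filter fun u => a / g ^ u % g = b / g ^ u % g).length

theorem eqDigits_succ (g n a b : ℕ) :
    eqDigits g (n + 1) a b = eqDigits g n a b + if a / g ^ n % g = b / g ^ n % g then 1 else 0 := by
  rw [eqDigits, List.range_succ, List.filter_append, List.length_append, List.filter_singleton]
  rw [eqDigits]
  split_ifs <;> simp_all

/-- Compares the digits of two sketches. -/
def digitLoop (g : ℕ) : Stmt := r_mm ≔ 𝖼 0 ;; r_e1 ≔ .get a_sk (𝗏 r_i) ;;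
  r_e2 ≔ .get a_sk (𝗏 r_lx + 𝗏 r_j) ;; forS r_u (𝗏 r_ls) (
    .ite (.eq (𝗏 r_e1 % 𝖼 g) (𝗏 r_e2 % 𝖼 g)) (r_mm ≔ 𝗏 r_mm + 𝖼 1) .skip ;;
    r_e1 ≔ 𝗏 r_e1 / 𝖼 g ;; r_e2 ≔ 𝗏 r_e2 / 𝖼 g)

theorem digitLoop_spec {g lx i j ls : ℕ} (hlx : s.v r_lx = lx) (hi : s.v r_i = i) (hj : s.v r_j = j)
    (hls : s.v r_ls = ls) (hU : ls + 1 < K.U) (hc1 : i < K.cap a_sk) (hc2 : lx + j < K.cap a_sk)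
    (h1U : s.a a_sk i < K.U) (h2U : s.a a_sk (lx + j) < K.U)
    (hQ : ∀ s' τ', Fr (digitLoop g).mods (digitLoop g).amods s s' → τ' ≤ τ + 6 * ls + 5 →
      s'.v r_mm = eqDigits g ls (s.a a_sk i) (s.a a_sk (lx + j)) → Q s' τ') :
    wp K (digitLoop g) [] Q s τ := by
  refine wp.spec ?_ hQ
  rw [digitLoop, wp_seq, wp_assign]
  refine ⟨by simp, by simp; omega, ?_⟩
  rw [wp_seq, wp_assign]
  refine ⟨by simp [hi]; omega, by simpa [hi], ?_⟩
  rw [wp_seq, wp_assign]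
  refine ⟨by simp [hlx, hj]; omega, by simpa [hlx, hj], ?_⟩
  set a := s.a a_sk i
  set b := s.a a_sk (lx + j)
  have hdg : ∀ x m, x / g ^ m / g = x / g ^ (m + 1) := fun x m => by
    rw [Nat.div_div_eq_div_mul, pow_succ]
  refine wp_for ls (fun m s' τ' => τ' ≤ τ + 6 * m + 4 ∧ s'.v r_mm = eqDigits g m a b ∧
    s'.v r_e1 = a / g ^ m ∧ s'.v r_e2 = b / g ^ m) (by simp [Stmt.mods]) (by omega) ?_ ?_ ?_ ?_
  · intro s' hf
    have v1 := hf.v r_ls (by simp [Stmt.mods])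
    simp at v1
    simp [v1, hls]
  · simp [hlx, hj, hi, eqDigits]
    exact ⟨rfl, rfl⟩
  · rintro m hm s' τ' hf hiv ⟨h1, h2, h3, h4⟩
    have hlen : eqDigits g m a b ≤ m :=
      (List.length_filter_le _ _).trans (List.length_range (n := m)).le
    have l1 : a / g ^ (m + 1) ≤ a := Nat.div_le_self _ _
    have l2 : b / g ^ (m + 1) ≤ b := Nat.div_le_self _ _
    rw [eqDigits_succ]
    simp only [wp_seq, wp_ite, wp_assign, wp_skip]
    simp [h2, h3, h4, hdg]
    refine ⟨fun h => ?_, fun h => ?_⟩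
    · and_intros <;> first | exact h | omega
    · and_intros <;> first | exact h | omega
  · rintro s' τ' hf hiv ⟨h1, h2, h3, h4⟩
    exact ⟨by omega, h2⟩

/-- The number of mismatches of the windows of length `l` at `i` and `j`. -/
def mis (inp : ℕ → ℕ) (l i j : ℕ) : ℕ :=
  ((List.range l).filter fun u => inp (i + u) ≠ inp (j + u)).length

/-- Counts mismatches. -/
def misLoop : Stmt := r_d ≔ 𝖼 0 ;; forS r_u (𝗏 r_l)
  (.ite (.eq (.get a_in (𝗏 r_i + 𝗏 r_u)) (.get a_in (𝗏 r_lx + 𝗏 r_j + 𝗏 r_u))) .skip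
    (r_d ≔ 𝗏 r_d + 𝖼 1))

theorem misLoop_spec {lx i j l : ℕ} (hlx : s.v r_lx = lx) (hi : s.v r_i = i) (hj : s.v r_j = j)
    (hl : s.v r_l = l) (hU : l + 1 < K.U) (hc1 : i + l ≤ K.cap a_in) (hc2 : lx + j + l ≤ K.cap a_in)
    (hQ : ∀ s' τ', Fr misLoop.mods misLoop.amods s s' → τ' ≤ τ + 4 * l + 3 →
      s'.v r_d = mis (s.a a_in) l i (lx + j) → Q s' τ') : wp K misLoop [] Q s τ := by
  refine wp.spec ?_ hQ
  rw [misLoop, wp_seq, wp_assign]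
  refine ⟨by simp, by simp; omega, ?_⟩
  refine wp_for l (fun m s' τ' => τ' ≤ τ + 4 * m + 2 ∧ s'.v r_d = mis (s.a a_in) m i (lx + j))
    (by decide) (by omega) ?_ ?_ ?_ ?_
  · intro s' hf
    have v1 := hf.v r_l (by decide)
    simp at v1
    simp [v1, hl]
  · simp [mis]
  · rintro m hm s' τ' hf hiv ⟨h1, h2⟩
    have v1 := hf.v r_i (by decide)
    have v2 := hf.v r_j (by decide)
    have v3 := hf.v r_lx (by decide)
    have v4 := hf.a a_in (by decide)
    simp [hi, hj, hlx] at v1 v2 v3 v4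
    have hlen : mis (s.a a_in) m i (lx + j) ≤ m :=
      (List.length_filter_le _ _).trans (List.length_range (n := m)).le
    have hsucc : mis (s.a a_in) (m + 1) i (lx + j) = mis (s.a a_in) m i (lx + j) +
        if s.a a_in (i + m) ≠ s.a a_in (lx + j + m) then 1 else 0 := by
      rw [mis, List.range_succ, List.filter_append, List.length_append, List.filter_singleton, mis]
      split_ifs <;> simp_all
    rw [hsucc]
    simp only [wp_ite, wp_assign, wp_skip]
    simp [h2, hiv, v1, v2, v3, v4]
    refine ⟨by omega, fun h => ?_, fun h => ?_⟩
    · and_intros <;> first | exact h | omega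
    · and_intros <;> first | exact h | omega
  · rintro s' τ' hf hiv ⟨h1, h2⟩
    exact ⟨by omega, h2⟩

/-- The state of the search: the numbers of candidates and of verified candidates, the answer, and
the witness. -/
structure CSt where
  cnt : ℕ
  vcnt : ℕ
  ans : ℕ
  ai : ℕ
  aj : ℕ

/-- The state of the search is in its variables. -/
structure CSt.In (st : CSt) (s : State) : Prop where
  cnt : s.v r_cnt = st.cnt
  vcnt : s.v r_vcnt = st.vcnt
  ans : s.v r_ans = st.ans
  ai : s.v r_ai = st.ai
  aj : s.v r_aj = st.aj

/-- The variables for the state of the search. -/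
def cstVars : List ℕ := [r_cnt, r_vcnt, r_ans, r_ai, r_aj]

theorem CSt.In.fr {st : CSt} {s s' : State} {l la : List ℕ} (h : st.In s) (hf : Fr l la s s')
    (hl : ∀ x ∈ cstVars, x ∉ l) : st.In s' := by
  have key : ∀ x ∈ cstVars, s'.v x = s.v x := fun x hx => hf.v x (hl x hx)
  constructor
  all_goals rw [key _ (by decide)]
  exacts [h.cnt, h.vcnt, h.ans, h.ai, h.aj]

open Classical in
/-- Treats a candidate. -/
noncomputable def proc (lim lim2 r : ℕ) (pass valid : ℕ × ℕ → Prop) (st : CSt) (c : ℕ × ℕ) : CSt :=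
  if st.ans = 1 ∨ lim ≤ st.cnt then st
  else if st.cnt = r ∨ (pass c ∧ st.vcnt < lim2) then
    if valid c then ⟨st.cnt + 1, st.vcnt + 1, 1, c.1, c.2⟩
    else ⟨st.cnt + 1, st.vcnt + 1, st.ans, st.ai, st.aj⟩
  else ⟨st.cnt + 1, st.vcnt, st.ans, st.ai, st.aj⟩

/-- Bounds for the counters. -/
structure CSt.Ok (lim lim2 r : ℕ) (st : CSt) : Prop where
  cnt : st.cnt ≤ lim
  vcnt : st.vcnt ≤ lim2 + 1
  vcnt' : st.cnt ≤ r → st.vcnt ≤ lim2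

/-- Only the candidate with number `r` is verified regardless of `lim2`, which happens at most once;
hence the bound `lim2 + 1`. -/
theorem proc_ok {lim lim2 r : ℕ} {pass valid : ℕ × ℕ → Prop} {st : CSt} (h : st.Ok lim lim2 r) (c : ℕ × ℕ) :
    (proc lim lim2 r pass valid st c).Ok lim lim2 r := by
  obtain ⟨h1, h2, h3⟩ := h
  simp only [proc]
  split_ifs with a1 a2 a3
  · exact ⟨h1, h2, h3⟩
  · rcases a2 with a2 | a2
    · exact ⟨by dsimp; omega, by have := h3 (by omega); dsimp; omega, by dsimp; omega⟩
    · exact ⟨by dsimp; omega, by dsimp; omega, by dsimp; omega⟩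
  · rcases a2 with a2 | a2
    · exact ⟨by dsimp; omega, by have := h3 (by omega); dsimp; omega, by dsimp; omega⟩
    · exact ⟨by dsimp; omega, by dsimp; omega, by dsimp; omega⟩
  · exact ⟨by dsimp; omega, by dsimp; omega, by dsimp; omega⟩

theorem foldl_proc_ok {lim lim2 r : ℕ} {pass valid : ℕ × ℕ → Prop} {st : CSt} (h : st.Ok lim lim2 r)
    (L : List (ℕ × ℕ)) : (L.foldl (proc lim lim2 r pass valid) st).Ok lim lim2 r := by
  induction L generalizing st with
  | nil => exact h
  | cons c L ih => exact ih (proc_ok h c)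

theorem foldl_proc_stop {lim lim2 r : ℕ} {pass valid : ℕ × ℕ → Prop} {st : CSt}
    (h : st.ans = 1 ∨ lim ≤ st.cnt) (L : List (ℕ × ℕ)) : L.foldl (proc lim lim2 r pass valid) st = st := by
  induction L with
  | nil => rfl
  | cons c L ih => rw [List.foldl_cons, proc, if_pos h, ih]

/-- A chain of links. -/
def IsChain (nx : ℕ → ℕ) : ℕ → List ℕ → Prop
  | cur, [] => cur = 0
  | cur, i :: L => cur = i + 1 ∧ IsChain nx (nx i) L

theorem IsChain.congr {nx nx' : ℕ → ℕ} {L : List ℕ} {cur : ℕ} (h : IsChain nx cur L)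
    (he : ∀ i ∈ L, nx' i = nx i) : IsChain nx' cur L := by
  induction L generalizing cur with
  | nil => exact h
  | cons i L ih =>
    refine ⟨h.1, ?_⟩
    rw [he i (by simp)]
    exact ih h.2 fun x hx => he x (by simp [hx])

/-- Verifies a candidate. -/
def verifyP (o : Option (ℕ × ℕ)) : Stmt := r_vcnt ≔ 𝗏 r_vcnt + 𝖼 1 ;; misLoop ;;
  .ite (.leE o (𝗏 r_d - 𝗏 r_k) (𝗏 r_k)) (r_ans ≔ 𝖼 1 ;; r_ai ≔ 𝗏 r_i ;; r_aj ≔ 𝗏 r_j) .skip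

/-- Decides whether a candidate is verified. -/
def decideP (c : Cst) : Stmt := r_do ≔ 𝖼 0 ;; .ite (.eq (𝗏 r_cnt) (𝗏 r_r)) (r_do ≔ 𝖼 1)
  (.ite (.lt (𝗏 r_mm) (𝖼 c.th * 𝗏 r_lam)) .skip
    (.ite (.lt (𝗏 r_vcnt) (𝗏 r_lim2)) (r_do ≔ 𝖼 1) .skip))

/-- Treats a candidate. -/
def candBody (c : Cst) : Stmt := .ite (.eq (𝗏 r_ans) (𝖼 1)) (r_cur ≔ 𝖼 0)
  (.ite (.lt (𝗏 r_cnt) (𝗏 r_lim)) (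
      r_i ≔ 𝗏 r_cur - 𝖼 1 ;; digitLoop c.g ;; decideP c ;; r_cnt ≔ 𝗏 r_cnt + 𝖼 1 ;;
      .ite (.eq (𝗏 r_do) (𝖼 1)) (verifyP c.eps) .skip ;;
      r_cur ≔ .get a_next (𝗏 r_i))
    (r_cur ≔ 𝖼 0))

/-- The sketches of the candidate are similar. -/
def passP (c : Cst) (D : Par) (sk : ℕ → ℕ) (x : ℕ × ℕ) : Prop :=
  c.th * D.lam ≤ eqDigits c.g D.ls (sk x.1) (sk (D.lx + x.2))

/-- The candidate is a witness. -/
def validP (ε : ℝ) (D : Par) (inp : ℕ → ℕ) (x : ℕ × ℕ) : Prop :=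
  ((mis inp D.l x.1 (D.lx + x.2) - D.k : ℕ) : ℝ) ≤ ε * D.k

/-- The cost of a search. -/
def CSt.W (D : Par) (st : CSt) : ℕ := st.cnt * (6 * D.ls + 30) + st.vcnt * (4 * D.l + 20)

/-- The part of the state that is fixed during the search. -/
structure Srch (K : Ctx) (D : Par) (r : ℕ) (inp sk : ℕ → ℕ) (s : State) : Prop where
  par : D.In s
  r : s.v r_r = r
  inp : s.a a_in = inp
  skU : ∀ i < D.lw + 1 - D.l, sk i < K.U
  sk : s.a a_sk = sk

theorem Srch.fr {r : ℕ} {inp sk : ℕ → ℕ} {s s' : State} {l la : List ℕ} (h : Srch K D r inp sk s)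
    (hf : Fr l la s s') (h1 : ∀ x ∈ r_r :: parVars, x ∉ l) (h2 : ∀ A ∈ [a_sk, a_in], A ∉ la) :
    Srch K D r inp sk s' :=
  ⟨h.par.fr hf fun x hx => h1 x (by simp [hx]), by rw [hf.v _ (h1 _ (by simp)), h.r],
    by rw [hf.a _ (h2 _ (by simp)), h.inp], h.skU, by rw [hf.a _ (h2 _ (by simp)), h.sk]⟩

theorem Srch.set {r : ℕ} {inp sk : ℕ → ℕ} {x m : ℕ} (h : Srch K D r inp sk s) (hx : x ∉ r_r :: parVars) :
    Srch K D r inp sk (s.set x m) :=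
  h.fr (l := [x]) (la := []) (Fr.rfl'.set (by simp)) (fun y hy h => hx (by simp_all)) (by simp)

theorem decideP_spec {c : Cst} {lam lim2 r : ℕ} {mm cnt vcnt : ℕ} (h1 : s.v r_mm = mm)
    (h2 : s.v r_lam = lam) (h3 : s.v r_lim2 = lim2) (h4 : s.v r_r = r) (h5 : s.v r_cnt = cnt)
    (h6 : s.v r_vcnt = vcnt) (hU : 1 < K.U)
    (hQ : ∀ s' τ', Fr (decideP c).mods (decideP c).amods s s' → τ' ≤ τ + 5 →
      (s'.v r_do = 1 ↔ cnt = r ∨ (c.th * lam ≤ mm ∧ vcnt < lim2)) → Q s' τ') : wp K (decideP c) [] Q s τ := by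
  refine wp.spec ?_ hQ
  simp only [decideP, wp_seq, wp_assign, wp_ite, wp_skip]
  simp [h1, h2, h3, h4, h5, h6, hU]
  omega

variable {c : Cst} {p r : ℕ} {inp sk : ℕ → ℕ} {st : CSt}

/-- Looks at a candidate. -/
local notation "◆" => proc D.lim D.lim2 r (passP c D sk) (validP K.ε D inp)

/-- The cost is charged to the potential `CSt.W`, whose increase pays for one comparison of
sketches, possibly one verification, and the test of the surrounding loop. If the search has
stopped, the chain is abandoned at constant cost. -/
theorem candBody_spec {i j : ℕ} {nx : ℕ → ℕ} {L : List ℕ} (ho : EpsOk c.eps K.ε) (hS : Sta K D tab p)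
    (hE : Srch K D r inp sk s) (hst : st.In s) (hok : st.Ok D.lim D.lim2 r) (hnx : s.a a_next = nx)
    (hj : s.v r_j = j) (hjl : j + D.l ≤ D.ly) (hil : i + D.l ≤ D.lx) (hcur : s.v r_cur = i + 1)
    (hch : IsChain nx (nx i) L) (hL : ∀ x ∈ L, x < D.lx)
    (hQ : ∀ s' τ' st', Fr (candBody c).mods (candBody c).amods s s' → st' = ◆ st (i, j) → st'.In s' →
      (¬ (st.ans = 1 ∨ D.lim ≤ st.cnt) ∧ IsChain nx (s'.v r_cur) L ∧ τ' + 1 + st.W D ≤ τ + st'.W D) ∨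
      ((st.ans = 1 ∨ D.lim ≤ st.cnt) ∧ s'.v r_cur = 0 ∧ τ' ≤ τ + 5) → Q s' τ') :
    wp K (candBody c) [] Q s τ := by
  obtain ⟨o1, o2, o3⟩ := hok
  have e1 := hS.lw
  have e2 := hS.lx_le
  have e3 := hS.ly_le
  have e5 := hS.l_pos
  have ulw := hS.small.lw
  have uls := hS.ls
  have ulim := hS.small.lim
  have ulim2 := hS.lim2
  have un := hS.small.n
  have c0 := hS.cap0
  have c1 := (hS.cap a_sk (by omega) (by omega)).1
  have c2 := (hS.cap a_next (by omega) (by omega)).1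
  refine wp.use (Q := fun s' τ' => ∃ st',
      st' = ◆ st (i, j) ∧ st'.In s' ∧
      ((¬ (st.ans = 1 ∨ D.lim ≤ st.cnt) ∧ IsChain nx (s'.v r_cur) L ∧ τ' + 1 + st.W D ≤ τ + st'.W D) ∨
      ((st.ans = 1 ∨ D.lim ≤ st.cnt) ∧ s'.v r_cur = 0 ∧ τ' ≤ τ + 5))) ?_
    fun s' τ' h hf => by
      obtain ⟨st', h1, h2, h3⟩ := h
      exact hQ s' τ' st' hf h1 h2 h3
  rw [candBody, wp_ite]
  refine ⟨by simp, fun ha => ?_, fun ha => ?_⟩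
  · simp [hst.ans] at ha
    rw [wp_assign]
    refine ⟨by simp, by simp; omega, st, ?_, ?_, ?_⟩
    · rw [proc, if_pos (.inl ha)]
    · exact hst.fr (l := [r_cur]) (la := []) (Fr.rfl'.set (by simp)) (by decide)
    · exact .inr ⟨.inl ha, by simp, by omega⟩
  simp [hst.ans] at ha
  rw [wp_ite]
  refine ⟨by simp, fun hb => ?_, fun hb => ?_⟩
  swap
  · simp [hst.cnt, hE.par.lim] at hb
    rw [wp_assign]
    refine ⟨by simp, by simp; omega, st, ?_, ?_, ?_⟩
    · rw [proc, if_pos (.inr hb)]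
    · exact hst.fr (l := [r_cur]) (la := []) (Fr.rfl'.set (by simp)) (by decide)
    · exact .inr ⟨.inr hb, by simp, by omega⟩
  simp [hst.cnt, hE.par.lim] at hb
  have hns : ¬ (st.ans = 1 ∨ D.lim ≤ st.cnt) := by omega
  rw [wp_seq, wp_assign]
  refine ⟨by simp, by simp [hcur]; omega, ?_⟩
  have hE1 := hE.set (x := r_i) (m := (𝗏 r_cur - 𝖼 1).val s) (by decide)
  have hst1 := hst.fr (s' := s.set r_i ((𝗏 r_cur - 𝖼 1).val s)) (l := [r_i]) (la := [])
    (Fr.rfl'.set (by simp)) (by decide)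
  have hi1 : (s.set r_i ((𝗏 r_cur - 𝖼 1).val s)).v r_i = i := by simp [hcur]
  have hj1 : (s.set r_i ((𝗏 r_cur - 𝖼 1).val s)).v r_j = j := by simp [hj]
  have hnx1 : (s.set r_i ((𝗏 r_cur - 𝖼 1).val s)).a a_next = nx := by simp [hnx]
  generalize s.set r_i ((𝗏 r_cur - 𝖼 1).val s) = s1 at hE1 hst1 hi1 hj1 hnx1
  rw [wp_seq]
  refine digitLoop_spec hE1.par.lx hi1 hj1 hE1.par.ls (by omega) (by omega) (by omega)
    (by rw [hE1.sk]; exact hE1.skU _ (by omega)) (by rw [hE1.sk]; exact hE1.skU _ (by omega)) ?_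
  intro s2 τ2 f2 t2 h2
  rw [hE1.sk] at h2
  have m2 : ∀ x, x ∉ [r_mm, r_e1, r_e2, r_u] → x ∉ (digitLoop c.g).mods := by
    intro x hx
    simp at hx
    simp [digitLoop, forS, Stmt.mods, hx]
  have hE2 := hE1.fr f2 (fun x hx => m2 x (by revert x; decide)) (by simp [digitLoop, forS, Stmt.amods])
  have hst2 := hst1.fr f2 (fun x hx => m2 x (by revert x; decide))
  have hi2 := (f2.v r_i (m2 _ (by decide))).trans hi1
  have hj2 := (f2.v r_j (m2 _ (by decide))).trans hj1
  have hnx2 := (f2.a a_next (by simp [digitLoop, forS, Stmt.amods])).trans hnx1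
  rw [wp_seq]
  refine decideP_spec h2 hE2.par.lam hE2.par.lim2 hE2.r hst2.cnt hst2.vcnt (by omega) ?_
  intro s3 τ3 f3 t3 h3
  have m3 : ∀ x, x ∉ [r_do] → x ∉ (decideP c).mods := by
    intro x hx
    simpa [decideP, Stmt.mods] using hx
  have hE3 := hE2.fr f3 (fun x hx => m3 x (by revert x; decide)) (by simp [decideP, Stmt.amods])
  have hst3 := hst2.fr f3 (fun x hx => m3 x (by revert x; decide))
  have hi3 := (f3.v r_i (m3 _ (by decide))).trans hi2
  have hj3 := (f3.v r_j (m3 _ (by decide))).trans hj2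
  have hnx3 := (f3.a a_next (by simp [decideP, Stmt.amods])).trans hnx2
  rw [wp_seq, wp_assign]
  refine ⟨by simp, by simp [hst3.cnt]; omega, ?_⟩
  have hcv : (𝗏 r_cnt + 𝖼 1).val s3 = st.cnt + 1 := by simp [hst3.cnt]
  rw [hcv]
  have hE4 := hE3.set (x := r_cnt) (m := st.cnt + 1) (by decide)
  have hW : (st.cnt + 1) * (6 * D.ls + 30) = st.cnt * (6 * D.ls + 30) + (6 * D.ls + 30) := by ring
  have hWv : (st.vcnt + 1) * (4 * D.l + 20) = st.vcnt * (4 * D.l + 20) + (4 * D.l + 20) := by ring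
  have fin : ∀ s5 τ5, s5.v r_i = i → s5.a a_next = nx →
      (◆ st (i, j)).In s5 → τ5 + 2 + st.W D ≤ τ +
        (◆ st (i, j)).W D →
      wp K (r_cur ≔ .get a_next (𝗏 r_i)) [] (fun s' τ' => ∃ st',
        st' = ◆ st (i, j) ∧ st'.In s' ∧
        ((¬ (st.ans = 1 ∨ D.lim ≤ st.cnt) ∧ IsChain nx (s'.v r_cur) L ∧ τ' + 1 + st.W D ≤ τ + st'.W D) ∨
        ((st.ans = 1 ∨ D.lim ≤ st.cnt) ∧ s'.v r_cur = 0 ∧ τ' ≤ τ + 5))) s5 τ5 := by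
    intro s5 τ5 a1 a2 a3 a4
    have hlt : nx i < K.U := by
      cases L with
      | nil => have : nx i = 0 := hch
               omega
      | cons y L => have := hch.1
                    have := hL y (by simp)
                    omega
    rw [wp_assign]
    refine ⟨by simp [a1]; omega, by simp [a1, a2, hlt], _, rfl, ?_, .inl ⟨hns, ?_, by omega⟩⟩
    · exact a3.fr (l := [r_cur]) (la := []) (Fr.rfl'.set (by simp)) (by decide)
    · simpa [a1, a2] using hch
  rw [wp_seq, wp_ite]
  refine ⟨by simp, fun hd => ?_, fun hd => ?_⟩
  · have hd' : st.cnt = r ∨ (passP c D sk (i, j) ∧ st.vcnt < D.lim2) := h3.1 (by simpa using hd)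
    have hvc : st.vcnt ≤ D.lim2 := by
      rcases hd' with h | h
      · exact o3 h.le
      · exact h.2.le
    rw [verifyP, wp_seq, wp_assign]
    refine ⟨by simp, by simp [hst3.vcnt]; omega, ?_⟩
    have hvv : (𝗏 r_vcnt + 𝖼 1).val (s3.set r_cnt (st.cnt + 1)) = st.vcnt + 1 := by
      simp [hst3.vcnt]
    rw [hvv, wp_seq]
    have hE5 := hE4.set (x := r_vcnt) (m := st.vcnt + 1) (by decide)
    have hst5 : CSt.In ⟨st.cnt + 1, st.vcnt + 1, st.ans, st.ai, st.aj⟩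
        ((s3.set r_cnt (st.cnt + 1)).set r_vcnt (st.vcnt + 1)) :=
      ⟨by simp, by simp, by simp [hst3.ans], by simp [hst3.ai], by simp [hst3.aj]⟩
    refine misLoop_spec (i := i) (j := j) hE5.par.lx (by simp [hi3]) (by simp [hj3]) hE5.par.l
      (by omega) (by omega) (by omega) ?_
    intro s6 τ6 f6 t6 h6
    rw [hE5.inp] at h6
    have hE6 := hE5.fr f6 (by decide) (by decide)
    have hst6 := hst5.fr f6 (by decide)
    have hi6 : s6.v r_i = i := by rw [f6.v _ (by decide)]; simp [hi3]
    have hj6 : s6.v r_j = j := by rw [f6.v _ (by decide)]; simp [hj3]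
    have hnx6 : s6.a a_next = nx := by rw [f6.a _ (by decide)]; simp [hnx3]
    rw [wp_ite, Cond.leE_ok, Cond.leE_holds ho]
    have hval : ((𝗏 r_d - 𝗏 r_k).val s6 : ℝ) ≤ K.ε * ((𝗏 r_k).val s6 : ℕ) ↔ validP K.ε D inp (i, j) := by
      simp [h6, hE6.par.k, validP]
    rw [hval]
    refine ⟨by simp, fun hv => ?_, fun hv => ?_⟩
    · have hpr : ◆ st (i, j) =
          ⟨st.cnt + 1, st.vcnt + 1, 1, i, j⟩ := by
        rw [proc, if_neg hns, if_pos hd', if_pos hv]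
      rw [wp_seq, wp_assign]
      refine ⟨by simp, by simp; omega, ?_⟩
      rw [wp_seq, wp_assign]
      refine ⟨by simp, by simp [hi6]; omega, ?_⟩
      rw [wp_assign]
      refine ⟨by simp, by simp [hj6]; omega, ?_⟩
      refine fin _ _ (by simpa) (by simpa) ?_ ?_
      · rw [hpr]
        exact ⟨by simp [hst6.cnt], by simp [hst6.vcnt], by simp, by simp [hi6], by simp [hj6]⟩
      · rw [hpr]; simp only [CSt.W]; omega
    · have hpr : ◆ st (i, j) =
          ⟨st.cnt + 1, st.vcnt + 1, st.ans, st.ai, st.aj⟩ := by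
        rw [proc, if_neg hns, if_pos hd', if_neg hv]
      rw [wp_skip]
      refine fin _ _ hi6 hnx6 ?_ ?_
      · rw [hpr]; exact hst6
      · rw [hpr]; simp only [CSt.W]; omega
  · have hd' : ¬ (st.cnt = r ∨ (passP c D sk (i, j) ∧ st.vcnt < D.lim2)) := fun h =>
      hd (by simpa using h3.2 h)
    have hpr : ◆ st (i, j) =
        ⟨st.cnt + 1, st.vcnt, st.ans, st.ai, st.aj⟩ := by
      rw [proc, if_neg hns, if_neg hd']
    rw [wp_skip]
    refine fin _ _ (by simpa) (by simpa) ?_ ?_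
    · rw [hpr]
      exact ⟨by simp, by simp [hst3.vcnt], by simp [hst3.ans], by simp [hst3.ai], by simp [hst3.aj]⟩
    · rw [hpr]; simp only [CSt.W]; omega

/-- Treats the candidates of a chain. -/
def chainLoop (c : Cst) : Stmt := .loop (.lt (𝖼 0) (𝗏 r_cur)) (candBody c)

theorem candBody_mods (c : Cst) (x : ℕ) :
    x ∈ (candBody c).mods ↔ x ∈ [r_cur, r_i, r_mm, r_e1, r_e2, r_u, r_do, r_cnt, r_vcnt, r_d, r_ans,
      r_ai, r_aj] := by
  simp [candBody, digitLoop, decideP, verifyP, misLoop, forS, Stmt.mods]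
  tauto

theorem candBody_amods (c : Cst) : (candBody c).amods = [] := by
  simp [candBody, digitLoop, decideP, verifyP, misLoop, forS, Stmt.amods]

/-- A stopped search ends the chain at once, and this does not change the fold over the remaining
candidates, as they leave a stopped state alone. So the time beyond the potential is constant. -/
theorem chainLoop_spec {j : ℕ} {nx : ℕ → ℕ} (ho : EpsOk c.eps K.ε) (hS : Sta K D tab p)
    (hjl : j + D.l ≤ D.ly) (L : List ℕ) :
    ∀ {st : CSt} {s : State} {τ : ℕ} {Q : State → ℕ → Prop}, Srch K D r inp sk s → st.In s →
      st.Ok D.lim D.lim2 r → s.a a_next = nx → s.v r_j = j → IsChain nx (s.v r_cur) L →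
      (∀ x ∈ L, x + D.l ≤ D.lx) → (∀ s' τ' st', Fr (chainLoop c).mods (chainLoop c).amods s s' →
      st' = (L.map fun i => (i, j)).foldl ◆ st → st'.In s' → τ' + st.W D ≤ τ + st'.W D + 10 → Q s' τ') →
      wp K (chainLoop c) [] Q s τ := by
  have e2 := hS.l_pos
  induction L with
  | nil =>
    intro st s τ Q hE hst hok hnx hj hch hL hQ
    have h0 : s.v r_cur = 0 := hch
    exact wp_loop_unfold (by simp) (fun h => absurd h (by simp [h0])) fun _ =>
      hQ _ _ st .rfl' rfl hst (by omega)
  | cons i L ih =>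
    intro st s τ Q hE hst hok hnx hj hch hL hQ
    have hi := hL i (by simp)
    have hL' : ∀ x ∈ L, x + D.l ≤ D.lx := fun x hx => hL x (by simp [hx])
    refine wp_loop_unfold (by simp) (fun h => ?_) fun h => absurd hch.1 (by simp at h; omega)
    refine candBody_spec ho hS hE hst hok hnx hj hjl hi hch.1 hch.2
      (fun x hx => by have := hL' x hx; omega) ?_
    intro s1 τ1 st1 f1 h1 hst1 h
    have hE1 := hE.fr f1 (fun x hx => by rw [candBody_mods]; revert x; decide)
      (by rw [candBody_amods]; simp)
    rcases h with ⟨-, h2, h3⟩ | ⟨h2, h3, h4⟩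
    · refine ih hE1 hst1 (by rw [h1]; exact proc_ok hok _)
        (by rw [f1.a _ (by rw [candBody_amods]; simp), hnx])
        (by rw [f1.v _ (by rw [candBody_mods]; decide), hj]) h2 hL' ?_
      intro s2 τ2 st2 f2 h5 hst2 h6
      refine hQ s2 τ2 st2 (f1.trans f2) ?_ hst2 (by omega)
      rw [h5, h1]; rfl
    · refine wp_loop_unfold (by simp) (fun h => absurd h (by simp [h3])) fun _ => ?_
      have : st1 = st := by rw [h1, proc, if_pos h2]
      subst this
      exact hQ _ _ st1 f1 (by rw [foldl_proc_stop h2]) hst1 (by omega)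

/-- Distributes the windows of the first string into buckets. -/
def bucketP : Stmt := forS r_i (𝗏 r_n) (.put a_head (𝗏 r_i) (𝖼 0)) ;;
  forS r_i (𝗏 r_lx + 𝖼 1 - 𝗏 r_l) (
    r_x ≔ .get a_f (𝗏 r_i) % 𝗏 r_n ;;
    .put a_next (𝗏 r_i) (.get a_head (𝗏 r_x)) ;;
    .put a_head (𝗏 r_x) (𝗏 r_i + 𝖼 1))

/-- Links and heads store `i + 1`, and `0` ends a list. New windows are inserted at the front, so
each bucket lists its indices in decreasing order, and writing a new link does not affect the old
chains. -/
theorem bucketP_spec (hS : Sta K D tab p) (hD : D.In s)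
    (hQ : ∀ s' τ', Fr bucketP.mods bucketP.amods s s' → τ' ≤ τ + 10 * D.n + 10 →
      (∀ v < D.n, IsChain (s'.a a_next) (s'.a a_head v)
      ((List.range (D.lx + 1 - D.l)).reverse.filter fun i => s.a a_f i % D.n = v)) → Q s' τ') :
    wp K bucketP [] Q s τ := by
  refine wp.spec ?_ hQ
  have e2 := hS.lx_le
  have e4 := hS.l_lx
  have e5 := hS.l_pos
  have un := hS.small.n
  have c1 := (hS.cap a_f (by omega) (by omega)).1
  have c2 := (hS.cap a_next (by omega) (by omega)).1
  have c3 := (hS.cap a_head (by omega) (by omega)).1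
  rw [bucketP, wp_seq]
  refine wp_for D.n (fun i s' τ' => τ' ≤ τ + 3 * i + 1 ∧ ∀ x < i, s'.a a_head x = 0)
    (by decide) (by omega) ?_ ?_ ?_ ?_
  · intro s' hf
    simp [hf.v r_n (by decide), hD.n]
  · simp
  · rintro i hi s' τ' hf hiv ⟨h1, h2⟩
    simp only [wp_put]
    simp [hiv]
    refine ⟨by omega, by omega, by omega, fun x hx => ?_⟩
    by_cases hxi : x = i
    · subst hxi; simp
    · rw [Function.update_of_ne hxi, h2 x (by omega)]
  rintro s1 τ1 f1 - ⟨t1, h1⟩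
  have hD1 := hD.fr f1 (by decide)
  refine wp_for (D.lx + 1 - D.l) (fun m s' τ' => τ' ≤ τ + 3 * D.n + 3 + 5 * m ∧
    (∀ v < D.n, IsChain (s'.a a_next) (s'.a a_head v)
        ((List.range m).reverse.filter fun i => s.a a_f i % D.n = v))) (by decide) (by omega) ?_ ?_ ?_ ?_
  · intro s' hf
    simp [hf.v r_lx (by decide), hf.v r_l (by decide), hD1.lx, hD1.l]
  · refine ⟨by omega, fun v hv => ?_⟩
    simpa [IsChain] using h1 v hv
  · rintro m hm s' τ' hf hiv ⟨h2, h3⟩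
    have hn0 : 0 < D.n := by omega
    have v1 : s'.v r_n = D.n := by rw [hf.v _ (by decide), hD1.n]
    have v2 : s'.a a_f = s.a a_f := by rw [hf.a _ (by decide), f1.a _ (by decide)]
    have hx : s.a a_f m % D.n < D.n := Nat.mod_lt _ hn0
    have hb : s'.a a_head (s.a a_f m % D.n) ≤ m := by
      have hc := h3 _ hx
      rcases hlist : ((List.range m).reverse.filter fun i => s.a a_f i % D.n = s.a a_f m % D.n)
        with - | ⟨y, L⟩
      · rw [hlist] at hc
        have : s'.a a_head (s.a a_f m % D.n) = 0 := hc
        omega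
      · rw [hlist] at hc
        have hy : y ∈ ((List.range m).reverse.filter fun i => s.a a_f i % D.n = s.a a_f m % D.n) := by
          rw [hlist]; simp
        simp at hy
        have := hc.1
        omega
    simp only [wp_seq, wp_assign, wp_put]
    simp [hiv, v1, v2]
    refine ⟨by omega, by omega, by omega, by omega, by omega, by omega, by omega, by omega, ?_⟩
    intro v hv
    rw [← List.filter_reverse, List.range_succ, List.reverse_append, List.reverse_singleton, List.singleton_append,
      List.filter_cons]
    have hcong : ∀ v < D.n, IsChain (Function.update (s'.a a_next) m (s'.a a_head (s.a a_f m % D.n)))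
        (s'.a a_head v) ((List.range m).reverse.filter fun i => s.a a_f i % D.n = v) := by
      intro v hv
      refine (h3 v hv).congr fun i hi => ?_
      simp at hi
      rw [Function.update_of_ne (by omega)]
    by_cases hvx : s.a a_f m % D.n = v
    · subst hvx
      simp only [decide_true, if_true]
      refine ⟨by rw [Function.update_self], ?_⟩
      rw [Function.update_self]
      exact hcong _ hv
    · simp only [hvx, decide_false]
      rw [Function.update_of_ne (fun h => hvx h.symm)]
      exact hcong _ hv
  · rintro s' τ' hf hiv ⟨h2, h3⟩
    exact ⟨by omega, h3⟩

/-- The candidates, for fingerprints `F`. -/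
def cands (D : Par) (F : ℕ → ℕ) : List (ℕ × ℕ) :=
  (List.range (D.ly + 1 - D.l)).flatMap fun j =>
    ((List.range (D.lx + 1 - D.l)).reverse.filter fun i =>
      F i % D.n = F (D.lx + j) % D.n).map fun i => (i, j)

/-- Enumerates the candidates. -/
def checkP (c : Cst) : Stmt := bucketP ;; forS r_j (𝗏 r_ly + 𝖼 1 - 𝗏 r_l) (
  r_cur ≔ .get a_head (.get a_f (𝗏 r_lx + 𝗏 r_j) % 𝗏 r_n) ;; chainLoop c)

theorem checkP_mods (c : Cst) (x : ℕ) :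
    x ∈ (checkP c).mods ↔ x ∈ [r_cur, r_i, r_mm, r_e1, r_e2, r_u, r_do, r_cnt, r_vcnt, r_d, r_ans, r_ai,
      r_aj, r_x, r_j] := by
  simp [checkP, forS, Stmt.mods, chainLoop, candBody_mods, bucketP]
  tauto

theorem checkP_amods (c : Cst) (x : ℕ) : x ∈ (checkP c).amods ↔ x ∈ [a_next, a_head] := by
  simp [checkP, forS, Stmt.amods, chainLoop, candBody_amods, bucketP]
  tauto

/-- Besides the potential, which pays for the candidates, only `O(n)` time is spent: building the
buckets and one lookup for each window of the second string. -/
theorem checkP_spec {F : ℕ → ℕ} (ho : EpsOk c.eps K.ε) (hS : Sta K D tab p) (hE : Srch K D r inp sk s)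
    (hst : st.In s) (hok : st.Ok D.lim D.lim2 r) (hF : ∀ i < D.lw + 1 - D.l, s.a a_f i = F i)
    (hQ : ∀ s' τ' st', Fr (checkP c).mods (checkP c).amods s s' → st' = (cands D F).foldl ◆ st → st'.In s' →
      τ' + st.W D ≤ τ + st'.W D + 40 * D.n + 30 → Q s' τ') : wp K (checkP c) [] Q s τ := by
  refine wp.use (Q := fun s' τ' => ∃ st',
      st' = (cands D F).foldl ◆ st ∧
      st'.In s' ∧ τ' + st.W D ≤ τ + st'.W D + 40 * D.n + 30) ?_
    fun s' τ' h hf => by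
      obtain ⟨st', h1, h2, h3⟩ := h
      exact hQ s' τ' st' hf h1 h2 h3
  have e1 := hS.lw
  have e2 := hS.lx_le
  have e3 := hS.ly_le
  have e4 := hS.l_lx
  have e5 := hS.l_pos
  have e6 := hS.l_ly
  have un := hS.small.n
  have ulw := hS.small.lw
  have c1 := (hS.cap a_f (by omega) (by omega)).1
  have c3 := (hS.cap a_head (by omega) (by omega)).1
  have hn0 : 0 < D.n := by omega
  rw [checkP, wp_seq]
  refine bucketP_spec hS hE.par ?_
  intro s1 τ1 f1 t1 h1
  have hE1 := hE.fr f1 (by decide) (by decide)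
  have hst1 := hst.fr f1 (by decide)
  have hF1 : s1.a a_f = s.a a_f := f1.a _ (by decide)
  have hmods : ∀ x, x ∉ [r_cur, r_i, r_mm, r_e1, r_e2, r_u, r_do, r_cnt, r_vcnt, r_d, r_ans, r_ai,
      r_aj] → x ∉ (r_cur ≔ .get a_head (.get a_f (𝗏 r_lx + 𝗏 r_j) % 𝗏 r_n) ;; chainLoop c).mods := by
    intro x hx
    simp only [Stmt.mods, chainLoop, List.mem_append, candBody_mods]
    simp at hx ⊢
    tauto
  have hamods : (r_cur ≔ .get a_head (.get a_f (𝗏 r_lx + 𝗏 r_j) % 𝗏 r_n) ;; chainLoop c).amods = [] := by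
    simp [Stmt.amods, chainLoop, candBody_amods]
  have hmods' : ∀ x, x ∉ [r_cur, r_i, r_mm, r_e1, r_e2, r_u, r_do, r_cnt, r_vcnt, r_d, r_ans, r_ai,
      r_aj, r_j] →
      x ∉ r_j :: (r_cur ≔ .get a_head (.get a_f (𝗏 r_lx + 𝗏 r_j) % 𝗏 r_n) ;; chainLoop c).mods := by
    intro x hx
    have := hmods x (by simp at hx ⊢; tauto)
    simp at hx
    simp only [List.mem_cons, not_or]
    exact ⟨by tauto, this⟩
  set pr := ◆
  set L : ℕ → List (ℕ × ℕ) := fun m => (List.range m).flatMap fun j =>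
    ((List.range (D.lx + 1 - D.l)).reverse.filter fun i =>
      F i % D.n = F (D.lx + j) % D.n).map fun i => (i, j)
  refine wp_for (D.ly + 1 - D.l) (fun m s' τ' => ∃ st', st' = (L m).foldl pr st ∧ st'.In s' ∧
    τ' + st.W D ≤ τ + st'.W D + 10 * D.n + 11 + 20 * m) (hmods _ (by decide)) (by omega) ?_ ?_ ?_ ?_
  · intro s' hf
    simp [hf.v r_ly (hmods' _ (by decide)), hf.v r_l (hmods' _ (by decide)), hE1.par.ly, hE1.par.l]
  · refine ⟨st, by simp [L], hst1.fr (l := [r_j]) (la := []) (Fr.rfl'.set (by simp)) (by decide), by omega⟩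
  · rintro j hj s2 τ2 hf hiv ⟨st2, h2, hst2, t2⟩
    have hE2 : Srch K D r inp sk s2 := hE1.fr hf (fun x hx => hmods' x (by revert x; decide))
      (by rw [hamods]; simp)
    have hhd : s2.a a_head = s1.a a_head := hf.a _ (by rw [hamods]; simp)
    have hnx : s2.a a_next = s1.a a_next := hf.a _ (by rw [hamods]; simp)
    have hf2 : s2.a a_f = s.a a_f := by rw [hf.a _ (by rw [hamods]; simp), hF1]
    have hx : F (D.lx + j) % D.n < D.n := Nat.mod_lt _ hn0
    have hval : (Ex.get a_head (.get a_f (𝗏 r_lx + 𝗏 r_j) % 𝗏 r_n)).val s2 =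
        s1.a a_head (F (D.lx + j) % D.n) := by
      simp [hhd, hf2, hE2.par.lx, hE2.par.n, hiv, hF (D.lx + j) (by omega)]
    have hfil : ((List.range (D.lx + 1 - D.l)).reverse.filter fun i =>
        s.a a_f i % D.n = F (D.lx + j) % D.n) = ((List.range (D.lx + 1 - D.l)).reverse.filter fun i =>
        F i % D.n = F (D.lx + j) % D.n) := by
      refine List.filter_congr fun i hi => ?_
      simp at hi
      rw [hF i (by omega)]
    have hch := h1 _ hx
    rw [hfil] at hch
    have hLm : ∀ x ∈ ((List.range (D.lx + 1 - D.l)).reverse.filter fun i =>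
        F i % D.n = F (D.lx + j) % D.n), x + D.l ≤ D.lx := by
      intro x hx
      simp at hx
      omega
    have hU : s1.a a_head (F (D.lx + j) % D.n) < K.U := by
      rcases hlist : ((List.range (D.lx + 1 - D.l)).reverse.filter fun i =>
        F i % D.n = F (D.lx + j) % D.n) with - | ⟨y, L⟩
      · rw [hlist] at hch
        have : s1.a a_head (F (D.lx + j) % D.n) = 0 := hch
        omega
      · rw [hlist] at hch hLm
        have := hch.1
        have := hLm y (by simp)
        omega
    rw [wp_seq, wp_assign, hval]
    refine ⟨by simp [hf2, hE2.par.lx, hE2.par.n, hiv, hF (D.lx + j) (by omega)]; omega, hU, ?_⟩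
    have hf' : Fr [r_cur] [] s2 (s2.set r_cur (s1.a a_head (F (D.lx + j) % D.n))) :=
      Fr.rfl'.set (by simp)
    refine chainLoop_spec (j := j) (nx := s1.a a_next) ho hS (by omega) _ (hE2.fr hf' (by decide) (by decide))
      (hst2.fr hf' (by decide)) (by rw [h2]; exact foldl_proc_ok hok _) (by simp [hnx]) (by simp [hiv])
      (by simpa using hch) hLm ?_
    intro s3 τ3 st3 f3 h3 hst3 t3
    refine ⟨st3, ?_, hst3.fr (l := [r_j]) (la := []) (Fr.rfl'.set (by simp)) (by decide), by omega⟩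
    have : L (j + 1) = L j ++ ((List.range (D.lx + 1 - D.l)).reverse.filter fun i =>
        F i % D.n = F (D.lx + j) % D.n).map fun i => (i, j) := by
      simp only [L, List.range_succ, List.flatMap_append, List.flatMap_singleton]
    rw [this, List.foldl_append, ← h2]
    exact h3
  · rintro s' τ' hf hiv ⟨st', h2, hst', t2⟩
    exact ⟨st', h2, hst', by omega⟩

end

/-! ### The sliding window of classes and the main loop. -/

section
variable {K : Ctx} {s : State} {τ : ℕ} {Q : State → ℕ → Prop} {D : Par} {tab : List ℕ}

/-- Removes the oldest class. -/
def popCls : Stmt := r_x ≔ 𝗏 r_q % 𝗏 r_lr ;; r_P ≔ .get a_rP (𝗏 r_x) ;; r_c ≔ .get a_rc (𝗏 r_x) ;;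
  r_z ≔ .get a_rz (𝗏 r_x) ;; r_y ≔ 𝗏 r_p - .get a_ry (𝗏 r_x) ;; addClass

/-- Stores a class. -/
def storeCls : Stmt := r_x ≔ 𝗏 r_q % 𝗏 r_lr ;; .put a_rP (𝗏 r_x) (𝗏 r_P) ;;
  .put a_rc (𝗏 r_x) (𝗏 r_c) ;; .put a_rz (𝗏 r_x) (𝗏 r_z) ;; .put a_ry (𝗏 r_x) (𝗏 r_y)

/-- Replaces the oldest class by a new one. -/
def mainStep : Stmt := .ite (.lt (𝗏 r_q) (𝗏 r_lr)) .skip popCls ;; drawCls ;; storeCls ;; addClass ;;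
  r_q ≔ 𝗏 r_q + 𝖼 1

/-- The classes in the ring buffer. -/
structure Ring (D : Par) (tab : List ℕ) (p : ℕ) (w : ℕ → ℕ) (cs : List Cls) (s : State) : Prop where
  q : s.v r_q = cs.length
  lt : ∀ i < D.lw, s.a a_f i < p
  f : ∀ i < D.lw + 1 - D.l, (s.a a_f i : ZMod p) = fp p D.l tab (trunc D.lw w) i (cs.drop (cs.length - D.lr))
  rP : ∀ u (h : u < cs.length), cs.length ≤ u + D.lr → s.a a_rP (u % D.lr) = tab.getD cs[u].1 0
  rc : ∀ u (h : u < cs.length), cs.length ≤ u + D.lr → s.a a_rc (u % D.lr) = cs[u].2.1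
  rz : ∀ u (h : u < cs.length), cs.length ≤ u + D.lr → s.a a_rz (u % D.lr) = cs[u].2.2.1 % p
  ry : ∀ u (h : u < cs.length), cs.length ≤ u + D.lr → s.a a_ry (u % D.lr) = cs[u].2.2.2 % p

theorem Ring.fr {p : ℕ} {w : ℕ → ℕ} {cs : List Cls} {s s' : State} {l la : List ℕ} (h : Ring D tab p w cs s)
    (hf : Fr l la s s') (h1 : r_q ∉ l) (h2 : ∀ A ∈ [a_f, a_rP, a_rc, a_rz, a_ry], A ∉ la) :
    Ring D tab p w cs s' := by
  have key : ∀ A ∈ [a_f, a_rP, a_rc, a_rz, a_ry], s'.a A = s.a A := fun A hA => hf.a A (h2 A hA)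
  constructor
  · rw [hf.v _ h1, h.q]
  all_goals rw [key _ (by decide)]
  exacts [h.lt, h.f, h.rP, h.rc, h.rz, h.ry]

theorem clsGen_mem {np R B : ℕ} {a : Cls} (h : (clsGen np R B).Mem a) :
    a.1 < np ∧ a.2.1 < R ∧ a.2.2.1 < B ∧ a.2.2.2 < B := by
  obtain ⟨h1, h2⟩ := Gen.prod_mem h
  obtain ⟨h2, h3⟩ := Gen.prod_mem h2
  obtain ⟨h3, h4⟩ := Gen.prod_mem h3
  rw [Gen.unif_mem] at h1 h2 h3 h4
  exact ⟨h1, h2, h3, h4⟩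

theorem eq_of_mod_eq_of_lt {u v q r : ℕ} (h : u % r = v % r) (hu : q ≤ u + r) (hu' : u < q + 1) (hv : v = q)
    (hne : u ≠ q) : u + r = q := by
  subst hv
  have hlt : u < v := by omega
  have h1 : r ∣ v - u := (Nat.modEq_iff_dvd' hlt.le).1 h
  obtain ⟨c, hc⟩ := h1
  rcases c with - | - | c
  · omega
  · omega
  · have : r * (c + 1 + 1) = r * c + r + r := by ring
    have hr : 0 < r := by
      rcases Nat.eq_zero_or_pos r with h0 | h0
      · subst h0; omega
      · exact h0
    omega

/-- Among the last `r` indices before `q` only `q - r` shares the slot of `q`, and this is the one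
that leaves the window. -/
theorem ring_update {f g : ℕ → ℕ} {r q x : ℕ} {val : ℕ → ℕ} (hr : 0 < r)
    (hold : ∀ u < q, q ≤ u + r → f (u % r) = val u) (hx : val q = x) (hg : g = Function.update f (q % r) x) :
    ∀ u < q + 1, q + 1 ≤ u + r → g (u % r) = val u := by
  intro u hu hur
  subst hg
  by_cases huq : u = q
  · subst huq; rw [Function.update_self, hx]
  · rw [Function.update_of_ne, hold u (by omega) (by omega)]
    intro h
    have := eq_of_mod_eq_of_lt h (by omega) hu rfl huq
    omega

/-- Fingerprints are linear in the factor `y`, so a class is removed by adding it again with the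
factor `-y`. Thus advancing the window by one class costs two passes over the text, whatever the
length of the window. -/
theorem mainStep_spec {p : ℕ} {w inp : ℕ → ℕ} (hS : Sta K D tab p) (hE : Env D tab p w inp s)
    (hw : ∀ x < D.lw, w x < p) {cs : List Cls} (hR : Ring D tab p w cs s) (hlr : 1 ≤ D.lr)
    (hcs : ∀ a ∈ cs, (clsGen tab.length D.R D.B).Mem a) (hq : cs.length + 1 < K.U) {a : Cls}
    (ha : (clsGen tab.length D.R D.B).Mem a)
    (hQ : ∀ s' τ', Fr mainStep.mods mainStep.amods s s' → τ' ≤ τ + 60 * (D.lw + 1) + 30 →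
      Ring D tab p w (cs ++ [a]) s' → Q s' τ') : wp K mainStep ((clsGen tab.length D.R D.B).enc a) Q s τ := by
  refine wp.spec ?_ hQ
  have clr : ∀ A, 1 ≤ A → A ≤ 12 → D.lr ≤ K.cap A := fun A h1 h2 => (hS.cap A h1 h2).2
  have ulr := hS.small.lr
  have uR := hS.small.R
  have hm : ∀ x, x % p < K.U := fun x => (Nat.mod_lt _ hS.p_pos).trans_le hS.p_le
  have hslot : cs.length % D.lr < D.lr := Nat.mod_lt _ (by omega)
  have htabU : ∀ a, (clsGen tab.length D.R D.B).Mem a → tab.getD a.1 0 < K.U := by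
    intro a ha
    have := (clsGen_mem ha).1
    rw [List.getD_eq_getElem _ _ this]; exact hS.tab_lt _ (List.getElem_mem this)
  have rest : ∀ s1 τ1, τ1 ≤ τ + 30 * (D.lw + 1) + 10 → Env D tab p w inp s1 →
      s1.v r_q = cs.length → (∀ i < D.lw, s1.a a_f i < p) → (∀ i < D.lw + 1 - D.l, (s1.a a_f i : ZMod p) =
        fp p D.l tab (trunc D.lw w) i (cs.drop (cs.length + 1 - D.lr))) →
      (∀ A ∈ [a_rP, a_rc, a_rz, a_ry], s1.a A = s.a A) →
      wp K (drawCls ;; storeCls ;; addClass ;; r_q ≔ 𝗏 r_q + 𝖼 1)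
        ((clsGen tab.length D.R D.B).enc a)
        (fun s' τ' => τ' ≤ τ + 60 * (D.lw + 1) + 30 ∧ Ring D tab p w (cs ++ [a]) s') s1 τ1 := by
    intro s1 τ1 t1 hE1 hq1 hlt1 hf1 ha1
    refine wp_seq_left (drawCls_spec hS hE1 ha ?_)
    intro s2 τ2 f2 t2 hP2 hc2 hz2 hy2
    have hE2 := hE1.fr f2 (by decide) (by decide)
    have hq2 := (f2.v r_q (by decide)).trans hq1
    have v1 := hE2.par.lr
    rw [wp_seq, storeCls]
    have c1 := clr a_rP (by omega) (by omega)
    have c2 := clr a_rc (by omega) (by omega)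
    have c3 := clr a_rz (by omega) (by omega)
    have c4 := clr a_ry (by omega) (by omega)
    have ua := clsGen_mem ha
    have uP := htabU a ha
    have um1 := hm a.2.2.1
    have um2 := hm a.2.2.2
    rw [wp_seq, wp_assign]
    refine ⟨by simp, by simp [hq2, v1]; omega, ?_⟩
    rw [wp_seq, wp_put]
    refine ⟨by simp, by simp, by simp [hq2, v1]; omega, by simp [hP2]; simpa using uP, ?_⟩
    rw [wp_seq, wp_put]
    refine ⟨by simp, by simp, by simp [hq2, v1]; omega, by simp [hc2]; omega, ?_⟩
    rw [wp_seq, wp_put]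
    refine ⟨by simp, by simp, by simp [hq2, v1]; omega, by simp [hz2]; omega, ?_⟩
    rw [wp_put]
    refine ⟨by simp, by simp, by simp [hq2, v1]; omega, by simp [hy2]; omega, ?_⟩
    generalize hs3 : State.put _ a_ry _ _ = s3
    have w1 : ∀ x, x ≠ r_x → s3.v x = s2.v x := by
      intro x hx; subst hs3; simp [hx]
    have w2 : ∀ A, A ∉ [a_rP, a_rc, a_rz, a_ry] → s3.a A = s2.a A := by
      intro A hA; subst hs3; simp at hA; simp [hA]
    have w3 : s3.a a_rP = Function.update (s.a a_rP) (cs.length % D.lr) (tab.getD a.1 0) := by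
      rw [← ha1 _ (by decide), ← f2.a _ (by decide)]
      subst hs3; simp [hq2, v1, hP2]
    have w4 : s3.a a_rc = Function.update (s.a a_rc) (cs.length % D.lr) a.2.1 := by
      rw [← ha1 _ (by decide), ← f2.a _ (by decide)]
      subst hs3; simp [hq2, v1, hc2]
    have w5 : s3.a a_rz = Function.update (s.a a_rz) (cs.length % D.lr) (a.2.2.1 % p) := by
      rw [← ha1 _ (by decide), ← f2.a _ (by decide)]
      subst hs3; simp [hq2, v1, hz2]
    have w6 : s3.a a_ry = Function.update (s.a a_ry) (cs.length % D.lr) (a.2.2.2 % p) := by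
      rw [← ha1 _ (by decide), ← f2.a _ (by decide)]
      subst hs3; simp [hq2, v1, hy2]
    clear hs3
    have hE3 : Env D tab p w inp s3 := hE2.fr (l := [r_x]) (la := [a_rP, a_rc, a_rz, a_ry])
      ⟨fun x hx => w1 x (by simpa using hx), w2⟩ (by decide) (by decide)
    have hfe : s3.a a_f = s1.a a_f := by rw [w2 _ (by decide), f2.a _ (by decide)]
    rw [wp_seq]
    refine addClass_env hS hE3 hw ((w1 _ (by decide)).trans hP2) ((w1 _ (by decide)).trans hc2)
      ((w1 _ (by decide)).trans hz2) ((w1 _ (by decide)).trans hy2) (by rw [hfe]; exact hlt1) ?_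
    intro s4 τ4 f4 t4 hlt4 hf4
    have hq4 : s4.v r_q = cs.length := by rw [f4.v _ (by decide), w1 _ (by decide), hq2]
    rw [wp_assign]
    refine ⟨by simp, by simp [hq4]; omega, by omega, ?_⟩
    have hlen : (cs ++ [a]).length = cs.length + 1 := by simp
    have hget : ∀ (val : Cls → ℕ), ∀ u (h : u < (cs ++ [a]).length), val (cs ++ [a])[u] =
        (fun u => if h : u < cs.length then val cs[u] else val a) u := by
      intro val u h
      dsimp only
      split_ifs with h'
      · rw [List.getElem_append_left h']
      · have : u = cs.length := by omega
        subst this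
        simp
    have hringgen : ∀ (A : ℕ) (val : Cls → ℕ), A ≠ a_f → A ∉ addClass.amods →
        s3.a A = Function.update (s.a A) (cs.length % D.lr) (val a) →
        (∀ u (h : u < cs.length), cs.length ≤ u + D.lr → s.a A (u % D.lr) = val cs[u]) →
        ∀ u (h : u < (cs ++ [a]).length), (cs ++ [a]).length ≤ u + D.lr →
          (s4.set r_q ((𝗏 r_q + 𝖼 1).val s4)).a A (u % D.lr) = val (cs ++ [a])[u] := by
      intro A val hA1 hA2 hA3 hold u hu hur
      rw [hget val u hu, State.set_a, f4.a A hA2]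
      refine ring_update (val := fun u => if h : u < cs.length then val cs[u] else val a) (by omega)
        ?_ ?_ hA3 u (by omega) (by omega)
      · intro u hu hur
        rw [dif_pos hu, hold u hu hur]
      · rw [dif_neg (by omega)]
    refine ⟨by simp [hq4], by simpa using hlt4, fun i hi => ?_, ?_, ?_, ?_, ?_⟩
    · rw [State.set_a, hf4 i hi, hfe, hf1 i hi, hlen, List.drop_append_of_le_length (by omega), fp_append]
      congr 1
      simp [fp, clsVal, clsSum_mod]
    · exact hringgen a_rP (fun a => tab.getD a.1 0) (by decide) (by decide) w3 hR.rP
    · exact hringgen a_rc (fun a => a.2.1) (by decide) (by decide) w4 hR.rc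
    · exact hringgen a_rz (fun a => a.2.2.1 % p) (by decide) (by decide) w5 hR.rz
    · exact hringgen a_ry (fun a => a.2.2.2 % p) (by decide) (by decide) w6 hR.ry
  refine wp_seq_right ?_
  rw [wp_ite]
  refine ⟨by simp, fun h => ?_, fun h => ?_⟩
  · simp [hR.q, hE.par.lr] at h
    rw [wp_skip]
    refine rest _ _ (by omega) hE hR.q hR.lt (fun i hi => ?_) (fun _ _ => rfl)
    rw [hR.f i hi]
    congr 2
    omega
  · simp [hR.q, hE.par.lr] at h
    obtain ⟨u, hu⟩ : ∃ u, cs.length = u + D.lr := ⟨cs.length - D.lr, by omega⟩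
    have hul : u < cs.length := by omega
    have hmod : cs.length % D.lr = u % D.lr := by rw [hu, Nat.add_mod_right]
    have r1 := hR.rP u hul (by omega)
    have r2 := hR.rc u hul (by omega)
    have r3 := hR.rz u hul (by omega)
    have r4 := hR.ry u hul (by omega)
    have hmem := hcs _ (List.getElem_mem hul)
    have uP := htabU _ hmem
    have ua := clsGen_mem hmem
    have um1 := hm cs[u].2.2.1
    have um2 := hm cs[u].2.2.2
    have hpU := hS.p_le
    have v1 := hE.par.lr
    have v2 := hR.q
    have c1 := clr a_rP (by omega) (by omega)
    have c2 := clr a_rc (by omega) (by omega)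
    have c3 := clr a_rz (by omega) (by omega)
    have c4 := clr a_ry (by omega) (by omega)
    rw [hmod] at hslot
    have hpp := hS.p_lt
    rw [popCls, wp_seq, wp_assign]
    have e0 : (𝗏 r_q % 𝗏 r_lr).val s = u % D.lr := by simp [v1, v2, hmod]
    rw [e0]
    refine ⟨by simp, by omega, ?_⟩
    rw [wp_seq, wp_assign]
    have e1 : (Ex.get a_rP (𝗏 r_x)).val (s.set r_x (u % D.lr)) = tab.getD cs[u].1 0 := by
      simpa using r1
    rw [e1]
    refine ⟨by simp; omega, uP, ?_⟩
    rw [wp_seq, wp_assign]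
    have e2 : (Ex.get a_rc (𝗏 r_x)).val ((s.set r_x (u % D.lr)).set r_P (tab.getD cs[u].1 0)) =
        cs[u].2.1 := by simpa using r2
    rw [e2]
    refine ⟨by simp; omega, by omega, ?_⟩
    rw [wp_seq, wp_assign]
    have e3 : (Ex.get a_rz (𝗏 r_x)).val (((s.set r_x (u % D.lr)).set r_P
        (tab.getD cs[u].1 0)).set r_c cs[u].2.1) = cs[u].2.2.1 % p := by simpa using r3
    rw [e3]
    refine ⟨by simp; omega, um1, ?_⟩
    rw [wp_seq, wp_assign]
    have e4 : (𝗏 r_p - Ex.get a_ry (𝗏 r_x)).val ((((s.set r_x (u % D.lr)).set r_P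
        (tab.getD cs[u].1 0)).set r_c cs[u].2.1).set r_z (cs[u].2.2.1 % p)) =
        p - cs[u].2.2.2 % p := by simp [hE.p, r4]
    rw [e4]
    refine ⟨by simp; omega, by omega, ?_⟩
    have hf5 : Fr [r_x, r_P, r_c, r_z, r_y] [] s (((((s.set r_x (u % D.lr)).set r_P
        (tab.getD cs[u].1 0)).set r_c cs[u].2.1).set r_z (cs[u].2.2.1 % p)).set r_y
          (p - cs[u].2.2.2 % p)) :=
      ((((Fr.rfl'.set (by simp)).set (by simp)).set (by simp)).set (by simp)).set (by simp)
    refine addClass_env hS (hE.fr hf5 (by decide) (by decide)) hw (P := tab.getD cs[u].1 0)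
      (c := cs[u].2.1) (z := cs[u].2.2.1 % p) (y := p - cs[u].2.2.2 % p) (by simp) (by simp)
      (by simp) (by simp) (by simpa using hR.lt) ?_
    intro s1 τ1 f1 t1 hlt1 hf1
    refine rest s1 τ1 (by omega) ((hE.fr hf5 (by decide) (by decide)).fr f1 (by decide) (by decide))
      (by rw [f1.v _ (by decide), hf5.v _ (by decide), hR.q]) hlt1 (fun i hi => ?_)
      (fun A hA => ?_)
    · rw [hf1 i hi, hf5.a _ (by decide), hR.f i hi]
      have h1 : cs.length - D.lr = u := by omega
      have h2 : cs.length + 1 - D.lr = u + 1 := by omega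
      rw [h1, h2, List.drop_eq_getElem_cons hul]
      simp only [fp, List.map_cons, List.sum_cons, clsVal, clsSum_mod]
      -- The stored factor is below `p`, so `p - y` is not truncated and represents `-y`.
      rw [Nat.cast_sub (Nat.mod_lt _ hS.p_pos).le, ZMod.natCast_mod, ZMod.natCast_self]
      ring
    · rw [f1.a _ (by revert A; decide), hf5.a _ (by simp)]

/-- The main loop. -/
def mainP (c : Cst) : Stmt := resetF ;; r_q ≔ 𝖼 0 ;; forS r_t (𝗏 r_nt) (forS r_mm (𝗏 r_m) mainStep ;;
  .ite (.lt (𝗏 r_b) (𝗏 r_t + 𝖼 2)) (checkP c) .skip)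

/-- The fingerprints with respect to the last classes. -/
def winF (p : ℕ) (D : Par) (tab : List ℕ) (w : ℕ → ℕ) (cs : List Cls) (i : ℕ) : ℕ :=
  (fp p D.l tab (trunc D.lw w) i (cs.drop (cs.length - D.lr))).val

/-- All candidates, after `m` blocks. -/
def allCands (p : ℕ) (D : Par) (tab : List ℕ) (w : ℕ → ℕ) (bl : List (List Cls)) (m : ℕ) :
    List (ℕ × ℕ) :=
  (List.range m).flatMap fun t =>
    if D.b < t + 2 then cands D (winF p D tab w (bl.take (t + 1)).flatten) else []

theorem mainStep_mods (x : ℕ) (h : x ∉ [r_x, r_P, r_c, r_z, r_y, r_q, r_e1, r_e2, r_un, r_pw, r_u, r_i]) :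
    x ∉ mainStep.mods := by
  simp [mainStep, popCls, drawCls, storeCls, addClass, powLoop, gLoop, fLoop, forS, Stmt.mods]
  simp at h
  tauto

theorem mainStep_amods (x : ℕ) (h : x ∉ [a_g, a_f, a_rP, a_rc, a_rz, a_ry]) : x ∉ mainStep.amods := by
  simp [mainStep, popCls, drawCls, storeCls, addClass, powLoop, gLoop, fLoop, forS, Stmt.amods]
  simp at h
  tauto

/-- The candidates are enumerated after every block for which a full window of `b` blocks exists.
Each block costs `m` updates in time `O(n)`; reusing `b - 1` blocks of the previous window avoids a
factor `b`. -/
theorem mainP_spec {c : Cst} {p r : ℕ} {w inp sk : ℕ → ℕ} {st : CSt} (ho : EpsOk c.eps K.ε)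
    (hS : Sta K D tab p) (hE : Env D tab p w inp s) (hE' : Srch K D r inp sk s) (hw : ∀ x < D.lw, w x < p)
    (hlr : 1 ≤ D.lr) (hst : st.In s) (hok : st.Ok D.lim D.lim2 r) {bl : List (List Cls)}
    (ha : (blockGen D tab.length D.nt).Mem bl)
    (hQ : ∀ s' τ' st', st' = (allCands p D tab w bl D.nt).foldl
      (proc D.lim D.lim2 r (passP c D sk) (validP K.ε D inp)) st → st'.In s' →
      τ' + st.W D ≤ τ + st'.W D + D.nt * (D.m * (60 * (D.lw + 1) + 32) + 40 * D.n + 40) + 3 * D.lw + 5 →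
      Q s' τ') : wp K (mainP c) ((blockGen D tab.length D.nt).enc bl) Q s τ := by
  obtain ⟨hlen, hmem⟩ := Gen.rep_mem ha
  rw [blockGen, Gen.rep_enc _ hlen]
  have unt := hS.small.nt
  have um := hS.small.m
  have uq := hS.small.q
  have un := hS.small.n
  have ulw := hS.small.lw
  have e1 := hS.lw
  have e2 := hS.lx_le
  have e3 := hS.ly_le
  have e4 := hS.l_lx
  have e5 := hS.l_pos
  have c3 := (hS.cap a_f (by omega) (by omega)).1
  have hpp := hS.p_pos
  refine wp_seq_right ?_
  refine resetF_spec hE.par.lw (by omega) (by omega) ?_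
  intro s1 τ1 f1 t1 h1
  have hE1 := hE.fr f1 (by decide) (by decide)
  have hE1' := hE'.fr f1 (by decide) (by decide)
  have hst1 := hst.fr f1 (by decide)
  refine wp_seq_right (wp_assign.2 ⟨by simp, by simp; omega, ?_⟩)
  have hf2 : Fr [r_q] [] s1 (s1.set r_q ((𝖼 0).val s1)) := Fr.rfl'.set (by simp)
  have hE2 := hE1.fr hf2 (by decide) (by decide)
  have hE2' := hE1'.fr hf2 (by decide) (by decide)
  have hst2 := hst1.fr hf2 (by decide)
  have hR2 : Ring D tab p w [] (s1.set r_q ((𝖼 0).val s1)) := by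
    refine ⟨by simp, fun i hi => ?_, fun i hi => ?_, by simp, by simp, by simp, by simp⟩
    · simp [h1 i hi, hpp]
    · simp [h1 i (by omega), fp]
  generalize s1.set r_q ((𝖼 0).val s1) = s2 at hE2 hE2' hst2 hR2
  set pr := proc D.lim D.lim2 r (passP c D sk) (validP K.ε D inp) with hpr
  have hmods : ∀ x, x ∉ [r_x, r_P, r_c, r_z, r_y, r_q, r_e1, r_e2, r_un, r_pw, r_u,
      r_i, r_cur, r_mm, r_do, r_cnt, r_vcnt, r_d, r_ans, r_ai, r_aj, r_j] → x ∉ (forS r_mm (𝗏 r_m) mainStep ;;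
        .ite (.lt (𝗏 r_b) (𝗏 r_t + 𝖼 2)) (checkP c) .skip).mods := by
    intro x hx
    simp only [forS, Stmt.mods, List.mem_append, checkP_mods, not_or]
    have h1 := mainStep_mods x (by simp at hx ⊢; tauto)
    simp at hx ⊢
    tauto
  have hamods : ∀ x, x ∉ [a_g, a_f, a_rP, a_rc, a_rz, a_ry, a_next, a_head] →
      x ∉ (forS r_mm (𝗏 r_m) mainStep ;;
        .ite (.lt (𝗏 r_b) (𝗏 r_t + 𝖼 2)) (checkP c) .skip).amods := by
    intro x hx
    simp only [forS, Stmt.amods, List.mem_append, checkP_amods, not_or]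
    have h1 := mainStep_amods x (by simp at hx ⊢; tauto)
    simp at hx ⊢
    tauto
  have hmods' : ∀ x, x ∉ [r_x, r_P, r_c, r_z, r_y, r_q, r_e1, r_e2, r_un, r_pw, r_u,
      r_i, r_cur, r_mm, r_do, r_cnt, r_vcnt, r_d, r_ans, r_ai, r_aj, r_j, r_t] →
      x ∉ r_t :: (forS r_mm (𝗏 r_m) mainStep ;;
        .ite (.lt (𝗏 r_b) (𝗏 r_t + 𝖼 2)) (checkP c) .skip).mods := by
    intro x hx
    have := hmods x (by simp at hx ⊢; tauto)
    simp at hx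
    simp only [List.mem_cons, not_or]
    exact ⟨by tauto, this⟩
  set T := D.m * (60 * (D.lw + 1) + 32) + 40 * D.n + 40 with hT
  refine wp_for_list bl _ (fun m s' τ' => ∃ st', st' = (allCands p D tab w bl m).foldl pr st ∧
    st'.In s' ∧ Ring D tab p w (bl.take m).flatten s' ∧
    τ' + st.W D ≤ τ + st'.W D + m * T + 3 * D.lw + 4) (hmods _ (by decide)) (by omega) ?_ ?_ ?_ ?_
  · intro s' hf
    simp [hf.v r_nt (hmods' _ (by decide)), hE2.par.nt, hlen]
  · have hf : Fr [r_t] [] s2 (s2.set r_t 0) := Fr.rfl'.set (by simp)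
    exact ⟨st, by simp [allCands], hst2.fr hf (by decide), hR2.fr hf (by decide) (by decide), by omega⟩
  · rintro m hm s3 τ3 hf hiv ⟨st3, h3, hst3, hR3, t3⟩
    have hE3 := hE2.fr hf (fun x hx => hmods' x (by revert x; decide))
      (fun x hx => hamods x (by revert x; decide))
    have hE3' := hE2'.fr hf (fun x hx => hmods' x (by revert x; decide))
      (fun x hx => hamods x (by revert x; decide))
    obtain ⟨hblen, hbmem⟩ := Gen.rep_mem (hmem _ (List.getElem_mem hm))
    have hflat : ∀ i, i ≤ bl.length → (bl.take i).flatten.length = i * D.m := by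
      intro i hi
      rw [List.length_flatten, List.map_congr_left (g := fun _ => D.m) (fun a ha =>
        (Gen.rep_mem (hmem a (List.mem_of_mem_take ha))).1)]
      simp [hi]
    have hfmem : ∀ i, ∀ a ∈ (bl.take i).flatten, (clsGen tab.length D.R D.B).Mem a := by
      intro i a ha
      obtain ⟨b, hb, hab⟩ := List.mem_flatten.1 ha
      exact (Gen.rep_mem (hmem b (List.mem_of_mem_take hb))).2 a hab
    refine wp_seq_left ?_
    rw [Gen.rep_enc _ hblen]
    refine wp_for_list bl[m] _ (fun i s' τ' => st3.In s' ∧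
      Ring D tab p w ((bl.take m).flatten ++ bl[m].take i) s' ∧
      τ' ≤ τ3 + i * (60 * (D.lw + 1) + 32) + 1) (mainStep_mods _ (by decide)) (by omega) ?_ ?_ ?_ ?_
    · intro s' hf'
      have hn : r_m ∉ r_mm :: mainStep.mods := by decide
      simp [hf'.v r_m hn, hE3.par.m, hblen]
    · have hf' : Fr [r_mm] [] s3 (s3.set r_mm 0) := Fr.rfl'.set (by simp)
      refine ⟨hst3.fr hf' (by decide), ?_, by omega⟩
      simpa using hR3.fr hf' (by decide) (by decide)
    · rintro i hi s4 τ4 hf' hiv' ⟨hst4, hR4, t4⟩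
      have hE4 := hE3.fr hf' (by decide) (by decide)
      refine mainStep_spec hS hE4 hw hR4 hlr ?_ ?_ (hbmem _ (List.getElem_mem hi)) ?_
      · intro a ha
        rcases List.mem_append.1 ha with h | h
        · exact hfmem m a h
        · exact hbmem a (List.mem_of_mem_take h)
      · rw [List.length_append, hflat m hm.le, List.length_take]
        have : (m + 1) * D.m ≤ D.nt * D.m := Nat.mul_le_mul_right _ (by omega)
        rw [Nat.succ_mul] at this
        rw [mul_comm D.m] at uq
        omega
      · intro s5 τ5 f5 t5 hR5
        have hf'' : Fr [r_mm] [] s5 (s5.set r_mm (i + 1)) := Fr.rfl'.set (by simp)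
        refine ⟨(hst4.fr f5 (by decide)).fr hf'' (by decide), ?_, by rw [Nat.succ_mul]; omega⟩
        have : bl[m].take (i + 1) = bl[m].take i ++ [bl[m][i]] := by simp
        rw [this, ← List.append_assoc]
        exact hR5.fr hf'' (by decide) (by decide)
    · rintro s4 τ4 hf' hiv' ⟨hst4, hR4, t4⟩
      rw [List.take_length] at hR4
      rw [hblen] at t4
      have htake : bl.take (m + 1) = bl.take m ++ [bl[m]] := by simp
      have hcs : (bl.take (m + 1)).flatten = (bl.take m).flatten ++ bl[m] := by
        rw [htake, List.flatten_append]; simp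
      rw [← hcs] at hR4
      have hE4 := hE3.fr hf' (by decide) (by decide)
      have hE4' := hE3'.fr hf' (by decide) (by decide)
      have ht4 : s4.v r_t = m := by rw [hf'.v _ (by decide), hiv]
      have hall : allCands p D tab w bl (m + 1) = allCands p D tab w bl m ++
          if D.b < m + 2 then cands D (winF p D tab w (bl.take (m + 1)).flatten) else [] := by
        rw [allCands, List.range_succ, List.flatMap_append, List.flatMap_singleton, ← allCands]
      have hmul : (m + 1) * T = m * T + T := by ring
      rw [wp_ite]
      refine ⟨by simp, fun hc => ?_, fun hc => ?_⟩
      · simp [hE4.par.b, ht4] at hc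
        refine checkP_spec ho hS hE4' hst4 (by rw [h3]; exact foldl_proc_ok hok _)
          (F := winF p D tab w (bl.take (m + 1)).flatten) ?_ ?_
        · intro i hi
          exact natCast_eq_val (hR4.lt i (by omega)) (hR4.f i hi)
        · intro s5 τ5 st5 f5 h5 hst5 t5
          have hf'' : Fr [r_t] [] s5 (s5.set r_t (m + 1)) := Fr.rfl'.set (by simp)
          refine ⟨st5, ?_, hst5.fr hf'' (by decide), ?_, by omega⟩
          · rw [hall, if_pos hc, List.foldl_append, ← h3]; exact h5
          · refine (hR4.fr f5 (by rw [checkP_mods]; decide) ?_).fr hf'' (by decide) (by decide)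
            intro A hA
            rw [checkP_amods]
            revert A; decide
      · simp [hE4.par.b, ht4] at hc
        rw [wp_skip]
        have hf'' : Fr [r_t] [] s4 (s4.set r_t (m + 1)) := Fr.rfl'.set (by simp)
        refine ⟨st3, ?_, hst4.fr hf'' (by decide), hR4.fr hf'' (by decide) (by decide), by omega⟩
        rw [hall, if_neg (by omega), List.append_nil, ← h3]
  · rintro s' τ' hf hiv ⟨st', h2, hst', -, t2⟩
    rw [hlen] at h2 t2
    exact hQ s' (τ' + 1) st' h2 hst' (by omega)

end

/-! ### The complete program and its outcome. -/

section
variable {K : Ctx} {s : State} {D : Par} {tab : List ℕ}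

/-- The program, for `k < l ≤ |X|, |Y|`. -/
def progP (c : Cst) : Stmt := paramsP c ;; tables ;; primeSearch c.K1 ;; lettersP ;;
  .rand r_r (𝗏 r_lim) ;; sketchP c.g ;; mainP c ;;
  r_n ≔ 𝗏 r_ans ;; r_lx ≔ 𝗏 r_ai ;; r_ly ≔ 𝗏 r_aj

/-- The random choices of a run: candidates for `p`, the number of the candidate that is verified
in any case, the blocks for the sketches, and the blocks for the search. -/
abbrev Rnd := List ℕ × ℕ × List (List Cls) × List (List Cls)

/-- Random choices for a run. -/
def rndGen (D : Par) (np : ℕ) : Gen Rnd :=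
  ((Gen.unif D.B).rep D.tr).prod ((Gen.unif D.lim).prod
    ((blockGen D np D.ls).prod (blockGen D np D.nt)))

/-- The outcome of a run. -/
noncomputable def outcome (c : Cst) (ε : ℝ) (D : Par) (inp : ℕ → ℕ) (x : Rnd) : CSt :=
  let p := firstGood (c.K1 * (D.n * D.n)) x.1
  let tab := tabList D.n D.R
  let w := fun i => inp i % p
  (allCands p D tab w x.2.2.2 D.nt).foldl (proc D.lim D.lim2 x.2.1
    (passP c D fun i => skVal p D.l c.g tab (trunc D.lw w) i x.2.2.1) (validP ε D inp))
    ⟨0, 0, 0, 0, 0⟩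

/-- Conditions on the parameters. -/
structure Pre (K : Ctx) (D : Par) (g : ℕ) : Prop where
  small : D.Small K.U
  lim2 : D.lim2 + 2 < K.U
  ls : D.ls + 1 < K.U
  B : D.B + 1 < K.U
  lw : D.lw = D.lx + D.ly
  lx_le : D.lx ≤ D.n
  ly_le : D.ly ≤ D.n
  l_pos : 1 ≤ D.l
  l_lx : D.l ≤ D.lx
  l_ly : D.l ≤ D.ly
  cap0 : D.lw ≤ K.cap 0
  cap : ∀ A, 1 ≤ A → A ≤ 12 → 2 * D.n + 2 ≤ K.cap A ∧ D.lr ≤ K.cap A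
  lr : 1 ≤ D.lr
  g_pos : 0 < g
  g_pow : g ^ D.ls ≤ K.U

theorem tabList_lt {n R P : ℕ} (h : P ∈ tabList n R) : P ≤ R := by
  rw [tabList] at h
  split_ifs at h with h1
  · have := List.mem_of_mem_filter h
    simp at this
    omega
  · simp at h; omega

theorem tabList_length {n R : ℕ} (hn : 1 ≤ n) : (tabList n R).length ≤ n := by
  rw [tabList]
  split_ifs with h1
  · refine (List.length_filter_le _ _).trans ?_
    simpa using h1
  · simpa using hn

theorem Pre.sta {g p : ℕ} (h : Pre K D g) (hp0 : 0 < p) (hp : p < K.U) : Sta K D (tabList D.n D.R) p := by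
  have hn : 1 ≤ D.n := h.l_pos.trans (h.l_lx.trans h.lx_le)
  have h1 := tabList_length (R := D.R) hn
  have h2 := (h.cap a_pr (by omega) (by omega)).1
  have h3 := h.small.n
  exact ⟨h.small, h.lim2, h.ls, hp0, hp, h.lw, h.lx_le, h.ly_le, h.l_pos, h.l_lx, h.l_ly, h.cap0,
    h.cap, by omega, by omega, fun P hP => (tabList_lt hP).trans_lt h.small.R⟩

/-- A bound for the time. -/
def timeB (D : Par) : ℕ :=
  3 * divSum D.n + 25 * D.n + 10 * D.lw + D.tr * (5 * D.B.sqrt + 20) +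
  D.ls * (D.m * (30 * (D.lw + 1) + 10) + 10 * D.lw + 20) +
  D.nt * (D.m * (60 * (D.lw + 1) + 32) + 40 * D.n + 40) +
  (D.lim * (6 * D.ls + 30) + (D.lim2 + 1) * (4 * D.l + 20)) + 200

/-- The array of sketches agrees with the ideal sketches only at start positions of windows, and the
candidates lie there. -/
theorem foldl_proc_congr {lim lim2 r : ℕ} {pass pass' valid : ℕ × ℕ → Prop} {st : CSt} {L : List (ℕ × ℕ)}
    (h : ∀ x ∈ L, pass x ↔ pass' x) :
    L.foldl (proc lim lim2 r pass valid) st = L.foldl (proc lim lim2 r pass' valid) st := by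
  induction L generalizing st with
  | nil => rfl
  | cons x L ih =>
    have : proc lim lim2 r pass valid st x = proc lim lim2 r pass' valid st x := by
      have e : pass x = pass' x := propext (h x (by simp))
      unfold proc
      rw [e]
    rw [List.foldl_cons, List.foldl_cons, this]
    exact ih fun y hy => h y (by simp [hy])

theorem mem_cands {F : ℕ → ℕ} {x : ℕ × ℕ} (h : x ∈ cands D F) :
    x.1 < D.lx + 1 - D.l ∧ x.2 < D.ly + 1 - D.l ∧ F x.1 % D.n = F (D.lx + x.2) % D.n := by
  simp only [cands, List.mem_flatMap, List.mem_map, List.mem_filter, List.mem_reverse,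
    List.mem_range, decide_eq_true_eq] at h
  obtain ⟨j, hj, i, ⟨hi, hF⟩, rfl⟩ := h
  exact ⟨hi, hj, hF⟩

theorem mem_allCands {p : ℕ} {w : ℕ → ℕ} {bl : List (List Cls)} {m : ℕ} {x : ℕ × ℕ}
    (h : x ∈ allCands p D tab w bl m) : x.1 < D.lx + 1 - D.l ∧ x.2 < D.ly + 1 - D.l := by
  simp only [allCands, List.mem_flatMap] at h
  obtain ⟨t, ht, h⟩ := h
  split_ifs at h with h1
  · have := mem_cands h
    exact ⟨this.1, this.2.1⟩
  · simp at h

theorem progP_spec {c : Cst} {n lx ly k l : ℕ} {inp : ℕ → ℕ} {x : Rnd} (ho : EpsOk c.eps K.ε) (hε : 0 < K.ε)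
    (hn : s.v r_n = n) (hlx : s.v r_lx = lx) (hly : s.v r_ly = ly) (hk : s.v r_k = k) (hl : s.v r_l = l)
    (hz : ∀ x, 5 ≤ x → s.v x = 0) (hza : ∀ A, 1 ≤ A → ∀ i, s.a A i = 0) (hinp : s.a a_in = inp)
    (hKN : 1 ≤ c.KN) (hK1 : 1 ≤ c.K1) (hP : Pre K (par c K.ε n lx ly k l) c.g)
    (hx : (rndGen (par c K.ε n lx ly k l) (tabList n (par c K.ε n lx ly k l).R).length).Mem x) :
    wp K (progP c) ((rndGen (par c K.ε n lx ly k l) (tabList n (par c K.ε n lx ly k l).R).length).enc x)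
      (fun s' τ' => τ' ≤ timeB (par c K.ε n lx ly k l) ∧
      s'.v r_n = (outcome c K.ε (par c K.ε n lx ly k l) inp x).ans ∧
      s'.v r_lx = (outcome c K.ε (par c K.ε n lx ly k l) inp x).ai ∧
      s'.v r_ly = (outcome c K.ε (par c K.ε n lx ly k l) inp x).aj) s 0 := by
  obtain ⟨tries, r, bsk, bmain⟩ := x
  set D := par c K.ε n lx ly k l with hD
  have dn : D.n = n := rfl
  have dl : D.l = l := rfl
  have e0 := hP.lw
  have e1 := hP.lx_le
  have e2 := hP.ly_le
  have e3 := hP.l_pos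
  have e4 := hP.l_lx
  have hn1 : 1 ≤ n := by rw [← dn]; omega
  obtain ⟨x1, hx⟩ := Gen.prod_mem hx
  obtain ⟨x2, hx⟩ := Gen.prod_mem hx
  obtain ⟨x3, x4⟩ := Gen.prod_mem hx
  dsimp only at x1 x2 x3 x4
  obtain ⟨hlen, hmem⟩ := Gen.rep_mem x1
  have htry : ∀ x ∈ tries, x < D.B := fun x hx => Gen.unif_mem.1 (hmem x hx)
  set p := firstGood (c.K1 * (n * n)) tries with hp
  have hp0 : 0 < p := firstGood_pos _ _
  have un : n * n + 2 * n + 3 < K.U := hP.small.n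
  have e1' : D.lx ≤ n := e1
  have e2' : D.ly ≤ n := e2
  have uB := hP.B
  have utr := hP.small.tr
  have uR := hP.small.R
  have ulim := hP.small.lim
  have ulw := hP.small.lw
  have hpU : p < K.U := by
    by_cases h : p = 1
    · omega
    · have := htry _ (firstGood_mem h).1
      omega
  have hS := hP.sta hp0 hpU
  have capn : ∀ A, 1 ≤ A → A ≤ 12 → 2 * n + 2 ≤ K.cap A := fun A h1 h2 => (hP.cap A h1 h2).1
  show wp K _ (((Gen.unif D.B).rep D.tr).enc tries ++ ([(D.lim, r)] ++
    ((blockGen D (tabList n D.R).length D.ls).enc bsk ++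
      (blockGen D (tabList n D.R).length D.nt).enc bmain))) _ _ _
  refine wp_seq_right (paramsP_spec ho hε hn hlx hly hk hl hn1 hKN hP.small ?_)
  intro s1 τ1 f1 t1 hD1
  have am1 : ∀ A, s1.a A = s.a A := fun A => f1.a A (by
    simp [paramsP, lenLoop, logLoop, ceilLoop, powTwoLoop, forS, Stmt.amods])
  have vm1 : ∀ x, x ∈ [r_cnt, r_vcnt, r_ans, r_ai, r_aj] → s1.v x = 0 := fun x hx => by
    rw [f1.v x, hz x]
    · simp at hx; omega
    · simp [paramsP, lenLoop, logLoop, ceilLoop, powTwoLoop, forS, Stmt.mods]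
      simp at hx; omega
  have c7 := capn a_mark (by omega) (by omega)
  have c8 := capn a_pr (by omega) (by omega)
  refine wp_seq_right (tables_spec (n := n) (R := D.R) hD1.n hD1.R (by omega) uR (by omega) (by omega) hn1
    (fun i => by rw [am1, hza _ (by omega)]) ?_)
  intro s2 τ2 f2 t2 hT2
  have hD2 := hD1.fr f2 (by decide)
  refine wp_seq_tr ?_
  rw [Gen.rep_enc _ hlen]
  have hpm : ∀ x, x ∉ [r_p, r_t, r_x, r_f, r_d] → x ∉ (primeSearch c.K1).mods := by
    intro x hx
    simp [primeSearch, trialDiv, forS, Stmt.mods]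
    simp at hx; tauto
  have hpa : (primeSearch c.K1).amods = [] := by
    simp [primeSearch, trialDiv, forS, Stmt.amods]
  refine primeSearch_spec (n := n) (B := D.B) tries htry hD2.n hD2.B (by rw [hD2.tr, hlen]) uB (by omega) hK1 hn1 ?_
  intro s3 τ3 f3 t3 hp3
  have hD3 := hD2.fr f3 (fun x hx => hpm x (by revert x; decide))
  have hT3 := hT2.fr f3 (hpm _ (by decide)) (by rw [hpa]; simp)
  have c1 := capn a_w (by omega) (by omega)
  refine wp_seq_right (lettersP_spec (lw := D.lw) hD3.lw hp3 hp0 hpU.le (by omega) hP.cap0 (by omega) ?_)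
  intro s4 τ4 f4 t4 hw4
  have hin3 : s3.a a_in = inp := by
    rw [f3.a _ (by rw [hpa]; simp), f2.a _ (by decide), am1, hinp]
  have hE4 : Env D (tabList D.n D.R) p (s4.a a_w) inp s4 :=
    ⟨hD3.fr f4 (by decide), hT3.fr f4 (by decide) (by decide), by rw [f4.v _ (by decide)]; exact hp3, rfl,
      by rw [f4.a _ (by decide), hin3]⟩
  rw [hin3] at hw4
  refine wp_seq_tr (wp_rand (by simp) (by simp [hE4.par.lim]) ulim.le (Gen.unif_mem.1 x2) ?_)
  have hf5 : Fr [r_r] [] s4 (s4.set r_r r) := Fr.rfl'.set (by simp)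
  have hE5 := hE4.fr hf5 (by decide) (by decide)
  have hr5 : (s4.set r_r r).v r_r = r := by simp
  have hsk5 : ∀ i, (s4.set r_r r).a a_sk i = 0 := fun i => by
    rw [State.set_a, f4.a _ (by decide), f3.a _ (by rw [hpa]; simp), f2.a _ (by decide), am1,
      hza _ (by omega)]
  have hv5 : ∀ x, x ∈ [r_cnt, r_vcnt, r_ans, r_ai, r_aj] → (s4.set r_r r).v x = 0 := by
    intro x hx
    rw [hf5.v x (by revert x; decide), f4.v x (by revert x; decide),
      f3.v x (hpm x (by revert x; decide)), f2.v x (by revert x; decide), vm1 x hx]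
  generalize s4.set r_r r = s5 at hE5 hr5 hsk5 hv5
  set w := s4.a a_w
  have hwp : ∀ x < D.lw, w x < p := fun x hx => by rw [hw4 x hx]; exact Nat.mod_lt _ hp0
  have hwt : trunc D.lw w = trunc D.lw (fun i => inp i % p) := by
    funext i
    simp only [trunc]
    split_ifs with h
    · exact hw4 i h
    · rfl
  have hskm : ∀ x, x ∉ [r_t, r_i, r_mm, r_e1, r_P, r_c, r_z, r_y, r_un, r_pw, r_u, r_x, r_e2] →
      x ∉ (sketchP c.g).mods := by
    intro x hx
    simp [sketchP, resetF, stepCls, drawCls, addClass, powLoop, gLoop, fLoop, forS, Stmt.mods]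
    simp at hx; tauto
  have hska : ∀ x, x ∉ [a_f, a_g, a_sk] → x ∉ (sketchP c.g).amods := by
    intro x hx
    simp [sketchP, resetF, stepCls, drawCls, addClass, powLoop, gLoop, fLoop, forS, Stmt.amods]
    simp at hx; tauto
  refine wp_seq_tr (sketchP_spec hS hE5 hwp hsk5 hP.g_pos hP.g_pow x3 ?_)
  intro s6 τ6 f6 t6 hsk6
  have hE6 := hE5.fr f6 (fun x hx => hskm x (by revert x; decide))
    (fun x hx => hska x (by revert x; decide))
  have hskU : ∀ i < D.lw + 1 - D.l, s6.a a_sk i < K.U := by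
    intro i hi
    rw [hsk6 i hi]
    refine (skVal_lt hP.g_pos _ _ _ _).trans_le ?_
    rw [(Gen.rep_mem x3).1]
    exact hP.g_pow
  have hE6' : Srch K D r inp (s6.a a_sk) s6 :=
    ⟨hE6.par, by rw [f6.v _ (hskm _ (by decide)), hr5], hE6.inp, hskU, rfl⟩
  have hv6 : ∀ x, x ∈ [r_cnt, r_vcnt, r_ans, r_ai, r_aj] → s6.v x = 0 := by
    intro x hx
    rw [f6.v x (hskm x (by revert x; decide)), hv5 x hx]
  have hst6 : CSt.In ⟨0, 0, 0, 0, 0⟩ s6 :=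
    ⟨hv6 _ (by decide), hv6 _ (by decide), hv6 _ (by decide), hv6 _ (by decide), hv6 _ (by decide)⟩
  have hok : CSt.Ok D.lim D.lim2 r ⟨0, 0, 0, 0, 0⟩ := ⟨by simp, by simp, by simp⟩
  refine wp_seq_left (mainP_spec ho hS hE6 hE6' hwp hP.lr hst6 hok x4 ?_)
  intro s7 τ7 st7 h7 hst7 t7
  have hall : allCands p D (tabList D.n D.R) w bmain D.nt =
      allCands p D (tabList D.n D.R) (fun i => inp i % p) bmain D.nt := by
    have : ∀ cs, winF p D (tabList D.n D.R) w cs = winF p D (tabList D.n D.R)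
        (fun i => inp i % p) cs := by
      intro cs; funext i; rw [winF, hwt, winF]
    simp only [allCands, this]
  have hout : st7 = outcome c K.ε D inp (tries, r, bsk, bmain) := by
    rw [h7, hall]
    simp only [outcome]
    refine foldl_proc_congr fun x hx => ?_
    obtain ⟨m1, m2⟩ := mem_allCands hx
    have e5 := hP.l_ly
    simp only [passP]
    rw [hsk6 _ (by omega), hsk6 _ (by omega), hwt, dn, hp]
  have hok7 : st7.Ok D.lim D.lim2 r := by rw [h7]; exact foldl_proc_ok hok _
  have hW : st7.W D ≤ D.lim * (6 * D.ls + 30) + (D.lim2 + 1) * (4 * D.l + 20) :=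
    Nat.add_le_add (Nat.mul_le_mul_right _ hok7.cnt) (Nat.mul_le_mul_right _ hok7.vcnt)
  have hle7 : D.lim2 + 2 < K.U := hP.lim2
  have hW0 : (⟨0, 0, 0, 0, 0⟩ : CSt).W D = 0 := by simp [CSt.W]
  rw [hW0] at t7
  rw [hlen] at t3
  -- the answer is bounded
  have hbd : ∀ (L : List (ℕ × ℕ)) (st : CSt) (lim lim2 r : ℕ) (pass valid : ℕ × ℕ → Prop),
      (∀ x ∈ L, x.1 < K.U ∧ x.2 < K.U) → st.ans < K.U ∧ st.ai < K.U ∧ st.aj < K.U →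
      (L.foldl (proc lim lim2 r pass valid) st).ans < K.U ∧
      (L.foldl (proc lim lim2 r pass valid) st).ai < K.U ∧
      (L.foldl (proc lim lim2 r pass valid) st).aj < K.U := by
    intro L
    induction L with
    | nil => intro st lim lim2 r pass valid _ h; exact h
    | cons y L ih =>
      intro st lim lim2 r pass valid hL h
      refine ih _ _ _ _ _ _ (fun x hx => hL x (by simp [hx])) ?_
      have := hL y (by simp)
      simp only [proc]
      split_ifs
      exacts [h, ⟨by dsimp; omega, this⟩, h, h]
  have hb7 := hbd (allCands p D (tabList D.n D.R) w bmain D.nt) ⟨0, 0, 0, 0, 0⟩ D.lim D.lim2 r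
    (passP c D (s6.a a_sk)) (validP K.ε D inp) (fun x hx => by
      obtain ⟨m1, m2⟩ := mem_allCands hx
      omega) (by dsimp; omega)
  rw [← h7] at hb7
  rw [wp_seq, wp_assign]
  refine ⟨by simp, by simp [hst7.ans, hb7.1], ?_⟩
  rw [wp_seq, wp_assign]
  refine ⟨by simp, by simp [hst7.ai, hb7.2.1], ?_⟩
  rw [wp_assign]
  refine ⟨by simp, by simp [hst7.aj, hb7.2.2], ?_, ?_⟩
  · rw [timeB, dn]; rw [dn] at t7; omega
  · rw [← hout]
    simp [hst7.ans, hst7.ai, hst7.aj]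

end

/-! ### Well-formedness, trivial instances and the machine program. -/

/-- The constants of the program are less than `U`. -/
structure CstLt (c : Cst) (U : ℕ) : Prop where
  two : 2 < U
  C0 : c.C0 < U
  g0 : c.g0 < U
  KN : c.KN < U
  C1 : c.C1 < U
  K1 : c.K1 < U
  KL : c.KL < U
  K2 : c.K2 < U
  KS : c.KS < U
  KT : c.KT < U
  th : c.th < U
  g : c.g < U
  eps : ∀ p q, c.eps = some (p, q) → p < U ∧ q < U

theorem Ex.wf_var (x V N U : ℕ) : (𝗏 x).Wf V N U ↔ x < V := .rfl
theorem Ex.wf_const (x V N U : ℕ) : (𝖼 x).Wf V N U ↔ x < U := .rfl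
theorem Ex.wf_get (A V N U : ℕ) (e : Ex) : (Ex.get A e).Wf V N U ↔ A ≤ N ∧ e.Wf V N U := .rfl
theorem Ex.deg_var (x : ℕ) : (𝗏 x).deg = 1 := rfl
theorem Ex.deg_const (x : ℕ) : (𝖼 x).deg = 1 := rfl
theorem Ex.deg_get (A : ℕ) (e : Ex) : (Ex.get A e).deg = max 1 e.deg := rfl

theorem Cond.wf_lt (V N U D : ℕ) (a b : Ex) :
    (Cond.lt a b).Wf V N U D ↔ a.Wf V N U ∧ b.Wf V N U ∧ a.deg ≤ D ∧ b.deg ≤ D := .rfl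
theorem Cond.wf_eq (V N U D : ℕ) (a b : Ex) :
    (Cond.eq a b).Wf V N U D ↔ a.Wf V N U ∧ b.Wf V N U ∧ a.deg ≤ D ∧ b.deg ≤ D := .rfl
theorem Cond.epsFree_lt (a b : Ex) : (Cond.lt a b).EpsFree ↔ True := .rfl
theorem Cond.epsFree_eq (a b : Ex) : (Cond.eq a b).EpsFree ↔ True := .rfl

theorem Cond.leE_wf {o : Option (ℕ × ℕ)} {V N U : ℕ} {a b : Ex} (h1 : 1 < U)
    (ho : ∀ p q, o = some (p, q) → p < U ∧ q < U) (ha : a.Wf V N U) (hb : b.Wf V N U) (hda : a.deg ≤ 1)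
    (hdb : b.deg ≤ 1) : (Cond.leE o a b).Wf V N U 8 := by
  rcases o with - | ⟨p, q⟩
  · exact ⟨ha, hb, hda.trans (by omega), hdb.trans (by omega)⟩
  · obtain ⟨hp, hq⟩ := ho p q rfl
    refine ⟨⟨hq, ha⟩, ⟨⟨hp, hb⟩, h1⟩, ?_, ?_⟩
    · show (𝖼 q * a).deg ≤ 8
      rw [Ex.deg_mul, Ex.deg_const]; omega
    · show (𝖼 p * b + 𝖼 1).deg ≤ 8
      rw [Ex.deg_add, Ex.deg_mul, Ex.deg_const, Ex.deg_const]; omega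

theorem ceilLoop_wf {o : Option (ℕ × ℕ)} {U x y : ℕ} (h1 : 1 < U) (hx : x < 64) (hy : y < 64)
    (ho : ∀ p q, o = some (p, q) → p < U ∧ q < U) : (ceilLoop o x y).Wf 64 12 U 8 := by
  have := Cond.leE_wf (o := o) (V := 64) (N := 12) (a := 𝗏 x - 𝗏 y) (b := 𝗏 y) h1 ho ⟨hx, hy⟩ hy
    (by simp [Ex.deg_sub, Ex.deg_var]) (by simp [Ex.deg_var])
  simp [ceilLoop, Stmt.Wf, Cond.wf_lt, Cond.wf_eq, Ex.wf_var, Ex.wf_const, Ex.wf_add,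
    Ex.deg_var, Ex.deg_const, Ex.deg_add, hy, this]
  omega

theorem verifyP_wf {o : Option (ℕ × ℕ)} {U : ℕ} (h1 : 1 < U) (ho : ∀ p q, o = some (p, q) → p < U ∧ q < U) :
    (verifyP o).Wf 64 12 U 8 := by
  have := Cond.leE_wf (o := o) (V := 64) (N := 12) (a := 𝗏 r_d - 𝗏 r_k) (b := 𝗏 r_k) h1 ho
    (by simp [Ex.wf_sub, Ex.wf_var]) (by simp [Ex.wf_var])
    (by simp [Ex.deg_sub, Ex.deg_var]) (by simp [Ex.deg_var])
  simp [verifyP, misLoop, forS, Stmt.Wf, Cond.wf_lt, Cond.wf_eq, Ex.wf_var, Ex.wf_const,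
    Ex.wf_add, Ex.wf_get, Ex.deg_var, Ex.deg_const, Ex.deg_add, Ex.deg_get, this]
  omega

theorem progP_wf {c : Cst} {U : ℕ} (h : CstLt c U) : (progP c).Wf 64 12 U 8 := by
  obtain ⟨h2, a1, a2, a3, a4, a5, a6, a7, a8, a9, a10, a11, a12⟩ := h
  have b1 := ceilLoop_wf (x := r_h) (y := r_b) (by omega) (by omega) (by omega) a12
  have b2 := ceilLoop_wf (x := r_lam) (y := r_b2) (by omega) (by omega) (by omega) a12
  have b3 := verifyP_wf (U := U) (by omega) a12
  have h0 : 0 < U := by omega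
  have h1 : 1 < U := by omega
  simp only [progP, paramsP, lenLoop, logLoop, powTwoLoop, tables, sieve, markLoop, primeSearch,
    trialDiv, lettersP, sketchP, mainP, resetF, stepCls, mainStep, popCls, storeCls, drawCls, addClass,
    powLoop, gLoop, fLoop, checkP, bucketP, chainLoop, candBody, digitLoop, decideP, forS, Stmt.Wf,
    Cond.wf_lt, Cond.wf_eq, Ex.wf_var, Ex.wf_const, Ex.wf_add, Ex.wf_sub, Ex.wf_mul,
    Ex.wf_div, Ex.wf_mod, Ex.wf_get, Ex.deg_var, Ex.deg_const, Ex.deg_add, Ex.deg_sub, Ex.deg_mul,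
    Ex.deg_div, Ex.deg_mod, Ex.deg_get, b1, b2, b3, h0, h1, h2, a1, a2, a3, a4, a5, a6, a7, a8, a9, a10, a11]
  simp

theorem leE_epsFree {o : Option (ℕ × ℕ)} (ho : o ≠ none) (a b : Ex) : (Cond.leE o a b).EpsFree := by
  rcases o with - | ⟨p, q⟩
  · exact absurd rfl ho
  · trivial

theorem progP_epsFree {c : Cst} (h : c.eps ≠ none) : (progP c).EpsFree := by
  simp only [progP, paramsP, lenLoop, logLoop, powTwoLoop, tables, sieve, markLoop, primeSearch,
    trialDiv, lettersP, sketchP, mainP, resetF, stepCls, mainStep, popCls, storeCls, drawCls, addClass,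
    powLoop, gLoop, fLoop, checkP, bucketP, chainLoop, candBody, digitLoop, decideP, forS, ceilLoop,
    verifyP, misLoop, Stmt.EpsFree, leE_epsFree h, Cond.epsFree_lt, Cond.epsFree_eq, and_self]

/-- The machine program. -/
def fullP (c : Cst) : Prog :=
  .ite (.lt 1 4) (.const 0 0) (.ite (.lt 2 4) (.const 0 0) (.ite (.lt 3 4)
    (.seq (.const 65 2) (.seq (.op .mul 64 0 65) ((progP c).comp 64 12)))
    (.seq (.const 0 1) (.seq (.const 1 0) (.const 2 0)))))

theorem fullP_epsFree {c : Cst} (h : c.eps ≠ none) : (fullP c).EpsFree := by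
  simp [fullP, Prog.EpsFree, Test.EpsFree, Stmt.comp_epsFree _ _ (progP_epsFree h)]

/-- The letters of the input, as a function. -/
def inpF (X Y : List ℕ) (i : ℕ) : ℕ := (X ++ Y).getD i 0

theorem mismatches_le (S T : List ℕ) : mismatches S T ≤ S.length := by
  rw [mismatches]
  refine List.countP_le_length.trans ?_
  simp

theorem lcs_le {t : ℝ} (ht : 0 ≤ t) (X Y : List ℕ) : lcs t X Y ≤ min X.length Y.length := by
  refine csSup_le ⟨0, [], [], by simp, by simp, rfl, rfl, by simpa [mismatches] using ht⟩ ?_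
  rintro m ⟨S, T, hS, hT, h1, h2, -⟩
  exact le_min (h1 ▸ hS.length_le) (h2 ▸ hT.length_le)

/-- Instances without long enough substrings. -/
theorem correct_no {ε : ℝ} (hε : 0 < ε) {X Y : List ℕ} {k l i j : ℕ} (h : X.length < l ∨ Y.length < l) :
    Correct ε X Y k l 0 i j := by
  refine ⟨.inl rfl, fun h1 => ?_, fun _ => rfl, fun h => absurd h (by simp)⟩
  have := lcs_le (t := k) (by positivity) X Y
  omega

/-- Instances with many allowed mismatches. -/
theorem correct_yes {ε : ℝ} (hε : 0 < ε) {X Y : List ℕ} {k l : ℕ} (h1 : l ≤ X.length) (h2 : l ≤ Y.length)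
    (h : l ≤ k) : Correct ε X Y k l 1 0 0 := by
  have hd : (mismatches (substr X 0 l) (substr Y 0 l) : ℝ) ≤ (1 + ε) * k := by
    have h3 : mismatches (substr X 0 l) (substr Y 0 l) ≤ k := by
      refine (mismatches_le _ _).trans ?_
      simp [substr]; omega
    have h4 : (mismatches (substr X 0 l) (substr Y 0 l) : ℝ) ≤ k := by exact_mod_cast h3
    nlinarith [mul_nonneg hε.le (Nat.cast_nonneg (α := ℝ) k)]
  refine ⟨.inr rfl, fun _ => rfl, fun h3 => ?_, fun _ => ⟨by omega, by omega, hd⟩⟩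
  exfalso
  have hmem : l ∈ {m : ℕ | ∃ S T : List ℕ, S <:+: X ∧ T <:+: Y ∧ S.length = m ∧ T.length = m ∧
      (mismatches S T : ℝ) ≤ (1 + ε) * k} := by
    refine ⟨substr X 0 l, substr Y 0 l, ?_, ?_, ?_, ?_, hd⟩
    · simpa [substr] using (List.take_prefix l X).isInfix
    · simpa [substr] using (List.take_prefix l Y).isInfix
    · simp [substr, h1]
    · simp [substr, h2]
  have hb : BddAbove {m : ℕ | ∃ S T : List ℕ, S <:+: X ∧ T <:+: Y ∧ S.length = m ∧ T.length = m ∧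
      (mismatches S T : ℝ) ≤ (1 + ε) * k} := by
    refine ⟨X.length, ?_⟩
    rintro m ⟨S, T, hS, -, h1, -, -⟩
    exact h1 ▸ hS.length_le
  have := le_csSup hb hmem
  rw [lcs] at h3
  omega

/-- A deterministic run is treated as a random one with an empty list of draws. -/
theorem solves_const {ε δ : ℝ} (hδ : 0 < δ) {w S T : ℕ} {P : Prog} {n : ℕ} {X Y : List ℕ} {k l : ℕ}
    (f : Config) {t : ℕ} (ht : t ≤ T) (hr : Reach ε w S (init P n X Y k l) [] f t) (hf : f.todo = [])
    (hc : Correct ε X Y k l (f.reg 0) (f.reg 1) (f.reg 2)) : Solves ε δ w S T P n X Y k l := by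
  have hpos : ((Gen.unif 1).rep 0).Pos := Gen.rep_pos (Gen.unif_pos one_pos) 0
  refine solves_of_gen ((Gen.unif 1).rep 0) hpos (fun _ => f) (fun a ha => ⟨t, ht, ?_, hf⟩)
    (fun _ => 0) (fun _ _ => le_rfl) (fun a _ h => absurd hc h) ?_
  · rw [Gen.rep_enc _ (Gen.rep_mem ha).1, List.length_eq_zero_iff.1 (Gen.rep_mem ha).1]
    exact hr
  · rw [Gen.E_const _ hpos]; exact hδ.le

theorem fullP_easy {c : Cst} {ε δ : ℝ} (hε : 0 < ε) (hδ : 0 < δ) {w S T : ℕ} (hw : 1 ≤ w) (hT : 20 ≤ T)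
    {n : ℕ} {X Y : List ℕ} {k l : ℕ} (h : X.length < l ∨ Y.length < l ∨ l ≤ k) :
    Solves ε δ w S T (fullP c) n X Y k l := by
  have h2 : 2 ≤ 2 ^ w := by
    calc 2 = 2 ^ 1 := rfl
      _ ≤ 2 ^ w := Nat.pow_le_pow_right (by omega) hw
  by_cases h1 : X.length < l
  · refine solves_const hδ ⟨[], _, _⟩ (t := 1 + 1) (by omega) (Reach.ite_true ?_ (reach_const ?_)) rfl ?_
    · exact h1
    · omega
    · simpa using correct_no hε (.inl h1)
  by_cases h3 : Y.length < l
  · refine solves_const hδ ⟨[], _, _⟩ (t := 1 + 1 + 1) (by omega)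
      (Reach.ite_false ?_ (Reach.ite_true ?_ (reach_const ?_))) rfl ?_
    · exact h1
    · exact h3
    · omega
    · simpa using correct_no hε (.inr h3)
  · have h4 : l ≤ k := by omega
    refine solves_const hδ ⟨[], _, _⟩ (t := _) ?_ (Reach.ite_false h1 (Reach.ite_false h3
      (Reach.ite_false (by simpa [Test.Holds, init] using h4)
        (Reach.seq ((reach_const (by omega)).trans (Reach.seq ((reach_const (by omega)).trans
          (reach_const (by omega))))))))) rfl ?_
    · omega
    · simpa using correct_yes hε (by omega) (by omega) h4

/-- The bridge from the machine to probabilities of outcomes. The prologue puts the base address `2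
n`, behind the input, into register `64`, just above the variables; work arrays are initially zero
because the memory is. -/
theorem fullP_solves {c : Cst} {ε δ : ℝ} (hε : 0 < ε) {K : Ctx} (hKε : K.ε = ε) {w S T : ℕ} {n : ℕ}
    {X Y : List ℕ} {k l : ℕ} (hX : X.length ≤ n) (hY : Y.length ≤ n) (hlX : l ≤ X.length)
    (hlY : l ≤ Y.length) (hkl : k < l) {D : Par} (hD : D = par c ε n X.length Y.length k l)
    (ho : EpsOk c.eps ε) (hc : CstLt c K.U) (hKN : 1 ≤ c.KN) (hK1 : 1 ≤ c.K1) (hP : Pre K D c.g)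
    (hF : Fits K 64 12 8 (2 * n) w S) (hcap : K.cap 0 = 2 * n) (hin : ∀ x ∈ X ++ Y, x < K.U)
    (hpos : (rndGen D (tabList n D.R).length).Pos) (hT : (progP c).cost * timeB D + 20 ≤ T) (fail : Rnd → ℝ)
    (h0 : ∀ a, 0 ≤ fail a)
    (h1 : ∀ a, (rndGen D (tabList n D.R).length).Mem a →
      ¬ Correct ε X Y k l (outcome c ε D (inpF X Y) a).ans (outcome c ε D (inpF X Y) a).ai
      (outcome c ε D (inpF X Y) a).aj → 1 ≤ fail a)
    (hE : (rndGen D (tabList n D.R).length).E fail ≤ δ) : Solves ε δ w S T (fullP c) n X Y k l := by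
  subst hKε
  subst hD
  set D := par c K.ε n X.length Y.length k l with hD
  have un : n * n + 2 * n + 3 < K.U := hP.small.n
  have hUw : K.U ≤ 2 ^ w := by
    calc K.U = K.U ^ 1 := (pow_one _).symm
      _ ≤ K.U ^ 8 := Nat.pow_le_pow_right (by omega) (by omega)
      _ ≤ 2 ^ w := hF.word
  have key : ∀ a, (rndGen D (tabList n D.R).length).Mem a → ∃ f : Config, ∃ t ≤ T,
      Reach K.ε w S (init (fullP c) n X Y k l) ((rndGen D (tabList n D.R).length).enc a) f t ∧
      f.todo = [] ∧ f.reg 0 = (outcome c K.ε D (inpF X Y) a).ans ∧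
      f.reg 1 = (outcome c K.ε D (inpF X Y) a).ai ∧ f.reg 2 = (outcome c K.ε D (inpF X Y) a).aj := by
    intro a ha
    set s : State := ⟨fun x => [n, X.length, Y.length, k, l].getD x 0,
      fun A i => if A = 0 then inpF X Y i else 0⟩ with hs
    have hz : ∀ x, 5 ≤ x → s.v x = 0 := by
      intro x hx
      show [n, X.length, Y.length, k, l].getD x 0 = 0
      rw [List.getD_eq_default]
      simpa using hx
    obtain ⟨s', t, hev, ht, q0, q1, q2⟩ := progP_spec (c := c) (K := K) (s := s) (n := n)
      (lx := X.length) (ly := Y.length) (k := k) (l := l) (inp := inpF X Y) (x := a) ho hε rfl rfl rfl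
      rfl rfl hz (fun A hA i => by simp [hs]; omega) (by funext i; simp [hs]) hKN hK1 hP ha
    have hinp : ∀ i, inpF X Y i < K.U := by
      intro i
      rw [inpF]
      rcases Nat.lt_or_ge i (X ++ Y).length with h | h
      · rw [List.getD_eq_getElem _ _ h]; exact hin _ (List.getElem_mem h)
      · rw [List.getD_eq_default _ _ h]; omega
    have hlt : s.Lt K.U := by
      refine ⟨fun x => ?_, fun A i => ?_⟩
      · rcases Nat.lt_or_ge x 5 with h | h
        · simp only [hs]
          interval_cases x <;> simp <;> omega
        · rw [hz x h]; omega
      · simp only [hs]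
        split_ifs
        · exact hinp i
        · omega
    set reg0 : ℕ → ℕ := Function.update (Function.update
      (fun r => [n, X.length, Y.length, k, l].getD r 0) 65 2) 64 (n * 2) with hreg0
    have hrep : Rep K 64 12 (2 * n) s reg0 (fun a => (X ++ Y).getD a 0) := by
      refine ⟨fun x hx => ?_, ?_, fun A hA i hi => ?_⟩
      · rw [hreg0, Function.update_of_ne (by omega), Function.update_of_ne (by omega)]
      · rw [hreg0, Function.update_self, mul_comm]
      · rcases A with - | A
        · simp [addr, hs, inpF]
        · simp only [addr, hs, if_neg (Nat.succ_ne_zero A)]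
          rw [List.getD_eq_default]
          simp; omega
    obtain ⟨reg', mem', m, hreach, hm, hrep'⟩ := Stmt.reach hF hev hlt (progP_wf hc) _ le_rfl reg0
      (fun a => (X ++ Y).getD a 0) hrep []
    have h2 : 2 < 2 ^ w := by omega
    have h2n : n * 2 < 2 ^ w := by omega
    have hr : Reach K.ε w S (init (fullP c) n X Y k l) ([] ++ ([] ++
        (rndGen D (tabList n D.R).length).enc a)) ⟨[], reg', mem'⟩ _ :=
      Reach.ite_false (u := .lt 1 4) (by simpa [Test.Holds] using hlX)
      (Reach.ite_false (u := .lt 2 4) (by simpa [Test.Holds] using hlY)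
      (Reach.ite_true (u := .lt 3 4) (by simpa [Test.Holds] using hkl)
      (Reach.seq ((reach_const h2).trans (Reach.seq ((reach_op (by simpa [Op.val] using h2n)).trans
        (by simpa [Op.val, hreg0] using hreach)))))))
    refine ⟨⟨[], reg', mem'⟩, _, ?_, hr, rfl, ?_, ?_, ?_⟩
    · have : (progP c).cost * t ≤ (progP c).cost * timeB D := Nat.mul_le_mul_left _ (by simpa using ht)
      omega
    · show reg' 0 = _
      rw [hrep'.v 0 (by omega), q0]
    · show reg' 1 = _
      rw [hrep'.v 1 (by omega), q1]
    · show reg' 2 = _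
      rw [hrep'.v 2 (by omega), q2]
  haveI : Nonempty Config := ⟨init (fullP c) n X Y k l⟩
  choose! f hf using key
  refine solves_of_gen _ hpos f (fun a ha => ?_) fail (fun a _ => h0 a) (fun a ha h => ?_) hE
  · obtain ⟨t, ht, hr, htodo, -⟩ := hf a ha
    exact ⟨t, ht, hr, htodo⟩
  · obtain ⟨t, ht, hr, htodo, e0, e1, e2⟩ := hf a ha
    rw [e0, e1, e2] at h
    exact h1 a ha h

/-! ### Mismatch counts, `lcs`, and correctness of outcomes. -/

theorem mem_range_filter_length {l : ℕ} {q : ℕ → Prop} [DecidablePred q] :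
    ((List.range l).filter fun u => q u).length = ((Finset.range l).filter q).card := by
  induction l with
  | zero => simp
  | succ l ih =>
    rw [List.range_succ, List.filter_append, List.length_append, ih, Finset.range_add_one,
      Finset.filter_insert]
    by_cases h : q l
    · rw [if_pos h, Finset.card_insert_of_notMem (by simp)]; simp [h]
    · rw [if_neg h]; simp [h]

theorem mis_eq_card (inp : ℕ → ℕ) (l i j : ℕ) :
    mis inp l i j = ((Finset.range l).filter fun u => inp (i + u) ≠ inp (j + u)).card := by
  rw [mis]
  exact mem_range_filter_length

theorem mis_mono (inp : ℕ → ℕ) {l m : ℕ} (h : l ≤ m) (i j : ℕ) : mis inp l i j ≤ mis inp m i j := by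
  rw [mis_eq_card, mis_eq_card]
  exact Finset.card_le_card (Finset.filter_subset_filter _ (Finset.range_mono h))

theorem substr_eq_map {X : List ℕ} {i l : ℕ} (h : i + l ≤ X.length) :
    substr X i l = (List.range l).map fun u => X.getD (i + u) 0 := by
  refine List.ext_getElem (by simp [substr]; omega) fun u h1 h2 => ?_
  simp at h2
  simp [substr, h2]
  rw [List.getElem?_eq_getElem (by omega)]
  rfl

theorem mismatches_substr {X Y : List ℕ} {i j l : ℕ} (hi : i + l ≤ X.length) (hj : j + l ≤ Y.length) :
    mismatches (substr X i l) (substr Y j l) = mis (inpF X Y) l i (X.length + j) := by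
  rw [mismatches, substr_eq_map hi, substr_eq_map hj, List.zip_map', List.countP_map,
    List.countP_eq_length_filter, mis]
  congr 1
  refine List.filter_congr fun u hu => ?_
  have hu : u < l := List.mem_range.1 hu
  have h1 : inpF X Y (i + u) = X.getD (i + u) 0 := by
    rw [inpF, List.getD_append _ _ _ _ (by omega)]
  have h2 : inpF X Y (X.length + j + u) = Y.getD (j + u) 0 := by
    rw [inpF, List.getD_append_right _ _ _ _ (by omega)]
    congr 1; omega
  simp only [Function.comp, h1, h2]

/-- The supremum is attained, and shortening two windows does not increase the number of mismatches;
hence every length up to the maximum is attained as well. -/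
theorem le_lcs_iff {t : ℝ} (ht : 0 ≤ t) {X Y : List ℕ} {l : ℕ} :
    l ≤ lcs t X Y ↔ ∃ i j, i + l ≤ X.length ∧ j + l ≤ Y.length ∧
      (mis (inpF X Y) l i (X.length + j) : ℝ) ≤ t := by
  set A := {m : ℕ | ∃ S T : List ℕ, S <:+: X ∧ T <:+: Y ∧ S.length = m ∧ T.length = m ∧
    (mismatches S T : ℝ) ≤ t} with hA
  have hb : BddAbove A := by
    refine ⟨X.length, ?_⟩
    rintro m ⟨S, T, hS, -, h1, -, -⟩
    exact h1 ▸ hS.length_le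
  constructor
  · intro h
    have hne : A.Nonempty := ⟨0, [], [], by simp, by simp, rfl, rfl, by simpa [mismatches] using ht⟩
    obtain ⟨S, T, ⟨a, b, hS⟩, ⟨a', b', hT⟩, h1, h2, h3⟩ := Nat.sSup_mem hne hb
    change _ = lcs t X Y at h1 h2
    set m := lcs t X Y
    have hX : a.length + m ≤ X.length := by rw [← hS]; simp [h1]
    have hY : a'.length + m ≤ Y.length := by rw [← hT]; simp [h2]
    have e1 : substr X a.length m = S := by rw [substr, ← hS]; simp [← h1]
    have e2 : substr Y a'.length m = T := by rw [substr, ← hT]; simp [← h2]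
    refine ⟨a.length, a'.length, by omega, by omega, ?_⟩
    rw [← e1, ← e2, mismatches_substr hX hY] at h3
    refine le_trans ?_ h3
    exact_mod_cast mis_mono _ h _ _
  · rintro ⟨i, j, hi, hj, h⟩
    rw [← mismatches_substr hi hj] at h
    refine le_csSup hb ⟨substr X i l, substr Y j l, ?_, ?_, ?_, ?_, h⟩
    · exact ((List.take_prefix _ _).isInfix).trans (List.drop_suffix _ _).isInfix
    · exact ((List.take_prefix _ _).isInfix).trans (List.drop_suffix _ _).isInfix
    · simp [substr]; omega
    · simp [substr]; omega

/-- This lets the program test `d ≤ (1 + ε) k` although only comparisons with `ε` times a word are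
available. Truncated subtraction is right for `d ≤ k`, where both sides hold. -/
theorem sub_le_mul_iff {ε : ℝ} (hε : 0 < ε) {d k : ℕ} :
    ((d - k : ℕ) : ℝ) ≤ ε * k ↔ (d : ℝ) ≤ (1 + ε) * k := by
  rcases le_total k d with h | h
  · rw [Nat.cast_sub h]
    constructor <;> intro h <;> linarith
  · rw [Nat.sub_eq_zero_of_le h]
    have h1 : (d : ℝ) ≤ k := by exact_mod_cast h
    have h2 : 0 ≤ ε * k := by positivity
    constructor
    · intro _; linarith
    · intro _; simpa using h2

/-- Candidates whose sketches are similar, but that are not witnesses. -/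
def badPass (pass valid : ℕ × ℕ → Prop) (x : ℕ × ℕ) : Prop := pass x ∧ ¬ valid x

theorem foldl_proc_sound {lim lim2 r : ℕ} {pass valid : ℕ × ℕ → Prop} {L : List (ℕ × ℕ)} {st : CSt}
    (P : ℕ × ℕ → Prop) (hP : ∀ x ∈ L, P x)
    (h : st.ans = 0 ∨ (st.ans = 1 ∧ P (st.ai, st.aj) ∧ valid (st.ai, st.aj))) :
    (L.foldl (proc lim lim2 r pass valid) st).ans =
      0 ∨ ((L.foldl (proc lim lim2 r pass valid) st).ans = 1 ∧
      P ((L.foldl (proc lim lim2 r pass valid) st).ai, (L.foldl (proc lim lim2 r pass valid) st).aj) ∧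
      valid ((L.foldl (proc lim lim2 r pass valid) st).ai, (L.foldl (proc lim lim2 r pass valid) st).aj)) := by
  induction L generalizing st with
  | nil => exact h
  | cons x L ih =>
    refine ih (fun y hy => hP y (by simp [hy])) ?_
    simp only [proc]
    split_ifs with a1 a2 a3
    · exact h
    · exact .inr ⟨rfl, hP _ (by simp), a3⟩
    · exact h
    · exact h

-- Up to number `r` no candidate is verified out of turn and the limit is not reached, so without
-- success the counter is exact. As only failed verifications count, and these are of bad
-- candidates, the quota `lim2` is not exhausted, and every candidate that passes is really
-- verified.
open Classical in
theorem foldl_proc_prefix {lim lim2 r : ℕ} {pass valid : ℕ × ℕ → Prop} (L : List (ℕ × ℕ))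
    (hr : L.length ≤ r) (hr2 : r < lim) (hc : L.countP (fun x => decide (badPass pass valid x)) < lim2) :
    (L.foldl (proc lim lim2 r pass valid) ⟨0, 0, 0, 0, 0⟩).ans =
      1 ∨ ((L.foldl (proc lim lim2 r pass valid) ⟨0, 0, 0, 0, 0⟩).cnt = L.length ∧
      (L.foldl (proc lim lim2 r pass valid) ⟨0, 0, 0, 0, 0⟩).vcnt ≤
      L.countP (fun x => decide (badPass pass valid x)) ∧ ∀ x ∈ L, ¬ (pass x ∧ valid x)) := by
  induction L using List.reverseRecOn with
  | nil => simp
  | append_singleton L x ih =>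
    rw [List.length_append, List.length_singleton] at hr
    rw [List.countP_append, List.countP_singleton] at hc
    rw [List.foldl_append, List.foldl_cons, List.foldl_nil]
    specialize ih (by omega) (by omega)
    set st := L.foldl (proc lim lim2 r pass valid) ⟨0, 0, 0, 0, 0⟩
    rcases ih with ih | ⟨h1, h2, h3⟩
    · left
      rw [proc, if_pos (.inl ih)]; exact ih
    · by_cases hans : st.ans = 1
      · left
        rw [proc, if_pos (.inl hans)]; exact hans
      · rw [proc, if_neg (by omega)]
        by_cases hp : pass x
        · rw [if_pos (.inr ⟨hp, by omega⟩)]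
          by_cases hv : valid x
          · rw [if_pos hv]; exact .inl rfl
          · rw [if_neg hv]
            right
            have hb : badPass pass valid x := ⟨hp, hv⟩
            rw [List.countP_append, List.countP_singleton, if_pos (by simpa using hb)]
            refine ⟨by simp [h1], by simpa using h2, fun y hy => ?_⟩
            rcases List.mem_append.1 hy with hy | hy
            · exact h3 y hy
            · obtain rfl : y = x := by simpa using hy
              exact fun h => hv h.2
        · rw [if_neg (by rintro (h | h); exacts [by omega, hp h.1])]
          right
          rw [List.countP_append]
          refine ⟨by simp [h1], h2.trans (Nat.le_add_right _ _), fun y hy => ?_⟩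
          rcases List.mem_append.1 hy with hy | hy
          · exact h3 y hy
          · obtain rfl : y = x := by simpa using hy
            exact fun h => hp h.1

-- If candidate number `r` exists, it is reached with the exact counter, unless a witness was found
-- before, and its verification succeeds. Otherwise the list is shorter than `lim`, and the good
-- candidate in it is verified in the regular way.
open Classical in
theorem foldl_proc_complete {lim lim2 r : ℕ} {pass valid : ℕ × ℕ → Prop} {L : List (ℕ × ℕ)} (hr2 : r < lim)
    (hc : L.countP (fun x => decide (badPass pass valid x)) < lim2) (hL : ∀ x, L[r]? = some x → valid x)
    (hg : ∃ x ∈ L, pass x ∧ valid x) : (L.foldl (proc lim lim2 r pass valid) ⟨0, 0, 0, 0, 0⟩).ans = 1 := by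
  rcases Nat.lt_or_ge r L.length with h | h
  · have hv := hL _ (List.getElem?_eq_getElem h)
    have hsplit : L = L.take r ++ L[r] :: L.drop (r + 1) := by
      rw [List.getElem_cons_drop, List.take_append_drop]
    have hc1 : (L.take r).countP (fun x => decide (badPass pass valid x)) < lim2 :=
      lt_of_le_of_lt ((List.take_sublist r L).countP_le) hc
    have key := foldl_proc_prefix (lim := lim) (lim2 := lim2) (r := r) (pass := pass) (valid := valid)
      (L.take r) (by simp) hr2 hc1
    rw [hsplit, List.foldl_append, List.foldl_cons]
    set st := (L.take r).foldl (proc lim lim2 r pass valid) ⟨0, 0, 0, 0, 0⟩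
    have hx : (proc lim lim2 r pass valid st L[r]).ans = 1 := by
      by_cases hans : st.ans = 1
      · rw [proc, if_pos (.inl hans)]; exact hans
      · rcases key with key | ⟨h1, h2, -⟩
        · exact absurd key hans
        · rw [List.length_take, min_eq_left h.le] at h1
          rw [proc, if_neg (by omega), if_pos (.inl h1), if_pos hv]
    rw [foldl_proc_stop (.inl hx)]
    exact hx
  · rcases foldl_proc_prefix (lim := lim) (lim2 := lim2) (r := r) (pass := pass) (valid := valid)
      L h hr2 hc with h1 | ⟨-, -, h1⟩
    · exact h1
    · obtain ⟨x, hx, hpv⟩ := hg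
      exact absurd hpv (h1 x hx)

/-- The error is one-sided: an answer YES comes from an exact count of mismatches. So only the case
of a pair with at most `k` mismatches needs a probabilistic argument. -/
theorem outcome_sound {c : Cst} {ε : ℝ} (hε : 0 < ε) {X Y : List ℕ} {k l n : ℕ} (x : Rnd)
    (hlX : l ≤ X.length) (hlY : l ≤ Y.length)
    (h : (∃ i j, i + l ≤ X.length ∧ j + l ≤ Y.length ∧ mis (inpF X Y) l i (X.length + j) ≤ k) →
      (outcome c ε (par c ε n X.length Y.length k l) (inpF X Y) x).ans = 1) :
    Correct ε X Y k l (outcome c ε (par c ε n X.length Y.length k l) (inpF X Y) x).ans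
      (outcome c ε (par c ε n X.length Y.length k l) (inpF X Y) x).ai
      (outcome c ε (par c ε n X.length Y.length k l) (inpF X Y) x).aj := by
  set D := par c ε n X.length Y.length k l with hD
  have key : (outcome c ε D (inpF X Y) x).ans = 0 ∨ ((outcome c ε D (inpF X Y) x).ans = 1 ∧
      ((outcome c ε D (inpF X Y) x).ai < D.lx + 1 - D.l ∧ (outcome c ε D (inpF X Y) x).aj < D.ly + 1 - D.l) ∧
      validP ε D (inpF X Y) ((outcome c ε D (inpF X Y) x).ai, (outcome c ε D (inpF X Y) x).aj)) :=
    foldl_proc_sound (fun x => x.1 < D.lx + 1 - D.l ∧ x.2 < D.ly + 1 - D.l)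
      (fun _ hx => mem_allCands hx) (.inl rfl)
  generalize outcome c ε D (inpF X Y) x = st at key h
  have hdx : D.lx = X.length := rfl
  have hdy : D.ly = Y.length := rfl
  have hdl : D.l = l := rfl
  have hdk : D.k = k := rfl
  have hv : st.ans = 1 → st.ai + l ≤ X.length ∧ st.aj + l ≤ Y.length ∧
      (mis (inpF X Y) l st.ai (X.length + st.aj) : ℝ) ≤ (1 + ε) * k := by
    intro h1
    rcases key with key | ⟨-, ⟨h2, h3⟩, h4⟩
    · omega
    · rw [validP, sub_le_mul_iff hε] at h4
      exact ⟨by omega, by omega, h4⟩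
  refine ⟨by tauto, fun h1 => h ?_, fun h1 => ?_, fun h1 => ?_⟩
  · obtain ⟨i, j, hi, hj, hm⟩ := (le_lcs_iff (Nat.cast_nonneg k)).1 h1
    exact ⟨i, j, hi, hj, by exact_mod_cast hm⟩
  · by_contra h2
    have h3 : st.ans = 1 := by tauto
    have := (le_lcs_iff (t := (1 + ε) * k) (by positivity)).2 ⟨_, _, hv h3⟩
    omega
  · obtain ⟨h2, h3, h4⟩ := hv h1
    exact ⟨h2, h3, by rwa [mismatches_substr h2 h3]⟩

/-! ### Indicators and expectations. -/

open Classical in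
/-- The indicator of a proposition. -/
noncomputable def ind (q : Prop) : ℝ := if q then 1 else 0

theorem ind_of {q : Prop} (h : q) : ind q = 1 := if_pos h
theorem ind_of_not {q : Prop} (h : ¬ q) : ind q = 0 := if_neg h

theorem ind_nonneg (q : Prop) : 0 ≤ ind q := by
  by_cases h : q
  · rw [ind_of h]; exact zero_le_one
  · rw [ind_of_not h]

theorem ind_le_one (q : Prop) : ind q ≤ 1 := by
  by_cases h : q
  · rw [ind_of h]
  · rw [ind_of_not h]; exact zero_le_one

theorem ind_le {q : Prop} {x : ℝ} (hx : 0 ≤ x) (h : q → 1 ≤ x) : ind q ≤ x := by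
  by_cases hq : q
  · rw [ind_of hq]; exact h hq
  · rw [ind_of_not hq]; exact hx

theorem ind_mono {q r : Prop} (h : q → r) : ind q ≤ ind r :=
  ind_le (ind_nonneg r) fun hq => (ind_of (h hq)).ge

theorem ind_not (q : Prop) : ind (¬ q) = 1 - ind q := by
  by_cases h : q
  · rw [ind_of h, ind_of_not (not_not.2 h)]; ring
  · rw [ind_of h, ind_of_not h]; ring

theorem ind_and (q r : Prop) : ind (q ∧ r) = ind q * ind r := by
  by_cases h : q <;> by_cases h' : r <;> simp [ind, h, h']

theorem sum_ind {ι : Type*} (s : Finset ι) (q : ι → Prop) [DecidablePred q] :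
    ∑ i ∈ s, ind (q i) = (s.filter q).card := by
  rw [Finset.card_filter, Nat.cast_sum]
  refine Finset.sum_congr rfl fun i _ => ?_
  by_cases h : q i
  · rw [ind_of h]; simp [h]
  · rw [ind_of_not h]; simp [h]

namespace Gen
variable {α β : Type}

theorem rep_prod_E (G : Gen α) (f : α → ℝ) (q : ℕ) : (G.rep q).E (fun l => (l.map f).prod) = G.E f ^ q := by
  induction q with
  | zero => simp [rep_zero_E]
  | succ q ih =>
    simp only [rep_succ_E, List.map_cons, List.prod_cons, E_mul_left, ih, E_mul_right]
    rw [pow_succ, mul_comm]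

theorem E_le_const (G : Gen α) (hG : G.Pos) {f : α → ℝ} {r : ℝ} (h : ∀ a, G.Mem a → f a ≤ r) : G.E f ≤ r :=
  (G.E_mono h).trans_eq (G.E_const hG r)

theorem E_sub (G : Gen α) (f g : α → ℝ) : G.E (fun a => f a - g a) = G.E f - G.E g := by
  have h := G.E_add (fun a => f a - g a) g
  simp only [sub_add_cancel] at h
  linarith

theorem E_ind_not (G : Gen α) (hG : G.Pos) (q : α → Prop) :
    G.E (fun a => ind (¬ q a)) = 1 - G.E (fun a => ind (q a)) := by
  simp only [ind_not]
  rw [E_sub, E_const G hG]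

theorem E_ind_le_one (G : Gen α) (hG : G.Pos) (q : α → Prop) : G.E (fun a => ind (q a)) ≤ 1 :=
  G.E_le_const hG fun _ _ => ind_le_one _

theorem rep_mul_E (G : Gen α) (m q : ℕ) (f : List α → ℝ) :
    ((G.rep m).rep q).E (fun l => f l.flatten) = (G.rep (q * m)).E f := by
  induction q generalizing f with
  | zero => simp [rep_zero_E]
  | succ q ih =>
    rw [rep_succ_E, Nat.succ_mul, Nat.add_comm, rep_add_E]
    simp only [List.flatten_cons]
    exact E_congr _ fun a _ => ih (fun l => f (a ++ l))

end Gen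

/-! ### Uniform numbers below `B` as random residues modulo `p`. -/

theorem sum_range_mul_period {p : ℕ} (f : ZMod p → ℝ) (q : ℕ) :
    ∑ x ∈ Finset.range (p * q), f x = q * ∑ x ∈ Finset.range p, f x := by
  induction q with
  | zero => simp
  | succ q ih =>
    rw [Nat.mul_succ, Finset.sum_range_add, ih]
    have : ∀ x : ℕ, ((p * q + x : ℕ) : ZMod p) = x := fun x => by simp
    simp only [this]
    push_cast; ring

theorem sum_range_zmod {p : ℕ} [NeZero p] (f : ZMod p → ℝ) :
    ∑ x ∈ Finset.range p, f x = ∑ t : ZMod p, f t := by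
  refine Finset.sum_nbij' (fun x => (x : ZMod p)) (fun t => t.val) (by simp) ?_ ?_ (by simp) (by simp)
  · intro t _
    simpa using ZMod.val_lt t
  · intro x hx
    exact ZMod.val_cast_of_lt (by simpa using hx)

/-- Each residue modulo `p` has at most `B / p + 1 ≤ 2 B / p` representatives below `B`; drawing
from a range independent of `p` thus costs a factor `2` only. -/
theorem unif_E_zmod_le {p B : ℕ} [NeZero p] (hB : p ≤ B) {f : ZMod p → ℝ} (hf : ∀ t, 0 ≤ f t) :
    (Gen.unif B).E (fun x => f x) ≤ 2 / p * ∑ t, f t := by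
  have hp : 0 < p := Nat.pos_of_ne_zero (NeZero.ne p)
  have hp' : (0 : ℝ) < p := by exact_mod_cast hp
  have hB' : (0 : ℝ) < B := by exact_mod_cast hp.trans_le hB
  have hS : 0 ≤ ∑ t, f t := Finset.sum_nonneg fun t _ => hf t
  rw [Gen.unif_E, div_le_iff₀ hB', ← sum_range_zmod]
  rw [← sum_range_zmod] at hS
  have h1 : ∑ x ∈ Finset.range B, f x ≤ ∑ x ∈ Finset.range (p * (B / p + 1)), f x := by
    refine Finset.sum_le_sum_of_subset_of_nonneg (Finset.range_mono ?_) fun x _ _ => hf x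
    exact (Nat.lt_mul_div_succ B hp).le
  rw [sum_range_mul_period] at h1
  refine h1.trans ?_
  have h2 : ((B / p + 1 : ℕ) : ℝ) ≤ 2 / p * B := by
    have h3 : ((B / p : ℕ) : ℝ) ≤ B / p := Nat.cast_div_le
    have h4 : (1 : ℝ) ≤ B / p := by
      rw [le_div_iff₀ hp', one_mul]; exact_mod_cast hB
    have h5 : (2 : ℝ) / p * B = B / p + B / p := by ring
    push_cast; linarith
  calc _ ≤ 2 / p * B * ∑ x ∈ Finset.range p, f x := mul_le_mul_of_nonneg_right h2 hS
    _ = _ := by ring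

theorem card_mod_le {p g a : ℕ} (hg : 0 < g) :
    (((Finset.range p).filter fun u => u ≡ a [MOD g]).card : ℝ) ≤ p / g + 1 := by
  rw [← Nat.count_eq_card_filter_range, Nat.count_modEq_card p hg]
  have h1 : ((p / g : ℕ) : ℝ) ≤ p / g := Nat.cast_div_le
  split_ifs <;> push_cast <;> linarith

/-- The representative of `a - b` is the difference of the representatives, or this difference plus
`p` if it wraps around. -/
theorem val_mod_eq {p g : ℕ} [NeZero p] {a b : ZMod p} (h : a.val % g = b.val % g) :
    (a - b).val ≡ 0 [MOD g] ∨ (a - b).val ≡ p [MOD g] := by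
  have ha := ZMod.val_lt a
  have hb := ZMod.val_lt b
  rcases le_or_gt b.val a.val with hle | hlt
  · left
    rw [ZMod.val_sub hle]
    exact (Nat.modEq_zero_iff_dvd.2 ((Nat.modEq_iff_dvd' hle).1 (Eq.symm h)))
  · right
    have hne : b - a ≠ 0 := by
      intro h0
      rw [sub_eq_zero.1 h0] at hlt
      exact lt_irrefl _ hlt
    have h1 : (a - b).val = p - (b - a).val := by
      have : NeZero (b - a) := ⟨hne⟩
      rw [← neg_sub b a, ZMod.val_neg_of_ne_zero]
    rw [h1, ZMod.val_sub hlt.le]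
    have h2 : g ∣ b.val - a.val := (Nat.modEq_iff_dvd' hlt.le).1 h
    refine (Nat.modEq_iff_dvd' (by omega)).2 ?_
    rwa [Nat.sub_sub_self (by omega)]

/-- The difference of the two fingerprints is a bijective affine function of `y`, and `p / g + 1`
bounds the number of its values in each of two residue classes modulo `g`. The factor `4` is `2` for
the two classes times `2` for drawing below `B`. -/
theorem E_factor_le {p B g : ℕ} [Fact p.Prime] (hB : p ≤ B) (hg : 0 < g) {s s' : ZMod p} (hs : s ≠ s')
    (α α' : ZMod p) :
    (Gen.unif B).E (fun y => ind ((α + y * s).val % g = (α' + y * s').val % g)) ≤ 4 * (1 / g + 1 / p) := by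
  classical
  have hp : (0 : ℝ) < p := by exact_mod_cast (Fact.out : p.Prime).pos
  refine (unif_E_zmod_le (f := fun y => ind ((α + y * s).val % g = (α' + y * s').val % g)) hB
    fun t => ind_nonneg _).trans ?_
  have hd : s - s' ≠ 0 := sub_ne_zero.2 hs
  set φ : ZMod p → ZMod p := fun y => (α + y * s) - (α' + y * s') with hφ
  have hinj : Function.Injective φ := by
    intro y y' h
    have h1 : y * (s - s') = y' * (s - s') := by
      simp only [hφ] at h; linear_combination h
    exact mul_right_cancel₀ hd h1
  have key : ∑ t : ZMod p, ind ((α + t * s).val % g = (α' + t * s').val % g) ≤ 2 * (p / g + 1) := by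
    calc _ ≤ ∑ t : ZMod p, (ind ((φ t).val ≡ 0 [MOD g]) + ind ((φ t).val ≡ p [MOD g])) := by
          refine Finset.sum_le_sum fun t _ => ?_
          refine ind_le (add_nonneg (ind_nonneg _) (ind_nonneg _)) fun h => ?_
          rcases val_mod_eq h with h | h
          · linarith [ind_of h, ind_nonneg ((φ t).val ≡ p [MOD g])]
          · linarith [ind_of h, ind_nonneg ((φ t).val ≡ 0 [MOD g])]
      _ = ∑ u : ZMod p, (ind (u.val ≡ 0 [MOD g]) + ind (u.val ≡ p [MOD g])) :=
          Function.Bijective.sum_comp (Finite.injective_iff_bijective.1 hinj)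
            (fun u => ind (u.val ≡ 0 [MOD g]) + ind (u.val ≡ p [MOD g]))
      _ = ∑ u ∈ Finset.range p, (ind (u ≡ 0 [MOD g]) + ind (u ≡ p [MOD g])) := by
          rw [← sum_range_zmod (fun u : ZMod p => ind (u.val ≡ 0 [MOD g]) + ind (u.val ≡ p [MOD g]))]
          refine Finset.sum_congr rfl fun u hu => ?_
          rw [ZMod.val_cast_of_lt (by simpa using hu)]
      _ ≤ _ := by
          rw [Finset.sum_add_distrib, sum_ind, sum_ind]
          have h1 := card_mod_le (p := p) (a := 0) hg
          have h2 := card_mod_le (p := p) (a := p) hg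
          linarith
  calc (2 / p * ∑ t : ZMod p, ind ((α + t * s).val % g = (α' + t * s').val % g) : ℝ)
      ≤ 2 / p * (2 * (p / g + 1)) := mul_le_mul_of_nonneg_left key (by positivity)
    _ = 4 * (1 / g + 1 / p) := by field_simp; ring

/-- A nonzero polynomial of degree at most `N` over a field has at most `N` roots. -/
theorem E_root_le {p B N : ℕ} [Fact p.Prime] (hB : p ≤ B) {d : ℕ → ZMod p} {u₀ : ℕ} (hu : u₀ < N)
    (hd : d u₀ ≠ 0) :
    (Gen.unif B).E (fun z => ind (∑ u ∈ Finset.range N, (z : ZMod p) ^ u * d u = 0)) ≤ 2 * N / p := by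
  classical
  refine (unif_E_zmod_le (f := fun z => ind (∑ u ∈ Finset.range N, z ^ u * d u = 0)) hB
    fun t => ind_nonneg _).trans ?_
  have hp : (0 : ℝ) < p := by exact_mod_cast (Fact.out : p.Prime).pos
  set f : Polynomial (ZMod p) := ∑ u ∈ Finset.range N, Polynomial.C (d u) * Polynomial.X ^ u with hf
  have hc : f.coeff u₀ = d u₀ := by
    simp [hf, Polynomial.finsetSum_coeff, Polynomial.coeff_C_mul, Polynomial.coeff_X_pow, hu]
  have hne : f ≠ 0 := by
    intro h; rw [h] at hc; exact hd (by simpa using hc.symm)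
  have hdeg : f.natDegree ≤ N := by
    refine Polynomial.natDegree_sum_le_of_forall_le _ _ fun u hu => ?_
    exact (Polynomial.natDegree_C_mul_X_pow_le _ _).trans (by simp at hu; omega)
  have heval : ∀ z, f.eval z = ∑ u ∈ Finset.range N, z ^ u * d u := by
    intro z
    rw [hf, Polynomial.eval_finsetSum]
    refine Finset.sum_congr rfl fun u _ => ?_
    rw [Polynomial.eval_mul, Polynomial.eval_C, Polynomial.eval_pow, Polynomial.eval_X, mul_comm]
  have hcard : ((Finset.univ.filter fun z : ZMod p =>
      ∑ u ∈ Finset.range N, z ^ u * d u = 0).card : ℝ) ≤ N := by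
    have h1 : (Finset.univ.filter fun z : ZMod p => ∑ u ∈ Finset.range N, z ^ u * d u = 0) ⊆
        f.roots.toFinset := by
      intro z hz
      rw [Multiset.mem_toFinset, Polynomial.mem_roots hne, Polynomial.IsRoot, heval]
      simpa using hz
    have h2 := (Finset.card_le_card h1).trans ((Multiset.toFinset_card_le _).trans
      (f.card_roots'.trans hdeg))
    exact_mod_cast h2
  rw [sum_ind]
  calc _ ≤ 2 / p * (N : ℝ) := mul_le_mul_of_nonneg_left hcard (by positivity)
    _ = _ := by ring

/-! ### Collision probability of fingerprints. -/

/-- The positions of the mismatches of two windows. -/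
def misSet (p l : ℕ) (w : ℕ → ℕ) (i j : ℕ) : Finset ℕ :=
  (Finset.range l).filter fun v => (w (i + v) : ZMod p) ≠ w (j + v)

/-- The class contains an element of `S`. -/
def Hit (S : Finset ℕ) (tab : List ℕ) (a : Cls) : Prop := ∃ v ∈ S, v % tab.getD a.1 0 = a.2.1

theorem Hit.mono {S T : Finset ℕ} (h : S ⊆ T) {tab : List ℕ} {a : Cls} (ha : Hit S tab a) : Hit T tab a := by
  obtain ⟨v, hv, h'⟩ := ha
  exact ⟨v, h hv, h'⟩

theorem lt_terms {l P c u : ℕ} (hc : c < P) (hu : u < (l + P - 1 - c) / P) : c + u * P < l := by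
  have h1 : (u + 1) * P ≤ l + P - 1 - c :=
    (Nat.mul_le_mul_right P hu).trans (Nat.div_mul_le_self _ _)
  rw [Nat.succ_mul] at h1
  omega

theorem terms_lt {l P c u : ℕ} (hc : c < P) (hu : c + u * P < l) : u < (l + P - 1 - c) / P := by
  refine (Nat.le_div_iff_mul_le (by omega)).2 ?_
  rw [Nat.succ_mul]
  omega

theorem clsVal_eq_of_not_hit {p l : ℕ} {tab : List ℕ} {w : ℕ → ℕ} {i j : ℕ} {a : Cls}
    (h : ¬ Hit (misSet p l w i j) tab a) : clsVal p l tab w i a = clsVal p l tab w j a := by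
  rw [clsVal, clsVal, clsSum, clsSum]
  split_ifs with hc
  · congr 1
    refine Finset.sum_congr rfl fun u hu => ?_
    have hlt := lt_terms hc (Finset.mem_range.1 hu)
    by_contra hne
    refine h ⟨a.2.1 + u * tab.getD a.1 0, ?_, ?_⟩
    · rw [misSet, Finset.mem_filter, Finset.mem_range]
      refine ⟨hlt, fun he => hne ?_⟩
      rw [← add_assoc, ← add_assoc] at he
      rw [he]
    · rw [Nat.add_mul_mod_self_right, Nat.mod_eq_of_lt hc]
  · rfl

theorem terms_le {l P c : ℕ} (hc : c < P) : (l + P - 1 - c) / P ≤ l := by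
  by_contra h
  have := lt_terms (l := l) (u := l) hc (by omega)
  have h1 : l * 1 ≤ l * P := Nat.mul_le_mul_left l (by omega)
  omega

/-- Once the class contains a mismatch, the two class polynomials differ, so their values at `z`
differ except for few `z`. Then the factor `y` of this one class spreads the difference of the total
fingerprints, whatever the other classes contribute. -/
theorem E_hit_class_le {p l B g q : ℕ} [Fact p.Prime] (hB : p ≤ B) (hg : 0 < g) {tab : List ℕ} {w : ℕ → ℕ}
    {i j e c : ℕ} (he : 0 < tab.getD e 0) (h : ∃ v ∈ misSet p l w i j, v % tab.getD e 0 = c) {G : Gen Cls}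
    (hG : G.Pos) (A A' : ZMod p) :
    (Gen.unif B).E (fun z => (Gen.unif B).E (fun y => (G.rep q).E
      (fun cs => ind ((A + fp p l tab w i ((e, c, z, y) :: cs)).val % g =
      (A' + fp p l tab w j ((e, c, z, y) :: cs)).val % g)))) ≤ 2 * l / p + 4 * (1 / g + 1 / p) := by
  set P := tab.getD e 0
  obtain ⟨v, hv, rfl⟩ := h
  set c := v % P
  have hc : c < P := Nat.mod_lt _ he
  have hp : (0 : ℝ) < p := by exact_mod_cast (Fact.out : p.Prime).pos
  have hB0 : (Gen.unif B).Pos := Gen.unif_pos ((Fact.out : p.Prime).pos.trans_le hB)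
  set N := (l + P - 1 - c) / P with hN
  set d : ℕ → ZMod p := fun u => (w (i + c + u * P) : ZMod p) - w (j + c + u * P) with hd
  rw [misSet, Finset.mem_filter, Finset.mem_range] at hv
  have hvd : c + v / P * P = v := by rw [mul_comm]; exact Nat.mod_add_div v P
  have hu : v / P < N := terms_lt hc (by rw [hvd]; exact hv.1)
  have hne : d (v / P) ≠ 0 := by
    simp only [hd]
    rw [add_assoc, add_assoc, hvd]
    exact sub_ne_zero.2 hv.2
  have h1 := E_root_le hB hu hne
  have h2 : (2 * N / p : ℝ) ≤ 2 * l / p := by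
    have : (N : ℝ) ≤ l := by exact_mod_cast terms_le hc
    gcongr
  have hsum : ∀ z : ℕ, clsSum p l P c z w i - clsSum p l P c z w j =
      ∑ u ∈ Finset.range N, (z : ZMod p) ^ u * d u := by
    intro z
    rw [clsSum, clsSum, if_pos hc, if_pos hc, ← Finset.sum_sub_distrib]
    exact Finset.sum_congr rfl fun u _ => by simp only [hd]; ring
  have hfp : ∀ (i z y : ℕ) (cs : List Cls), fp p l tab w i ((e, c, z, y) :: cs) =
      y * clsSum p l P c z w i + fp p l tab w i cs := fun i z y cs => rfl
  have hpt : ∀ z, (Gen.unif B).E (fun y => (G.rep q).E (fun cs =>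
      ind ((A + fp p l tab w i ((e, c, z, y) :: cs)).val % g =
        (A' + fp p l tab w j ((e, c, z, y) :: cs)).val % g))) ≤
      ind (∑ u ∈ Finset.range N, (z : ZMod p) ^ u * d u = 0) + 4 * (1 / g + 1 / p) := by
    intro z
    by_cases hz : ∑ u ∈ Finset.range N, (z : ZMod p) ^ u * d u = 0
    · rw [ind_of hz]
      have h3 : (0 : ℝ) ≤ 4 * (1 / g + 1 / p) := by positivity
      refine (Gen.E_le_const _ hB0 (r := 1) fun y _ => ?_).trans (by linarith)
      exact Gen.E_le_const _ (Gen.rep_pos hG q) fun _ _ => ind_le_one _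
    · rw [ind_of_not hz, zero_add, Gen.E_swap]
      refine Gen.E_le_const _ (Gen.rep_pos hG q) fun cs _ => ?_
      rw [← hsum, sub_eq_zero] at hz
      have := E_factor_le hB hg hz (A + fp p l tab w i cs) (A' + fp p l tab w j cs)
      refine le_of_eq_of_le ?_ this
      refine Gen.E_congr _ fun y _ => ?_
      rw [hfp, hfp]
      congr 4 <;> ring
  calc _ ≤ (Gen.unif B).E (fun z => ind (∑ u ∈ Finset.range N, (z : ZMod p) ^ u * d u = 0) +
        4 * (1 / g + 1 / p)) := Gen.E_mono _ fun z _ => hpt z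
    _ ≤ _ := by
      rw [Gen.E_add, Gen.E_const _ hB0]
      linarith

theorem clsGen_pos {np R B : ℕ} (h1 : 0 < np) (h2 : 0 < R) (h3 : 0 < B) : (clsGen np R B).Pos :=
  Gen.prod_pos (Gen.unif_pos h1) (Gen.prod_pos (Gen.unif_pos h2)
    (Gen.prod_pos (Gen.unif_pos h3) (Gen.unif_pos h3)))

/-- Two windows get the same fingerprint, modulo `g`, with small probability. -/
theorem E_match_le {p l np R B g : ℕ} [Fact p.Prime] (hB : p ≤ B) (hg : 0 < g) (hnp : 0 < np) (hR : 0 < R)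
    {tab : List ℕ} (htab : ∀ e < np, 0 < tab.getD e 0) {w : ℕ → ℕ} {i j : ℕ} {h : ℝ} (hh1 : h ≤ 1)
    (hh : h ≤ (clsGen np R B).E (fun a => ind (Hit (misSet p l w i j) tab a))) (q : ℕ) (A A' : ZMod p) :
    ((clsGen np R B).rep q).E (fun cs => ind ((A + fp p l tab w i cs).val % g =
      (A' + fp p l tab w j cs).val % g)) ≤ (1 - h) ^ q + (2 * l / p + 4 * (1 / g + 1 / p)) := by
  have hp : (0 : ℝ) < p := by exact_mod_cast (Fact.out : p.Prime).pos
  have hB0 : 0 < B := (Fact.out : p.Prime).pos.trans_le hB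
  have hG := clsGen_pos hnp hR hB0
  set G := clsGen np R B with hGdef
  set e := (2 * l / p + 4 * (1 / g + 1 / p) : ℝ) with he
  have he0 : 0 ≤ e := by positivity
  set S := misSet p l w i j with hS
  induction q generalizing A A' with
  | zero =>
    rw [pow_zero]
    have := Gen.E_ind_le_one (G.rep 0) (Gen.rep_pos hG 0)
      (fun cs => (A + fp p l tab w i cs).val % g = (A' + fp p l tab w j cs).val % g)
    linarith
  | succ q ih =>
    have hq : 0 ≤ (1 - h) ^ q := pow_nonneg (by linarith) q
    rw [Gen.rep_succ_E]
    set F : Cls → ℝ := fun a => (G.rep q).E (fun cs => ind ((A + fp p l tab w i (a :: cs)).val % g =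
      (A' + fp p l tab w j (a :: cs)).val % g)) with hF
    -- A class without mismatch shifts both fingerprints by the same amount; this is why the
    -- induction runs over arbitrary shifts `A`, `A'`.
    have hF1 : ∀ a, ¬ Hit S tab a → F a ≤ (1 - h) ^ q + e := by
      intro a ha
      have h1 := clsVal_eq_of_not_hit ha
      refine le_of_eq_of_le ?_ (ih (A + clsVal p l tab w i a) (A' + clsVal p l tab w j a))
      refine Gen.E_congr _ fun cs _ => ?_
      have : ∀ i, fp p l tab w i (a :: cs) = clsVal p l tab w i a + fp p l tab w i cs := fun i => rfl
      rw [this, this, add_assoc, add_assoc]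
    -- At the first hit the error `e` is paid and the recursion ends, so `e` appears once and not
    -- `q` times.
    have hF2 : G.E (fun a => ind (Hit S tab a) * F a) ≤ G.E (fun a => ind (Hit S tab a) * e) := by
      rw [hGdef, clsGen]
      simp only [Gen.prod_E]
      refine Gen.E_mono _ fun e' he' => Gen.E_mono _ fun c hc => ?_
      have hHit : ∀ z y, Hit S tab (e', c, z, y) ↔ ∃ v ∈ S, v % tab.getD e' 0 = c := fun _ _ => .rfl
      simp only [hHit, Gen.E_mul_left]
      have hB1 : (Gen.unif B).Pos := Gen.unif_pos hB0
      rw [Gen.E_const _ hB1, Gen.E_const _ hB1]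
      by_cases hx : ∃ v ∈ S, v % tab.getD e' 0 = c
      · rw [ind_of hx, one_mul, one_mul]
        exact E_hit_class_le hB hg (htab e' (Gen.unif_mem.1 he')) hx hG A A'
      · rw [ind_of_not hx, zero_mul, zero_mul]
    calc G.E F = G.E (fun a => ind (¬ Hit S tab a) * F a + ind (Hit S tab a) * F a) := by
          refine Gen.E_congr _ fun a _ => ?_
          rw [ind_not]; ring
      _ = G.E (fun a => ind (¬ Hit S tab a) * F a) + G.E (fun a => ind (Hit S tab a) * F a) :=
          Gen.E_add _ _ _
      _ ≤ G.E (fun a => ind (¬ Hit S tab a) * ((1 - h) ^ q + e)) + G.E (fun a => ind (Hit S tab a) * e) := by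
          refine add_le_add (Gen.E_mono _ fun a _ => ?_) hF2
          by_cases ha : Hit S tab a
          · rw [ind_of_not (not_not.2 ha)]; simp
          · exact mul_le_mul_of_nonneg_left (hF1 a ha) (ind_nonneg _)
      _ = (1 - G.E (fun a => ind (Hit S tab a))) * (1 - h) ^ q + e := by
          rw [Gen.E_mul_right, Gen.E_mul_right, Gen.E_ind_not _ hG]; ring
      _ ≤ _ := by
          rw [pow_succ]
          have : (1 - G.E (fun a => ind (Hit S tab a))) * (1 - h) ^ q ≤ (1 - h) * (1 - h) ^ q :=
            mul_le_mul_of_nonneg_right (by linarith) hq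
          linarith

/-! ### Probability that a class contains a mismatch. -/

/-- The residue is uniform below `R` for every `P ≤ R`, so each residue that occurs in `S` has the
same weight `1 / R`, independently of `P`. -/
theorem unif_E_image {R P : ℕ} (hP : 0 < P) (hPR : P ≤ R) (S : Finset ℕ) :
    (Gen.unif R).E (fun c => ind (∃ v ∈ S, v % P = c)) = (S.image (· % P)).card / R := by
  classical
  rw [Gen.unif_E, sum_ind]
  congr 3
  ext c
  simp only [Finset.mem_filter, Finset.mem_range, Finset.mem_image]
  constructor
  · rintro ⟨-, h⟩; exact h
  · rintro ⟨v, hv, rfl⟩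
    exact ⟨(Nat.mod_lt _ hP).trans_le hPR, v, hv, rfl⟩

theorem clsGen_E_hit {np R B : ℕ} (hB : 0 < B) {tab : List ℕ}
    (htab : ∀ e < np, 0 < tab.getD e 0 ∧ tab.getD e 0 ≤ R) (S : Finset ℕ) :
    (clsGen np R B).E (fun a => ind (Hit S tab a)) =
      (∑ e ∈ Finset.range np, ((S.image (· % tab.getD e 0)).card : ℝ) / R) / np := by
  have hB1 := Gen.unif_pos hB
  rw [clsGen]
  simp only [Gen.prod_E, Hit]
  rw [Gen.unif_E]
  congr 1
  refine Finset.sum_congr rfl fun e he => ?_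
  obtain ⟨h1, h2⟩ := htab e (Finset.mem_range.1 he)
  rw [← unif_E_image h1 h2]
  refine Gen.E_congr _ fun c _ => ?_
  rw [Gen.E_const _ hB1, Gen.E_const _ hB1]

theorem E_hit_le {np R B : ℕ} (hB : 0 < B) (hnp : 0 < np) {tab : List ℕ}
    (htab : ∀ e < np, 0 < tab.getD e 0 ∧ tab.getD e 0 ≤ R) (S : Finset ℕ) :
    (clsGen np R B).E (fun a => ind (Hit S tab a)) ≤ S.card / R := by
  rw [clsGen_E_hit hB htab, div_le_iff₀ (by exact_mod_cast hnp)]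
  calc _ ≤ ∑ e ∈ Finset.range np, (S.card : ℝ) / R := by
        refine Finset.sum_le_sum fun e _ => ?_
        refine div_le_div_of_nonneg_right ?_ (Nat.cast_nonneg _)
        exact_mod_cast Finset.card_image_le (s := S) (f := (· % tab.getD e 0))
    _ = _ := by simp [mul_comm]

/-- Adding an element to `S` either enlarges the image or creates a new colliding pair. -/
theorem card_le_image_add {S : Finset ℕ} (f : ℕ → ℕ) :
    S.card ≤ (S.image f).card + (S.offDiag.filter fun x => f x.1 = f x.2).card := by
  classical
  induction S using Finset.induction_on with
  | empty => simp
  | insert a S ha ih =>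
    have hsub : (S.offDiag.filter fun x => f x.1 = f x.2) ⊆
        ((insert a S).offDiag.filter fun x => f x.1 = f x.2) :=
      Finset.filter_subset_filter _ (Finset.offDiag_mono (Finset.subset_insert a S))
    rw [Finset.card_insert_of_notMem ha, Finset.image_insert]
    by_cases h : f a ∈ S.image f
    · rw [Finset.insert_eq_of_mem h]
      obtain ⟨b, hb, hab⟩ := Finset.mem_image.1 h
      have hne : a ≠ b := by rintro rfl; exact ha hb
      have hmem : (a, b) ∈ ((insert a S).offDiag.filter fun x => f x.1 = f x.2) := by
        simp [hb, hne, hab]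
      have hnot : (a, b) ∉ (S.offDiag.filter fun x => f x.1 = f x.2) := by simp [ha]
      have := Finset.card_lt_card (Finset.ssubset_iff_of_subset hsub |>.2 ⟨_, hmem, hnot⟩)
      omega
    · rw [Finset.card_insert_of_notMem h]
      have := Finset.card_le_card hsub
      omega

/-- On average over the moduli, a pair of distinct positions collides with probability at most `κ`,
since a collision means that the modulus divides their distance. Hence the expected number of
residues is at least `|S| - |S| (|S| - 1) κ`. -/
theorem le_E_hit {np R B n : ℕ} (hB : 0 < B) (hnp : 0 < np) {tab : List ℕ}
    (htab : ∀ e < np, 0 < tab.getD e 0 ∧ tab.getD e 0 ≤ R) {κ : ℝ}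
    (hκ : ∀ δ, 0 < δ → δ < n → (((Finset.range np).filter fun e => tab.getD e 0 ∣ δ).card : ℝ) ≤ κ * np)
    {S : Finset ℕ} (hS : ∀ v ∈ S, v < n) :
    (S.card : ℝ) * (1 - (S.card - 1) * κ) / R ≤ (clsGen np R B).E (fun a => ind (Hit S tab a)) := by
  classical
  have hnp' : (0 : ℝ) < np := by exact_mod_cast hnp
  rw [clsGen_E_hit hB htab, ← Finset.sum_div, div_div, mul_comm (R : ℝ), ← div_div]
  gcongr
  rw [le_div_iff₀ hnp']
  have h1 : ∀ e ∈ Finset.range np, (S.card : ℝ) - ∑ x ∈ S.offDiag,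
      (if x.1 % tab.getD e 0 = x.2 % tab.getD e 0 then (1 : ℝ) else 0) ≤
      ((S.image (· % tab.getD e 0)).card : ℝ) := by
    intro e _
    have := card_le_image_add (S := S) (· % tab.getD e 0)
    rw [Finset.card_filter] at this
    have h2 : (S.card : ℝ) ≤ (S.image (· % tab.getD e 0)).card + ∑ x ∈ S.offDiag,
      (if x.1 % tab.getD e 0 = x.2 % tab.getD e 0 then (1 : ℝ) else 0) := by
      exact_mod_cast this
    linarith
  refine le_trans ?_ (Finset.sum_le_sum h1)
  rw [Finset.sum_sub_distrib, Finset.sum_comm]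
  have h3 : ∀ x ∈ S.offDiag, ∑ e ∈ Finset.range np,
      (if x.1 % tab.getD e 0 = x.2 % tab.getD e 0 then (1 : ℝ) else 0) ≤ κ * np := by
    rintro ⟨a, b⟩ hx
    rw [Finset.mem_offDiag] at hx
    obtain ⟨ha, hb, hne⟩ := hx
    have key : ∀ a b, a < n → a < b → b < n → ∑ e ∈ Finset.range np,
        (if a % tab.getD e 0 = b % tab.getD e 0 then (1 : ℝ) else 0) ≤ κ * np := by
      intro a b ha hab hb
      refine le_trans (le_of_eq ?_) (hκ (b - a) (by omega) (by omega))
      rw [Finset.card_filter, Nat.cast_sum]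
      refine Finset.sum_congr rfl fun e _ => ?_
      have : a % tab.getD e 0 = b % tab.getD e 0 ↔ tab.getD e 0 ∣ b - a := Nat.modEq_iff_dvd' hab.le
      simp only [this]
      split_ifs <;> simp
    dsimp only
    rcases lt_or_gt_of_ne hne with h | h
    · exact key a b (hS a ha) h (hS b hb)
    · simp only [eq_comm (a := a % _)]
      exact key b a (hS b hb) h (hS a ha)
  have h4 := Finset.sum_le_sum h3
  rw [Finset.sum_const, Finset.offDiag_card, nsmul_eq_mul, Nat.cast_sub (Nat.le_mul_self _)] at h4
  push_cast at h4
  simp only [Finset.sum_const, Finset.card_range, nsmul_eq_mul]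
  nlinarith

/-! ### Waiting for a run of good blocks. -/

section Runs
variable {α : Type}

open Classical in
/-- There is no run of `b` good elements, if the first element continues a run of length `r`. -/
def NoRun (good : α → Prop) (b : ℕ) : ℕ → List α → Prop
  | _, [] => True
  | r, a :: l => if good a then r + 1 < b ∧ NoRun good b (r + 1) l else NoRun good b 0 l

/-- The generalization carries the part `pre` already read, which ends with `r` good elements. The
run found ends inside `l`, hence `1 ≤ s`. -/
theorem exists_run {good : α → Prop} {b : ℕ} (l : List α) :
    ∀ (r : ℕ) (pre : List α), r < b → r ≤ pre.length → (∀ a ∈ pre.drop (pre.length - r), good a) →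
      ¬ NoRun good b r l → ∃ s ≤ l.length, 1 ≤ s ∧ b ≤ pre.length + s ∧
      ∀ a ∈ (pre ++ l.take s).drop (pre.length + s - b), good a := by
  induction l with
  | nil => intro r pre _ _ _ h; exact absurd trivial h
  | cons a l ih =>
    intro r pre hr hr' hpre h
    rw [NoRun] at h
    have fin : ∀ r', r' < b → r' ≤ pre.length + 1 → (∀ x ∈ (pre ++ [a]).drop (pre.length + 1 - r'),
        good x) → ¬ NoRun good b r' l → ∃ s ≤ (a :: l).length, 1 ≤ s ∧ b ≤ pre.length + s ∧
        ∀ x ∈ (pre ++ (a :: l).take s).drop (pre.length + s - b), good x := by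
      intro r' h1 h2 h3 h4
      obtain ⟨s, hs, hs1, hs2, hs3⟩ := ih r' (pre ++ [a]) h1 (by simpa using h2) (by simpa using h3) h4
      refine ⟨s + 1, by simpa using hs, by omega, by simp at hs2; omega, fun x hx => hs3 x ?_⟩
      have e : (pre ++ [a]).length + s - b = pre.length + (s + 1) - b := by simp; omega
      rw [e]
      simpa using hx
    split_ifs at h with ha
    · have hgood : ∀ r', r' ≤ r + 1 → ∀ x ∈ (pre ++ [a]).drop (pre.length + 1 - r'), good x := by
        intro r' hr'' x hx
        rcases Nat.eq_zero_or_pos r' with h0 | h0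
        · subst h0
          rw [List.drop_of_length_le (by simp)] at hx
          simp at hx
        · rw [List.drop_append_of_le_length (by omega), List.mem_append] at hx
          rcases hx with hx | hx
          · refine hpre x ?_
            have e : pre.length + 1 - r' = (pre.length - r) + (r + 1 - r') := by omega
            rw [e, ← List.drop_drop] at hx
            exact List.mem_of_mem_drop hx
          · obtain rfl : x = a := by simpa using hx
            exact ha
      by_cases hb : r + 1 < b
      · exact fin (r + 1) hb (by omega) (hgood _ le_rfl) fun hn => h ⟨hb, hn⟩
      · have e : b = r + 1 := by omega
        refine ⟨1, by simp, le_rfl, by omega, ?_⟩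
        rw [e]
        simpa using hgood (r + 1) le_rfl
    · exact fin 0 (by omega) (by omega) (by simp) h

/-- The right-hand side is the expected waiting time for a run of length `b` when `r` good elements
have been seen: it is the difference of the waiting times from the start for `b` and for `r`. So
this is Markov's inequality, proved directly by induction from the one-step recursion. -/
theorem rep_E_noRun_le {G : Gen α} (hG : G.Pos) {good : α → Prop} {β : ℝ} (hβ : 0 < β)
    (hβE : G.E (fun a => ind (good a)) = β) {b : ℕ} (N : ℕ) :
    ∀ r, r < b → N * (G.rep N).E (fun l => ind (NoRun good b r l)) ≤ ∑ i ∈ Finset.Ico (r + 1) (b + 1),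
      β⁻¹ ^ i := by
  have hβ1 : β ≤ 1 := hβE ▸ G.E_ind_le_one hG good
  induction N with
  | zero =>
    intro r hr
    rw [Nat.cast_zero, zero_mul]
    exact Finset.sum_nonneg fun i _ => by positivity
  | succ N ih =>
    intro r hr
    have hN0 : ∀ r, 0 ≤ (G.rep N).E (fun l => ind (NoRun good b r l)) := fun r =>
      Gen.E_nonneg _ fun _ _ => ind_nonneg _
    have hN1 : ∀ r, (G.rep N).E (fun l => ind (NoRun good b r l)) ≤ 1 := fun r =>
      Gen.E_ind_le_one _ (Gen.rep_pos hG N) _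
    set x := (G.rep N).E (fun l => ind (NoRun good b 0 l)) with hx
    set y := (G.rep N).E (fun l => ind (r + 1 < b ∧ NoRun good b (r + 1) l)) with hy
    have hstep : (G.rep (N + 1)).E (fun l => ind (NoRun good b r l)) = β * y + (1 - β) * x := by
      rw [Gen.rep_succ_E]
      calc _ = G.E (fun a => ind (good a) * y + ind (¬ good a) * x) := by
            refine Gen.E_congr _ fun a _ => ?_
            by_cases ha : good a
            · rw [ind_of ha, ind_of_not (not_not.2 ha)]
              simp only [NoRun, if_pos ha, one_mul, zero_mul, add_zero]; rfl
            · rw [ind_of ha, ind_of_not ha]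
              simp only [NoRun, if_neg ha, one_mul, zero_mul, zero_add]; rfl
        _ = _ := by
            rw [Gen.E_add, Gen.E_mul_right, Gen.E_mul_right, Gen.E_ind_not _ hG, hβE]
    have h0 := ih 0 (by omega)
    have hy' : N * y ≤ ∑ i ∈ Finset.Ico (r + 2) (b + 1), β⁻¹ ^ i ∧ y ≤ 1 := by
      by_cases hb : r + 1 < b
      · have e : y = (G.rep N).E (fun l => ind (NoRun good b (r + 1) l)) := by
          rw [hy]
          exact Gen.E_congr _ fun l _ => by simp only [hb, true_and]
        rw [e]
        exact ⟨ih (r + 1) hb, hN1 _⟩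
      · have e : y = 0 := by
          rw [hy, ← (G.rep N).E_zero]
          exact Gen.E_congr _ fun l _ => ind_of_not fun h => hb h.1
        rw [e, mul_zero]
        exact ⟨Finset.sum_nonneg fun i _ => by positivity, zero_le_one⟩
    -- Multiplying by `β` shifts the geometric sum. Together with the same shift for `r = 0`, the
    -- waiting times satisfy `W r = 1 + β W (r + 1) + (1 - β) W 0`.
    have hT : β * ∑ i ∈ Finset.Ico (r + 2) (b + 1), β⁻¹ ^ i = ∑ i ∈ Finset.Ico (r + 1) b, β⁻¹ ^ i := by
      rw [Finset.mul_sum, Finset.sum_Ico_eq_sum_range, Finset.sum_Ico_eq_sum_range]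
      refine Finset.sum_congr (by congr 1; omega) fun i _ => ?_
      have : r + 2 + i = r + 1 + i + 1 := by omega
      rw [this, pow_succ, mul_comm, mul_assoc, inv_mul_cancel₀ hβ.ne', mul_one]
    have hT0 : β * ∑ i ∈ Finset.Ico (0 + 1) (b + 1), β⁻¹ ^ i = ∑ i ∈ Finset.Ico 0 b, β⁻¹ ^ i := by
      rw [Finset.mul_sum, Finset.sum_Ico_eq_sum_range, Finset.sum_Ico_eq_sum_range]
      refine Finset.sum_congr (by congr 1) fun i _ => ?_
      have : 0 + 1 + i = 0 + i + 1 := by omega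
      rw [this, pow_succ, mul_comm, mul_assoc, inv_mul_cancel₀ hβ.ne', mul_one]
    have s1 : ∑ i ∈ Finset.Ico (r + 1) (b + 1), β⁻¹ ^ i =
        ∑ i ∈ Finset.Ico (r + 1) b, β⁻¹ ^ i + β⁻¹ ^ b := Finset.sum_Ico_succ_top (by omega) _
    have s2 : ∑ i ∈ Finset.Ico (0 + 1) (b + 1), β⁻¹ ^ i =
        ∑ i ∈ Finset.Ico (0 + 1) b, β⁻¹ ^ i + β⁻¹ ^ b := Finset.sum_Ico_succ_top (by omega) _
    have s3 : ∑ i ∈ Finset.Ico 0 b, β⁻¹ ^ i = β⁻¹ ^ 0 + ∑ i ∈ Finset.Ico (0 + 1) b, β⁻¹ ^ i :=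
      Finset.sum_eq_sum_Ico_succ_bot (by omega) _
    rw [pow_zero] at s3
    rw [hstep]
    push_cast
    have a1 : β * (N * y) ≤ β * ∑ i ∈ Finset.Ico (r + 2) (b + 1), β⁻¹ ^ i :=
      mul_le_mul_of_nonneg_left hy'.1 hβ.le
    have a2 : (1 - β) * (N * x) ≤ (1 - β) * ∑ i ∈ Finset.Ico (0 + 1) (b + 1), β⁻¹ ^ i :=
      mul_le_mul_of_nonneg_left h0 (by linarith)
    have a3 : β * y ≤ β := by nlinarith [hy'.2]
    have a4 : (1 - β) * x ≤ 1 - β := by nlinarith [hN1 0]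
    rw [sub_mul, sub_mul, hT0] at a2
    rw [hT] at a1
    have e : ((N : ℝ) + 1) * (β * y + (1 - β) * x) =
        β * (N * y) + (1 - β) * (N * x) + β * y + (1 - β) * x := by ring
    rw [e]
    linarith

end Runs

/-! ### Chernoff bounds for the sketches. -/

section Chernoff
variable {α : Type}

open Classical in
theorem rep_E_pow_countP {G : Gen α} (hG : G.Pos) (good : α → Prop) (s : ℝ) (q : ℕ) :
    (G.rep q).E (fun l => s ^ l.countP (fun a => decide (good a))) =
      (1 + G.E (fun a => ind (good a)) * (s - 1)) ^ q := by
  have h1 : ∀ l : List α, s ^ l.countP (fun a => decide (good a)) =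
      (l.map fun a => 1 + ind (good a) * (s - 1)).prod := by
    intro l
    induction l with
    | nil => simp
    | cons a l ih =>
      rw [List.map_cons, List.prod_cons, ← ih, List.countP_cons]
      by_cases h : good a
      · rw [ind_of h]; simp [h, pow_succ]; ring
      · rw [ind_of_not h]; simp [h]
  simp only [h1]
  rw [Gen.rep_prod_E, Gen.E_add, Gen.E_const _ hG, Gen.E_mul_right]

-- Markov's inequality for the exponential moment `s ^ count` with `s ≥ 1`, which factorizes by
-- independence; the parameter `s` is optimized later.
open Classical in
theorem rep_E_countP_ge {G : Gen α} (hG : G.Pos) {good : α → Prop} {s β : ℝ} (hs : 1 ≤ s)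
    (hβ : G.E (fun a => ind (good a)) ≤ β) (q t : ℕ) :
    (G.rep q).E (fun l => ind (t ≤ l.countP (fun a => decide (good a)))) ≤ (1 + β * (s - 1)) ^ q / s ^ t := by
  have hs0 : 0 < s := by linarith
  have h0 : 0 ≤ G.E (fun a => ind (good a)) := Gen.E_nonneg _ fun _ _ => ind_nonneg _
  calc _ ≤ (G.rep q).E (fun l => s ^ l.countP (fun a => decide (good a)) * (s ^ t)⁻¹) := by
        refine Gen.E_mono _ fun l _ => ind_le (by positivity) fun h => ?_
        rw [← div_eq_mul_inv, one_le_div (by positivity)]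
        exact pow_le_pow_right₀ hs h
    _ = (1 + G.E (fun a => ind (good a)) * (s - 1)) ^ q / s ^ t := by
        rw [Gen.E_mul_right, rep_E_pow_countP hG, div_eq_mul_inv]
    _ ≤ _ := by
        have h1 : 0 ≤ G.E (fun a => ind (good a)) * (s - 1) := mul_nonneg h0 (by linarith)
        have h2 : G.E (fun a => ind (good a)) * (s - 1) ≤ β * (s - 1) :=
          mul_le_mul_of_nonneg_right hβ (by linarith)
        gcongr

open Classical in
theorem rep_E_countP_lt {G : Gen α} (hG : G.Pos) {good : α → Prop} {s β : ℝ} (hs0 : 0 < s) (hs : s ≤ 1)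
    (hβ : β ≤ G.E (fun a => ind (good a))) (q t : ℕ) :
    (G.rep q).E (fun l => ind (l.countP (fun a => decide (good a)) < t)) ≤ (1 - β * (1 - s)) ^ q / s ^ t := by
  have h1 := G.E_ind_le_one hG good
  calc _ ≤ (G.rep q).E (fun l => s ^ l.countP (fun a => decide (good a)) * (s ^ t)⁻¹) := by
        refine Gen.E_mono _ fun l _ => ind_le (by positivity) fun h => ?_
        rw [← div_eq_mul_inv, one_le_div (by positivity)]
        exact pow_le_pow_of_le_one hs0.le hs h.le
    _ = (1 + G.E (fun a => ind (good a)) * (s - 1)) ^ q / s ^ t := by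
        rw [Gen.E_mul_right, rep_E_pow_countP hG, div_eq_mul_inv]
    _ ≤ _ := by
        have h2 : 0 ≤ 1 + G.E (fun a => ind (good a)) * (s - 1) := by nlinarith
        have h3 : 1 + G.E (fun a => ind (good a)) * (s - 1) ≤ 1 - β * (1 - s) := by nlinarith
        gcongr

end Chernoff

/-! ### Sketch digits, windows of blocks, and counting candidates. -/

theorem eqDigits_mul_add {g : ℕ} {a b d d' : ℕ} (hd : d < g) (hd' : d' < g) (n : ℕ) :
    eqDigits g (n + 1) (a * g + d) (b * g + d') = eqDigits g n a b + if d = d' then 1 else 0 := by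
  have hg : 0 < g := by omega
  have h1 : ∀ a d n, d < g → (a * g + d) / g ^ (n + 1) = a / g ^ n := by
    intro a d n hd
    rw [pow_succ', ← Nat.div_div_eq_div_mul, mul_comm a, Nat.mul_add_div hg, Nat.div_eq_of_lt hd, add_zero]
  induction n with
  | zero =>
    rw [eqDigits_succ, pow_zero, Nat.div_one, Nat.div_one, Nat.mul_add_mod_self_right,
      Nat.mul_add_mod_self_right, Nat.mod_eq_of_lt hd, Nat.mod_eq_of_lt hd']
    simp [eqDigits]
  | succ n ih =>
    rw [eqDigits_succ, ih, eqDigits_succ, h1 _ _ _ hd, h1 _ _ _ hd']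
    omega

open Classical in
theorem eqDigits_skVal {p l g : ℕ} (hg : 0 < g) (tab : List ℕ) (w : ℕ → ℕ) (i j : ℕ) (bl : List (List Cls)) :
    eqDigits g bl.length (skVal p l g tab w i bl) (skVal p l g tab w j bl) =
      bl.countP (fun cs => decide ((fp p l tab w i cs).val % g = (fp p l tab w j cs).val % g)) := by
  induction bl using List.reverseRecOn with
  | nil => simp [eqDigits]
  | append_singleton bl cs ih =>
    rw [skVal_concat, skVal_concat, List.length_append, List.length_singleton,
      eqDigits_mul_add (Nat.mod_lt _ hg) (Nat.mod_lt _ hg), ih, List.countP_append, List.countP_singleton]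
    simp

theorem flatten_drop {α : Type*} {m : ℕ} {l : List (List α)} (h : ∀ x ∈ l, x.length = m) (q : ℕ) :
    l.flatten.drop (q * m) = (l.drop q).flatten := by
  induction q generalizing l with
  | zero => simp
  | succ q ih =>
    cases l with
    | nil => simp
    | cons x l =>
      rw [List.flatten_cons, List.drop_succ_cons, ← ih fun y hy => h y (by simp [hy]), Nat.succ_mul,
        add_comm, ← List.drop_drop, ← h x (by simp), List.drop_left]

theorem flatten_length {α : Type*} {m : ℕ} {l : List (List α)} (h : ∀ x ∈ l, x.length = m) :
    l.flatten.length = l.length * m := by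
  induction l with
  | nil => simp
  | cons x l ih =>
    rw [List.flatten_cons, List.length_append, ih fun y hy => h y (by simp [hy]), h x (by simp),
      List.length_cons, Nat.succ_mul, add_comm]

/-- Any `b` consecutive blocks of an independent sequence are distributed like `b` fresh blocks. The
overlap of the windows plays no role in expectations. -/
theorem rep_E_window {α : Type} {G : Gen α} (hG : G.Pos) {N b t : ℕ} (h1 : b ≤ t) (h2 : t ≤ N)
    (f : List α → ℝ) : (G.rep N).E (fun l => f ((l.take t).drop (t - b))) = (G.rep b).E f := by
  obtain ⟨u, rfl⟩ : ∃ u, t = u + b := ⟨t - b, by omega⟩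
  obtain ⟨v, rfl⟩ : ∃ v, N = u + (b + v) := ⟨N - (u + b), by omega⟩
  rw [Gen.rep_add_E]
  rw [← Gen.E_const (G.rep u) (Gen.rep_pos hG u) ((G.rep b).E f)]
  refine Gen.E_congr _ fun l₁ hl₁ => ?_
  rw [Gen.rep_add_E]
  refine Gen.E_congr _ fun l₂ hl₂ => ?_
  rw [← Gen.E_const (G.rep v) (Gen.rep_pos hG v) (f l₂)]
  refine Gen.E_congr _ fun l₃ _ => ?_
  congr 1
  have e1 := (Gen.rep_mem hl₁).1
  have e2 := (Gen.rep_mem hl₂).1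
  rw [← List.append_assoc, List.take_append_of_le_length (by simp; omega),
    List.take_of_length_le (by simp; omega), Nat.add_sub_cancel, ← e1, List.drop_left]

theorem winF_eq {p : ℕ} {D : Par} (hlr : D.lr = D.m * D.b) (tab : List ℕ) (w : ℕ → ℕ) {bl : List (List Cls)}
    (hbl : ∀ x ∈ bl, x.length = D.m) {t : ℕ} (ht : t ≤ bl.length) (i : ℕ) :
    winF p D tab w (bl.take t).flatten i = (fp p D.l tab (trunc D.lw w) i
      ((bl.take t).drop (t - D.b)).flatten).val := by
  have h : ∀ x ∈ bl.take t, x.length = D.m := fun x hx => hbl x (List.mem_of_mem_take hx)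
  rw [winF, flatten_length h, ← flatten_drop h, List.length_take, min_eq_left ht, hlr,
    mul_comm D.m, Nat.sub_mul]

theorem sum_map_range (f : ℕ → ℕ) (n : ℕ) : ((List.range n).map f).sum = ∑ i ∈ Finset.range n, f i := by
  induction n with
  | zero => simp
  | succ n ih => rw [List.sum_range_succ, ih, Finset.sum_range_succ]

open Classical in
theorem countP_cands (D : Par) (F : ℕ → ℕ) (Q : ℕ × ℕ → Prop) :
    ((cands D F).countP (fun x => decide (Q x)) : ℝ) = ∑ j ∈ Finset.range (D.ly + 1 - D.l),
      ∑ i ∈ Finset.range (D.lx + 1 - D.l), ind (F i % D.n = F (D.lx + j) % D.n ∧ Q (i, j)) := by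
  rw [cands, List.countP_flatMap, sum_map_range, Nat.cast_sum]
  refine Finset.sum_congr rfl fun j _ => ?_
  rw [sum_ind, Function.comp, List.countP_map, List.countP_filter, List.countP_reverse,
    List.countP_eq_length_filter]
  rw [← mem_range_filter_length]
  congr 2
  refine List.filter_congr fun i _ => ?_
  simp [Bool.and_comm]

open Classical in
theorem countP_allCands (p : ℕ) (D : Par) (tab : List ℕ) (w : ℕ → ℕ) (bl : List (List Cls)) (m : ℕ)
    (Q : ℕ × ℕ → Prop) :
    ((allCands p D tab w bl m).countP (fun x => decide (Q x)) : ℝ) = ∑ t ∈ Finset.range m,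
      ∑ j ∈ Finset.range (D.ly + 1 - D.l), ∑ i ∈ Finset.range (D.lx + 1 - D.l),
      ind (D.b < t + 2 ∧ winF p D tab w (bl.take (t + 1)).flatten i % D.n =
      winF p D tab w (bl.take (t + 1)).flatten (D.lx + j) % D.n ∧ Q (i, j)) := by
  rw [allCands, List.countP_flatMap, sum_map_range, Nat.cast_sum]
  refine Finset.sum_congr rfl fun t _ => ?_
  rw [Function.comp]
  by_cases h : D.b < t + 2
  · rw [if_pos h, countP_cands]
    simp only [h, true_and]
  · rw [if_neg h]
    simp only [h, false_and]
    rw [List.countP_nil, Nat.cast_zero, eq_comm]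
    exact Finset.sum_eq_zero fun j _ => Finset.sum_eq_zero fun i _ => ind_of_not (by simp)

-- A random position below `lim` selects each element with probability at most `1 / lim`; positions
-- behind the end of the list select nothing.
open Classical in
theorem unif_E_getElem_le {α : Type} (L : List α) (Q : α → Prop) (lim : ℕ) :
    (Gen.unif lim).E (fun r => ind (∃ x, L[r]? = some x ∧ Q x)) ≤ L.countP (fun x => decide (Q x)) / lim := by
  rw [Gen.unif_E]
  gcongr
  induction L generalizing lim with
  | nil => simp [ind]
  | cons a L ih =>
    cases lim with
    | zero => simp
    | succ lim =>
      rw [Finset.sum_range_succ', List.countP_cons]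
      have h1 := ih lim
      simp only [List.getElem?_cons_succ, List.getElem?_cons_zero]
      have h2 : ind (∃ x, some a = some x ∧ Q x) = if decide (Q a) = true then 1 else 0 := by
        by_cases h : Q a <;> simp [ind, h]
      rw [h2]
      push_cast
      linarith

theorem mem_cands_of {D : Par} {F : ℕ → ℕ} {i j : ℕ} (hi : i < D.lx + 1 - D.l) (hj : j < D.ly + 1 - D.l)
    (h : F i = F (D.lx + j)) : (i, j) ∈ cands D F := by
  simp only [cands, List.mem_flatMap, List.mem_map, List.mem_filter, List.mem_reverse,
    List.mem_range, decide_eq_true_eq]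
  exact ⟨j, hj, i, ⟨hi, by rw [h]⟩, rfl⟩

/-- The letters at the positions below `N` are distinct modulo `p` if they are distinct. -/
def SepMod (p : ℕ) (inp : ℕ → ℕ) (N : ℕ) : Prop :=
  ∀ x < N, ∀ y < N, inp x % p = inp y % p → inp x = inp y

theorem misSet_eq {p : ℕ} {inp : ℕ → ℕ} {lw l i j : ℕ} (hs : SepMod p inp lw) (hi : i + l ≤ lw)
    (hj : j + l ≤ lw) :
    misSet p l (trunc lw fun x => inp x % p) i j =
      (Finset.range l).filter fun v => inp (i + v) ≠ inp (j + v) := by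
  refine Finset.filter_congr fun v hv => ?_
  have hv : v < l := Finset.mem_range.1 hv
  rw [trunc, trunc, if_pos (by omega), if_pos (by omega)]
  refine not_congr ⟨fun h => hs _ (by omega) _ (by omega) ?_, fun h => by rw [h]⟩
  rw [ZMod.natCast_mod, ZMod.natCast_mod] at h
  exact (ZMod.natCast_eq_natCast_iff' _ _ _).1 h

/-- This is the side without error: windows whose mismatches are avoided by all classes get equal
fingerprints with certainty. -/
theorem fp_congr {p l : ℕ} {tab : List ℕ} {w : ℕ → ℕ} {i j : ℕ} {cs : List Cls}
    (h : ∀ a ∈ cs, ¬ Hit (misSet p l w i j) tab a) : fp p l tab w i cs = fp p l tab w j cs := by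
  rw [fp, fp]
  congr 1
  exact List.map_congr_left fun a ha => clsVal_eq_of_not_hit (h a ha)

/-- No class of the block contains an element of `S`. -/
def Clean (S : Finset ℕ) (tab : List ℕ) (cs : List Cls) : Prop := ∀ a ∈ cs, ¬ Hit S tab a

theorem E_clean {G : Gen Cls} (hG : G.Pos) (S : Finset ℕ) (tab : List ℕ) (m : ℕ) :
    (G.rep m).E (fun cs => ind (Clean S tab cs)) = (1 - G.E (fun a => ind (Hit S tab a))) ^ m := by
  rw [← Gen.E_ind_not _ hG, ← Gen.rep_prod_E]
  refine Gen.E_congr _ fun cs hcs => ?_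
  clear hcs
  induction cs with
  | nil => exact ind_of (by simp [Clean])
  | cons a cs ih =>
    rw [List.map_cons, List.prod_cons, ← ih, ← ind_and]
    simp only [Clean, List.forall_mem_cons]

/-! ### Failure probability for a fixed modulus. -/

section Fixed
variable {D : Par} {p : ℕ} {tab : List ℕ} {w : ℕ → ℕ}

/-- A run of `b` clean blocks is exactly one position of the sliding window, and there the two
fingerprints agree. -/
theorem mem_allCands_of_run {i j m : ℕ} (hlr : D.lr = D.m * D.b) {bl : List (List Cls)}
    (hbl : ∀ x ∈ bl, x.length = D.m) (hm : bl.length = m) (hi : i < D.lx + 1 - D.l)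
    (hj : j < D.ly + 1 - D.l) (hb : 0 < D.b)
    (h : ¬ NoRun (Clean (misSet p D.l (trunc D.lw w) i (D.lx + j)) tab) D.b 0 bl) :
    (i, j) ∈ allCands p D tab w bl m := by
  obtain ⟨s, hs, hs1, hs2, hs3⟩ := exists_run bl 0 [] hb le_rfl (by simp) h
  simp only [List.length_nil, zero_add, List.nil_append] at hs2 hs3
  obtain ⟨t, rfl⟩ : ∃ t, s = t + 1 := ⟨s - 1, by omega⟩
  simp only [allCands, List.mem_flatMap, List.mem_range]
  refine ⟨t, by omega, ?_⟩
  rw [if_pos (by omega)]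
  refine mem_cands_of hi hj ?_
  rw [winF_eq hlr tab w hbl hs, winF_eq hlr tab w hbl hs]
  congr 1
  refine fp_congr fun a ha => ?_
  obtain ⟨cs, hcs, ha⟩ := List.mem_flatten.1 ha
  exact hs3 cs hcs a ha

theorem E_not_mem_allCands_le {i j np : ℕ} (hlr : D.lr = D.m * D.b) (hnp : 0 < np) (hR : 0 < D.R)
    (hB : 0 < D.B) (hi : i < D.lx + 1 - D.l) (hj : j < D.ly + 1 - D.l) (hb : 0 < D.b) (hnt : 0 < D.nt)
    {β : ℝ} (hβ0 : 0 < β)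
    (hβ : β ≤ ((clsGen np D.R D.B).rep D.m).E (fun cs => ind
      (Clean (misSet p D.l (trunc D.lw w) i (D.lx + j)) tab cs))) :
    (blockGen D np D.nt).E (fun bl => ind ((i, j) ∉ allCands p D tab w bl D.nt)) ≤
      (∑ i ∈ Finset.Ico 1 (D.b + 1), β⁻¹ ^ i) / D.nt := by
  have hG : ((clsGen np D.R D.B).rep D.m).Pos := Gen.rep_pos (clsGen_pos hnp hR hB) _
  rw [le_div_iff₀ (by exact_mod_cast hnt), mul_comm]
  set β' := ((clsGen np D.R D.B).rep D.m).E
      (fun cs => ind (Clean (misSet p D.l (trunc D.lw w) i (D.lx + j)) tab cs)) with hβ'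
  have hβ'0 : 0 < β' := hβ0.trans_le hβ
  refine le_trans ?_ ((rep_E_noRun_le hG hβ'0 hβ'.symm D.nt 0 hb).trans ?_)
  · refine mul_le_mul_of_nonneg_left (Gen.E_mono _ fun bl hbl => ind_mono fun h => ?_)
      (Nat.cast_nonneg _)
    by_contra hn
    obtain ⟨h1, h2⟩ := Gen.rep_mem hbl
    exact h (mem_allCands_of_run hlr (fun x hx => (Gen.rep_mem (h2 x hx)).1) h1 hi hj hb hn)
  · refine Finset.sum_le_sum fun i _ => ?_
    gcongr

open Classical in
/-- The expected number of candidates that satisfy a condition. -/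
theorem E_countP_allCands_le {np : ℕ} (hlr : D.lr = D.m * D.b) (hnp : 0 < np) (hR : 0 < D.R) (hB : 0 < D.B)
    (hlx : D.lx ≤ D.n) (hly : D.ly ≤ D.n) (hl : 1 ≤ D.l) {μ : ℝ} (hμ0 : 0 ≤ μ) {Q : ℕ × ℕ → Prop}
    {q : ℕ × ℕ → ℝ} (hQ : ∀ x, 0 ≤ q x) {ν : ℝ}
    (hqν : ∀ i j, i < D.lx + 1 - D.l → j < D.ly + 1 - D.l → Q (i, j) → q (i, j) ≤ ν) (hν : 0 ≤ ν)
    (hμ : ∀ i j, i < D.lx + 1 - D.l → j < D.ly + 1 - D.l → Q (i, j) →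
      ((clsGen np D.R D.B).rep (D.b * D.m)).E (fun cs => ind
      ( (fp p D.l tab (trunc D.lw w) i cs).val % D.n =
      (fp p D.l tab (trunc D.lw w) (D.lx + j) cs).val % D.n)) ≤ μ) :
    (blockGen D np D.nt).E (fun bl => ∑ t ∈ Finset.range D.nt, ∑ j ∈ Finset.range (D.ly + 1 - D.l),
      ∑ i ∈ Finset.range (D.lx + 1 - D.l), ind (D.b < t + 2 ∧
      winF p D tab w (bl.take (t + 1)).flatten i % D.n =
      winF p D tab w (bl.take (t + 1)).flatten (D.lx + j) % D.n ∧ Q (i, j)) * q (i, j)) ≤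
      D.nt * (D.n * D.n) * (μ * ν) := by
  have hG : ((clsGen np D.R D.B).rep D.m).Pos := Gen.rep_pos (clsGen_pos hnp hR hB) _
  simp only [Gen.E_sum, Gen.E_mul_right]
  have key : ∀ t ∈ Finset.range D.nt, ∀ j ∈ Finset.range (D.ly + 1 - D.l),
      ∀ i ∈ Finset.range (D.lx + 1 - D.l), (blockGen D np D.nt).E (fun bl => ind (D.b < t + 2 ∧
        winF p D tab w (bl.take (t + 1)).flatten i % D.n =
          winF p D tab w (bl.take (t + 1)).flatten (D.lx + j) % D.n ∧ Q (i, j))) * q (i, j) ≤ μ * ν := by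
    intro t ht j hj i hi
    rw [Finset.mem_range] at ht hj hi
    by_cases hq : Q (i, j)
    · refine mul_le_mul ?_ (hqν i j hi hj hq) (hQ _) hμ0
      by_cases hbt : D.b < t + 2
      · refine le_trans (le_of_eq ?_) (hμ i j hi hj hq)
        -- The window that ends with block `t` may be replaced by `b` fresh blocks, that is, by `b *
        -- m` independent classes.
        rw [← Gen.rep_mul_E, ← rep_E_window hG (N := D.nt) (b := D.b) (t := t + 1) (by omega) (by omega)
          (fun l => ind ((fp p D.l tab (trunc D.lw w) i l.flatten).val % D.n =
            (fp p D.l tab (trunc D.lw w) (D.lx + j) l.flatten).val % D.n))]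
        refine Gen.E_congr _ fun bl hbl => ?_
        obtain ⟨h1, h2⟩ := Gen.rep_mem hbl
        have h3 : ∀ x ∈ bl, x.length = D.m := fun x hx => (Gen.rep_mem (h2 x hx)).1
        simp only [hbt, hq, true_and, and_true]
        rw [winF_eq hlr tab w h3 (by omega), winF_eq hlr tab w h3 (by omega)]
      · rw [← Gen.E_zero] at hμ0
        refine le_trans (le_of_eq ?_) hμ0
        exact Gen.E_congr _ fun bl _ => ind_of_not fun h => hbt h.1
    · refine le_trans (le_of_eq ?_) (mul_nonneg hμ0 hν)
      rw [mul_eq_zero]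
      left
      rw [← (blockGen D np D.nt).E_zero]
      exact Gen.E_congr _ fun bl _ => ind_of_not fun h => hq h.2.2
  calc _ ≤ ∑ t ∈ Finset.range D.nt, ∑ j ∈ Finset.range (D.ly + 1 - D.l),
        ∑ i ∈ Finset.range (D.lx + 1 - D.l), μ * ν :=
        Finset.sum_le_sum fun t ht => Finset.sum_le_sum fun j hj => Finset.sum_le_sum fun i hi =>
          key t ht j hj i hi
    _ = D.nt * ((D.ly + 1 - D.l : ℕ) * (D.lx + 1 - D.l : ℕ)) * (μ * ν) := by
        simp only [Finset.sum_const, Finset.card_range, nsmul_eq_mul]; ring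
    _ ≤ _ := by
        have h1 : ((D.ly + 1 - D.l : ℕ) : ℝ) ≤ D.n := by exact_mod_cast (by omega)
        have h2 : ((D.lx + 1 - D.l : ℕ) : ℝ) ≤ D.n := by exact_mod_cast (by omega)
        have h3 : 0 ≤ μ * ν := mul_nonneg hμ0 hν
        gcongr

/-- The event that the search fails for the candidate `(i, j)`. -/
theorem ind_ans_le {c : Cst} {ε : ℝ} {inp : ℕ → ℕ} {r i j : ℕ} {sk : ℕ → ℕ} (hlim2 : 0 < D.lim2)
    (hr : r < D.lim) (hv : validP ε D inp (i, j)) (L : List (ℕ × ℕ))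
    [DecidablePred fun x => badPass (passP c D sk) (validP ε D inp) x] :
    ind ((L.foldl (proc D.lim D.lim2 r (passP c D sk) (validP ε D inp)) ⟨0, 0, 0, 0, 0⟩).ans ≠ 1) ≤
      ind ((i, j) ∉ L) + ind (¬ passP c D sk (i, j)) + ind (∃ x, L[r]? = some x ∧ ¬ validP ε D inp x) +
      (L.countP fun x => decide (badPass (passP c D sk) (validP ε D inp) x)) / D.lim2 := by
  have hl : (0 : ℝ) < D.lim2 := by exact_mod_cast hlim2
  have n1 := ind_nonneg ((i, j) ∉ L)
  have n2 := ind_nonneg (¬ passP c D sk (i, j))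
  have n3 := ind_nonneg (∃ x, L[r]? = some x ∧ ¬ validP ε D inp x)
  have n4 : (0 : ℝ) ≤ (L.countP fun x => decide (badPass (passP c D sk) (validP ε D inp) x)) /
    D.lim2 := by positivity
  refine ind_le (by linarith) fun h => ?_
  by_contra hlt
  have h1 : (i, j) ∈ L := by
    by_contra hn; rw [ind_of hn] at hlt n1; linarith
  have h2 : passP c D sk (i, j) := by
    by_contra hn; rw [ind_of hn] at hlt; linarith
  have h3 : ¬ ∃ x, L[r]? = some x ∧ ¬ validP ε D inp x := by
    intro hn; rw [ind_of hn] at hlt; linarith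
  have h4 : (L.countP fun x => decide (badPass (passP c D sk) (validP ε D inp) x)) < D.lim2 := by
    by_contra hn
    have : (1 : ℝ) ≤ (L.countP fun x => decide (badPass (passP c D sk) (validP ε D inp) x)) /
        D.lim2 := by
      rw [one_le_div hl]; exact_mod_cast not_lt.1 hn
    linarith
  refine h (foldl_proc_complete hr ?_ (fun x hx => ?_) ⟨_, h1, h2, hv⟩)
  · convert h4
  · by_contra hn; exact h3 ⟨x, hx, hn⟩

/-- The conditions for a bound of the failure probability for a fixed modulus `p`. -/
structure Probs (c : Cst) (ε : ℝ) (D : Par) (inp : ℕ → ℕ) (tab : List ℕ) (p i j : ℕ)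
    (β μ ν σ : ℝ) : Prop where
  lr : D.lr = D.m * D.b
  np : 0 < tab.length
  R : 0 < D.R
  B : 0 < D.B
  lx : D.lx ≤ D.n
  ly : D.ly ≤ D.n
  l : 1 ≤ D.l
  b : 0 < D.b
  nt : 0 < D.nt
  lim : 0 < D.lim
  lim2 : 0 < D.lim2
  i_lt : i < D.lx + 1 - D.l
  j_lt : j < D.ly + 1 - D.l
  valid : validP ε D inp (i, j)
  β0 : 0 < β
  μ0 : 0 ≤ μ
  ν0 : 0 ≤ ν
  clean : β ≤ ((clsGen tab.length D.R D.B).rep D.m).E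
      (fun cs => ind (Clean (misSet p D.l (trunc D.lw fun x => inp x % p) i (D.lx + j)) tab cs))
  bad : ∀ i j, i < D.lx + 1 - D.l → j < D.ly + 1 - D.l → ¬ validP ε D inp (i, j) →
      ((clsGen tab.length D.R D.B).rep (D.b * D.m)).E (fun cs => ind (
        (fp p D.l tab (trunc D.lw fun x => inp x % p) i cs).val % D.n =
        (fp p D.l tab (trunc D.lw fun x => inp x % p) (D.lx + j) cs).val % D.n)) ≤ μ
  pass : ∀ i j, i < D.lx + 1 - D.l → j < D.ly + 1 - D.l → ¬ validP ε D inp (i, j) →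
      (blockGen D tab.length D.ls).E (fun bl => ind (passP c D (fun x => skVal p D.l c.g tab
        (trunc D.lw fun x => inp x % p) x bl) (i, j))) ≤ ν
  good : (blockGen D tab.length D.ls).E (fun bl => ind (¬ passP c D (fun x => skVal p D.l c.g tab
        (trunc D.lw fun x => inp x % p) x bl) (i, j))) ≤ σ

/-- The four terms bound the ways to fail: no run of clean blocks, a good pair rejected by its
sketches, a bad candidate at the random position `r`, and too many bad candidates that pass. The
last two are Markov bounds from expected numbers of bad candidates. -/
theorem Probs.E_le {c : Cst} {ε : ℝ} {inp : ℕ → ℕ} {i j : ℕ} {β μ ν σ : ℝ}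
    (h : Probs c ε D inp tab p i j β μ ν σ) :
    ((Gen.unif D.lim).prod ((blockGen D tab.length D.ls).prod (blockGen D tab.length D.nt))).E
      (fun x => ind (((allCands p D tab (fun x => inp x % p) x.2.2 D.nt).foldl
      (proc D.lim D.lim2 x.1 (passP c D fun i => skVal p D.l c.g tab (trunc D.lw fun x => inp x % p) i
      x.2.1) (validP ε D inp)) ⟨0, 0, 0, 0, 0⟩).ans ≠ 1)) ≤ (∑ i ∈ Finset.Ico 1 (D.b + 1), β⁻¹ ^ i) / D.nt +
      σ + D.nt * (D.n * D.n) * μ / D.lim + D.nt * (D.n * D.n) * (μ * ν) / D.lim2 := by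
  classical
  have hG : (clsGen tab.length D.R D.B).Pos := clsGen_pos h.np h.R h.B
  have hP : ∀ q, (blockGen D tab.length q).Pos := fun q => Gen.rep_pos (Gen.rep_pos hG _) _
  set w : ℕ → ℕ := fun x => inp x % p with hw
  set sk : List (List Cls) → ℕ → ℕ := fun bl i => skVal p D.l c.g tab (trunc D.lw w) i bl with hsk
  set G1 := blockGen D tab.length D.ls
  set G2 := blockGen D tab.length D.nt
  have hU := Gen.unif_pos h.lim
  have step : ((Gen.unif D.lim).prod (G1.prod G2)).E (fun x =>
      ind (((allCands p D tab w x.2.2 D.nt).foldl (proc D.lim D.lim2 x.1 (passP c D (sk x.2.1))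
        (validP ε D inp)) ⟨0, 0, 0, 0, 0⟩).ans ≠ 1)) ≤ ((Gen.unif D.lim).prod (G1.prod G2)).E (fun x =>
        ind ((i, j) ∉ allCands p D tab w x.2.2 D.nt) + ind (¬ passP c D (sk x.2.1) (i, j)) +
        ind (∃ y, (allCands p D tab w x.2.2 D.nt)[x.1]? = some y ∧ ¬ validP ε D inp y) +
        ((allCands p D tab w x.2.2 D.nt).countP fun y =>
          decide (badPass (passP c D (sk x.2.1)) (validP ε D inp) y)) / D.lim2) := by
    refine Gen.E_mono _ fun x hx => ?_
    have hr := Gen.unif_mem.1 (Gen.prod_mem hx).1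
    exact ind_ans_le h.lim2 hr h.valid _
  refine step.trans ?_
  rw [Gen.E_add, Gen.E_add, Gen.E_add]
  simp only [div_eq_mul_inv _ (D.lim2 : ℝ), Gen.E_mul_right]
  simp only [Gen.prod_E]
  have b1 : (Gen.unif D.lim).E (fun _ => G1.E (fun _ => G2.E (fun bl =>
      ind ((i, j) ∉ allCands p D tab w bl D.nt)))) ≤ (∑ i ∈ Finset.Ico 1 (D.b + 1), β⁻¹ ^ i) / D.nt := by
    rw [Gen.E_const _ hU, Gen.E_const _ (hP _)]
    exact E_not_mem_allCands_le h.lr h.np h.R h.B h.i_lt h.j_lt h.b h.nt h.β0 h.clean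
  have b2 : (Gen.unif D.lim).E (fun _ => G1.E (fun b => G2.E (fun _ =>
      ind (¬ passP c D (sk b) (i, j))))) ≤ σ := by
    rw [Gen.E_const _ hU]
    refine le_trans (le_of_eq ?_) h.good
    exact Gen.E_congr _ fun b _ => Gen.E_const _ (hP _) _
  have b3 : (Gen.unif D.lim).E (fun r => G1.E (fun _ => G2.E (fun bl =>
      ind (∃ y, (allCands p D tab w bl D.nt)[r]? = some y ∧ ¬ validP ε D inp y)))) ≤
      D.nt * (D.n * D.n) * μ / D.lim := by
    rw [Gen.E_swap]
    refine Gen.E_le_const _ (hP _) fun _ _ => ?_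
    rw [Gen.E_swap]
    calc _ ≤ G2.E (fun bl => ((allCands p D tab w bl D.nt).countP fun y =>
            decide (¬ validP ε D inp y)) * (D.lim : ℝ)⁻¹) := by
          refine Gen.E_mono _ fun bl _ => ?_
          rw [← div_eq_mul_inv]
          convert unif_E_getElem_le (allCands p D tab w bl D.nt) (fun y => ¬ validP ε D inp y) D.lim
      _ = G2.E (fun bl => ((allCands p D tab w bl D.nt).countP fun y =>
            decide (¬ validP ε D inp y) : ℝ)) / D.lim := by
          rw [Gen.E_mul_right, div_eq_mul_inv]
      _ ≤ _ := by
          gcongr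
          have := E_countP_allCands_le (D := D) (p := p) (tab := tab) (w := w) h.lr h.np h.R h.B h.lx
            h.ly h.l h.μ0 (Q := fun y => ¬ validP ε D inp y) (q := fun _ => 1) (ν := 1)
            (fun _ => zero_le_one) (fun _ _ _ _ _ => le_rfl) zero_le_one h.bad
          simp only [mul_one] at this
          refine le_trans (le_of_eq ?_) this
          refine Gen.E_congr _ fun bl _ => ?_
          convert countP_allCands p D tab w bl D.nt (fun y => ¬ validP ε D inp y)
  -- Sketches and search use independent blocks, so the probabilities `μ` of a common bucket and `ν`
  -- of passing multiply.
  have b4 : (Gen.unif D.lim).E (fun _ => G1.E (fun b => G2.E (fun bl =>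
      ((allCands p D tab w bl D.nt).countP fun y =>
          decide (badPass (passP c D (sk b)) (validP ε D inp) y) : ℝ)))) ≤ D.nt * (D.n * D.n) * (μ * ν) := by
    rw [Gen.E_const _ hU, Gen.E_swap]
    have := E_countP_allCands_le (D := D) (p := p) (tab := tab) (w := w) h.lr h.np h.R h.B h.lx
      h.ly h.l h.μ0 (Q := fun y => ¬ validP ε D inp y)
      (q := fun y => G1.E (fun b => ind (passP c D (sk b) y))) (ν := ν)
      (fun _ => Gen.E_nonneg _ fun _ _ => ind_nonneg _) h.pass h.ν0 h.bad
    refine le_trans (le_of_eq ?_) this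
    refine Gen.E_congr _ fun bl _ => ?_
    simp only [countP_allCands, Gen.E_sum]
    refine Finset.sum_congr rfl fun t _ => Finset.sum_congr rfl fun j _ =>
      Finset.sum_congr rfl fun i _ => ?_
    rw [← Gen.E_mul_left]
    refine Gen.E_congr _ fun b _ => ?_
    rw [← ind_and]
    congr 1
    simp only [badPass, eq_iff_iff]
    tauto
  have b5 := mul_le_mul_of_nonneg_right b4 (inv_nonneg.2 (Nat.cast_nonneg (α := ℝ) D.lim2))
  linarith

end Fixed

/-! ### Prime counting and the table of moduli. -/

/-- The product of distinct prime divisors divides `m`, and each of these primes is at least `√R`;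
squaring avoids the root. -/
theorem pow_card_le_sq {T : Finset ℕ} {m R : ℕ} (hm : m ≠ 0) (hT : ∀ q ∈ T, q.Prime ∧ q ∣ m ∧ R ≤ q * q) :
    R ^ T.card ≤ m * m := by
  have h1 : ∏ q ∈ T, q ∣ m :=
    Finset.prod_primes_dvd m (fun q hq => (hT q hq).1.prime) fun q hq => (hT q hq).2.1
  have h2 := Nat.le_of_dvd (Nat.pos_of_ne_zero hm) h1
  calc R ^ T.card = ∏ _q ∈ T, R := by rw [Finset.prod_const]
    _ ≤ ∏ q ∈ T, q * q := Finset.prod_le_prod' fun q hq => (hT q hq).2.2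
    _ = (∏ q ∈ T, q) * ∏ q ∈ T, q := Finset.prod_mul_distrib
    _ ≤ m * m := Nat.mul_le_mul h2 h2

theorem card_primes_dvd_le {T : Finset ℕ} {m v : ℕ} (hm : m ≠ 0) (hv : m < 2 ^ v)
    (hT : ∀ q ∈ T, q.Prime ∧ q ∣ m) : T.card ≤ v := by
  have h1 := pow_card_le_sq (R := 2 * 2) hm fun q hq =>
    ⟨(hT q hq).1, (hT q hq).2, Nat.mul_le_mul (hT q hq).1.two_le (hT q hq).1.two_le⟩
  rw [mul_pow] at h1
  have h2 : 2 ^ T.card ≤ m := by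
    by_contra h
    have := Nat.mul_lt_mul'' (not_le.1 h) (not_le.1 h)
    omega
  exact (Nat.pow_lt_pow_iff_right (by omega)).1 (h2.trans_lt hv) |>.le

theorem log_le_four_mul {R : ℝ} (hR : 0 < R) : Real.log R ≤ 4 * √(√R) := by
  have h1 : 0 < √(√R) := Real.sqrt_pos.2 (Real.sqrt_pos.2 hR)
  have h2 := Real.log_le_sub_one_of_pos h1
  rw [Real.log_sqrt (Real.sqrt_nonneg _), Real.log_sqrt hR.le] at h2
  linarith

/-- From Chebyshev's lower bound. The extra `√R` pays for discarding the small primes. The threshold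
is `20736 = 12 ^ 4`: with `s` the fourth root of `R`, one has `log R ≤ 4 s`, and `s ≥ 12` makes `s ^
4` dominate the lower order terms. -/
theorem primeCounting_ge {R : ℕ} (hR : 20736 ≤ R) : R / (4 * Real.log R) + √R ≤ Nat.primeCounting R := by
  have hR' : (20736 : ℝ) ≤ R := by exact_mod_cast hR
  have hlog : 0 < Real.log R := Real.log_pos (by linarith)
  refine le_trans ?_ (Chebyshev.pi_ge R)
  have e : (R : ℝ) / (4 * Real.log R) + √R = (R / 4 + √R * Real.log R) / Real.log R := by
    field_simp
  rw [e]
  refine div_le_div_of_nonneg_right ?_ hlog.le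
  set s := √(√(R : ℝ)) with hs
  have hs2 : s * s = √R := Real.mul_self_sqrt (Real.sqrt_nonneg _)
  have hs4 : √(R : ℝ) * √R = R := Real.mul_self_sqrt (by linarith)
  have hs12 : 12 ≤ s := Real.le_sqrt_of_sq_le (Real.le_sqrt_of_sq_le (by norm_num; linarith))
  have h1 : Real.log R ≤ 4 * s := log_le_four_mul (by linarith)
  have h2 : Real.log (R + 1) ≤ 4 * s + 1 := by
    have h3 : Real.log (R + 1) ≤ Real.log (R * 2) := Real.log_le_log (by linarith) (by linarith)
    rw [Real.log_mul (by linarith) (by norm_num)] at h3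
    have := Real.log_two_lt_d9
    linarith
  have h3 := Real.log_two_gt_d9
  have h4 : (R : ℝ) = s ^ 4 := by rw [← hs4, ← hs2]; ring
  have h5 : √(R : ℝ) * Real.log R ≤ s * s * (4 * s) := by
    rw [hs2]; exact mul_le_mul_of_nonneg_left h1 (Real.sqrt_nonneg _)
  have h6 : (0.6931 : ℝ) * R ≤ R * Real.log 2 := by nlinarith
  have h7 : s ^ 4 ≥ 12 * s ^ 3 := by
    have : 0 ≤ s ^ 3 := by positivity
    nlinarith
  have h8 : s ^ 3 ≥ 144 * s := by nlinarith [mul_nonneg (by linarith : 0 ≤ s) (by nlinarith : 0 ≤ s * s - 144)]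
  linarith

/-- The properties of the table of moduli. -/
structure TabOk (n R : ℕ) (tab : List ℕ) : Prop where
  pos : 0 < tab.length
  le : ∀ e < tab.length, 0 < tab.getD e 0 ∧ tab.getD e 0 ≤ R
  coll : ∀ δ, 0 < δ → δ < n → (((Finset.range tab.length).filter fun e => tab.getD e 0 ∣ δ).card : ℝ) ≤
      8 * Real.log n / R * tab.length

/-- For `R < n`, a number below `n` has at most `2 log n / log R` prime divisors that are at least
`√R`, while the table has at least `R / (4 log R)` entries. For `R ≥ n`, the only modulus `R`
divides no positive number below `n`. -/
theorem tabOk {n R : ℕ} (hR : 20736 ≤ R) (hn : 1 ≤ n) : TabOk n R (tabList n R) := by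
  classical
  have hR' : (0 : ℝ) < R := by exact_mod_cast (by omega : 0 < R)
  have hn' : 0 ≤ Real.log n := Real.log_nonneg (by exact_mod_cast hn)
  rw [tabList]
  split_ifs with hRn
  · set L := (List.range (R + 1)).filter (fun x => decide (x.Prime ∧ R ≤ x * x)) with hL
    have hnd : L.Nodup := List.nodup_range.filter _
    have hmem : ∀ x, x ∈ L ↔ x ≤ R ∧ x.Prime ∧ R ≤ x * x := fun x => by
      simp [hL, Nat.lt_succ_iff]
    have hget : ∀ e, e < L.length → L.getD e 0 ∈ L := fun e he => by
      rw [List.getD_eq_getElem _ _ he]; exact List.getElem_mem he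
    have hlog : 0 < Real.log R := Real.log_pos (by exact_mod_cast (by omega : 1 < R))
    have hlen : R / (4 * Real.log R) ≤ L.length := by
      have h1 := primeCounting_ge hR
      have h2 : Nat.primeCounting R ≤ L.length + R.sqrt := by
        rw [Nat.primeCounting, Nat.primeCounting', Nat.count_eq_card_filter_range, hL,
          mem_range_filter_length]
        have h3 : (Finset.range (R + 1)).filter Nat.Prime ⊆
            (Finset.range (R + 1)).filter (fun x => x.Prime ∧ R ≤ x * x) ∪ Finset.Icc 1 R.sqrt := by
          intro x hx
          simp only [Finset.mem_union, Finset.mem_filter, Finset.mem_Icc] at hx ⊢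
          rcases le_or_gt R (x * x) with h | h
          · exact .inl ⟨hx.1, hx.2, h⟩
          · exact .inr ⟨hx.2.one_le, Nat.le_sqrt.2 h.le⟩
        refine (Finset.card_le_card h3).trans ((Finset.card_union_le _ _).trans ?_)
        simp
      have h3 : (R.sqrt : ℝ) ≤ √R := Real.nat_sqrt_le_real_sqrt
      have h4 : (Nat.primeCounting R : ℝ) ≤ L.length + R.sqrt := by exact_mod_cast h2
      linarith
    have hpos : 0 < L.length := by
      have : (0 : ℝ) < L.length := lt_of_lt_of_le (by positivity) hlen
      exact_mod_cast this
    refine ⟨hpos, fun e he => ?_, fun δ h0 hδ => ?_⟩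
    · have := (hmem _).1 (hget e he)
      exact ⟨this.2.1.pos, this.1⟩
    · set T := (Finset.range L.length).filter fun e => L.getD e 0 ∣ δ with hT
      have hcard : (T.image fun e => L.getD e 0).card = T.card := by
        refine Finset.card_image_of_injOn fun e he e' he' h => ?_
        have h1 : e < L.length := by simpa using (Finset.mem_filter.1 he).1
        have h2 : e' < L.length := by simpa using (Finset.mem_filter.1 he').1
        rw [List.getD_eq_getElem _ _ h1, List.getD_eq_getElem _ _ h2] at h
        exact (hnd.getElem_inj_iff).1 h
      have h1 := pow_card_le_sq (T := T.image fun e => L.getD e 0) (R := R) h0.ne' (by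
        intro q hq
        obtain ⟨e, he, rfl⟩ := Finset.mem_image.1 hq
        obtain ⟨he, hd⟩ := Finset.mem_filter.1 he
        have := (hmem _).1 (hget e (by simpa using he))
        exact ⟨this.2.1, hd, this.2.2⟩)
      rw [hcard] at h1
      have h2 : (R : ℝ) ^ T.card ≤ (n : ℝ) * n := by
        exact_mod_cast h1.trans (Nat.mul_le_mul hδ.le hδ.le)
      have h3 := Real.log_le_log (by positivity) h2
      have hn0 : (n : ℝ) ≠ 0 := by exact_mod_cast (by omega : n ≠ 0)
      rw [Real.log_pow, Real.log_mul hn0 hn0] at h3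
      have h4 : (T.card : ℝ) ≤ 2 * Real.log n / Real.log R := by
        rw [le_div_iff₀ hlog]; linarith
      refine h4.trans ?_
      calc 2 * Real.log n / Real.log R = 8 * Real.log n / R * (R / (4 * Real.log R)) := by
            field_simp; ring
        _ ≤ _ := mul_le_mul_of_nonneg_left hlen (by positivity)
  · refine ⟨by simp, fun e he => ?_, fun δ h0 hδ => ?_⟩
    · obtain rfl : e = 0 := by simpa using he
      simp; omega
    · have : ¬ R ∣ δ := fun h => by have := Nat.le_of_dvd h0 h; omega
      simp [Finset.filter_singleton, this]
      positivity

/-! ### The random prime. -/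

theorem unif_E_goodTry_ge {a B : ℕ} (hB : 20736 ≤ B) :
    1 / (4 * Real.log B) - a / B ≤ (Gen.unif B).E (fun x => ind (goodTry a x)) := by
  classical
  have hB' : (20736 : ℝ) ≤ B := by exact_mod_cast hB
  rw [Gen.unif_E, sum_ind, le_div_iff₀ (by linarith), sub_mul, div_mul_cancel₀ _ (by linarith)]
  have h1 := primeCounting_ge hB
  have h2 : Nat.primeCounting B ≤ ((Finset.range B).filter (goodTry a)).card + (a + 1) := by
    rw [Nat.primeCounting, Nat.primeCounting', Nat.count_eq_card_filter_range]
    have h3 : (Finset.range (B + 1)).filter Nat.Prime ⊆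
        (Finset.range B).filter (goodTry a) ∪ (Finset.Icc 1 a ∪ {B}) := by
      intro x hx
      simp only [Finset.mem_union, Finset.mem_filter, Finset.mem_Icc, Finset.mem_range,
        Finset.mem_singleton, goodTry] at hx ⊢
      have := hx.2.one_le
      by_cases h : x = B
      · exact .inr (.inr h)
      · rcases lt_or_ge a x with h' | h'
        · exact .inl ⟨by omega, hx.2, h'⟩
        · exact .inr (.inl ⟨this, h'⟩)
    refine (Finset.card_le_card h3).trans ((Finset.card_union_le _ _).trans ?_)
    have := Finset.card_union_le (Finset.Icc 1 a) {B}
    simp at this ⊢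
    omega
  have h3 : (Nat.primeCounting B : ℝ) ≤ ((Finset.range B).filter (goodTry a)).card + (a + 1) := by
    exact_mod_cast h2
  have h4 : 1 ≤ √(B : ℝ) := Real.one_le_sqrt.2 (by linarith)
  have e : 1 / (4 * Real.log B) * (B : ℝ) = B / (4 * Real.log B) := by ring
  rw [e]
  linarith

/-- If `x` identifies two different letters, it divides their difference, which is positive and
below `2 ^ v` and so has at most `v` prime divisors. A union bound over the pairs of positions gives
the factor `N * N`. -/
theorem unif_E_not_sep_le {a B N v : ℕ} {inp : ℕ → ℕ} (hinp : ∀ x < N, inp x < 2 ^ v) :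
    (Gen.unif B).E (fun x => ind (goodTry a x ∧ ¬ SepMod x inp N)) ≤ N * N * v / B := by
  classical
  rw [Gen.unif_E]
  gcongr
  calc _ ≤ ∑ x ∈ Finset.range B, ∑ u ∈ Finset.range N, ∑ u' ∈ Finset.range N,
        ind (x.Prime ∧ inp u < inp u' ∧ x ∣ inp u' - inp u) := by
        refine Finset.sum_le_sum fun x _ => ind_le ?_ ?_
        · exact Finset.sum_nonneg fun _ _ => Finset.sum_nonneg fun _ _ => ind_nonneg _
        · rintro ⟨hx, hs⟩
          have key : ∃ u < N, ∃ u' < N, inp u < inp u' ∧ x ∣ inp u' - inp u := by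
            by_contra hn
            push Not at hn
            refine hs fun u hu u' hu' h => ?_
            by_contra hne
            rcases lt_or_gt_of_ne hne with hlt | hlt
            · exact hn u hu u' hu' hlt ((Nat.modEq_iff_dvd' hlt.le).1 h)
            · exact hn u' hu' u hu hlt ((Nat.modEq_iff_dvd' hlt.le).1 (Eq.symm h))
          obtain ⟨u, hu, u', hu', h⟩ := key
          calc (1 : ℝ) = ind (x.Prime ∧ inp u < inp u' ∧ x ∣ inp u' - inp u) :=
                (ind_of ⟨hx.1, h⟩).symm
            _ ≤ ∑ u' ∈ Finset.range N, ind (x.Prime ∧ inp u < inp u' ∧ x ∣ inp u' - inp u) :=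
                Finset.single_le_sum (f := fun u' => ind (x.Prime ∧ inp u < inp u' ∧
                  x ∣ inp u' - inp u)) (fun _ _ => ind_nonneg _) (Finset.mem_range.2 hu')
            _ ≤ _ := Finset.single_le_sum (f := fun u => ∑ u' ∈ Finset.range N,
                  ind (x.Prime ∧ inp u < inp u' ∧ x ∣ inp u' - inp u))
                  (fun _ _ => Finset.sum_nonneg fun _ _ => ind_nonneg _) (Finset.mem_range.2 hu)
    _ = ∑ u ∈ Finset.range N, ∑ u' ∈ Finset.range N, ∑ x ∈ Finset.range B,
        ind (x.Prime ∧ inp u < inp u' ∧ x ∣ inp u' - inp u) := by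
        rw [Finset.sum_comm]
        exact Finset.sum_congr rfl fun u _ => Finset.sum_comm
    _ ≤ ∑ u ∈ Finset.range N, ∑ u' ∈ Finset.range N, (v : ℝ) := by
        refine Finset.sum_le_sum fun u _ => Finset.sum_le_sum fun u' hu' => ?_
        rw [sum_ind]
        have hu'' := hinp u' (Finset.mem_range.1 hu')
        by_cases h : inp u < inp u'
        · have h2 := card_primes_dvd_le (m := inp u' - inp u) (v := v) (T := (Finset.range B).filter
            fun x => x.Prime ∧ inp u < inp u' ∧ x ∣ inp u' - inp u) (by omega) (by omega) (by
              intro q hq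
              rw [Finset.mem_filter] at hq
              exact ⟨hq.2.1, hq.2.2.2⟩)
          exact_mod_cast h2
        · simp [h]
    _ = _ := by simp; ring

/-- The modulus `p` is large enough, and it separates the letters. -/
def GoodMod (a : ℕ) (inp : ℕ → ℕ) (N p : ℕ) : Prop := goodTry a p ∧ SepMod p inp N

/-- Either no try is a large prime, or some try is one that fails to separate the letters. -/
theorem rep_E_firstGood_le {a B N : ℕ} (hB : 0 < B) {inp : ℕ → ℕ} {ρ η : ℝ} (hρ1 : ρ ≤ 1)
    (hρ : ρ ≤ (Gen.unif B).E (fun x => ind (goodTry a x))) (hρ0 : 0 ≤ ρ) (hη0 : 0 ≤ η)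
    (hη : (Gen.unif B).E (fun x => ind (goodTry a x ∧ ¬ SepMod x inp N)) ≤ η) (tr : ℕ) :
    ((Gen.unif B).rep tr).E (fun l => ind (¬ GoodMod a inp N (firstGood a l))) ≤ (1 - ρ) ^ tr + tr * η := by
  have hU := Gen.unif_pos hB
  induction tr with
  | zero => simpa using Gen.E_ind_le_one _ (Gen.rep_pos hU 0) _
  | succ t ih =>
    rw [Gen.rep_succ_E]
    set F := ((Gen.unif B).rep t).E (fun l => ind (¬ GoodMod a inp N (firstGood a l))) with hF
    have hF0 : 0 ≤ F := Gen.E_nonneg _ fun _ _ => ind_nonneg _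
    calc _ = (Gen.unif B).E (fun x => ind (goodTry a x ∧ ¬ SepMod x inp N) + ind (¬ goodTry a x) * F) := by
          refine Gen.E_congr _ fun x _ => ?_
          by_cases hx : goodTry a x
          · rw [ind_of_not (not_not.2 hx), zero_mul, add_zero]
            simp only [firstGood, if_pos hx]
            rw [Gen.E_const _ (Gen.rep_pos hU t)]
            congr 1
            simp [GoodMod, hx]
          · rw [ind_of hx, one_mul, ind_of_not fun h => hx h.1, zero_add]
            simp only [firstGood, if_neg hx]; rfl
      _ ≤ η + (1 - ρ) * F := by
          rw [Gen.E_add, Gen.E_mul_right, Gen.E_ind_not _ hU]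
          gcongr
      _ ≤ η + (1 - ρ) * ((1 - ρ) ^ t + t * η) := by
          have : 0 ≤ 1 - ρ := by linarith
          gcongr
      _ ≤ _ := by
          rw [pow_succ]; push_cast
          nlinarith [mul_nonneg hρ0 (mul_nonneg (Nat.cast_nonneg (α := ℝ) t) hη0)]

/-! ### Approximate logarithms computed with integers. -/

theorem log_le_size {n : ℕ} (hn : 1 ≤ n) : Real.log n ≤ n.size := by
  have h1 : (n : ℝ) ≤ 2 ^ n.size := by exact_mod_cast (Nat.lt_size_self n).le
  have h2 := Real.log_le_log (by exact_mod_cast hn) h1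
  rw [Real.log_pow] at h2
  have := Real.log_two_lt_d9
  nlinarith [Nat.cast_nonneg (α := ℝ) n.size]

theorem one_le_size {n : ℕ} (hn : 1 ≤ n) : (1 : ℝ) ≤ n.size := by
  exact_mod_cast Nat.size_pos.2 hn

theorem harmonic_cast (n : ℕ) : ((harmonic n : ℚ) : ℝ) = ∑ i ∈ Finset.range n, ((i : ℝ) + 1)⁻¹ := by
  rw [harmonic]; push_cast; rfl

theorem divSum_le_mul_log (n : ℕ) : (divSum n : ℝ) ≤ n * (1 + Real.log n) := by
  refine le_trans ?_ (mul_le_mul_of_nonneg_left (harmonic_le_one_add_log n) (Nat.cast_nonneg n))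
  rw [harmonic_cast, Finset.mul_sum, divSum, Nat.cast_sum]
  refine Finset.sum_le_sum fun i _ => Nat.cast_div_le.trans (le_of_eq ?_)
  push_cast; rfl

theorem divSum_div_le {n : ℕ} (hn : 1 ≤ n) : ((divSum n / n : ℕ) : ℝ) ≤ 1 + Real.log n := by
  refine Nat.cast_div_le.trans ?_
  rw [div_le_iff₀ (by exact_mod_cast hn), mul_comm]
  exact divSum_le_mul_log n

/-- The `n` floors in the sum lose at most `n` in total, which is `1` after the division by `n`; the
final floor loses another `1`. -/
theorem le_divSum_div {n : ℕ} (hn : 1 ≤ n) : Real.log n - 2 ≤ ((divSum n / n : ℕ) : ℝ) := by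
  have hn' : (1 : ℝ) ≤ n := by exact_mod_cast hn
  have hdiv : ∀ a b : ℕ, 0 < b → (a : ℝ) / b - 1 ≤ ((a / b : ℕ) : ℝ) := by
    intro a b hb
    have hb' : (0 : ℝ) < b := by exact_mod_cast hb
    have h1 : (a : ℝ) ≤ b * ((a / b : ℕ) + 1) := by exact_mod_cast (Nat.lt_mul_div_succ a hb).le
    rw [sub_le_iff_le_add, div_le_iff₀ hb']
    linarith
  have h1 : (n : ℝ) * harmonic n - n ≤ divSum n := by
    have h : ∑ i ∈ Finset.range n, ((n : ℝ) * ((i : ℝ) + 1)⁻¹ - 1) ≤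
        ∑ i ∈ Finset.range n, ((n / (i + 1) : ℕ) : ℝ) := by
      refine Finset.sum_le_sum fun i _ => ?_
      have := hdiv n (i + 1) (by omega)
      push_cast at this ⊢
      exact this
    rw [Finset.sum_sub_distrib, ← Finset.mul_sum, ← harmonic_cast] at h
    simpa [divSum] using h
  have h2 := hdiv (divSum n) n hn
  have h3 : Real.log n ≤ harmonic n := by
    refine le_trans (Real.log_le_log (by linarith) ?_) (log_add_one_le_harmonic n)
    push_cast; linarith
  have h4 : Real.log n - 1 ≤ (divSum n : ℝ) / n := by
    rw [le_div_iff₀ (by linarith)]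
    nlinarith
  linarith

theorem le_mul_ceilDiv {ε : ℝ} (hε : 0 < ε) (x : ℕ) : (x : ℝ) ≤ (1 + ε) * ceilDiv ε x :=
  (sub_le_mul_iff hε).1 (ceilDiv_mem hε x).2

theorem mul_ceilDiv_sub_one_le {ε : ℝ} (hε : 0 < ε) (x : ℕ) : (1 + ε) * (ceilDiv ε x - 1) ≤ x := by
  have h1 := (ceilDiv_mem hε x).1
  rcases Nat.lt_or_ge 1 (ceilDiv ε x) with h | h
  · have := not_of_lt_ceilDiv (ε := ε) (x := x) (b := ceilDiv ε x - 1) (by omega) (by omega)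
    rw [sub_le_mul_iff hε, not_le, Nat.cast_sub h1] at this
    simpa using this.le
  · have : ceilDiv ε x = 1 := by omega
    rw [this]; simp

/-! ### Failure probabilities for the chosen parameters. -/

/-- Conditions on the constants of the program, for the bound of its failure probability. -/
structure CstOk (c : Cst) (ε δ : ℝ) (a : ℕ) : Prop where
  C0 : 20736 ≤ c.C0
  C0' : 8 * (3 + ε) ≤ c.C0
  C0ε : 4 ≤ ε * (c.C0 - 1)
  C0ε' : 32 * (1 + ε) ≤ ε * c.C0
  g0 : 1 + ε ≤ c.g0
  g : 0 < c.g
  K1 : 0 < c.K1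
  -- Accidental agreement of a sketch digit must not close the gap between the chances of agreement,
  -- `exp (-1 - ε / 4)` for good pairs and `exp (-1 - 3 ε / 4)`, apart from such accidents, for bad
  -- ones.
  gap : 4 / (c.g : ℝ) + 6 / c.K1 ≤ Real.exp (-1 - ε / 2) - Real.exp (-1 - 3 * ε / 4)
  KN : 0 < c.KN
  KN' : 42 / (c.KN : ℝ) ≤ δ / 8
  KL : 0 < c.KL
  KL' : 31 / (c.KL : ℝ) ≤ δ / 8
  K2 : 0 < c.K2
  K2' : 31 / (c.K2 : ℝ) ≤ δ / 8
  low : ∃ s : ℝ, 0 < s ∧ s ≤ 1 ∧ (1 - Real.exp (-1 - ε / 4) * (1 - s)) ^ c.KS / s ^ c.th ≤ δ / 8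
  high : ∃ s : ℝ, 1 ≤ s ∧ (1 + Real.exp (-1 - ε / 2) * (s - 1)) ^ c.KS / s ^ c.th ≤ 1 / 2
  C1 : 20736 ≤ c.C1
  C1' : (Real.log c.C1 + 4) * 8 * c.K1 ≤ c.C1
  KT : Real.exp (-(c.KT / (8 * (Real.log c.C1 + 4)))) ≤ δ / 8
  KT' : 8 * (a : ℝ) * c.KT / c.C1 ≤ δ / 8
  δ : δ ≤ 1

/-- Instances that are not solved trivially. -/
structure Inst (n lx ly k l : ℕ) : Prop where
  two_le : 2 ≤ n
  one_le : 1 ≤ l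
  l_lx : l ≤ lx
  l_ly : l ≤ ly
  lx_n : lx ≤ n
  ly_n : ly ≤ n
  k_l : k < l

section Bounds
variable {c : Cst} {ε δ : ℝ} {a n lx ly k l : ℕ}

/-- The parameters of the instance at hand. -/
local notation "◇" => par c ε n lx ly k l

theorem par_m_cast : (◇.m : ℝ) = c.C0 * c.g0 * (n.size * n.size) := by
  simp [par]

theorem par_R_ge (hc : CstOk c ε δ a) (hε : 0 < ε) (hn : 1 ≤ n) : 20736 ≤ ◇.R := by
  have hs : 1 ≤ n.size := Nat.size_pos.2 hn
  have h0 := hc.C0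
  have hg : 1 ≤ c.g0 := by
    have h1 : (1 : ℝ) ≤ c.g0 := by linarith [hc.g0]
    exact_mod_cast h1
  have h2 : 1 ≤ n.size * n.size := Nat.mul_pos hs hs
  simp only [par]
  split_ifs with hk
  · nlinarith
  · calc 20736 ≤ 1 * (c.C0 * 1 * 1) := by omega
      _ ≤ _ := by gcongr; omega

theorem m_ge (hc : CstOk c ε δ a) (hε : 0 < ε) (hn : 1 ≤ n) :
    (c.C0 : ℝ) * n.size ≤ ◇.m ∧ (c.C0 : ℝ) ≤ ◇.m := by
  have hs := one_le_size hn
  have hg : (1 : ℝ) ≤ c.g0 := by linarith [hc.g0]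
  have h0 : (20736 : ℝ) ≤ c.C0 := by exact_mod_cast hc.C0
  rw [par_m_cast]
  have h1 : (c.C0 : ℝ) * 1 ≤ c.C0 * c.g0 := by gcongr
  have h2 : (n.size : ℝ) * 1 ≤ n.size * n.size := by gcongr
  have h3 : (c.C0 : ℝ) * n.size ≤ c.C0 * c.g0 * (n.size * n.size) := by
    refine mul_le_mul (by linarith) (by linarith) (by linarith) (by positivity)
  exact ⟨h3, by nlinarith⟩

/-- The lower bound for hits is not monotone in the size of the set, so the mismatches are thinned
out to the least integer `d` above `(1 + ε) k`. Then the loss by collisions is at most `(d - 1) 8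
log n / R ≤ 8 / (C0 log n)`, with the binary length for the last logarithm. -/
theorem le_E_hit_par (hc : CstOk c ε δ a) (hε : 0 < ε) (hn : 1 ≤ n) {B : ℕ} (hB : 0 < B) {tab : List ℕ}
    (ht : TabOk n ◇.R tab) {S : Finset ℕ} (hS : ∀ v ∈ S, v < n) (hSk : (1 + ε) * k < S.card) :
    (1 + ε) * (1 - 8 / (c.C0 * n.size)) / ◇.m ≤ (clsGen tab.length ◇.R B).E (fun a => ind (Hit S tab a)) := by
  have hs := one_le_size hn
  have hg := hc.g0
  have h0 : (20736 : ℝ) ≤ c.C0 := by exact_mod_cast hc.C0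
  have hmC := m_ge (lx := lx) (ly := ly) (k := k) (l := l) hc hε hn
  have hR := par_R_ge (lx := lx) (ly := ly) (k := k) (l := l) hc hε hn
  have hm := par_m_cast (c := c) (ε := ε) (n := n) (lx := lx) (ly := ly) (k := k) (l := l)
  have hRdef : ◇.R = if k < 1 then c.C0 * (n.size * n.size) else
    k * ◇.m := rfl
  generalize ◇.R = R at *
  generalize ◇.m = m at *
  have hR' : (0 : ℝ) < R := by exact_mod_cast (by omega : 0 < R)
  have hm0 : (0 : ℝ) < m := by linarith
  set d := ⌊(1 + ε) * k⌋₊ + 1 with hd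
  have hd1 : (1 + ε) * k < d := by rw [hd]; push_cast; exact Nat.lt_floor_add_one _
  have hd2 : (d : ℝ) ≤ (1 + ε) * k + 1 := by
    rw [hd]; push_cast
    linarith [Nat.floor_le (by positivity : 0 ≤ (1 + ε) * (k : ℝ))]
  have hdS : d ≤ S.card := by
    rw [hd, Nat.succ_le_iff, Nat.floor_lt (by positivity)]; exact hSk
  obtain ⟨S', hS', hcard⟩ := Finset.exists_subset_card_eq hdS
  have h1 := le_E_hit hB ht.pos ht.le ht.coll (S := S') fun v hv => hS v (hS' hv)
  refine le_trans ?_ (h1.trans (Gen.E_mono _ fun a _ => ind_mono (Hit.mono hS')))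
  rw [hcard, div_le_div_iff₀ hm0 hR']
  have hlog := log_le_size hn
  have hlog0 : 0 ≤ Real.log n := Real.log_nonneg (by exact_mod_cast hn)
  rcases Nat.lt_or_ge k 1 with hk | hk
  · obtain rfl : k = 0 := by omega
    rw [if_pos hk] at hRdef
    have hd' : d = 1 := by simp [hd]
    have e : (m : ℝ) = R * c.g0 := by rw [hm, hRdef]; push_cast; ring
    rw [e, hd']
    have h2 : 0 ≤ 8 / (c.C0 * (n.size : ℝ)) := by positivity
    have h3 : (1 + ε) * (1 - 8 / (c.C0 * n.size)) ≤ c.g0 := by nlinarith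
    push_cast
    nlinarith
  · rw [if_neg (by omega)] at hRdef
    have hk' : (1 : ℝ) ≤ k := by exact_mod_cast hk
    have e : (R : ℝ) = k * m := by rw [hRdef]; push_cast; ring
    have h2 : ((d : ℝ) - 1) * (8 * Real.log n / R) ≤ 8 / (c.C0 * n.size) := by
      calc ((d : ℝ) - 1) * (8 * Real.log n / R) ≤ ((1 + ε) * k) * (8 * n.size / R) := by
            have : 0 ≤ 8 * Real.log n / R := by positivity
            gcongr; linarith
        _ = (1 + ε) * (8 * n.size / m) := by rw [e]; field_simp
        _ ≤ c.g0 * (8 * n.size / m) := by gcongr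
        _ = 8 / (c.C0 * n.size) := by
            rw [hm]
            have : (c.g0 : ℝ) ≠ 0 := by linarith
            field_simp
    have h3 : 0 ≤ 1 - 8 / (c.C0 * (n.size : ℝ)) := by
      rw [sub_nonneg, div_le_one (by positivity)]; nlinarith
    calc (1 + ε) * (1 - 8 / (c.C0 * n.size)) * R = ((1 + ε) * k) * (1 - 8 / (c.C0 * n.size)) * m := by
          rw [e]; ring
      _ ≤ d * (1 - (d - 1) * (8 * Real.log n / R)) * m := by
          gcongr

theorem geom_sum_le {x : ℝ} (hx : 2 ≤ x) (b : ℕ) : ∑ i ∈ Finset.Ico 1 (b + 1), x ^ i ≤ 2 * x ^ b := by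
  induction b with
  | zero => simp
  | succ b ih =>
    rw [Finset.sum_Ico_succ_top (by omega), pow_succ]
    nlinarith [pow_pos (by linarith : 0 < x) b]

/-- The inverse of `1 - 1/m` is `1 + 1/(m - 1)`, which is at most `exp (1/(m - 1))`; then take the
`m`-th power. -/
theorem exp_le_one_sub_inv_pow {m : ℕ} (hm : 2 ≤ m) :
    Real.exp (-(1 + 1 / ((m : ℝ) - 1))) ≤ (1 - 1 / (m : ℝ)) ^ m := by
  have hm' : (2 : ℝ) ≤ m := by exact_mod_cast hm
  have h1 : Real.exp (-(1 / ((m : ℝ) - 1))) ≤ 1 - 1 / m := by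
    rw [Real.exp_neg, inv_le_comm₀ (Real.exp_pos _) (by rw [sub_pos, div_lt_one] <;> linarith)]
    refine le_trans (le_of_eq ?_) (Real.add_one_le_exp _)
    have : (m : ℝ) - 1 ≠ 0 := by linarith
    field_simp; ring
  calc Real.exp (-(1 + 1 / ((m : ℝ) - 1))) = Real.exp (-(1 / ((m : ℝ) - 1))) ^ m := by
        rw [← Real.exp_nat_mul]
        congr 1
        have : (m : ℝ) - 1 ≠ 0 := by linarith
        field_simp; ring
    _ ≤ _ := by gcongr

theorem one_sub_pow_le {h : ℝ} (hh : h ≤ 1) (q : ℕ) : (1 - h) ^ q ≤ Real.exp (-(h * q)) := by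
  calc (1 - h) ^ q ≤ Real.exp (-h) ^ q := by
        refine pow_le_pow_left₀ (by linarith) ?_ _
        linarith [Real.add_one_le_exp (-h)]
    _ = _ := by rw [← Real.exp_nat_mul]; congr 1; ring

theorem exp_three_le : Real.exp 3 ≤ 21 := by
  have h := Real.exp_one_lt_d9
  have : Real.exp 3 = Real.exp 1 ^ 3 := by rw [← Real.exp_nat_mul]; norm_num
  rw [this]
  calc Real.exp 1 ^ 3 ≤ 2.7182818286 ^ 3 := by gcongr
    _ ≤ 21 := by norm_num

/-- Since `n < 2 ^ n.size`, a power of two with an exponent at least `n.size / (1 + ε)` dominates `n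
^ (1 / (1 + ε))`. -/
theorem two_pow_ceilDiv_ge (hε : 0 < ε) (hn : 1 ≤ n) :
    Real.exp (Real.log n / (1 + ε)) ≤ 2 ^ ceilDiv ε n.size := by
  have h1 := le_mul_ceilDiv hε n.size
  have h2 : Real.log n ≤ n.size * Real.log 2 := by
    rw [← Real.log_pow]
    exact Real.log_le_log (by exact_mod_cast hn) (by exact_mod_cast (Nat.lt_size_self n).le)
  rw [← Real.le_log_iff_exp_le (by positivity), Real.log_pow, div_le_iff₀ (by linarith)]
  have h3 : 0 < Real.log 2 := Real.log_pos one_lt_two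
  nlinarith

set_option maxHeartbeats 1000000 in
/-- The probabilities for a good modulus. -/
theorem probs_par (hc : CstOk c ε δ a) (hε : 0 < ε) (hI : Inst n lx ly k l) {inp : ℕ → ℕ} {p i j : ℕ}
    (hp : GoodMod (c.K1 * (n * n)) inp (lx + ly) p) (hpB : p ≤ ◇.B) (hi : i + l ≤ lx) (hj : j + l ≤ ly)
    (hk : mis inp l i (lx + j) ≤ k) :
    Probs c ε ◇ inp (tabList n ◇.R) p i j (Real.exp (-(1 + 1 / ((◇.m : ℝ) - 1)))) (31 / n) (1 / n)
      (δ / 8) := by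
  have hn1 : 1 ≤ n := by linarith [hI.two_le]
  obtain ⟨⟨hprime, hpK⟩, hsep⟩ := hp
  have : Fact p.Prime := ⟨hprime⟩
  have hs := one_le_size hn1
  have hn' : (2 : ℝ) ≤ n := by exact_mod_cast hI.two_le
  have h0 : (20736 : ℝ) ≤ c.C0 := by exact_mod_cast hc.C0
  have hR := par_R_ge (lx := lx) (ly := ly) (k := k) (l := l) hc hε hn1
  have hm := m_ge (lx := lx) (ly := ly) (k := k) (l := l) hc hε hn1
  have hT := tabOk hR hn1
  have hB0 := hprime.pos.trans_le hpB
  have hhit := fun S => le_E_hit_par (lx := lx) (ly := ly) (l := l) hc hε hn1 hB0 hT (S := S)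
  have hRk : (k : ℝ) / ◇.R ≤ 1 / ◇.m := by
    have : ◇.R = if k < 1 then c.C0 * (n.size * n.size) else
      k * ◇.m := rfl
    rcases Nat.lt_or_ge k 1 with hk | hk
    · obtain rfl : k = 0 := by omega
      simp
    · rw [this, if_neg (by omega)]
      have : (0 : ℝ) < k := by exact_mod_cast hk
      have : (0 : ℝ) < ◇.m := by linarith
      push_cast
      rw [div_le_div_iff₀ (by positivity) (by positivity)]
      linarith
  have hb1 := mul_ceilDiv_sub_one_le hε (divSum n / n)
  have hb2 := le_mul_ceilDiv hε (divSum n / n)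
  have hb3 := divSum_div_le hn1
  have hb4 := le_divSum_div hn1
  have hlog := log_le_size hn1
  set D := ◇ with hD
  have eb : D.b = ceilDiv ε (divSum n / n) := rfl
  have ent : D.nt = c.KN * 2 ^ ceilDiv ε n.size := rfl
  rw [← eb] at hb1 hb2
  have hm2 : 2 ≤ D.m := by
    have : (2 : ℝ) ≤ D.m := by linarith
    exact_mod_cast this
  have hm0 : (0 : ℝ) < D.m := by linarith
  have hG := clsGen_pos hT.pos (by omega : 0 < D.R) hB0
  have hGm : ((clsGen (tabList n D.R).length D.R D.B).rep D.m).Pos := Gen.rep_pos hG _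
  have hpn : c.K1 * ((n : ℝ) * n) ≤ p := by exact_mod_cast hpK.le
  have hK1 : (1 : ℝ) ≤ c.K1 := by exact_mod_cast hc.K1
  have hp0 : (0 : ℝ) < p := by exact_mod_cast hprime.pos
  have hln : (l : ℝ) ≤ n := by exact_mod_cast hI.l_lx.trans hI.lx_n
  set W := trunc D.lw fun x => inp x % p with hW
  have hmis : ∀ i j, i + l ≤ lx → j + l ≤ ly → (misSet p l W i (lx + j)).card = mis inp l i (lx + j) := by
    intro i j hi hj
    rw [misSet_eq (lw := D.lw) hsep (show i + l ≤ lx + ly by omega) (show lx + j + l ≤ lx + ly by omega),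
      mis_eq_card]
  have hmlt : ∀ i j, ∀ v ∈ misSet p l W i j, v < n := by
    intro i j v hv
    have h1 := Finset.mem_range.1 (Finset.mem_filter.1 hv).1
    have h2 := hI.l_lx
    have h3 := hI.lx_n
    omega
  set h := (1 + ε) * (1 - 8 / (c.C0 * n.size)) / D.m with hh
  have hbad : ∀ i j, i < D.lx + 1 - D.l → j < D.ly + 1 - D.l → ¬ validP ε D inp (i, j) →
      h ≤ (clsGen (tabList n D.R).length D.R D.B).E (fun a => ind (Hit (misSet p l W i (lx + j))
        (tabList n D.R) a)) := by
    intro i j hi hj hv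
    have hi : i + l ≤ lx := by have : i < lx + 1 - l := hi; omega
    have hj : j + l ≤ ly := by have : j < ly + 1 - l := hj; omega
    refine hhit _ (hmlt _ _) ?_
    rw [validP, sub_le_mul_iff hε, not_le] at hv
    rw [hmis i j hi hj]
    exact hv
  have hcl : Real.exp (-(1 + 1 / ((D.m : ℝ) - 1))) ≤ ((clsGen (tabList n D.R).length D.R D.B).rep D.m).E
      (fun cs => ind (Clean (misSet p l W i (lx + j)) (tabList n D.R) cs)) := by
    rw [E_clean hG]
    refine (exp_le_one_sub_inv_pow hm2).trans ?_
    have h1 := E_hit_le hB0 hT.pos hT.le (misSet p l W i (lx + j))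
    have h2 : ((misSet p l W i (lx + j)).card : ℝ) / D.R ≤ k / D.R := by
      gcongr
      rw [hmis i j hi hj]; exact hk
    have h3 : 1 / (D.m : ℝ) ≤ 1 := by rw [div_le_one hm0]; linarith
    refine pow_le_pow_left₀ (by linarith) (by linarith) _
  have hfrac : (8 : ℝ) / (c.C0 * n.size) ≤ 8 / c.C0 := by
    gcongr
    exact le_mul_of_one_le_right (by linarith) hs
  have hfrac1 : (8 : ℝ) / c.C0 ≤ 1 := by rw [div_le_one] <;> linarith
  have hfrac0 : (0 : ℝ) ≤ 8 / (c.C0 * n.size) := by positivity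
  have hh1 : h ≤ 1 := by
    rw [hh, div_le_one hm0]
    have h1 : 8 * (3 + ε) ≤ (D.m : ℝ) := hc.C0'.trans hm.2
    exact (mul_le_of_le_one_right (by linarith) (by linarith)).trans (by linarith)
  have hK1n : ((n : ℝ) * n) ≤ p := (le_mul_of_one_le_left (by positivity) hK1).trans hpn
  have hnp : (n : ℝ) ≤ p := (le_mul_of_one_le_left (by linarith) (by linarith)).trans hK1n
  have hKp : (c.K1 : ℝ) ≤ p := (le_mul_of_one_le_right (by linarith) (one_le_mul_of_one_le_of_one_le (by linarith) (by linarith))).trans hpn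
  have hlp : 2 * (l : ℝ) / p ≤ 2 / (c.K1 * n) := by
    rw [div_le_div_iff₀ hp0 (by positivity)]
    linarith [mul_le_mul_of_nonneg_right hln (by positivity : 0 ≤ (c.K1 : ℝ) * n)]
  refine ⟨rfl, hT.pos, by omega, hB0, hI.lx_n, hI.ly_n, hI.one_le, (ceilDiv_mem hε _).1,
    Nat.mul_pos hc.KN (by positivity), Nat.mul_pos hc.KL (Nat.mul_pos (by omega)
    (Nat.mul_pos hc.KN (by positivity))), Nat.mul_pos hc.K2 (Nat.mul_pos hc.KN (by positivity)),
    show i < lx + 1 - l by omega, show j < ly + 1 - l by omega, ?_, Real.exp_pos _, by positivity,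
    by positivity, hcl, ?_, ?_, ?_⟩
  · rw [validP, sub_le_mul_iff hε]
    have h1 : (mis inp l i (lx + j) : ℝ) ≤ k := by exact_mod_cast hk
    show (mis inp l i (lx + j) : ℝ) ≤ (1 + ε) * k
    linarith [mul_nonneg hε.le (Nat.cast_nonneg (α := ℝ) k)]
  · intro i j hi hj hv
    have h1 := E_match_le hpB (g := n) (by omega) hT.pos (by omega : 0 < D.R) (fun e he => (hT.le e he).1)
      hh1 (hbad i j hi hj hv) (D.b * D.m) 0 0
    simp only [zero_add] at h1
    refine h1.trans ?_
    have h2 := one_sub_pow_le hh1 (D.b * D.m)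
    -- The approximation of the logarithm loses `2`, and the collisions of positions lose at most
    -- `1` over all `b` blocks.
    have h3 : Real.log n - 3 ≤ h * (D.b * D.m : ℕ) := by
      have e : h * (D.b * D.m : ℕ) = (1 + ε) * D.b * (1 - 8 / (c.C0 * n.size)) := by
        rw [hh]; push_cast; field_simp
      rw [e]
      have h4 : (1 + ε) * D.b * (8 / (c.C0 * n.size)) ≤ 1 := by
        rw [mul_div_assoc', div_le_one (by positivity)]
        linarith [mul_le_mul_of_nonneg_right hc.C0' (by linarith : (0 : ℝ) ≤ n.size),
          mul_le_mul_of_nonneg_left hs (by linarith : 0 ≤ 2 + ε)]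
      rw [mul_sub, mul_one]
      linarith
    have h5 : (1 - h) ^ (D.b * D.m) ≤ 21 / n := by
      calc _ ≤ Real.exp (3 - Real.log n) := h2.trans (Real.exp_le_exp.2 (by linarith))
        _ = Real.exp 3 / n := by rw [Real.exp_sub, Real.exp_log (by linarith)]
        _ ≤ _ := by gcongr; exact exp_three_le
    have h6 : 2 * (l : ℝ) / p ≤ 2 / n :=
      hlp.trans (div_le_div_of_nonneg_left (by norm_num) (by linarith) (le_mul_of_one_le_left (by linarith) hK1))
    have h7 : (1 : ℝ) / p ≤ 1 / n := by gcongr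
    -- The `21` bounds `exp 3`; the rest is the collision error of fingerprints modulo `n`, since
    -- `p` is at least `K1 * n * n`.
    have h8 : (31 : ℝ) / n = 21 / n + (2 / n + 4 * (1 / n + 1 / n)) := by ring
    rw [h8]
    gcongr
  · intro i j hi hj hv
    obtain ⟨s, hs1, hs2⟩ := hc.high
    have hblock : ((clsGen (tabList n D.R).length D.R D.B).rep D.m).E (fun cs => ind (
        (fp p l (tabList n D.R) W i cs).val % c.g = (fp p l (tabList n D.R) W (lx + j) cs).val % c.g)) ≤
        Real.exp (-1 - ε / 2) := by
      have h1 := E_match_le hpB hc.g hT.pos (by omega : 0 < D.R) (fun e he => (hT.le e he).1)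
        hh1 (hbad i j hi hj hv) D.m 0 0
      simp only [zero_add] at h1
      refine h1.trans ?_
      have h2 := one_sub_pow_le hh1 D.m
      -- The loss by collisions uses up at most `ε / 4` of the ideal exponent `1 + ε`.
      have h3 : 1 + 3 * ε / 4 ≤ h * D.m := by
        rw [hh, div_mul_cancel₀ _ hm0.ne']
        have h4 : (1 + ε) * (8 / c.C0) ≤ ε / 4 := by
          rw [mul_div_assoc', div_le_iff₀ (by linarith)]
          linarith [hc.C0ε']
        linarith [mul_le_mul_of_nonneg_left hfrac (by linarith : 0 ≤ 1 + ε)]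
      have h5 : Real.exp (-(h * D.m)) ≤ Real.exp (-1 - 3 * ε / 4) := Real.exp_le_exp.2 (by linarith)
      have h6 : 2 * (l : ℝ) / p ≤ 2 / c.K1 :=
        hlp.trans (div_le_div_of_nonneg_left (by norm_num) (by linarith) (le_mul_of_one_le_right (by linarith) (by linarith)))
      have h7 : (1 : ℝ) / p ≤ 1 / c.K1 := by gcongr
      have h8 := hc.gap
      have e : (4 : ℝ) * (1 / c.g + 1 / p) = 4 / c.g + 4 * (1 / p) := by ring
      have e2 : (6 : ℝ) / c.K1 = 2 / c.K1 + 4 * (1 / c.K1) := by ring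
      linarith
    have h1 := rep_E_countP_ge hGm hs1 hblock (c.KS * n.size) (c.th * n.size)
    have h2 : (1 + Real.exp (-1 - ε / 2) * (s - 1)) ^ (c.KS * n.size) / s ^ (c.th * n.size) ≤ 1 / n := by
      rw [pow_mul, pow_mul, ← div_pow]
      have h3 : 0 ≤ Real.exp (-1 - ε / 2) * (s - 1) := mul_nonneg (Real.exp_pos _).le (by linarith)
      -- The Chernoff factor `1/2` per unit of `n.size` gives `2 ^ (-n.size) ≤ 1 / n`.
      calc _ ≤ (1 / 2 : ℝ) ^ n.size := by gcongr
        _ = 1 / 2 ^ n.size := by rw [div_pow, one_pow]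
        _ ≤ 1 / n := by gcongr; exact_mod_cast (Nat.lt_size_self n).le
    refine le_trans (Gen.E_mono _ fun bl hbl => ind_mono fun hpass => ?_) (h1.trans h2)
    have e := eqDigits_skVal (p := p) (l := l) hc.g (tabList n D.R) W i (lx + j) bl
    rw [(Gen.rep_mem hbl).1] at e
    exact le_of_le_of_eq hpass (e.trans (List.countP_congr fun cs _ => by simp))
  · obtain ⟨s, hs0, hs1, hs2⟩ := hc.low
    have hblock : Real.exp (-1 - ε / 4) ≤ ((clsGen (tabList n D.R).length D.R D.B).rep D.m).E
        (fun cs => ind ((fp p l (tabList n D.R) W i cs).val % c.g =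
          (fp p l (tabList n D.R) W (lx + j) cs).val % c.g)) := by
      refine le_trans (Real.exp_le_exp.2 ?_) (hcl.trans (Gen.E_mono _ fun cs _ => ind_mono fun h => ?_))
      · have h1 : 1 / ((D.m : ℝ) - 1) ≤ ε / 4 := by
          rw [div_le_div_iff₀ (by linarith) (by norm_num)]
          linarith [hc.C0ε, mul_le_mul_of_nonneg_left hm.2 hε.le]
        linarith
      · rw [fp_congr h]
    have h1 := rep_E_countP_lt hGm hs0 hs1 hblock (c.KS * n.size) (c.th * n.size)
    have h2 : (1 - Real.exp (-1 - ε / 4) * (1 - s)) ^ (c.KS * n.size) / s ^ (c.th * n.size) ≤ δ / 8 := by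
      rw [pow_mul, pow_mul, ← div_pow]
      have hexp : Real.exp (-1 - ε / 4) ≤ 1 := Real.exp_le_one_iff.2 (by linarith)
      have h3 : 0 ≤ 1 - Real.exp (-1 - ε / 4) * (1 - s) := by
        linarith [mul_le_mul_of_nonneg_right hexp (by linarith : 0 ≤ 1 - s)]
      have h4 : 0 ≤ (1 - Real.exp (-1 - ε / 4) * (1 - s)) ^ c.KS / s ^ c.th := by positivity
      refine (pow_le_of_le_one h4 (by linarith [hc.δ]) (Nat.size_pos.2 hn1).ne').trans hs2
    refine le_trans (Gen.E_mono _ fun bl hbl => ind_mono fun hpass => ?_) (h1.trans h2)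
    have e := eqDigits_skVal (p := p) (l := l) hc.g (tabList n D.R) W i (lx + j) bl
    rw [(Gen.rep_mem hbl).1] at e
    exact lt_of_eq_of_lt ((List.countP_congr fun cs _ => by simp).trans e.symm) (not_le.1 hpass)

end Bounds

section Failure
variable {c : Cst} {ε δ : ℝ} {a n lx ly k l : ℕ}

/-- The parameters of the instance at hand. -/
local notation "◇" => par c ε n lx ly k l

theorem log_B_le (hc : CstOk c ε δ a) (hn : 1 ≤ n) : Real.log ◇.B ≤ (Real.log c.C1 + 4) * n.size := by
  have e : (◇.B : ℝ) = c.C1 * (n * n) * (n.size * n.size) := by simp [par]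
  have hs := one_le_size hn
  have hn' : (1 : ℝ) ≤ n := by exact_mod_cast hn
  have h0 : (20736 : ℝ) ≤ c.C1 := by exact_mod_cast hc.C1
  have h1 := log_le_size hn
  have h2 := Real.log_le_sub_one_of_pos (show (0 : ℝ) < n.size by linarith)
  have h3 : 0 ≤ Real.log c.C1 := Real.log_nonneg (by linarith)
  have hn0 : (n : ℝ) ≠ 0 := by positivity
  have hs0 : (n.size : ℝ) ≠ 0 := by positivity
  have hc0 : (c.C1 : ℝ) ≠ 0 := by positivity
  rw [e, Real.log_mul (by positivity) (by positivity), Real.log_mul hc0 (by positivity),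
    Real.log_mul hn0 hn0, Real.log_mul hs0 hs0]
  nlinarith

/-- A try is a large prime with probability of order `1 / log B`, so `KT * n.size` tries make
failure unlikely. A single try is a prime that does not separate the letters with probability `O(1 /
(C1 log n))`, so the union bound over the tries remains small. -/
theorem E_not_goodMod_le (hc : CstOk c ε δ a) (hn : 1 ≤ n) (hlx : lx ≤ n) (hly : ly ≤ n) {inp : ℕ → ℕ}
    (hinp : ∀ x < lx + ly, inp x < 2 ^ (a + a * n.size)) :
    ((Gen.unif ◇.B).rep ◇.tr).E (fun t => ind (¬ GoodMod (c.K1 * (n * n)) inp (lx + ly)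
      (firstGood (c.K1 * (n * n)) t))) ≤ δ / 8 + δ / 8 := by
  have e : (◇.B : ℝ) = c.C1 * (n * n) * (n.size * n.size) := by simp [par]
  have etr : ◇.tr = c.KT * n.size := rfl
  have hlog := log_B_le (lx := lx) (ly := ly) (k := k) (l := l) hc hn
  have hs := one_le_size hn
  have hn' : (1 : ℝ) ≤ n := by exact_mod_cast hn
  have h0 : (20736 : ℝ) ≤ c.C1 := by exact_mod_cast hc.C1
  have hL : 0 ≤ Real.log c.C1 := Real.log_nonneg (by linarith)
  set B := ◇.B
  have hB : (20736 : ℝ) ≤ B := by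
    rw [e]
    have h1 : (1 : ℝ) ≤ n * n := one_le_mul_of_one_le_of_one_le hn' hn'
    have h2 : (1 : ℝ) ≤ n.size * n.size := one_le_mul_of_one_le_of_one_le hs hs
    have h3 := le_mul_of_one_le_right (show (0 : ℝ) ≤ c.C1 by linarith) h1
    exact h0.trans (h3.trans (le_mul_of_one_le_right (by linarith) h2))
  have hB' : 20736 ≤ B := by exact_mod_cast hB
  have hlogB : 0 < Real.log B := Real.log_pos (by linarith)
  have hC1' := hc.C1'
  have hKT := hc.KT
  set L := Real.log c.C1 + 4 with hLdef
  have hL0 : 0 < L := by linarith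
  have hρ1 : 1 / (8 * L * n.size) ≤ 1 := by
    rw [div_le_one (by positivity)]
    nlinarith
  have hρ : 1 / (8 * L * n.size) ≤ (Gen.unif B).E (fun x => ind (goodTry (c.K1 * (n * n)) x)) := by
    refine le_trans ?_ (unif_E_goodTry_ge hB')
    have h1 : 1 / (4 * (L * n.size)) ≤ 1 / (4 * Real.log B) := by gcongr
    have h2 : ((c.K1 * (n * n) : ℕ) : ℝ) / B ≤ 1 / (8 * L * n.size) := by
      rw [e, div_le_div_iff₀ (by positivity) (by positivity)]
      push_cast
      have h4 : (n : ℝ) * n * n.size * ((L * 8) * c.K1) ≤ n * n * n.size * (c.C1 * n.size) :=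
        mul_le_mul_of_nonneg_left (hC1'.trans (le_mul_of_one_le_right (by linarith) hs)) (by positivity)
      nlinarith
    have h3 : 1 / (4 * (L * n.size)) = 2 * (1 / (8 * L * n.size)) := by field_simp; norm_num
    linarith
  have hη : (Gen.unif B).E (fun x => ind (goodTry (c.K1 * (n * n)) x ∧ ¬ SepMod x inp (lx + ly))) ≤
      8 * a / (c.C1 * n.size) := by
    refine (unif_E_not_sep_le hinp).trans ?_
    rw [e, div_le_div_iff₀ (by positivity) (by positivity)]
    have h1 : ((lx + ly : ℕ) : ℝ) ≤ 2 * n := by exact_mod_cast (by omega : lx + ly ≤ 2 * n)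
    have h2 : ((a + a * n.size : ℕ) : ℝ) ≤ 2 * a * n.size := by
      push_cast; nlinarith [Nat.cast_nonneg (α := ℝ) a]
    calc _ ≤ (2 * n : ℝ) * (2 * n) * (2 * a * n.size) * (c.C1 * n.size) := by gcongr
      _ = _ := by ring
  refine (rep_E_firstGood_le (by omega) hρ1 hρ (by positivity) (by positivity) hη _).trans ?_
  gcongr
  · refine (one_sub_pow_le hρ1 _).trans (le_trans (le_of_eq ?_) hKT)
    rw [etr]
    congr 2
    push_cast
    field_simp
  · refine le_trans (le_of_eq ?_) hc.KT'
    rw [etr]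
    push_cast
    field_simp

/-- The geometric sum is at most twice its last term, and this term is at most `21 * 2 ^ ceilDiv ε
n.size`, that is, `21 * nt / KN`; hence the constant `42`. -/
theorem sum_div_nt_le (hc : CstOk c ε δ a) (hε : 0 < ε) (hn : 1 ≤ n) :
    (∑ i ∈ Finset.Ico 1 (◇.b + 1), (Real.exp (-(1 + 1 / ((◇.m : ℝ) - 1))))⁻¹ ^ i) / ◇.nt ≤ δ / 8 := by
  have hm := (m_ge (lx := lx) (ly := ly) (k := k) (l := l) hc hε hn).1
  have hb := mul_ceilDiv_sub_one_le hε (divSum n / n)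
  have hb3 := divSum_div_le hn
  have hlog := log_le_size hn
  have hs := one_le_size hn
  have h0 : (20736 : ℝ) ≤ c.C0 := by exact_mod_cast hc.C0
  have eb : ◇.b = ceilDiv ε (divSum n / n) := rfl
  have ent : (◇.nt : ℝ) = c.KN * 2 ^ ceilDiv ε n.size := by simp [par]
  rw [← eb] at hb
  rw [ent]
  set m := ◇.m
  set b := ◇.b
  have hlog0 : 0 ≤ Real.log n := Real.log_natCast_nonneg n
  have hm1 : (20736 : ℝ) * n.size ≤ m := le_trans (by gcongr) hm
  have hb1 : (b : ℝ) ≤ (1 + Real.log n) / (1 + ε) + 1 := by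
    rw [← sub_le_iff_le_add, le_div_iff₀ (by linarith), mul_comm]
    exact hb.trans hb3
  have hfr : (1 + Real.log n) / (1 + ε) ≤ 1 + Real.log n := div_le_self (by linarith) (by linarith)
  have hbm : b * (1 / ((m : ℝ) - 1)) ≤ 1 := by
    rw [mul_one_div, div_le_one (by linarith)]
    linarith
  have h1 : (1 : ℝ) / (1 + ε) ≤ 1 := by rw [div_le_one] <;> linarith
  have hx : (2 : ℝ) ≤ Real.exp (1 + 1 / ((m : ℝ) - 1)) := by
    have h2 := Real.add_one_le_exp (1 + 1 / ((m : ℝ) - 1))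
    have h3 : 0 ≤ 1 / ((m : ℝ) - 1) := one_div_nonneg.2 (by linarith)
    linarith
  have hpow : Real.exp (1 + 1 / ((m : ℝ) - 1)) ^ b ≤ 21 * 2 ^ ceilDiv ε n.size := by
    rw [← Real.exp_nat_mul]
    -- Three units of slack: the upper bound for the approximate logarithm, the rounding in `b`, and
    -- the correction `b / (m - 1) ≤ 1`.
    calc _ ≤ Real.exp (3 + Real.log n / (1 + ε)) := by
          refine Real.exp_le_exp.2 ?_
          rw [add_div] at hb1
          linarith
      _ ≤ _ := by
          rw [Real.exp_add]
          exact mul_le_mul exp_three_le (two_pow_ceilDiv_ge hε hn) (Real.exp_pos _).le (by norm_num)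
  have hKN : (0 : ℝ) < c.KN := by exact_mod_cast hc.KN
  rw [← Real.exp_neg, neg_neg]
  refine le_trans ?_ hc.KN'
  rw [div_le_div_iff₀ (by positivity) hKN]
  nlinarith [geom_sum_le hx b]

theorem E_outcome_le {D : Par} {inp : ℕ → ℕ} {t : List ℕ} {i j : ℕ} {β μ ν σ : ℝ}
    (h : Probs c ε D inp (tabList D.n D.R) (firstGood (c.K1 * (D.n * D.n)) t) i j β μ ν σ) :
    ((Gen.unif D.lim).prod ((blockGen D (tabList D.n D.R).length D.ls).prod
      (blockGen D (tabList D.n D.R).length D.nt))).E (fun y => ind ((outcome c ε D inp (t, y)).ans ≠ 1)) ≤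
      (∑ i ∈ Finset.Ico 1 (D.b + 1), β⁻¹ ^ i) / D.nt + σ + D.nt * (D.n * D.n) * μ / D.lim +
      D.nt * (D.n * D.n) * (μ * ν) / D.lim2 := h.E_le

theorem blockGen_pos (hc : CstOk c ε δ a) (hε : 0 < ε) (hn : 1 ≤ n) (q : ℕ) :
    (blockGen ◇ (tabList n ◇.R).length q).Pos := by
  have hs : 1 ≤ n.size := Nat.size_pos.2 hn
  have hR := par_R_ge (lx := lx) (ly := ly) (k := k) (l := l) hc hε hn
  have hC1 : 0 < c.C1 := lt_of_lt_of_le (by norm_num) hc.C1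
  exact Gen.rep_pos (Gen.rep_pos (clsGen_pos (tabOk hR hn).pos (by omega)
    (show 0 < c.C1 * (n * n) * (n.size * n.size) by positivity)) _) _

theorem rndGen_pos (hc : CstOk c ε δ a) (hε : 0 < ε) (hn : 1 ≤ n) :
    (rndGen ◇ (tabList n ◇.R).length).Pos := by
  have hs : 1 ≤ n.size := Nat.size_pos.2 hn
  have hC1 : 0 < c.C1 := lt_of_lt_of_le (by norm_num) hc.C1
  have hKN := hc.KN
  have hKL := hc.KL
  exact Gen.prod_pos (Gen.rep_pos (Gen.unif_pos
    (show 0 < c.C1 * (n * n) * (n.size * n.size) by positivity)) _)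
    (Gen.prod_pos (Gen.unif_pos (show 0 < c.KL * (n * (c.KN * 2 ^ ceilDiv ε n.size)) by positivity))
      (Gen.prod_pos (blockGen_pos hc hε hn _) (blockGen_pos hc hε hn _)))

/-- The program finds a witness if there is one. -/
theorem E_fail_le (hc : CstOk c ε δ a) (hε : 0 < ε) (hδ : 0 < δ) (hI : Inst n lx ly k l) {inp : ℕ → ℕ}
    {i j : ℕ} (hinp : ∀ x < lx + ly, inp x < 2 ^ (a + a * n.size)) (hi : i + l ≤ lx) (hj : j + l ≤ ly)
    (hk : mis inp l i (lx + j) ≤ k) :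
    (rndGen ◇ (tabList n ◇.R).length).E (fun x => ind ((outcome c ε ◇ inp x).ans ≠ 1)) ≤ δ := by
  have hn : 1 ≤ n := by linarith [hI.two_le]
  have hn0 : (0 : ℝ) < n := by exact_mod_cast hn
  have hs : 1 ≤ n.size := Nat.size_pos.2 hn
  have hC1 : 0 < c.C1 := lt_of_lt_of_le (by norm_num) hc.C1
  have hKN' := hc.KN
  have hKL' := hc.KL
  have hKN : (0 : ℝ) < c.KN := by exact_mod_cast hc.KN
  have hKL : (0 : ℝ) < c.KL := by exact_mod_cast hc.KL
  have hK2 : (0 : ℝ) < c.K2 := by exact_mod_cast hc.K2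
  have hprime := E_not_goodMod_le (ε := ε) (k := k) (l := l) hc hn hI.lx_n hI.ly_n hinp
  have hsum := sum_div_nt_le (lx := lx) (ly := ly) (k := k) (l := l) hc hε hn
  have hpr := fun t hp hpB => E_outcome_le (t := t) (probs_par hc hε hI hp hpB hi hj hk)
  have hlim : (◇.lim : ℝ) = c.KL * (n * ◇.nt) := by simp [par]
  have hlim2 : (◇.lim2 : ℝ) = c.K2 * ◇.nt := by simp [par]
  have hnt : (0 : ℝ) < ◇.nt := by simp [par]; positivity
  have hbl := fun q => blockGen_pos (lx := lx) (ly := ly) (k := k) (l := l) hc hε hn q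
  have hU1 := Gen.unif_pos (show 0 < ◇.B from
    (by positivity : 0 < c.C1 * (n * n) * (n.size * n.size)))
  have hU2 := Gen.unif_pos (show 0 < ◇.lim from
    (by positivity : 0 < c.KL * (n * (c.KN * 2 ^ ceilDiv ε n.size))))
  have e3 : (◇.nt * (n * n) * (31 / n) / ◇.lim : ℝ) ≤ δ / 8 := by
    refine le_trans (le_of_eq ?_) hc.KL'
    rw [hlim]; field_simp
  have e4 : (◇.nt * (n * n) * (31 / n * (1 / n)) / ◇.lim2 : ℝ) ≤ δ / 8 := by
    refine le_trans (le_of_eq ?_) hc.K2'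
    rw [hlim2]; field_simp
  have hrest := Gen.prod_pos hU2 (Gen.prod_pos (hbl ◇.ls) (hbl ◇.nt))
  rw [rndGen, Gen.prod_E]
  set D := ◇ with hD
  -- Conditioning on the modulus: a good one leaves four failure events of probability `δ / 8`, and
  -- a bad one is counted in full. With the two events for the modulus the total is `6 δ / 8`.
  have hsplit : ∀ t, ((Gen.unif D.B).rep D.tr).Mem t →
      ((Gen.unif D.lim).prod ((blockGen D (tabList n D.R).length D.ls).prod
        (blockGen D (tabList n D.R).length D.nt))).E (fun y => ind ((outcome c ε D inp (t, y)).ans ≠ 1)) ≤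
      ind (¬ GoodMod (c.K1 * (n * n)) inp (lx + ly) (firstGood (c.K1 * (n * n)) t)) + 4 * (δ / 8) := by
    intro t ht
    by_cases hg : GoodMod (c.K1 * (n * n)) inp (lx + ly) (firstGood (c.K1 * (n * n)) t)
    · rw [ind_of_not (not_not.2 hg), zero_add]
      have hmem := firstGood_mem hg.1.1.ne_one
      have hlt := Gen.unif_mem.1 ((Gen.rep_mem ht).2 _ hmem.1)
      refine le_trans (hpr t hg hlt.le) ?_
      show _ + _ + (D.nt * (n * n) * (31 / n) / D.lim : ℝ) + (D.nt * (n * n) * (31 / n * (1 / n)) / D.lim2 : ℝ) ≤ _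
      linarith
    · rw [ind_of hg]
      have := Gen.E_ind_le_one _ hrest fun y => (outcome c ε D inp (t, y)).ans ≠ 1
      linarith
  refine (Gen.E_mono _ hsplit).trans ?_
  rw [Gen.E_add, Gen.E_const _ (Gen.rep_pos hU1 _)]
  linarith

end Failure

/-! ### Choice of the constants. -/

/-- For a rational `ε` the test is replaced by an integer comparison with numerator and denominator.
-/
theorem exists_epsOk {ε : ℝ} (hε : 0 < ε) : ∃ o, EpsOk o ε ∧ ((∃ q : ℚ, (q : ℝ) = ε) → o ≠ none) := by
  by_cases h : ∃ q : ℚ, (q : ℝ) = ε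
  · obtain ⟨q, rfl⟩ := h
    refine ⟨some (q.num.toNat, q.den), ?_, fun _ => by simp⟩
    rintro _ _ ⟨⟩
    refine ⟨q.den_pos, ?_⟩
    have h1 : 0 < q.num := Rat.num_pos.2 (by exact_mod_cast hε)
    have h2 : ((q.num.toNat : ℕ) : ℝ) = (q.num : ℝ) := by
      exact_mod_cast Int.toNat_of_nonneg h1.le
    rw [h2]
    exact Rat.cast_def q
  · exact ⟨none, fun _ _ h => (Option.noConfusion rfl (heq_of_eq h)), fun h' => absurd h' h⟩

theorem exists_div_le (x : ℝ) {y : ℝ} (hy : 0 < y) : ∃ K : ℕ, 0 < K ∧ x / K ≤ y := by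
  obtain ⟨K, hK⟩ := exists_nat_ge (x / y)
  refine ⟨K + 1, by omega, ?_⟩
  push_cast
  rw [div_le_iff₀ (by positivity)]
  rw [div_le_iff₀ hy] at hK
  nlinarith

/-- The sample size and the threshold of the sketches. -/
theorem exists_sketch {Q₀ Q₁ η : ℝ} (h1 : 0 < Q₁) (h2 : Q₁ < Q₀) (h3 : Q₀ < 1) (hη : 0 < η) :
    ∃ q t : ℕ, (∃ s : ℝ, 0 < s ∧ s ≤ 1 ∧ (1 - Q₀ * (1 - s)) ^ q / s ^ t ≤ η) ∧
      (∃ s : ℝ, 1 ≤ s ∧ (1 + Q₁ * (s - 1)) ^ q / s ^ t ≤ 1 / 2) := by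
  -- The threshold is `⌊θ q⌋` for a `θ` strictly between the two probabilities. The parameters `s <
  -- 1 < r` are close enough to `1` for both exponential rates `u`, `v` to be positive.
  set θ := (Q₀ + Q₁) / 2 with hθ
  have hθ0 : 0 < θ := by linarith
  have hQ : 0 < Q₀ := by linarith
  obtain ⟨s, hs1, hs2⟩ := exists_between (show θ / Q₀ < 1 by rw [div_lt_one hQ]; linarith)
  obtain ⟨r, hr1, hr2⟩ := exists_between (show 1 < θ / Q₁ by rw [lt_div_iff₀ h1]; linarith)
  rw [div_lt_iff₀ hQ] at hs1
  rw [lt_div_iff₀ h1] at hr2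
  have hs0 : 0 < s := by
    by_contra h
    nlinarith
  have hr0 : 0 < r := by linarith
  have hu : 0 < (1 - s) * (Q₀ - θ / s) := by
    refine mul_pos (by linarith) ?_
    rw [sub_pos, div_lt_iff₀ hs0]; linarith
  have hv : 0 < (r - 1) * (θ / r - Q₁) := by
    refine mul_pos (by linarith) ?_
    rw [sub_pos, lt_div_iff₀ hr0]; linarith
  set u := (1 - s) * (Q₀ - θ / s) with hudef
  set v := (r - 1) * (θ / r - Q₁) with hvdef
  -- The `2` gives the exponent `-1`, with `exp (-1) ≤ 1/2`, and one more unit for the rounding of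
  -- the threshold.
  obtain ⟨q, hq⟩ := exists_nat_ge (max (-Real.log η / u) (2 / v))
  have hq1 := (le_max_left _ _).trans hq
  have hq2 := (le_max_right _ _).trans hq
  rw [div_le_iff₀ hu] at hq1
  rw [div_le_iff₀ hv] at hq2
  have ht1 : (⌊θ * q⌋₊ : ℝ) ≤ θ * q := Nat.floor_le (by positivity)
  have ht2 : θ * q - 1 ≤ ⌊θ * q⌋₊ := (Nat.sub_one_lt_floor _).le
  refine ⟨q, ⌊θ * q⌋₊, ⟨s, hs0, hs2.le, ?_⟩, ⟨r, hr1.le, ?_⟩⟩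
  · have a1 : (1 - Q₀ * (1 - s)) ^ q ≤ Real.exp (-(Q₀ * (1 - s) * q)) :=
      one_sub_pow_le (by nlinarith) q
    have a2 : Real.exp (-((1 - s) / s * (θ * q))) ≤ s ^ ⌊θ * q⌋₊ := by
      rw [← Real.le_log_iff_exp_le (by positivity), Real.log_pow]
      have b1 := Real.one_sub_inv_le_log_of_pos hs0
      have b2 : 0 ≤ (1 - s) / s := div_nonneg (by linarith) hs0.le
      have b3 : -((1 - s) / s) ≤ Real.log s := by
        refine le_trans (le_of_eq ?_) b1
        field_simp; ring
      nlinarith [mul_le_mul_of_nonneg_left ht1 b2, mul_le_mul_of_nonneg_left b3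
        (Nat.cast_nonneg (α := ℝ) ⌊θ * q⌋₊)]
    rw [div_le_iff₀ (by positivity)]
    refine a1.trans (le_trans ?_ (mul_le_mul_of_nonneg_left a2 hη.le))
    nth_rw 1 [← Real.exp_log hη]
    rw [← Real.exp_add]
    refine Real.exp_le_exp.2 ?_
    have e : (q : ℝ) * u = Q₀ * (1 - s) * q - (1 - s) / s * (θ * q) := by
      rw [hudef]; field_simp
    linarith
  · have a1 : (1 + Q₁ * (r - 1)) ^ q ≤ Real.exp (Q₁ * (r - 1) * q) := by
      have := one_sub_pow_le (h := -(Q₁ * (r - 1))) (by nlinarith) q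
      rw [sub_neg_eq_add] at this
      refine this.trans (le_of_eq ?_)
      congr 1; ring
    have a2 : Real.exp ((r - 1) / r * (θ * q - 1)) ≤ r ^ ⌊θ * q⌋₊ := by
      rw [← Real.le_log_iff_exp_le (by positivity), Real.log_pow]
      have b1 := Real.one_sub_inv_le_log_of_pos hr0
      have b2 : 0 ≤ (r - 1) / r := div_nonneg (by linarith) hr0.le
      have b3 : (r - 1) / r ≤ Real.log r := by
        refine le_trans (le_of_eq ?_) b1
        field_simp
      nlinarith [mul_le_mul_of_nonneg_left ht2 b2, mul_le_mul_of_nonneg_left b3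
        (Nat.cast_nonneg (α := ℝ) ⌊θ * q⌋₊)]
    rw [div_le_iff₀ (by positivity)]
    have h12 : Real.exp (-1) ≤ 1 / 2 := by
      rw [Real.exp_neg, inv_eq_one_div]
      exact one_div_le_one_div_of_le two_pos (by linarith [Real.add_one_le_exp (1 : ℝ)])
    calc _ ≤ Real.exp (Q₁ * (r - 1) * q) := a1
      _ ≤ Real.exp (-1 + (r - 1) / r * (θ * q - 1)) := by
        refine Real.exp_le_exp.2 ?_
        have e : (q : ℝ) * v = (r - 1) / r * (θ * q) - Q₁ * (r - 1) * q := by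
          rw [hvdef]; field_simp
        have b4 : (r - 1) / r ≤ 1 := by rw [div_le_one hr0]; linarith
        linarith
      _ ≤ _ := by
        rw [Real.exp_add]
        exact mul_le_mul h12 a2 (Real.exp_pos _).le (by norm_num)

/-- The size of the random numbers for the modulus, and the number of tries. -/
theorem exists_tries (K : ℕ) (a : ℕ) {δ : ℝ} (hδ : 0 < δ) :
    ∃ C₁ q : ℕ, 20736 ≤ C₁ ∧ (Real.log C₁ + 4) * 8 * K ≤ C₁ ∧
      Real.exp (-(q / (8 * (Real.log C₁ + 4)))) ≤ δ ∧ 8 * (a : ℝ) * q / C₁ ≤ δ := by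
  set J := |Real.log δ| with hJ
  have hJ0 : 0 ≤ J := abs_nonneg _
  -- The constant `C₁` is taken to be a square `N * N`, as `log (N * N) + 4 ≤ 4 N` is then immediate
  -- and every requirement of the form `L * const ≤ C₁` reduces to a lower bound for `N`.
  obtain ⟨N, hN⟩ := exists_nat_ge (4 * (8 * K + 8 * a * (8 * J + 1) / δ) + 144)
  have hM : 0 ≤ 8 * a * (8 * J + 1) / δ := by positivity
  have hN1 : (144 : ℝ) ≤ N := by linarith [Nat.cast_nonneg (α := ℝ) K]
  have hlog : Real.log ((N * N : ℕ) : ℝ) + 4 ≤ 4 * N := by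
    push_cast
    rw [Real.log_mul (by linarith) (by linarith)]
    linarith [Real.log_le_sub_one_of_pos (show (0 : ℝ) < N by linarith)]
  have hL : 4 ≤ Real.log ((N * N : ℕ) : ℝ) + 4 := by linarith [Real.log_natCast_nonneg (N * N)]
  have hNN : ((N * N : ℕ) : ℝ) = N * N := by push_cast; rfl
  set L := Real.log ((N * N : ℕ) : ℝ) + 4
  have hC : L * (8 * K + 8 * a * (8 * J + 1) / δ) ≤ ((N * N : ℕ) : ℝ) := by
    rw [hNN]
    calc _ ≤ 4 * N * (8 * K + 8 * a * (8 * J + 1) / δ) := by gcongr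
      _ ≤ N * N := by nlinarith
  have hq := Nat.ceil_lt_add_one (show 0 ≤ 8 * L * J by positivity)
  refine ⟨N * N, ⌈8 * L * J⌉₊, ?_, ?_, ?_, ?_⟩
  · have : 144 ≤ N := by exact_mod_cast hN1
    calc 20736 = 144 * 144 := by norm_num
      _ ≤ _ := Nat.mul_le_mul this this
  · have : 0 ≤ L * (8 * a * (8 * J + 1) / δ) := by positivity
    nlinarith
  · rw [← Real.le_log_iff_exp_le hδ]
    have h1 : J ≤ (⌈8 * L * J⌉₊ : ℝ) / (8 * L) := by
      rw [le_div_iff₀ (by positivity), mul_comm]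
      exact Nat.le_ceil _
    linarith [neg_abs_le (Real.log δ)]
  · rw [div_le_iff₀ (by rw [hNN]; nlinarith)]
    have h1 : (8 : ℝ) * a * ⌈8 * L * J⌉₊ ≤ 8 * a * (L * (8 * J + 1)) := by
      gcongr
      nlinarith
    have h2 : δ * (L * (8 * a * (8 * J + 1) / δ)) = 8 * a * (L * (8 * J + 1)) := by field_simp
    have h3 : L * (8 * a * (8 * J + 1) / δ) ≤ ((N * N : ℕ) : ℝ) := by
      have : (0 : ℝ) ≤ L * (8 * K) := by positivity
      nlinarith
    have := mul_le_mul_of_nonneg_left h3 hδ.le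
    linarith

theorem exists_cstOk {ε δ : ℝ} (hε : 0 < ε) (hδ : 0 < δ) (hδ1 : δ ≤ 1) (a : ℕ) :
    ∃ c, CstOk c ε δ a ∧ EpsOk c.eps ε ∧ ((∃ q : ℚ, (q : ℝ) = ε) → c.eps ≠ none) := by
  have hδ8 : 0 < δ / 8 := by linarith
  obtain ⟨o, ho1, ho2⟩ := exists_epsOk hε
  obtain ⟨C0, hC0⟩ := exists_nat_ge (20736 + 8 * (3 + ε) + (4 / ε + 1) + 32 * (1 + ε) / ε)
  obtain ⟨g0, hg0⟩ := exists_nat_ge (1 + ε)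
  obtain ⟨g, hg, hgap⟩ := exists_div_le 10 (sub_pos.2 (Real.exp_lt_exp.2
    (show -1 - 3 * ε / 4 < -1 - ε / 2 by linarith)))
  obtain ⟨KN, hKN, hKN'⟩ := exists_div_le 42 hδ8
  obtain ⟨KL, hKL, hKL'⟩ := exists_div_le 31 hδ8
  obtain ⟨KS, th, hlow, hhigh⟩ := exists_sketch (Real.exp_pos (-1 - ε / 2))
    (Real.exp_lt_exp.2 (show -1 - ε / 2 < -1 - ε / 4 by linarith))
    (Real.exp_lt_one_iff.2 (show -1 - ε / 4 < 0 by linarith)) hδ8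
  obtain ⟨C1, KT, h1, h2, h3, h4⟩ := exists_tries g a hδ8
  have e1 : 0 < 8 * (3 + ε) := by positivity
  have e2 : 0 < 4 / ε + 1 := by positivity
  have e3 : 0 < 32 * (1 + ε) / ε := by positivity
  -- With `K1 = g` the gap condition only asks that `10 / g` be small, and `K2 = KL` since both
  -- satisfy the same inequality.
  refine ⟨⟨o, C0, g0, KN, C1, g, KL, KL, KS, KT, th, g⟩, ⟨?_, by linarith, ?_, ?_, hg0, hg, hg, ?_, hKN,
    hKN', hKL, hKL', hKL, hKL', hlow, hhigh, h1, h2, h3, h4, hδ1⟩, ho1, ho2⟩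
  · have : (20736 : ℝ) ≤ C0 := by linarith
    exact_mod_cast this
  · have : 4 / ε ≤ C0 - 1 := by linarith
    rwa [div_le_iff₀' hε] at this
  · have : 32 * (1 + ε) / ε ≤ C0 := by linarith
    rwa [div_le_iff₀' hε] at this
  · rw [← add_div]
    norm_num
    exact hgap

/-! ### Sizes and the running time. -/

section Size
variable {n : ℕ}

theorem two_pow_size_le (hn : 1 ≤ n) : 2 ^ n.size ≤ 2 * n := by
  have hs : 0 < n.size := Nat.size_pos.2 hn
  have h : 2 ^ (n.size - 1) ≤ n := by
    by_contra h
    have := Nat.size_le.2 (not_le.1 h)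
    omega
  calc 2 ^ n.size = 2 * 2 ^ (n.size - 1) := by rw [← pow_succ']; congr 1; omega
    _ ≤ 2 * n := by omega

theorem size_le_self (n : ℕ) : n.size ≤ n := Nat.size_le.2 Nat.lt_two_pow_self

/-- The ring buffer stores about `log³ n` classes, so this keeps the space linear. -/
theorem cube_le (s : ℕ) : s * s * s ≤ 4 * 2 ^ s := by
  rcases Nat.lt_or_ge s 6 with h | h
  · interval_cases s <;> norm_num
  · induction s, h using Nat.le_induction with
    | base => norm_num
    | succ s hs ih =>
      rw [pow_succ]
      nlinarith [mul_le_mul hs hs (by omega) (by omega), Nat.mul_le_mul (Nat.mul_le_mul hs hs) hs]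

theorem ceilDiv_le_of_le {ε : ℝ} (hε : 0 < ε) {x y : ℕ} (h : x ≤ y) (hy : 1 ≤ y) : ceilDiv ε x ≤ y :=
  Nat.sInf_le ⟨hy, by rw [Nat.sub_eq_zero_of_le h]; push_cast; positivity⟩

theorem size_le_three_log (hn : 2 ≤ n) : (n.size : ℝ) ≤ 3 * Real.log n := by
  have hn' : (2 : ℝ) ≤ n := by exact_mod_cast hn
  have h1 : ((2 ^ n.size : ℕ) : ℝ) ≤ ((2 * n : ℕ) : ℝ) := by exact_mod_cast two_pow_size_le (by omega)
  have h2 := Real.log_le_log (by positivity) h1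
  push_cast at h2
  rw [Real.log_pow, Real.log_mul (by norm_num) (by linarith)] at h2
  have h3 := Real.log_le_log (by norm_num) hn'
  have h4 := Real.log_two_gt_d9
  nlinarith

theorem size_le_rpow {ε : ℝ} (hε : 0 < ε) (hn : 2 ≤ n) :
    (n.size : ℝ) ≤ 3 * (1 + ε) * (n : ℝ) ^ (1 / (1 + ε)) := by
  have hn' : (2 : ℝ) ≤ n := by exact_mod_cast hn
  have h1 := Real.log_le_rpow_div (x := n) (ε := 1 / (1 + ε)) (by linarith) (by positivity)
  rw [div_div_eq_mul_div, div_one] at h1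
  linarith [size_le_three_log hn]

/-- One factor `2` comes from rounding the exponent up, the other one from `2 ^ n.size ≤ 2 n`. -/
theorem two_pow_ceilDiv_le {ε : ℝ} (hε : 0 < ε) (hn : 1 ≤ n) :
    (2 : ℝ) ^ ceilDiv ε n.size ≤ 4 * (n : ℝ) ^ (1 / (1 + ε)) := by
  have hn' : (1 : ℝ) ≤ n := by exact_mod_cast hn
  have h1 := mul_ceilDiv_sub_one_le hε n.size
  have h2 : ((2 : ℝ) ^ n.size) ≤ 2 * n := by exact_mod_cast two_pow_size_le hn
  have h3 : (ceilDiv ε n.size : ℝ) ≤ n.size * (1 / (1 + ε)) + 1 := by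
    rw [mul_one_div, ← sub_le_iff_le_add, le_div_iff₀ (by linarith)]
    linarith
  have h4 : (1 : ℝ) / (1 + ε) ≤ 1 := by rw [div_le_one] <;> linarith
  calc (2 : ℝ) ^ ceilDiv ε n.size = (2 : ℝ) ^ (ceilDiv ε n.size : ℝ) := (Real.rpow_natCast _ _).symm
    _ ≤ (2 : ℝ) ^ (n.size * (1 / (1 + ε)) + 1 : ℝ) := Real.rpow_le_rpow_of_exponent_le one_le_two h3
    _ = ((2 : ℝ) ^ n.size) ^ (1 / (1 + ε)) * 2 := by
      rw [Real.rpow_add two_pos, Real.rpow_one, Real.rpow_mul two_pos.le, Real.rpow_natCast]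
    _ ≤ (2 * n : ℝ) ^ (1 / (1 + ε)) * 2 := by gcongr
    _ = 2 ^ (1 / (1 + ε)) * (n : ℝ) ^ (1 / (1 + ε)) * 2 := by rw [Real.mul_rpow two_pos.le (by linarith)]
    _ ≤ 2 ^ (1 : ℝ) * (n : ℝ) ^ (1 / (1 + ε)) * 2 := by
      gcongr
      exact one_le_two
    _ = _ := by rw [Real.rpow_one]; ring

end Size

/-- The running time. -/
theorem exists_timeB_le (c : Cst) {ε : ℝ} (hε : 0 < ε) :
    ∃ K : ℝ, 0 ≤ K ∧ ∀ n lx ly k l, Inst n lx ly k l →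
      (timeB (par c ε n lx ly k l) : ℝ) ≤ K * (n * (n : ℝ) ^ (1 / (1 + ε)) * (n.size * n.size)) := by
  refine ⟨3 * 2 + 25 + 20 + c.KT * (5 * c.C1 + 20) +
    c.KS * (c.C0 * c.g0 * 100 + 40) * (3 * (1 + ε)) + c.KN * 4 * (c.C0 * c.g0 * 212 + 80) +
    (c.KL * (c.KN * 4) * (6 * c.KS + 30) + (c.K2 * (c.KN * 4) + 1) * 24) + 200, by positivity, ?_⟩
  intro n lx ly k l hI
  have hn : 1 ≤ n := by linarith [hI.two_le]
  have hn1 : (1 : ℝ) ≤ n := by exact_mod_cast hn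
  have hs := one_le_size hn
  have hlog := log_le_size hn
  have hy1 : 1 ≤ (n : ℝ) ^ (1 / (1 + ε)) := Real.one_le_rpow hn1 (by positivity)
  have hd := divSum_le_mul_log n
  have hsy := size_le_rpow hε hI.two_le
  have h2 := two_pow_ceilDiv_le hε hn
  have hlx : (lx : ℝ) ≤ n := by exact_mod_cast hI.lx_n
  have hly : (ly : ℝ) ≤ n := by exact_mod_cast hI.ly_n
  have hl : (l : ℝ) ≤ n := by exact_mod_cast hI.l_lx.trans hI.lx_n
  have hsq : ((par c ε n lx ly k l).B.sqrt : ℝ) ≤ c.C1 * n * n.size := by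
    have : (par c ε n lx ly k l).B.sqrt ≤ c.C1 * n * n.size := by
      refine (Nat.sqrt_le_sqrt ?_).trans_eq (Nat.sqrt_eq (c.C1 * n * n.size))
      calc c.C1 * (n * n) * (n.size * n.size) ≤ c.C1 * c.C1 * (n * n) * (n.size * n.size) := by
            gcongr; exact Nat.le_mul_self _
        _ = _ := by ring
    exact_mod_cast this
  set y := (n : ℝ) ^ (1 / (1 + ε))
  set s := (n.size : ℝ)
  set N := (n : ℝ)
  set q := (par c ε n lx ly k l).B.sqrt with hq
  have e : (timeB (par c ε n lx ly k l) : ℝ) = 3 * divSum n + 25 * N + 10 * (lx + ly) +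
      c.KT * s * (5 * q + 20) + c.KS * s * (c.C0 * c.g0 * (s * s) * (30 * (lx + ly + 1) + 10) +
      10 * (lx + ly) + 20) + c.KN * 2 ^ ceilDiv ε n.size * (c.C0 * c.g0 * (s * s) *
      (60 * (lx + ly + 1) + 32) + 40 * N + 40) + (c.KL * (N * (c.KN * 2 ^ ceilDiv ε n.size)) *
      (6 * (c.KS * s) + 30) + (c.K2 * (c.KN * 2 ^ ceilDiv ε n.size) + 1) * (4 * l + 20)) + 200 := by
    rw [timeB, ← hq]
    simp only [par]
    push_cast
    rfl
  have hs2 : 1 ≤ s * s := one_le_mul_of_one_le_of_one_le hs hs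
  have hss : s ≤ s * s := le_mul_of_one_le_left (by linarith) hs
  have hZ1 : N * (s * s) ≤ N * y * (s * s) := by
    gcongr; exact le_mul_of_one_le_right (by linarith) hy1
  have hZ2 : N * s ≤ N * (s * s) := by gcongr
  have hZ3 : N ≤ N * s := le_mul_of_one_le_right (by linarith) hs
  have hZ0 : N * y ≤ N * y * (s * s) := le_mul_of_one_le_right (by positivity) hs2
  have hZ4 : N * y * s ≤ N * y * (s * s) := by gcongr
  have t1 : (divSum n : ℝ) ≤ 2 * (N * y * (s * s)) := by
    have : N * (1 + Real.log n) ≤ N * (2 * s) := by gcongr; linarith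
    linarith
  have t2 : c.KT * s * (5 * q + 20) ≤ c.KT * (5 * c.C1 + 20) * (N * y * (s * s)) := by
    calc c.KT * s * (5 * q + 20) ≤ c.KT * s * (5 * (c.C1 * N * s) + 20 * (N * s)) := by
          gcongr; linarith
      _ = c.KT * (5 * c.C1 + 20) * (N * (s * s)) := by ring
      _ ≤ _ := by gcongr
  -- The sketches cost `n log³ n`; one logarithm is absorbed by `n ^ (1 / (1 + ε))`.
  have t3 : c.KS * s * (c.C0 * c.g0 * (s * s) * (30 * (lx + ly + 1) + 10) + 10 * (lx + ly) + 20) ≤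
      c.KS * (c.C0 * c.g0 * 100 + 40) * (3 * (1 + ε)) * (N * y * (s * s)) := by
    calc _ ≤ c.KS * s * (c.C0 * c.g0 * (s * s) * (100 * N) + 40 * (N * (s * s))) := by
          have : 10 * (lx + ly : ℝ) + 20 ≤ 40 * (N * (s * s)) := by linarith
          rw [add_assoc (c.C0 * c.g0 * (s * s) * (30 * (lx + ly + 1) + 10) : ℝ)]
          gcongr; linarith
      _ = c.KS * (c.C0 * c.g0 * 100 + 40) * (s * (N * (s * s))) := by ring
      _ ≤ c.KS * (c.C0 * c.g0 * 100 + 40) * (3 * (1 + ε) * y * (N * (s * s))) := by gcongr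
      _ = _ := by ring
  have t4 : c.KN * 2 ^ ceilDiv ε n.size * (c.C0 * c.g0 * (s * s) * (60 * (lx + ly + 1) + 32) + 40 * N + 40) ≤
      c.KN * 4 * (c.C0 * c.g0 * 212 + 80) * (N * y * (s * s)) := by
    calc _ ≤ c.KN * (4 * y) * (c.C0 * c.g0 * (s * s) * (212 * N) + 80 * (N * (s * s))) := by
          have : 40 * N + 40 ≤ 80 * (N * (s * s)) := by linarith
          rw [add_assoc (c.C0 * c.g0 * (s * s) * (60 * (lx + ly + 1) + 32) : ℝ)]
          gcongr; linarith
      _ = _ := by ring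
  have t5 : c.KL * (N * (c.KN * 2 ^ ceilDiv ε n.size)) * (6 * (c.KS * s) + 30) ≤
      c.KL * (c.KN * 4) * (6 * c.KS + 30) * (N * y * (s * s)) := by
    calc _ ≤ c.KL * (N * (c.KN * (4 * y))) * (6 * (c.KS * s) + 30 * s) := by gcongr; linarith
      _ = c.KL * (c.KN * 4) * (6 * c.KS + 30) * (N * y * s) := by ring
      _ ≤ _ := by gcongr
  have t6 : (c.K2 * (c.KN * 2 ^ ceilDiv ε n.size) + 1) * (4 * l + 20) ≤
      (c.K2 * (c.KN * 4) + 1) * 24 * (N * y * (s * s)) := by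
    calc _ ≤ (c.K2 * (c.KN * (4 * y)) + y) * (24 * N) := by gcongr; linarith
      _ = (c.K2 * (c.KN * 4) + 1) * 24 * (N * y) := by ring
      _ ≤ _ := by gcongr
  rw [e]
  linarith

/-! ### Word size and space. -/

theorem CstLt.mono {c : Cst} {U U' : ℕ} (h : CstLt c U) (hU : U ≤ U') : CstLt c U' := by
  obtain ⟨h1, h2, h3, h4, h5, h6, h7, h8, h9, h10, h11, h12, h13⟩ := h
  exact ⟨by omega, by omega, by omega, by omega, by omega, by omega, by omega, by omega, by omega,
    by omega, by omega, by omega, fun p q h => ⟨(h13 p q h).1.trans_le hU, (h13 p q h).2.trans_le hU⟩⟩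

theorem exists_cstLt (c : Cst) (a : ℕ) : ∃ e, CstLt c (2 ^ e) ∧ a < 2 ^ e := by
  obtain ⟨v, hv⟩ : ∃ v, ∀ p q, c.eps = some (p, q) → p ≤ v ∧ q ≤ v := by
    rcases h : c.eps with - | ⟨p, q⟩
    · exact ⟨0, by simp⟩
    · refine ⟨p + q, ?_⟩
      rintro _ _ ⟨⟩
      omega
  set e := 3 + a + v + c.C0 + c.g0 + c.KN + c.C1 + c.K1 + c.KL + c.K2 + c.KS + c.KT + c.th + c.g
  have h : e < 2 ^ e := Nat.lt_two_pow_self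
  refine ⟨e, ⟨by omega, by omega, by omega, by omega, by omega, by omega, by omega, by omega, by omega,
    by omega, by omega, by omega, fun p q h => ?_⟩, by omega⟩
  have := hv p q h
  omega

/-- The exponent of the bound on words. -/
def wordExp (c : Cst) (a e : ℕ) : ℕ := e * (2 * c.KS + 4) + a + 10

/-- The bounds on words and arrays. -/
noncomputable def ctx (c : Cst) (ε : ℝ) (a e n : ℕ) : Ctx where
  ε := ε
  U := n ^ wordExp c a e
  cap := fun A => if A = 0 then 2 * n else (16 * (c.C0 * c.g0) + 4) * n

/-- All quantities are powers of `n` with constant exponents, and the lower bound for `w` makes `2 ^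
w` exceed `n ^ A`. The eighth power of `U` leaves room for intermediate results. -/
theorem ctx_fits (c : Cst) (ε : ℝ) (a e : ℕ) {n w C A : ℕ} (hn : 2 ≤ n)
    (hC : 12 * (16 * (c.C0 * c.g0) + 4) + 8 ≤ C) (hA : 8 * wordExp c a e + C ≤ A)
    (hw : A * (Nat.log 2 n + 1) ≤ w) : Fits (ctx c ε a e n) 64 12 8 (2 * n) w (C * n) := by
  have hE : 10 ≤ wordExp c a e := by simp [wordExp]
  have hpow : n < 2 ^ (Nat.log 2 n + 1) := Nat.lt_pow_succ_log_self one_lt_two n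
  have hl : 1 ≤ Nat.log 2 n + 1 := by omega
  have hle : ∀ i, i ≤ A → n ^ i ≤ 2 ^ w := by
    intro i hi
    calc n ^ i ≤ (2 ^ (Nat.log 2 n + 1)) ^ i := Nat.pow_le_pow_left hpow.le i
      _ = 2 ^ (i * (Nat.log 2 n + 1)) := by rw [← pow_mul, mul_comm]
      _ ≤ 2 ^ w := Nat.pow_le_pow_right two_pos ((Nat.mul_le_mul_right _ hi).trans hw)
  refine ⟨?_, by omega, ?_, ?_, by omega, ?_, ?_, ?_, ?_⟩
  · calc 2 ≤ n ^ 1 := by simpa using hn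
      _ ≤ n ^ wordExp c a e := Nat.pow_le_pow_right (by omega) (by omega)
  · show (n ^ wordExp c a e) ^ 8 ≤ 2 ^ w
    rw [← pow_mul]
    exact hle _ (by omega)
  · calc 12 < 2 ^ 4 := by norm_num
      _ ≤ n ^ 4 := Nat.pow_le_pow_left hn 4
      _ ≤ 2 ^ w := hle _ (by omega)
  · simp [ctx]
  · gcongr; omega
  · intro B hB _
    simp only [ctx, if_neg (show B ≠ 0 by omega)]
    calc (16 * (c.C0 * c.g0) + 4) * n * 12 + 2 * n + 12 ≤
          (16 * (c.C0 * c.g0) + 4) * n * 12 + 2 * n + 6 * n := by omega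
      _ = (12 * (16 * (c.C0 * c.g0) + 4) + 8) * n := by ring
      _ ≤ _ := by gcongr
  · calc C * n ≤ n ^ (C - 1) * n := by
          gcongr
          have : C - 1 < n ^ (C - 1) := Nat.lt_pow_self (by omega)
          omega
      _ = n ^ C := by rw [← pow_succ]; congr 1; omega
      _ ≤ _ := hle _ (by omega)

section Parameters
variable {c : Cst} {ε δ : ℝ} {a e n lx ly k l : ℕ}

/-- The parameters of the instance at hand. -/
local notation "◇" => par c ε n lx ly k l

/-- Constants are below `2 ^ e ≤ n ^ e`, so every parameter is bounded by an explicit power of `n`.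
The largest exponents come from the sketches, which are numbers with `KS * n.size` digits in base
`g`. -/
theorem ctx_pre (hc : CstOk c ε δ a) (hε : 0 < ε)
    (hI : Inst n lx ly k l) (he : CstLt c (2 ^ e)) : Pre (ctx c ε a e n) ◇ c.g := by
  have hn := hI.two_le
  have hs := Nat.size_pos.2 (show 0 < n by omega)
  have he' := he.mono (Nat.pow_le_pow_left hn e)
  set E := wordExp c a e with hE
  have hE4 : 4 * e + 10 ≤ E := by rw [hE, wordExp]; nlinarith
  have lt : ∀ {x i : ℕ}, x ≤ n ^ i → i < E → x < n ^ E := fun hx hi =>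
    lt_of_le_of_lt hx (Nat.pow_lt_pow_right (by omega) hi)
  have add2 : ∀ {x i : ℕ}, x ≤ n ^ i → i + 3 ≤ E → x + 2 < n ^ E := by
    intro x i hx hi
    refine lt (i := i + 2) ?_ (by omega)
    have h1 : 1 ≤ n ^ i := Nat.one_le_pow _ _ (by omega)
    calc x + 2 ≤ n ^ i * (2 * 2) := by omega
      _ ≤ n ^ (i + 2) := by rw [pow_add, pow_two]; gcongr
  have mul : ∀ {x y i j : ℕ}, x ≤ n ^ i → y ≤ n ^ j → x * y ≤ n ^ (i + j) := fun hx hy => by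
    rw [pow_add]; exact Nat.mul_le_mul hx hy
  have hn1 : n ≤ n ^ 1 := (pow_one n).ge
  have hs1 : n.size ≤ n ^ 1 := by simpa using size_le_self n
  have h2n : 2 * n ≤ n ^ 2 := by rw [pow_two]; gcongr
  have hp2 : 2 ^ ceilDiv ε n.size ≤ n ^ 2 :=
    (Nat.pow_le_pow_right two_pos (ceilDiv_le_of_le hε le_rfl hs)).trans ((two_pow_size_le (by omega)).trans h2n)
  have hb : ◇.b ≤ 2 * n.size := by
    refine ceilDiv_le_of_le hε ?_ (by omega)
    have h1 := divSum_div_le (show 1 ≤ n by omega)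
    have h2 := log_le_size (show 1 ≤ n by omega)
    have h3 : ((divSum n / n : ℕ) : ℝ) ≤ ((1 + n.size : ℕ) : ℝ) := by push_cast; linarith
    have h4 : divSum n / n ≤ 1 + n.size := by exact_mod_cast h3
    omega
  have hb2 : ◇.b ≤ n ^ 2 := hb.trans (le_trans (by gcongr; exact size_le_self n) h2n)
  have hkn : k ≤ n ^ 1 := by
    have := hI.k_l; have := hI.l_lx; have := hI.lx_n
    rw [pow_one]; omega
  have hss := mul hs1 hs1
  have hnt : ◇.nt ≤ n ^ (e + 2) := mul he'.KN.le hp2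
  have hm : ◇.m ≤ n ^ (e + e + (1 + 1)) := mul (mul he'.C0.le he'.g0.le) hss
  have hR : ◇.R ≤ n ^ (e + e + 3) := by
    simp only [par]
    split_ifs
    · exact (mul he'.C0.le hss).trans (Nat.pow_le_pow_right (by omega) (by omega))
    · exact (mul hkn hm).trans (Nat.pow_le_pow_right (by omega) (by omega))
  have hB : ◇.B ≤ n ^ (e + (1 + 1) + (1 + 1)) := mul (mul he'.C1.le (mul hn1 hn1)) hss
  have hlim : ◇.lim ≤ n ^ (e + (1 + (e + 2))) := mul he'.KL.le (mul hn1 hnt)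
  have hlim2 : ◇.lim2 ≤ n ^ (e + (e + 2)) := mul he'.K2.le hnt
  have hls : ◇.ls ≤ n ^ (e + 1) := mul he'.KS.le hs1
  have hlr : ◇.lr ≤ n ^ (e + e + (1 + 1) + 2) := mul hm hb2
  have htr : ◇.tr ≤ n ^ (e + 1) := mul he'.KT.le hs1
  have hq := mul hm hnt
  have hlw : ◇.lw ≤ n ^ 2 :=
    le_trans (show lx + ly ≤ 2 * n by have := hI.lx_n; have := hI.ly_n; omega) h2n
  have hg0 : 0 < c.g0 := by
    have h1 : (0 : ℝ) < c.g0 := by linarith [hc.g0]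
    exact_mod_cast h1
  have hC0 := hc.C0
  -- The factor `16` is `2` from `b ≤ 2 * n.size` times `8` from the bound `8 n` for the cube of
  -- `n.size`.
  have hlrn : ◇.lr ≤ 16 * (c.C0 * c.g0) * n := by
    calc _ ≤ c.C0 * c.g0 * (n.size * n.size) * (2 * n.size) := Nat.mul_le_mul_left _ hb
      _ = c.C0 * c.g0 * 2 * (n.size * n.size * n.size) := by ring
      _ ≤ c.C0 * c.g0 * 2 * (4 * (2 * n)) := Nat.mul_le_mul_left _
        ((cube_le _).trans (Nat.mul_le_mul_left _ (two_pow_size_le (n := n) (by omega))))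
      _ = _ := by ring
  have w1 : ∀ {x : ℕ}, x + 2 < n ^ E → x + 1 < n ^ E := fun h => by omega
  have w0 : ∀ {x : ℕ}, x + 2 < n ^ E → x < n ^ E := fun h => by omega
  refine ⟨⟨?_, w1 (add2 hlw (by omega)), w0 (add2 hnt (by omega)), w0 (add2 hm (by omega)),
    w0 (add2 hR (by omega)), w0 (add2 hB (by omega)), w0 (add2 hlim (by omega)),
    w0 (add2 hlim2 (by omega)), w0 (add2 hls (by omega)), w0 (add2 hlr (by omega)),
    w0 (add2 htr (by omega)), w0 (add2 hq (by omega))⟩, add2 hlim2 (by omega), w1 (add2 hls (by omega)),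
    w1 (add2 hB (by omega)), rfl, hI.lx_n, hI.ly_n, hI.one_le, hI.l_lx, hI.l_ly, ?_, ?_, ?_, hc.g, ?_⟩
  · refine lt (i := 4) ?_ (by omega)
    show n * n + 2 * n + 3 ≤ n ^ 4
    have h1 : 2 * 2 ≤ n * n := Nat.mul_le_mul hn hn
    have h2 : n ^ 4 = n * n * (n * n) := by ring
    rw [h2]
    nlinarith
  · show lx + ly ≤ 2 * n
    have := hI.lx_n; have := hI.ly_n; omega
  · intro A hA _
    simp only [ctx, if_neg (show A ≠ 0 by omega)]
    rw [add_mul]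
    refine ⟨?_, by omega⟩
    show 2 * n + 2 ≤ _
    omega
  · exact Nat.mul_pos (Nat.mul_pos (Nat.mul_pos (by omega) hg0) (Nat.mul_pos hs hs)) (ceilDiv_mem hε _).1
  · show c.g ^ (c.KS * n.size) ≤ n ^ E
    calc c.g ^ (c.KS * n.size) ≤ (2 ^ e) ^ (c.KS * n.size) := Nat.pow_le_pow_left he.g.le _
      _ = (2 ^ n.size) ^ (e * c.KS) := by rw [← pow_mul, ← pow_mul]; congr 1; ring
      _ ≤ (n ^ 2) ^ (e * c.KS) := Nat.pow_le_pow_left ((two_pow_size_le (by omega)).trans h2n) _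
      _ = n ^ (2 * (e * c.KS)) := by rw [← pow_mul]
      _ ≤ n ^ E := Nat.pow_le_pow_right (by omega) (by rw [hE, wordExp]; nlinarith)

end Parameters

/-- The program solves an instance. -/
theorem fullP_solves_inst {c : Cst} {ε δ : ℝ} {a e n w C A T : ℕ} {X Y : List ℕ} {k l : ℕ}
    (hc : CstOk c ε δ a) (ho : EpsOk c.eps ε) (hε : 0 < ε) (hδ : 0 < δ) (he : CstLt c (2 ^ e))
    (ha : a < 2 ^ e) (hI : Inst n X.length Y.length k l) (hletter : ∀ x ∈ X ++ Y, x ≤ a * n ^ a)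
    (hC : 12 * (16 * (c.C0 * c.g0) + 4) + 8 ≤ C) (hA : 8 * wordExp c a e + C ≤ A)
    (hw : A * (Nat.log 2 n + 1) ≤ w)
    (hT : (progP c).cost * timeB (par c ε n X.length Y.length k l) + 20 ≤ T) :
    Solves ε δ w (C * n) T (fullP c) n X Y k l := by
  classical
  have hn := hI.two_le
  have hE4 : 4 * e + a + 10 ≤ wordExp c a e := by rw [wordExp]; nlinarith
  have hlet : ∀ x < X.length + Y.length, inpF X Y x < 2 ^ (a + a * n.size) := by
    intro x hx
    have h1 : inpF X Y x ≤ a * n ^ a := by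
      rw [inpF, List.getD_eq_getElem _ _ (by simpa using hx)]
      exact hletter _ (List.getElem_mem _)
    refine lt_of_le_of_lt h1 ?_
    rw [pow_add, mul_comm a n.size, pow_mul]
    exact Nat.mul_lt_mul_of_lt_of_le Nat.lt_two_pow_self (Nat.pow_le_pow_left (Nat.lt_size_self n).le a)
      (by positivity)
  refine fullP_solves hε (K := ctx c ε a e n) rfl hI.lx_n hI.ly_n hI.l_lx hI.l_ly hI.k_l rfl ho
    (he.mono ((Nat.pow_le_pow_left hn e).trans (Nat.pow_le_pow_right (by omega) (by omega)))) hc.KN hc.K1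
    (ctx_pre hc hε hI he) (ctx_fits c ε a e hn hC hA hw) rfl (fun x hx => ?_)
    (rndGen_pos hc hε (by omega)) hT (fun x => ind (¬ Correct ε X Y k l
      (outcome c ε (par c ε n X.length Y.length k l) (inpF X Y) x).ans
      (outcome c ε (par c ε n X.length Y.length k l) (inpF X Y) x).ai
      (outcome c ε (par c ε n X.length Y.length k l) (inpF X Y) x).aj))
    (fun x => ind_nonneg _) (fun x _ h => (ind_of h).ge) ?_
  · show x < n ^ wordExp c a e
    calc x ≤ a * n ^ a := hletter x hx
      _ < 2 ^ e * n ^ a := Nat.mul_lt_mul_of_pos_right ha (by positivity)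
      _ ≤ n ^ e * n ^ a := by gcongr
      _ = n ^ (e + a) := (pow_add _ _ _).symm
      _ ≤ _ := Nat.pow_le_pow_right (by omega) (by omega)
  · by_cases h : ∃ i j, i + l ≤ X.length ∧ j + l ≤ Y.length ∧ mis (inpF X Y) l i (X.length + j) ≤ k
    · obtain ⟨i, j, hi, hj, hk⟩ := h
      refine le_trans (Gen.E_mono _ fun x _ => ind_mono fun hx => ?_) (E_fail_le hc hε hδ hI hlet hi hj hk)
      intro h1
      refine hx ?_
      exact outcome_sound hε x hI.l_lx hI.l_ly fun _ => h1
    · refine le_trans (Gen.E_le_const _ (rndGen_pos hc hε (by omega)) (r := 0) fun x _ => ?_) hδ.le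
      rw [ind_of_not]
      exact not_not.2 (outcome_sound hε x hI.l_lx hI.l_ly fun h' => absurd h' h)

end LCSApprox

theorem theorem2 (ε : ℝ) (hε : 0 < ε) (δ : ℝ) (hδ : 0 < δ) (a : ℕ) :
    ∃ (P : LCSApprox.Prog) (A C : ℕ),
      ((∃ q : ℚ, (q : ℝ) = ε) → P.EpsFree) ∧
      ∀ (n σ : ℕ), 2 ≤ n → σ ≤ a * n ^ a →
      ∀ (X Y : List ℕ), X.length ≤ n → Y.length ≤ n →
        (∀ x ∈ X, 1 ≤ x ∧ x ≤ σ) → (∀ y ∈ Y, 1 ≤ y ∧ y ≤ σ) →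
      ∀ (w k l : ℕ), A * (Nat.log 2 n + 1) ≤ w → k < 2 ^ w → l < 2 ^ w →
        ∃ T : ℕ,
          (T : ℝ) ≤ C * (n : ℝ) ^ (1 + 1 / (1 + ε)) * Real.log n ^ 2 ∧
          LCSApprox.Solves ε δ w (C * n) T P n X Y k l := by
  -- Replacing `δ` by `min δ 1` only strengthens the conclusion.
  obtain ⟨c, hc, ho, hr⟩ := LCSApprox.exists_cstOk hε (lt_min hδ one_pos) (min_le_right δ 1) a
  obtain ⟨e, he, ha⟩ := LCSApprox.exists_cstLt c a
  obtain ⟨K, hK0, hK⟩ := LCSApprox.exists_timeB_le c hε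
  obtain ⟨q, hq⟩ : ∃ q, ∀ x, (LCSApprox.progP c).cost * x = q * x := ⟨_, fun _ => rfl⟩
  -- The factor `9` converts the square of the binary length into the square of the natural
  -- logarithm, by `n.size ≤ 3 log n`; the `20` covers the prologue and the trivial instances.
  obtain ⟨C, hC⟩ := exists_nat_ge (max ((q * K + 20) * 9)
    ((12 * (16 * (c.C0 * c.g0) + 4) + 8 : ℕ) : ℝ))
  have hC1 := (le_max_left _ _).trans hC
  have hC2 : 12 * (16 * (c.C0 * c.g0) + 4) + 8 ≤ C := by exact_mod_cast (le_max_right _ _).trans hC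
  refine ⟨LCSApprox.fullP c, 8 * LCSApprox.wordExp c a e + C, C, fun h => LCSApprox.fullP_epsFree (hr h), ?_⟩
  intro n σ hn hσ X Y hX hY hXσ hYσ w k l hw _ _
  have hn' : (2 : ℝ) ≤ n := by exact_mod_cast hn
  have hpow : (n : ℝ) ^ (1 + 1 / (1 + ε)) = n * (n : ℝ) ^ (1 / (1 + ε)) := by
    rw [Real.rpow_add (by linarith), Real.rpow_one]
  have hs := LCSApprox.one_le_size (show 1 ≤ n by omega)
  have hz : 1 ≤ (n : ℝ) * (n : ℝ) ^ (1 / (1 + ε)) * (n.size * n.size) :=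
    one_le_mul_of_one_le_of_one_le (one_le_mul_of_one_le_of_one_le (by linarith)
      (Real.one_le_rpow (by linarith) (by positivity))) (one_le_mul_of_one_le_of_one_le hs hs)
  have hB : 0 ≤ q * K + 20 := add_nonneg (mul_nonneg (Nat.cast_nonneg _) hK0) (by norm_num)
  have aux : ∀ B x s L D : ℝ, 0 ≤ x → 0 ≤ s → s ≤ 3 * L → 0 ≤ B → B * 9 ≤ D →
      B * (x * (s * s)) ≤ D * x * L ^ 2 := by
    intro B x s L D hx hs0 hs hB hD
    have h1 : B * x * (s * s) ≤ B * x * (3 * L * (3 * L)) :=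
      mul_le_mul_of_nonneg_left (mul_self_le_mul_self hs0 hs) (mul_nonneg hB hx)
    have h2 := mul_le_mul_of_nonneg_right hD (mul_nonneg hx (sq_nonneg L))
    linarith
  have htime := aux (q * K + 20) (n * (n : ℝ) ^ (1 / (1 + ε))) n.size (Real.log n) C
    (mul_nonneg (Nat.cast_nonneg _) (Real.rpow_nonneg (Nat.cast_nonneg _) _)) (Nat.cast_nonneg _)
    (LCSApprox.size_le_three_log hn) hB hC1
  rw [← hpow] at htime hz
  by_cases h : X.length < l ∨ Y.length < l ∨ l ≤ k
  · refine ⟨20, le_trans ?_ htime, LCSApprox.fullP_easy hε hδ ?_ le_rfl h⟩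
    · have : 0 ≤ q * K := mul_nonneg (Nat.cast_nonneg _) hK0
      push_cast
      nlinarith
    · refine le_trans ?_ hw
      exact Nat.mul_pos (by omega) (by omega)
  · have hI : LCSApprox.Inst n X.length Y.length k l :=
      ⟨hn, by omega, by omega, by omega, hX, hY, by omega⟩
    refine ⟨q * LCSApprox.timeB (LCSApprox.par c ε n X.length Y.length k l) + 20, le_trans ?_ htime, ?_⟩
    · have := mul_le_mul_of_nonneg_left (hK n _ _ k l hI) (Nat.cast_nonneg (α := ℝ) q)
      rw [← hpow] at this
      push_cast
      nlinarith
    · have hlet : ∀ x ∈ X ++ Y, x ≤ a * n ^ a := fun x hx => by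
        rcases List.mem_append.1 hx with hx | hx
        exacts [(hXσ x hx).2.trans hσ, (hYσ x hx).2.trans hσ]
      obtain ⟨h1, h2⟩ := LCSApprox.fullP_solves_inst (T := q *
        LCSApprox.timeB (LCSApprox.par c ε n X.length Y.length k l) + 20) hc ho hε (lt_min hδ one_pos) he ha hI
        hlet hC2 le_rfl hw (by rw [hq])
      exact ⟨h1, (ENNReal.ofReal_le_ofReal (by linarith [min_le_left δ 1])).trans h2⟩
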